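/- Let $\gamma>0$ and $0<\alpha\le 1$. There is a constant $C=C(\gamma,\alpha)>0$, and for every $n\ge 2$ a constant $c=c(n,\gamma,\alpha)>0$, with the following property. Let $0\le k\le n-1$, $M\in\mathbb R$, and let $\Gamma\subset\mathbb{R}^n$ be a $k$-dimensional $(1,M)$-$C^{1,\alpha}$ submanifold: for each $x\in\Gamma$ the set $\Gamma\cap B_1(x)$ is the part in $B_1(x)$ of the graph, over the tangent plane $x+T_x\Gamma$, of a $C^1$ function $f_x:T_x\Gamma\to (T_x\Gamma)^\perp$ with $Df_x(0)=0$ and $|Df_x(y)-Df_x(z)|\le M|y-z|^\alpha$ for $|y|,|z|<1$. Let $[\Gamma]_\alpha$ be the least constant $M\ge 0$ for which this holds. Put $Q(x)=\mathrm{dist}(x,\Gamma)^\gamma$. Let $\Omega\subset\mathbb{R}^n$ be open, $0\le u_0\in W^{1,2}(\Omega)$, and let $u\in W^{1,2}(\Omega)$ with $u-u_0\in W^{1,2}_0(\Omega)$ be a local minimizer of $J_Q(\cdot,\Omega)$, where $J_Q(v,D)=\int_D|\nabla v|^2+Q^2\chi_{\{v>0\}}\,dx$; that is, for some $\epsilon_0>0$,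 $J_Q(u,B)\le J_Q(v,B)$ for every ball $B\subset\Omega$ and every $v\in W^{1,2}(B)$ with $v-u\in W^{1,2}_0(B)$ and $\|\nabla(u-v)\|_{L^2(B)}^2+\|\chi_{\{u>0\}}-\chi_{\{v>0\}}\|_{L^1(B)}<\epsilon_0$. Take the representative $u(x)=\lim_{\rho\to0^+}\frac1{|B_\rho(x)|}\int_{B_\rho(x)}u$ for $x\in\Omega$. Let $x_0\in\Omega\cap\Gamma\cap\partial\{u>0\}$, and set $$W(x_0,r)=\frac{1}{r^{n-2+2(\gamma+1)}}\int_{B_r(x_0)}|\nabla u|^2+Q^2\chi_{\{u>0\}}\,dx-\frac{\gamma+1}{r^{n-1+2(\gamma+1)}}\int_{\partial B_r(x_0)}u^2\,d\sigma .$$ 1. For almost every $0<r\le\min\{1,\tfrac12\mathrm{dist}(x_0,\Omega^c)\}$, the function $W(x_0,\cdot)$ is differentiable at $r$, the integral below converges, and, with $\eta(x)=(x-x_0)/r$, $$\frac{d}{dr}W(x_0,r)\le\frac{2}{r^{n+2\gamma}}\int_{\partial B_r(x_0)}\Big(\nabla u\cdot\eta-\frac{\gamma+1}{r}u\Big)^2d\sigma+C\gamma[\Gamma]_\alpha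 r^{\alpha-1}.$$ 2. For all $0<r<R\le\min\{\tfrac12,\tfrac12\mathrm{dist}(x_0,\Omega^c)\}$, $$W(x_0,r)\le W(x_0,R)+\frac{C\gamma}{\alpha}[\Gamma]_\alpha R^\alpha.$$ 3. The limit $W(x_0,0^+)=\lim_{r\to0^+}W(x_0,r)$ exists and lies in $[-c,c]$. (If $\Omega=\mathbb{R}^n$, $\mathrm{dist}(x_0,\Omega^c)=\infty$.) -/

import Mathlib

open MeasureTheory Set Filter Topology Metric
open scoped ContDiff

noncomputable section

/-- The Euclidean space of dimension `n`. -/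
abbrev Euc (n : ℕ) : Type := EuclideanSpace ℝ (Fin n)

/-- Smooth functions with compact support in `D`. -/
def IsTestFunction {n : ℕ} (D : Set (Euc n)) (φ : Euc n → ℝ) : Prop :=
  ContDiff ℝ ∞ φ ∧ HasCompactSupport φ ∧ tsupport φ ⊆ D

/-- `u ∈ W^{1,2}(D)` and its weak gradient on `D` is (the a.e. class of) `Du`. -/
structure MemW12 {n : ℕ} (D : Set (Euc n)) (u : Euc n → ℝ) (Du : Euc n → Euc n) : Prop where
  memLp : MemLp u 2 (volume.restrict D)
  memLp_grad : MemLp Du 2 (volume.restrict D)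
  weak_grad : ∀ φ : Euc n → ℝ, IsTestFunction D φ → ∀ e : Euc n,
    ∫ x in D, u x * fderiv ℝ φ x e = - ∫ x in D, inner ℝ (Du x) e * φ x

/-- `w ∈ W^{1,2}_0(D)`, the closure of the test functions in `W^{1,2}(D)`, with weak gradient
`Dw`. -/
structure MemW12Zero {n : ℕ} (D : Set (Euc n)) (w : Euc n → ℝ) (Dw : Euc n → Euc n) : Prop where
  memW12 : MemW12 D w Dw
  approx : ∃ φ : ℕ → Euc n → ℝ, (∀ j, IsTestFunction D (φ j)) ∧
    Tendsto (fun j => eLpNorm (fun x => φ j x - w x) 2 (volume.restrict D)) atTop (𝓝 0) ∧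
    Tendsto (fun j => eLpNorm (fun x => gradient (φ j) x - Dw x) 2 (volume.restrict D))
      atTop (𝓝 0)

/-- `v`, with weak gradient `Dv`, lies in `K_{u, D} = {v ∈ W^{1,2}(D) : v - u ∈ W^{1,2}_0(D)}`. -/
def MemK {n : ℕ} (D : Set (Euc n)) (u : Euc n → ℝ) (Du : Euc n → Euc n)
    (v : Euc n → ℝ) (Dv : Euc n → Euc n) : Prop :=
  MemW12 D v Dv ∧ MemW12Zero D (fun x => v x - u x) (fun x => Dv x - Du x)

/-- The characteristic function of `{u > 0}`. -/
def posChar {n : ℕ} (u : Euc n → ℝ) : Euc n → ℝ :=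
  {x | 0 < u x}.indicator (fun _ => 1)

/-- The functional `J_Q(u, D) = ∫_D |∇u|² + Q² χ_{u > 0}`. -/
def energyJ {n : ℕ} (Q : Euc n → ℝ) (D : Set (Euc n)) (u : Euc n → ℝ) (Du : Euc n → Euc n) : ℝ :=
  ∫ x in D, (‖Du x‖ ^ 2 + Q x ^ 2 * posChar u x)

/-- `u` (with weak gradient `Du`) is a local minimizer of `J_Q(·, Ω)` in the class `K_{u₀, Ω}`,
for boundary data `0 ≤ u₀ ∈ W^{1,2}(Ω)`. -/
structure IsLocalMinimizer {n : ℕ} (Q : Euc n → ℝ) (Ω : Set (Euc n))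
    (u₀ : Euc n → ℝ) (Du₀ : Euc n → Euc n) (u : Euc n → ℝ) (Du : Euc n → Euc n) : Prop where
  data_memW12 : MemW12 Ω u₀ Du₀
  data_nonneg : ∀ᵐ x ∂(volume.restrict Ω), 0 ≤ u₀ x
  memK : MemK Ω u₀ Du₀ u Du
  minimal : ∃ ε₀ : ℝ, 0 < ε₀ ∧ ∀ (x : Euc n) (r : ℝ), 0 < r → ball x r ⊆ Ω →
    ∀ (v : Euc n → ℝ) (Dv : Euc n → Euc n), MemK (ball x r) u Du v Dv →
      (∫ y in ball x r, ‖Du y - Dv y‖ ^ 2) + (∫ y in ball x r, |posChar u y - posChar v y|) < ε₀ →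
      energyJ Q (ball x r) u Du ≤ energyJ Q (ball x r) v Dv

/-- `u` is the pointwise defined representative of its class on `Ω`: its value at every point of
`Ω` is the limit of its averages over small balls. -/
def IsPreciseRepresentative {n : ℕ} (Ω : Set (Euc n)) (u : Euc n → ℝ) : Prop :=
  ∀ x ∈ Ω, Tendsto (fun ρ : ℝ => ⨍ y in ball x ρ, u y) (𝓝[>] 0) (𝓝 (u x))

/-- `Γ` is an `(r, M)`-`C^{1,α}` submanifold of dimension `k`: around each `x ∈ Γ` it is, inside
`B_r(x)`, the graph over the tangent plane `x + T` of a `C¹` function `f : T → Tᗮ` whose derivative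
is `α`-Hölder on the ball of radius `r` of `T` with constant `M` (values of `f` outside that ball
play no role). That `T` is the tangent space is expressed by `Df(0) = 0`. -/
def IsC1AlphaSubmanifold {n : ℕ} (k : ℕ) (α r M : ℝ) (Γ : Set (Euc n)) : Prop :=
  ∀ x ∈ Γ, ∃ (T : Submodule ℝ (Euc n)) (f : T → Tᗮ),
    Module.finrank ℝ T = k ∧ ContDiff ℝ 1 f ∧ fderiv ℝ f 0 = 0 ∧
    Γ ∩ ball x r = (Set.range fun y : T => x + (y : Euc n) + (f y : Euc n)) ∩ ball x r ∧
    ∀ y ∈ ball (0 : T) r, ∀ z ∈ ball (0 : T) r,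
      ‖fderiv ℝ f y - fderiv ℝ f z‖ ≤ M * ‖y - z‖ ^ α

/-- The seminorm `[Γ]_α` of a `(1, M)`-`C^{1,α}` submanifold: the supremum over `x ∈ Γ` of the
Hölder seminorm of `Df_x` on the unit ball, with the best choice of the graph functions; that is,
the least constant with which `Γ` is a `(1, ·)`-`C^{1,α}` submanifold. -/
def holderSeminorm {n : ℕ} (k : ℕ) (α : ℝ) (Γ : Set (Euc n)) : ℝ :=
  sInf {M : ℝ | 0 ≤ M ∧ IsC1AlphaSubmanifold k α 1 M Γ}

/-- The weight `Q(x) = dist(x, Γ)^γ`. -/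
def distWeight {n : ℕ} (γ : ℝ) (Γ : Set (Euc n)) (x : Euc n) : ℝ :=
  infDist x Γ ^ γ

/-- `∫_{∂B_r(x₀)} g dσ`, with `σ` the surface measure. -/
def sphereIntegral {n : ℕ} (x₀ : Euc n) (r : ℝ) (g : Euc n → ℝ) : ℝ :=
  r ^ (n - 1) * ∫ η : sphere (0 : Euc n) 1, g (x₀ + r • (η : Euc n))
    ∂((volume : Measure (Euc n)).toSphere)

/-- `g` is integrable over `∂B_r(x₀)` for the surface measure. -/
def SphereIntegrable {n : ℕ} (x₀ : Euc n) (r : ℝ) (g : Euc n → ℝ) : Prop :=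
  Integrable (fun η : sphere (0 : Euc n) 1 => g (x₀ + r • (η : Euc n)))
    ((volume : Measure (Euc n)).toSphere)

/-- The Weiss `(1+γ)`-density `W_{γ+1}(x₀, r, u, Γ)`; `Du` is the weak gradient of `u`. -/
def weissDensity {n : ℕ} (γ : ℝ) (Γ : Set (Euc n)) (u : Euc n → ℝ) (Du : Euc n → Euc n)
    (x₀ : Euc n) (r : ℝ) : ℝ :=
  1 / r ^ ((n : ℝ) - 2 + 2 * (γ + 1)) * energyJ (distWeight γ Γ) (ball x₀ r) u Du
    - (γ + 1) / r ^ ((n : ℝ) - 1 + 2 * (γ + 1)) * sphereIntegral x₀ r (fun x => u x ^ 2)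

/-- The integrand `(∇u · η - ((γ+1)/r) u)²` on `∂B_r(x₀)`, where `η = (x - x₀)/r`. -/
def homogeneityDefect {n : ℕ} (γ : ℝ) (u : Euc n → ℝ) (Du : Euc n → Euc n)
    (x₀ : Euc n) (r : ℝ) (x : Euc n) : ℝ :=
  (inner ℝ (Du x) (r⁻¹ • (x - x₀)) - (γ + 1) / r * u x) ^ 2

end

/-!
The Weiss density is differentiated along radii. Write `a = n + 2γ`, `D(r) = ∫_{B_r} |∇u|²` and
`V(r) = ∫_{B_r} Q² χ_{u > 0}`. Three facts carry the computation.

* `sphereSq_sub`: for almost every `r` the normalised spherical integral of `u²` has derivative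
  `2 r^{1-n} ∫_{∂B_r} u ∂_η u`.
* `MinimizesOnBalls.ae_dirichlet_eq`: `D(r) = ∫_{∂B_r} u ∂_η u` for almost every `r`, because
  multiplying `u` by a factor close to `1` does not change `{u > 0}`.
* `exists_pohozaevDefect_bound`: in the Pohozaev identity
  `r (D' + V') = (n - 2) D + a V + 2 r ∫_{∂B_r} (∂_η u)²` the error is at most
  `C [Γ]_α r^{a + α}` in absolute value.

The first two alone turn the derivative of the Weiss density into the squared deviation of `u` from
homogeneity plus `r^{-a-1}` times the error (`MinimizesOnBalls.hasDerivAt_weissDensity`), and the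
third gives the two monotonicity formulas (`MinimizesOnBalls.weissDensity_monotone`).

The Pohozaev inequalities come from comparing `u` with `u ∘ σ_t`, where `σ_t` dilates the sphere of
radius `ρ` about `x₀` by `1 + t G(ρ²)` (`MinimizesOnBalls.domain_variation`). If `Γ` were a cone
with vertex `x₀`, the weight `Q²` would be homogeneous of degree `2γ` and the error would be zero.
In general `Γ` is a `C^{1,α}` graph over its tangent plane at `x₀`, so that dilating by `l` moves it
by at most `C [Γ]_α |l - 1| |y|^{1+α}` (`mul_infDist_dilation_le`). This changes `dist(·, Γ)^{2γ}` by
`|l - 1| κ`; when `2γ < 1` the factor `κ` is singular on `Γ`, but it is integrable, of total mass at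
most `C [Γ]_α b^{a+α}` on `B_b`, since the distance to `Γ` controls the height above the graph in a
normal direction (`exists_dilation_density`). Concentrating `-G'` at a single radius yields the
bounds for almost every radius; dilations and contractions give the two signs. A dilation may bring
points of `B_b` from outside `B_1`, where nothing is known about `Γ`, which is why one of the two
bounds holds only for radii below `1 / 2`.

For the limit, the Weiss density has to be bounded for small radii, by a constant depending only on
`n` and `γ`. On small balls the weight perturbs the harmonicity of `u` by at most
`sup Q ≤ (2r)^γ`, which makes `u` continuous (`MinimizesOnBalls.continuousOn`) and, because
`u(x₀) = 0` and `u ≥ 0`, bounded by a multiple of `r^{γ+1}` on `B_r(x₀)`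
(`MinimizesOnBalls.growth`). The energy identity then bounds `D(r)` by a multiple of `r^a`
(`MinimizesOnBalls.dirichlet_le`). That `u ≥ 0` is `MinimizesOnBalls.nonneg`: minimality on balls
makes the gradient of the negative part of `u` vanish, once it is tested with functions of the test
functions approximating `u - u₀`; no regularity of `Ω` is needed.
-/

open scoped ENNReal NNReal

section

/-! ### Translations and mollification in `L²` -/

section Lp

variable {E F : Type*} [NormedAddCommGroup E] [InnerProductSpace ℝ E] [FiniteDimensional ℝ E]
  [MeasurableSpace E] [BorelSpace E] [NormedAddCommGroup F]

/-- Composition with a map that distorts volumes by a factor at most `2` is bounded on `L^p`. -/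
theorem eLpNorm_comp_le {p : ℝ≥0∞} (hp1 : 1 ≤ p) (hp : p ≠ ⊤) {f : E → F}
    (hf : AEStronglyMeasurable f volume) {σ : E → E} (hσ : Measurable σ)
    (hvol : Measure.map σ volume ≤ (2 : ℝ≥0∞) • (volume : Measure E)) :
    eLpNorm (fun x => f (σ x)) p volume ≤ 2 * eLpNorm f p volume := by
  have hac : Measure.map σ volume ≪ (volume : Measure E) :=
    (Measure.absolutelyContinuous_of_le hvol).trans
      (Measure.smul_absolutelyContinuous)
  have h1 : eLpNorm (f ∘ σ) p volume = eLpNorm f p (Measure.map σ volume) :=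
    (eLpNorm_map_measure (hf.mono_ac hac) hσ.aemeasurable).symm
  have h2 := eLpNorm_mono_measure (p := p) f hvol
  rw [eLpNorm_smul_measure_of_ne_top hp] at h2
  change eLpNorm (f ∘ σ) p volume ≤ _
  rw [h1]
  refine h2.trans ?_
  rw [smul_eq_mul]
  gcongr
  have : (1 / p).toReal ≤ 1 := by
    rw [one_div]
    refine ENNReal.toReal_le_of_le_ofReal zero_le_one ?_
    simpa using hp1
  calc (2 : ℝ≥0∞) ^ (1 / p).toReal ≤ 2 ^ (1 : ℝ) :=
        ENNReal.rpow_le_rpow_of_exponent_le (by norm_num) this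
    _ = 2 := by simp

/-- Composition with maps close to the identity is continuous in `Lᵖ`, uniformly over all maps
which expand volumes at most by a factor two. -/
theorem exists_eLpNorm_comp_sub_le {p : ℝ≥0∞} (hp1 : 1 ≤ p) (hp : p ≠ ⊤) [NormedSpace ℝ F]
    {f : E → F} (hf : MemLp f p volume) {ε : ℝ≥0∞} (hε : ε ≠ 0) :
    ∃ δ : ℝ, 0 < δ ∧ ∀ σ : E → E, Measurable σ →
      Measure.map σ volume ≤ (2 : ℝ≥0∞) • (volume : Measure E) → (∀ x, ‖σ x - x‖ ≤ δ) →
      eLpNorm (fun x => f (σ x) - f x) p volume ≤ ε := by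
  have hη : ε / 4 ≠ 0 := by simp [hε]
  obtain ⟨g, gsupp, hfg, gcont, gmem⟩ := hf.exists_hasCompactSupport_eLpNorm_sub_le hp hη
  set K := cthickening 1 (tsupport g)
  have hK : IsCompact K := gsupp.isCompact.cthickening
  have hA : volume K ^ (1 / p.toReal) ≠ ⊤ :=
    ENNReal.rpow_ne_top_of_nonneg (by positivity) hK.measure_lt_top.ne
  obtain ⟨c, hc, hcA⟩ := ENNReal.exists_nnreal_pos_mul_lt hA hη
  obtain ⟨δ, hδ, hgδ⟩ := Metric.uniformContinuous_iff.1
    (gcont.uniformContinuous_of_tendsto_cocompact gsupp.is_zero_at_infty) c (by exact_mod_cast hc)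
  refine ⟨min (δ / 2) 1, by positivity, fun σ hσ hvol hclose => ?_⟩
  have hac : Measure.map σ volume ≪ (volume : Measure E) :=
    (Measure.absolutelyContinuous_of_le hvol).trans
      (Measure.smul_absolutelyContinuous)
  have hd : AEStronglyMeasurable (f - g) volume := hf.1.sub gmem.1
  have e1 : eLpNorm (fun x => (f - g) (σ x)) p volume ≤ 2 * (ε / 4) :=
    (eLpNorm_comp_le hp1 hp hd hσ hvol).trans (by gcongr)
  have e2 : eLpNorm (fun x => g (σ x) - g x) p volume ≤ ε / 4 := by
    have : ∀ x, ‖g (σ x) - g x‖ ≤ ‖K.indicator (fun _ => (c : ℝ)) x‖ := by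
      intro x
      by_cases hx : x ∈ K
      · rw [indicator_of_mem hx]
        have : dist (σ x) x < δ := by
          rw [dist_eq_norm]
          exact ((hclose x).trans (min_le_left _ _)).trans_lt (by linarith)
        have := hgδ this
        rw [dist_eq_norm] at this
        simpa using this.le
      · have h1 : x ∉ tsupport g := fun h => hx (self_subset_cthickening _ h)
        have h2 : σ x ∉ tsupport g := fun h => by
          apply hx
          refine mem_cthickening_of_dist_le x (σ x) 1 _ h ?_
          rw [dist_comm, dist_eq_norm]
          exact (hclose x).trans (min_le_right _ _)
        simp [image_eq_zero_of_notMem_tsupport h1, image_eq_zero_of_notMem_tsupport h2]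
    refine (eLpNorm_mono this).trans ((eLpNorm_indicator_const_le _ _).trans ?_)
    simpa using hcA.le
  have e3 : eLpNorm (fun x => g x - f x) p volume ≤ ε / 4 := by
    rw [← eLpNorm_neg]
    refine le_of_eq_of_le ?_ hfg
    congr 1; ext x; simp
  have hgm : AEStronglyMeasurable (fun x => g (σ x) - g x) volume :=
    ((gcont.aestronglyMeasurable.mono_ac hac).comp_measurable hσ).sub gmem.1
  have hdm : AEStronglyMeasurable (fun x => (f - g) (σ x)) volume :=
    (hd.mono_ac hac).comp_measurable hσ
  calc eLpNorm (fun x => f (σ x) - f x) p volume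
      = eLpNorm ((fun x => (f - g) (σ x)) + ((fun x => g (σ x) - g x) + fun x => g x - f x))
          p volume := by
        congr 1; ext x; simp
    _ ≤ 2 * (ε / 4) + (ε / 4 + ε / 4) := by
        refine (eLpNorm_add_le hdm (hgm.add (gmem.1.sub hf.1)) hp1).trans ?_
        refine add_le_add e1 ((eLpNorm_add_le hgm (gmem.1.sub hf.1) hp1).trans ?_)
        exact add_le_add e2 e3
    _ = ε := by
        have : (ε / 4 + ε / 4) = 2 * (ε / 4) := by ring
        rw [this, ← two_mul, ← mul_assoc]
        norm_num
        exact ENNReal.mul_div_cancel (by norm_num) (by norm_num)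

theorem sq_lintegral_le_lintegral_sq {α : Type*} [MeasurableSpace α] {μ : Measure α}
    [IsProbabilityMeasure μ] {f : α → ℝ≥0∞} (hf : AEMeasurable f μ) :
    (∫⁻ x, f x ∂μ) ^ 2 ≤ ∫⁻ x, f x ^ 2 ∂μ := by
  have h := ENNReal.lintegral_mul_le_Lp_mul_Lq μ Real.HolderConjugate.two_two hf
    (aemeasurable_const (b := (1 : ℝ≥0∞)))
  simp only [Pi.mul_apply, mul_one, ENNReal.one_rpow, lintegral_const, measure_univ] at h
  have h2 := pow_le_pow_left' h 2
  refine h2.trans (le_of_eq ?_)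
  rw [← ENNReal.rpow_natCast, ← ENNReal.rpow_mul]
  norm_num

theorem eLpNorm_two_sq {α : Type*} [MeasurableSpace α] {μ : Measure α} (f : α → F) :
    eLpNorm f 2 μ ^ 2 = ∫⁻ x, ‖f x‖ₑ ^ 2 ∂μ := by
  have := eLpNorm_nnreal_pow_eq_lintegral (f := f) (μ := μ) (p := 2) (by norm_num)
  simpa using this

theorem eLpNorm_convolution_sub_le [NormedSpace ℝ F] [CompleteSpace F] (ρ : ContDiffBump (0 : E))
    {f : E → F} (hf : MemLp f 2 volume) {ε : ℝ≥0∞}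
    (h : ∀ y : E, ‖y‖ ≤ ρ.rOut → eLpNorm (fun x => f (x - y) - f x) 2 volume ≤ ε) :
    eLpNorm (fun x => (convolution (ρ.normed volume) f (ContinuousLinearMap.lsmul ℝ ℝ) volume) x
      - f x) 2 volume ≤ ε := by
  classical
  set r : E → ℝ := ρ.normed volume with hr
  set w : E → ℝ≥0∞ := fun y => ENNReal.ofReal (r y) with hw
  have hwm : Measurable w := ρ.continuous_normed.measurable.ennreal_ofReal
  have hw1 : ∫⁻ y, w y = 1 := by
    rw [hw, ← ofReal_integral_eq_lintegral_ofReal ρ.integrable_normed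
      (Eventually.of_forall ρ.nonneg_normed), ρ.integral_normed, ENNReal.ofReal_one]
  set μ : Measure E := volume.withDensity w
  have : IsProbabilityMeasure μ := ⟨by simp [μ, withDensity_apply, hw1]⟩
  have hfl : LocallyIntegrable f volume := hf.locallyIntegrable (by norm_num)
  have hprod : AEMeasurable (fun z : E × E => ‖f (z.1 - z.2) - f z.1‖ₑ)
      ((volume : Measure E).prod volume) := by
    refine AEStronglyMeasurable.enorm (AEStronglyMeasurable.sub ?_ ?_)
    · exact hf.1.comp_quasiMeasurePreserving (quasiMeasurePreserving_sub volume volume)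
    · exact hf.1.comp_quasiMeasurePreserving Measure.quasiMeasurePreserving_fst
  have hμac : μ ≪ volume := withDensity_absolutelyContinuous _ _
  have key : ∀ x, ‖(convolution r f (ContinuousLinearMap.lsmul ℝ ℝ) volume) x - f x‖ₑ
      ≤ ∫⁻ y, ‖f (x - y) - f x‖ₑ ∂μ := by
    intro x
    have hi : Integrable (fun y => r y • f (x - y)) volume := by
      have := (ρ.hasCompactSupport_normed (μ := volume)).convolutionExists_left
        (ContinuousLinearMap.lsmul ℝ ℝ : ℝ →L[ℝ] F →L[ℝ] F) ρ.continuous_normed hfl x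
      exact this
    have : (convolution r f (ContinuousLinearMap.lsmul ℝ ℝ) volume) x - f x
        = ∫ y, r y • (f (x - y) - f x) := by
      rw [convolution_def]
      simp only [ContinuousLinearMap.lsmul_apply, smul_sub]
      rw [integral_sub hi (ρ.integrable_normed.smul_const _), integral_smul_const,
        ρ.integral_normed, one_smul]
    rw [this]
    refine (enorm_integral_le_lintegral_enorm _).trans (le_of_eq ?_)
    rw [lintegral_withDensity_eq_lintegral_mul_non_measurable₀ _ hwm.aemeasurable
      (Eventually.of_forall fun y => ENNReal.ofReal_lt_top)]
    refine lintegral_congr fun y => ?_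
    rw [enorm_smul, Pi.mul_apply, hw, Real.enorm_eq_ofReal (ρ.nonneg_normed y)]
  have hmx : ∀ᵐ x, AEMeasurable (fun y => ‖f (x - y) - f x‖ₑ) (volume : Measure E) :=
    by
    filter_upwards [hprod.aestronglyMeasurable.prodMk_left] with x hx using hx.aemeasurable
  refine (ENNReal.pow_le_pow_left_iff (n := 2) (by norm_num)).1 ?_
  rw [eLpNorm_two_sq]
  calc ∫⁻ x, ‖(convolution r f (ContinuousLinearMap.lsmul ℝ ℝ) volume) x - f x‖ₑ ^ 2
      ≤ ∫⁻ x, ∫⁻ y, ‖f (x - y) - f x‖ₑ ^ 2 ∂μ := by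
        refine lintegral_mono_ae ?_
        filter_upwards [hmx] with x hx
        exact (pow_le_pow_left' (key x) 2).trans
          (sq_lintegral_le_lintegral_sq (hx.mono_ac hμac))
    _ = ∫⁻ y, (∫⁻ x, ‖f (x - y) - f x‖ₑ ^ 2) ∂μ := by
        refine lintegral_lintegral_swap ?_
        exact (hprod.pow_const 2).mono_ac (Measure.AbsolutelyContinuous.prod
          Measure.AbsolutelyContinuous.rfl hμac)
    _ ≤ ∫⁻ y, ε ^ 2 ∂μ := by
        rw [lintegral_withDensity_eq_lintegral_mul_non_measurable₀ _ hwm.aemeasurable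
            (Eventually.of_forall fun y => ENNReal.ofReal_lt_top),
          lintegral_withDensity_eq_lintegral_mul_non_measurable₀ _ hwm.aemeasurable
            (Eventually.of_forall fun y => ENNReal.ofReal_lt_top)]
        refine lintegral_mono fun y => ?_
        simp only [Pi.mul_apply]
        by_cases hy : ‖y‖ ≤ ρ.rOut
        · gcongr
          rw [← eLpNorm_two_sq]
          exact pow_le_pow_left' (h y hy) 2
        · have : r y = 0 := by
            have : y ∉ Function.support r := by
              rw [hr, ρ.support_normed_eq]; simp; linarith
            simpa using this
          simp [hw, this]
    _ = ε ^ 2 := by simp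

end Lp

variable {n : ℕ} {D D' Ω : Set (Euc n)} {Q u w v : Euc n → ℝ} {Du Dw Dv : Euc n → Euc n}

/-! ### Sobolev functions and test functions -/

theorem eLpNorm_tendsto_const_zero {α ι F : Type*} [MeasurableSpace α] {μ : Measure α}
    [NormedAddCommGroup F] {l : Filter ι} (f : α → F) :
    Tendsto (fun _ : ι => eLpNorm (fun x => f x - f x) 2 μ) l (𝓝 0) := by
  simpa using tendsto_const_nhds

section L2

variable {α ι F : Type*} [MeasurableSpace α] {μ : Measure α} [NormedAddCommGroup F]
  [InnerProductSpace ℝ F] {l : Filter ι}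

theorem tendsto_integral_inner {f g : ι → α → F} {f₀ g₀ : α → F}
    (hf : ∀ i, MemLp (f i) 2 μ) (hf₀ : MemLp f₀ 2 μ) (hg : ∀ i, MemLp (g i) 2 μ)
    (hg₀ : MemLp g₀ 2 μ)
    (hfl : Tendsto (fun i => eLpNorm (fun x => f i x - f₀ x) 2 μ) l (𝓝 0))
    (hgl : Tendsto (fun i => eLpNorm (fun x => g i x - g₀ x) 2 μ) l (𝓝 0)) :
    Tendsto (fun i => ∫ x, inner ℝ (f i x) (g i x) ∂μ) l (𝓝 (∫ x, inner ℝ (f₀ x) (g₀ x) ∂μ)) := by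
  have h1 : Tendsto (fun i => (hf i).toLp) l (𝓝 hf₀.toLp) :=
    (Lp.tendsto_Lp_iff_tendsto_eLpNorm'' _ hf _ hf₀).2 hfl
  have h2 : Tendsto (fun i => (hg i).toLp) l (𝓝 hg₀.toLp) :=
    (Lp.tendsto_Lp_iff_tendsto_eLpNorm'' _ hg _ hg₀).2 hgl
  have h3 := h1.inner (𝕜 := ℝ) h2
  have key : ∀ (a b : α → F) (ha : MemLp a 2 μ) (hb : MemLp b 2 μ),
      inner ℝ ha.toLp hb.toLp = ∫ x, inner ℝ (a x) (b x) ∂μ := by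
    intro a b ha hb
    rw [L2.inner_def]
    refine integral_congr_ae ?_
    filter_upwards [ha.coeFn_toLp, hb.coeFn_toLp] with x hx hy
    rw [hx, hy]
  simpa only [key] using h3

theorem tendsto_integral_mul {f g : ι → α → ℝ} {f₀ g₀ : α → ℝ}
    (hf : ∀ i, MemLp (f i) 2 μ) (hf₀ : MemLp f₀ 2 μ) (hg : ∀ i, MemLp (g i) 2 μ)
    (hg₀ : MemLp g₀ 2 μ)
    (hfl : Tendsto (fun i => eLpNorm (fun x => f i x - f₀ x) 2 μ) l (𝓝 0))
    (hgl : Tendsto (fun i => eLpNorm (fun x => g i x - g₀ x) 2 μ) l (𝓝 0)) :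
    Tendsto (fun i => ∫ x, f i x * g i x ∂μ) l (𝓝 (∫ x, f₀ x * g₀ x ∂μ)) := by
  have := tendsto_integral_inner hg hg₀ hf hf₀ hgl hfl
  simpa using this

theorem integrable_inner {f g : α → F} (hf : MemLp f 2 μ) (hg : MemLp g 2 μ) :
    Integrable (fun x => inner ℝ (f x) (g x)) μ := by
  refine (L2.integrable_inner (𝕜 := ℝ) hf.toLp hg.toLp).congr ?_
  filter_upwards [hf.coeFn_toLp, hg.coeFn_toLp] with x hx hy
  rw [hx, hy]

theorem integrable_norm_sq {f : α → F} (hf : MemLp f 2 μ) :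
    Integrable (fun x => ‖f x‖ ^ 2) μ := by
  simpa using (integrable_inner hf hf)

theorem abs_integral_inner_le {f g : α → F} (hf : MemLp f 2 μ) (hg : MemLp g 2 μ) :
    |∫ x, inner ℝ (f x) (g x) ∂μ| ≤ √(∫ x, ‖f x‖ ^ 2 ∂μ) * √(∫ x, ‖g x‖ ^ 2 ∂μ) := by
  have key : ∀ (a b : α → F) (ha : MemLp a 2 μ) (hb : MemLp b 2 μ),
      inner ℝ ha.toLp hb.toLp = ∫ x, inner ℝ (a x) (b x) ∂μ := by
    intro a b ha hb
    rw [L2.inner_def]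
    refine integral_congr_ae ?_
    filter_upwards [ha.coeFn_toLp, hb.coeFn_toLp] with x hx hy
    rw [hx, hy]
  have key2 : ∀ (a : α → F) (ha : MemLp a 2 μ), ‖ha.toLp‖ = √(∫ x, ‖a x‖ ^ 2 ∂μ) := by
    intro a ha
    have h1 := key a a ha ha
    rw [real_inner_self_eq_norm_sq] at h1
    simp only [real_inner_self_eq_norm_sq] at h1
    rw [← h1, Real.sqrt_sq (norm_nonneg _)]
  have := abs_real_inner_le_norm hf.toLp hg.toLp
  rwa [key, key2, key2] at this

end L2

theorem IsTestFunction.mono {φ : Euc n → ℝ} (h : IsTestFunction D φ) (hD : D ⊆ D') :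
    IsTestFunction D' φ := ⟨h.1, h.2.1, h.2.2.trans hD⟩

theorem IsTestFunction.eq_zero {φ : Euc n → ℝ} (h : IsTestFunction D φ) {x : Euc n} (hx : x ∉ D) :
    φ x = 0 := image_eq_zero_of_notMem_tsupport fun h' => hx (h.2.2 h')

theorem IsTestFunction.fderiv_eq_zero {φ : Euc n → ℝ} (h : IsTestFunction D φ) {x : Euc n}
    (hx : x ∉ D) : fderiv ℝ φ x = 0 := fderiv_of_notMem_tsupport ℝ fun h' => hx (h.2.2 h')

theorem IsTestFunction.gradient_eq_zero {φ : Euc n → ℝ} (h : IsTestFunction D φ) {x : Euc n}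
    (hx : x ∉ D) : gradient φ x = 0 := by
  rw [gradient, h.fderiv_eq_zero hx, map_zero]

theorem continuous_gradient {φ : Euc n → ℝ} (h : ContDiff ℝ ∞ φ) : Continuous (gradient φ) := by
  unfold gradient
  exact (LinearIsometryEquiv.continuous _).comp (h.continuous_fderiv (by simp))

theorem hasCompactSupport_gradient {φ : Euc n → ℝ} (h : HasCompactSupport φ) :
    HasCompactSupport (gradient φ) := by
  unfold gradient
  exact (h.fderiv ℝ).comp_left (map_zero _)

theorem IsTestFunction.memLp {φ : Euc n → ℝ} (h : IsTestFunction D φ) {p : ℝ≥0∞} :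
    MemLp φ p volume := h.1.continuous.memLp_of_hasCompactSupport h.2.1

theorem IsTestFunction.memLp_gradient {φ : Euc n → ℝ} (h : IsTestFunction D φ) {p : ℝ≥0∞} :
    MemLp (gradient φ) p volume :=
  (continuous_gradient h.1).memLp_of_hasCompactSupport (hasCompactSupport_gradient h.2.1)

theorem IsTestFunction.differentiableAt {φ : Euc n → ℝ} (h : IsTestFunction D φ) (x : Euc n) :
    DifferentiableAt ℝ φ x := h.1.differentiable (by simp) x

theorem IsTestFunction.mul_left {φ ψ : Euc n → ℝ} (h : IsTestFunction D φ) (hψ : ContDiff ℝ ∞ ψ) :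
    IsTestFunction D (fun x => ψ x * φ x) :=
  ⟨hψ.mul h.1, h.2.1.mul_left, (tsupport_mul_subset_right).trans h.2.2⟩

theorem IsTestFunction.const_mul {φ : Euc n → ℝ} (h : IsTestFunction D φ) (c : ℝ) :
    IsTestFunction D (fun x => c * φ x) := h.mul_left contDiff_const

theorem gradient_mul {φ ψ : Euc n → ℝ} {x : Euc n} (hφ : DifferentiableAt ℝ φ x)
    (hψ : DifferentiableAt ℝ ψ x) :
    gradient (fun y => φ y * ψ y) x = φ x • gradient ψ x + ψ x • gradient φ x := by
  unfold gradient
  rw [fderiv_fun_mul hφ hψ]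
  simp

theorem gradient_sub {φ ψ : Euc n → ℝ} {x : Euc n} (hφ : DifferentiableAt ℝ φ x)
    (hψ : DifferentiableAt ℝ ψ x) :
    gradient (fun y => φ y - ψ y) x = gradient φ x - gradient ψ x := by
  unfold gradient
  rw [fderiv_fun_sub hφ hψ]
  simp

theorem memLp_fderiv_apply {φ : Euc n → ℝ} (h : IsTestFunction D φ) (e : Euc n) {p : ℝ≥0∞} :
    MemLp (fun x => fderiv ℝ φ x e) p volume :=
  ((h.1.continuous_fderiv (by simp)).clm_apply continuous_const).memLp_of_hasCompactSupport
    (h.2.1.fderiv_apply ℝ e)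

theorem MemW12.mono (h : MemW12 D u Du) (hD : D' ⊆ D) : MemW12 D' u Du where
  memLp := h.memLp.mono_measure (Measure.restrict_mono hD le_rfl)
  memLp_grad := h.memLp_grad.mono_measure (Measure.restrict_mono hD le_rfl)
  weak_grad φ hφ e := by
    have h1 := h.weak_grad φ (hφ.mono hD) e
    have e1 : ∀ x, x ∉ D' → u x * fderiv ℝ φ x e = 0 := fun x hx => by
      simp [hφ.fderiv_eq_zero hx]
    have e2 : ∀ x, x ∉ D' → inner ℝ (Du x) e * φ x = 0 := fun x hx => by
      simp [hφ.eq_zero hx]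
    rw [setIntegral_eq_integral_of_forall_compl_eq_zero e1,
      setIntegral_eq_integral_of_forall_compl_eq_zero e2]
    rwa [setIntegral_eq_integral_of_forall_compl_eq_zero (fun x hx => e1 x fun h => hx (hD h)),
      setIntegral_eq_integral_of_forall_compl_eq_zero (fun x hx => e2 x fun h => hx (hD h))] at h1

theorem MemW12.weak_grad_integrable (h : MemW12 D u Du) {φ : Euc n → ℝ} (hφ : IsTestFunction D φ)
    (e : Euc n) : Integrable (fun x => u x * fderiv ℝ φ x e) (volume.restrict D) ∧
      Integrable (fun x => inner ℝ (Du x) e * φ x) (volume.restrict D) :=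
  ⟨h.memLp.integrable_mul ((memLp_fderiv_apply hφ e (p := 2)).restrict _),
    ((h.memLp_grad.inner_const e)).integrable_mul ((hφ.memLp (p := 2)).restrict _)⟩

theorem MemW12.add (h : MemW12 D u Du) (h' : MemW12 D w Dw) :
    MemW12 D (fun x => u x + w x) (fun x => Du x + Dw x) where
  memLp := h.memLp.add h'.memLp
  memLp_grad := h.memLp_grad.add h'.memLp_grad
  weak_grad φ hφ e := by
    have i1 := h.weak_grad_integrable hφ e
    have i2 := h'.weak_grad_integrable hφ e
    simp only [add_mul, inner_add_left]
    rw [integral_add i1.1 i2.1, integral_add i1.2 i2.2, h.weak_grad φ hφ e, h'.weak_grad φ hφ e]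
    ring

theorem MemW12.const_mul (h : MemW12 D u Du) (c : ℝ) :
    MemW12 D (fun x => c * u x) (fun x => c • Du x) where
  memLp := h.memLp.const_mul c
  memLp_grad := h.memLp_grad.const_smul c
  weak_grad φ hφ e := by
    simp only [inner_smul_left, mul_assoc, integral_const_mul, h.weak_grad φ hφ e]
    simp

theorem MemW12.of_tendsto {ι : Type*} {l : Filter ι} [l.NeBot] {f : ι → Euc n → ℝ}
    {Df : ι → Euc n → Euc n} (hf : ∀ j, MemW12 D (f j) (Df j))
    (hw : MemLp w 2 (volume.restrict D)) (hDw : MemLp Dw 2 (volume.restrict D))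
    (h1 : Tendsto (fun j => eLpNorm (fun x => f j x - w x) 2 (volume.restrict D)) l (𝓝 0))
    (h2 : Tendsto (fun j => eLpNorm (fun x => Df j x - Dw x) 2 (volume.restrict D)) l (𝓝 0)) :
    MemW12 D w Dw where
  memLp := hw
  memLp_grad := hDw
  weak_grad φ hφ e := by
    have m1 : MemLp (fun x => fderiv ℝ φ x e) 2 (volume.restrict D) :=
      (memLp_fderiv_apply hφ e).restrict _
    have m2 : MemLp (fun x => φ x • e) 2 (volume.restrict D) := by
      have : MemLp (fun x => φ x • e) 2 volume :=
        (hφ.1.continuous.smul continuous_const).memLp_of_hasCompactSupport hφ.2.1.smul_right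
      exact this.restrict _
    have t1 := tendsto_integral_mul (fun j => (hf j).memLp) hw (fun _ => m1) m1 h1
      (eLpNorm_tendsto_const_zero _)
    have t2 := tendsto_integral_inner (fun j => (hf j).memLp_grad) hDw (fun _ => m2) m2 h2
      (eLpNorm_tendsto_const_zero _)
    simp only [inner_smul_right] at t2
    have e0 : ∀ j, ∫ x in D, f j x * fderiv ℝ φ x e
        = - ∫ x in D, φ x * inner ℝ (Df j x) e := fun j => by
      rw [(hf j).weak_grad φ hφ e]; simp only [mul_comm]
    simp only [e0] at t1
    have := tendsto_nhds_unique t1 t2.neg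
    rw [this]; simp only [mul_comm]

theorem memW12_of_test {φ : Euc n → ℝ} (h : IsTestFunction D' φ) : MemW12 D φ (gradient φ) where
  memLp := (h.memLp.restrict _)
  memLp_grad := (h.memLp_gradient.restrict _)
  weak_grad ψ hψ e := by
    rw [setIntegral_eq_integral_of_forall_compl_eq_zero
        (fun x hx => by simp [hψ.fderiv_eq_zero hx]),
      setIntegral_eq_integral_of_forall_compl_eq_zero
        (fun x hx => by simp [hψ.eq_zero hx])]
    simp only [inner_gradient_left]
    refine integral_mul_fderiv_eq_neg_fderiv_mul_of_integrable ?_ ?_ ?_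
      (fun x _ => h.differentiableAt x) (fun x _ => hψ.differentiableAt x)
    · exact (memLp_fderiv_apply h e (p := 2)).integrable_mul (hψ.memLp (p := 2))
    · exact (h.memLp (p := 2)).integrable_mul (memLp_fderiv_apply hψ e (p := 2))
    · exact (h.memLp (p := 2)).integrable_mul (hψ.memLp (p := 2))

theorem memW12Zero_of_approx {φ : ℕ → Euc n → ℝ} (hφ : ∀ j, IsTestFunction D (φ j))
    (hw : MemLp w 2 (volume.restrict D)) (hDw : MemLp Dw 2 (volume.restrict D))
    (h1 : Tendsto (fun j => eLpNorm (fun x => φ j x - w x) 2 (volume.restrict D)) atTop (𝓝 0))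
    (h2 : Tendsto (fun j => eLpNorm (fun x => gradient (φ j) x - Dw x) 2 (volume.restrict D))
      atTop (𝓝 0)) : MemW12Zero D w Dw :=
  ⟨MemW12.of_tendsto (fun j => memW12_of_test (hφ j)) hw hDw h1 h2, φ, hφ, h1, h2⟩

theorem memW12Zero_of_test {φ : Euc n → ℝ} (h : IsTestFunction D φ) :
    MemW12Zero D φ (gradient φ) :=
  memW12Zero_of_approx (φ := fun _ => φ) (fun _ => h) (h.memLp.restrict _) (h.memLp_gradient.restrict _)
    (eLpNorm_tendsto_const_zero _) (eLpNorm_tendsto_const_zero _)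

theorem MemW12Zero.const_mul (h : MemW12Zero D w Dw) (c : ℝ) :
    MemW12Zero D (fun x => c * w x) (fun x => c • Dw x) := by
  obtain ⟨φ, hφ, h1, h2⟩ := h.approx
  refine ⟨h.memW12.const_mul c, fun j x => c * φ j x, fun j => (hφ j).const_mul c, ?_, ?_⟩
  · have := ENNReal.Tendsto.const_mul (a := ‖c‖ₑ) h1 (Or.inr enorm_ne_top)
    simp only [mul_zero] at this
    refine this.congr fun j => ?_
    rw [← eLpNorm_const_smul]
    congr 1; ext x; simp [mul_sub]
  · have := ENNReal.Tendsto.const_mul (a := ‖c‖ₑ) h2 (Or.inr enorm_ne_top)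
    simp only [mul_zero] at this
    refine this.congr fun j => ?_
    rw [← eLpNorm_const_smul]
    congr 1; ext x
    rw [gradient_mul (differentiableAt_const c) ((hφ j).differentiableAt x)]
    simp [mul_sub]

theorem memK_add (h : MemW12 D u Du) (hw : MemW12Zero D w Dw) :
    MemK D u Du (fun x => u x + w x) (fun x => Du x + Dw x) := by
  refine ⟨h.add hw.memW12, ?_⟩
  simpa using hw

theorem memLp_univ_of_restrict {F : Type*} [NormedAddCommGroup F] {f : Euc n → F} {p : ℝ≥0∞}
    (hD : MeasurableSet D) (h : MemLp f p (volume.restrict D)) (h0 : ∀ x ∉ D, f x = 0) :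
    MemLp f p volume := by
  rw [← memLp_indicator_iff_restrict hD] at h
  rwa [indicator_eq_self.2] at h
  intro x hx
  by_contra h'
  exact hx (h0 x h')

/-- Multiplication by a cut-off function extends a Sobolev function by zero to the whole space. -/
theorem MemW12.cutoff (hD : MeasurableSet D) (h : MemW12 D u Du) {ζ : Euc n → ℝ}
    (hζ : IsTestFunction D ζ) :
    MemW12 univ (fun x => ζ x * u x) (fun x => ζ x • Du x + u x • gradient ζ x) where
  memLp := by
    rw [Measure.restrict_univ]
    refine memLp_univ_of_restrict hD ?_ (fun x hx => by simp [hζ.eq_zero hx])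
    exact h.memLp.mul' (hζ.memLp.restrict _) (p := ⊤) (q := 2)
  memLp_grad := by
    rw [Measure.restrict_univ]
    refine memLp_univ_of_restrict hD ?_
      (fun x hx => by simp [hζ.eq_zero hx, hζ.gradient_eq_zero hx])
    refine MemLp.add ?_ ?_
    · exact h.memLp_grad.smul (hζ.memLp.restrict _) (p := ⊤) (q := 2)
    · exact (hζ.memLp_gradient.restrict _).smul h.memLp (p := 2) (q := ⊤)
  weak_grad φ hφ e := by
    have t := hζ.mul_left hφ.1
    have h1 := h.weak_grad _ t e
    have i1 := h.weak_grad_integrable t e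
    have hζ0 : ∀ x ∉ D, ζ x = 0 := fun x hx => hζ.eq_zero hx
    have hζ1 : ∀ x ∉ D, gradient ζ x = 0 := fun x hx => hζ.gradient_eq_zero hx
    have hA := setIntegral_eq_integral_of_forall_compl_eq_zero (μ := volume) (s := D)
      (f := fun x => ζ x * u x * fderiv ℝ φ x e) (fun x hx => by simp [hζ0 x hx])
    have hB := setIntegral_eq_integral_of_forall_compl_eq_zero (μ := volume) (s := D)
      (f := fun x => inner ℝ (ζ x • Du x + u x • gradient ζ x) e * φ x)
      (fun x hx => by simp [hζ0 x hx, hζ1 x hx])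
    rw [Measure.restrict_univ, ← hA, ← hB]
    have e1 : ∀ x, ζ x * u x * fderiv ℝ φ x e
        = u x * fderiv ℝ (fun y => φ y * ζ y) x e - u x * fderiv ℝ ζ x e * φ x := by
      intro x
      rw [fderiv_fun_mul (hφ.differentiableAt x) (hζ.differentiableAt x)]
      simp; ring
    have i2 : Integrable (fun x => u x * fderiv ℝ ζ x e * φ x) (volume.restrict D) := by
      have : MemLp (fun x => fderiv ℝ ζ x e * φ x) 2 (volume.restrict D) :=
        (hφ.memLp.mul' (memLp_fderiv_apply hζ e) (p := 2) (q := ⊤)).restrict _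
      refine (h.memLp.integrable_mul this).congr (Eventually.of_forall fun x => ?_)
      simp [mul_assoc]
    simp only [e1]
    rw [integral_sub i1.1 i2, h1, ← integral_neg, ← integral_neg, ← integral_sub (by exact i1.2.neg) i2]
    refine integral_congr_ae (Eventually.of_forall fun x => ?_)
    simp only [inner_add_left, inner_smul_left, inner_gradient_left]
    simp; ring

/-! ### Approximation by test functions -/

theorem tendsto_eLpNorm_convolution_sub {E F : Type*} [NormedAddCommGroup E]
    [InnerProductSpace ℝ E] [FiniteDimensional ℝ E] [MeasurableSpace E] [BorelSpace E]
    [NormedAddCommGroup F] [NormedSpace ℝ F] [CompleteSpace F] {ρ : ℕ → ContDiffBump (0 : E)}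
    (hρ : Tendsto (fun j => (ρ j).rOut) atTop (𝓝 0)) {f : E → F} (hf : MemLp f 2 volume) :
    Tendsto (fun j => eLpNorm (fun x => (convolution ((ρ j).normed volume) f
      (ContinuousLinearMap.lsmul ℝ ℝ) volume) x - f x) 2 volume) atTop (𝓝 0) := by
  refine ENNReal.tendsto_nhds_zero.2 fun ε hε => ?_
  obtain ⟨δ, hδ, h⟩ := exists_eLpNorm_comp_sub_le (by norm_num) (by norm_num) hf hε.ne'
  filter_upwards [hρ.eventually (gt_mem_nhds hδ)] with j hj
  refine eLpNorm_convolution_sub_le (ρ j) hf fun y hy => ?_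
  refine h (fun x => x - y) (by fun_prop) ?_ fun x => ?_
  · rw [(measurePreserving_sub_right volume y).map_eq]
    intro s
    simp only [Measure.smul_apply, smul_eq_mul]
    exact le_mul_of_one_le_left (by positivity) (by norm_num)
  · simpa using hy.trans hj.le

/-- The gradient of a mollified Sobolev function is the mollified weak gradient. -/
theorem MemW12.hasGradientAt_convolution (h : MemW12 univ u Du) (ρ : ContDiffBump (0 : Euc n))
    (x : Euc n) :
    HasGradientAt (convolution (ρ.normed volume) u (ContinuousLinearMap.lsmul ℝ ℝ) volume)
      ((convolution (ρ.normed volume) Du (ContinuousLinearMap.lsmul ℝ ℝ) volume) x) x := by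
  set r : Euc n → ℝ := ρ.normed volume
  have hrc : ContDiff ℝ ∞ r := ρ.contDiff_normed
  have hrs : HasCompactSupport r := ρ.hasCompactSupport_normed
  have hu : MemLp u 2 volume := by simpa using h.memLp
  have hDu : MemLp Du 2 volume := by simpa using h.memLp_grad
  have hul : LocallyIntegrable u volume := hu.locallyIntegrable (by norm_num)
  have hDul : LocallyIntegrable Du volume := hDu.locallyIntegrable (by norm_num)
  have hflip : convolution r u (ContinuousLinearMap.lsmul ℝ ℝ) volume
      = convolution u r (ContinuousLinearMap.lsmul ℝ ℝ) volume := by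
    rw [← convolution_flip]
    congr 1
    ext; simp
  have hd := hrs.hasFDerivAt_convolution_right (ContinuousLinearMap.lsmul ℝ ℝ) hul
    (hrc.of_le (by exact_mod_cast le_top)) x
  rw [hasGradientAt_iff_hasFDerivAt, hflip]
  refine hd.congr_fderiv (ContinuousLinearMap.ext fun e => ?_)
  rw [convolution_precompR_apply (ContinuousLinearMap.lsmul ℝ ℝ) hul
    (hrs.fderiv ℝ) (hrc.continuous_fderiv (by simp)) x e]
  have hφ : IsTestFunction univ (fun y => r (x - y)) := by
    refine ⟨hrc.comp (contDiff_const.sub contDiff_id), ?_, subset_univ _⟩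
    exact hrs.comp_homeomorph (Homeomorph.subLeft x)
  have hfd : ∀ y, fderiv ℝ (fun y => r (x - y)) y e = - fderiv ℝ r (x - y) e := by
    intro y
    have h1 : HasFDerivAt (fun y : Euc n => x - y) (-ContinuousLinearMap.id ℝ (Euc n)) y := by
      simpa using (hasFDerivAt_id y).const_sub x
    have h2 := ((hrc.differentiable (by simp)) (x - y)).hasFDerivAt.comp y h1
    rw [show (fun y => r (x - y)) = r ∘ fun y => x - y from rfl, h2.fderiv]
    simp
  have hw := h.weak_grad _ hφ e
  simp only [Measure.restrict_univ, hfd, mul_neg, integral_neg, neg_inj] at hw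
  rw [convolution_def]
  simp only [ContinuousLinearMap.lsmul_apply, smul_eq_mul, InnerProductSpace.toDual_apply_apply]
  rw [hw, convolution_eq_swap]
  simp only [ContinuousLinearMap.lsmul_apply]
  have hi : Integrable (fun y => r (x - y) • Du y) volume := by
    have := hrs.convolutionExists_left
      (ContinuousLinearMap.lsmul ℝ ℝ : ℝ →L[ℝ] Euc n →L[ℝ] Euc n) hrc.continuous hDul x
    exact this.integrable_swap
  rw [real_inner_comm, ← integral_inner hi]
  refine integral_congr_ae (Eventually.of_forall fun y => ?_)
  simp [inner_smul_right, real_inner_comm, mul_comm]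

/-- A compactly supported Sobolev function is a limit of test functions, supported in any given
neighbourhood of its support; the convergence is uniform if the function is continuous. -/
theorem MemW12.exists_test_approx (h : MemW12 univ u Du) {K U : Set (Euc n)} (hK : IsCompact K)
    (hU : IsOpen U) (hKU : K ⊆ U) (hu0 : ∀ x ∉ K, u x = 0) :
    ∃ φ : ℕ → Euc n → ℝ, (∀ j, IsTestFunction U (φ j)) ∧
      Tendsto (fun j => eLpNorm (fun x => φ j x - u x) 2 volume) atTop (𝓝 0) ∧
      Tendsto (fun j => eLpNorm (fun x => gradient (φ j) x - Du x) 2 volume) atTop (𝓝 0) ∧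
      (Continuous u → TendstoUniformly φ u atTop) := by
  have hu : MemLp u 2 volume := by simpa using h.memLp
  have hDu : MemLp Du 2 volume := by simpa using h.memLp_grad
  have hul : LocallyIntegrable u volume := hu.locallyIntegrable (by norm_num)
  obtain ⟨δ, hδ, hδU⟩ := hK.exists_cthickening_subset_open hU hKU
  let ρ : ℕ → ContDiffBump (0 : Euc n) := fun j =>
    { rIn := δ / (j + 1) / 2
      rOut := δ / (j + 1)
      rIn_pos := by positivity
      rIn_lt_rOut := half_lt_self (by positivity) }
  have hρ : Tendsto (fun j => (ρ j).rOut) atTop (𝓝 0) := by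
    have := (tendsto_one_div_add_atTop_nhds_zero_nat (𝕜 := ℝ)).const_mul δ
    simpa [ρ, div_eq_mul_inv] using this
  refine ⟨fun j => convolution ((ρ j).normed volume) u (ContinuousLinearMap.lsmul ℝ ℝ) volume,
    fun j => ?_, tendsto_eLpNorm_convolution_sub hρ hu, ?_, fun hc => ?_⟩
  · have hs : tsupport (convolution ((ρ j).normed volume) u (ContinuousLinearMap.lsmul ℝ ℝ) volume)
        ⊆ cthickening δ K := by
      refine closure_minimal ?_ isClosed_cthickening
      refine (support_convolution_subset _).trans ?_
      rintro x ⟨a, ha, b, hb, rfl⟩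
      have hbK : b ∈ K := by
        by_contra hb'
        exact hb (hu0 b hb')
      rw [(ρ j).support_normed_eq] at ha
      refine mem_cthickening_of_dist_le _ b _ _ hbK ?_
      have ha' : ‖a‖ < δ / (j + 1) := by simpa [ρ] using ha
      have : δ / ((j : ℝ) + 1) ≤ δ := div_le_self hδ.le (by linarith [j.cast_nonneg (α := ℝ)])
      simp only [dist_eq_norm, add_sub_cancel_right]
      exact ha'.le.trans this
    refine ⟨?_, ?_, hs.trans hδU⟩
    · exact ((ρ j).hasCompactSupport_normed).contDiff_convolution_left _
        (ρ j).contDiff_normed hul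
    · exact hK.cthickening.of_isClosed_subset (isClosed_tsupport _) hs
  · have := tendsto_eLpNorm_convolution_sub hρ hDu
    refine this.congr fun j => ?_
    congr 1; ext1 x
    rw [(h.hasGradientAt_convolution (ρ j) x).gradient]
  · have hsupp : HasCompactSupport u := by
      refine hK.of_isClosed_subset (isClosed_tsupport _) (closure_minimal ?_ hK.isClosed)
      intro x hx
      by_contra hx'
      exact hx (hu0 x hx')
    have huc := hc.uniformContinuous_of_tendsto_cocompact hsupp.is_zero_at_infty
    rw [Metric.tendstoUniformly_iff]
    intro ε hε
    obtain ⟨η, hη, huη⟩ := Metric.uniformContinuous_iff.1 huc (ε / 2) (by positivity)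
    filter_upwards [hρ.eventually (gt_mem_nhds hη)] with j hj x
    rw [dist_comm]
    refine lt_of_le_of_lt ((ρ j).dist_normed_convolution_le hul.aestronglyMeasurable
      (ε := ε / 2) (x₀ := x) fun y hy => ?_) (half_lt_self hε)
    exact (huη ((mem_ball.1 hy).trans hj)).le

/-- A compactly supported Sobolev function lies in `W₀^{1,2}` of any neighbourhood of its
support. -/
theorem MemW12.memW12Zero (h : MemW12 univ u Du) {K U : Set (Euc n)} (hK : IsCompact K)
    (hU : IsOpen U) (hKU : K ⊆ U) (hu0 : ∀ x ∉ K, u x = 0) : MemW12Zero U u Du := by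
  obtain ⟨φ, hφ, h1, h2, -⟩ := h.exists_test_approx hK hU hKU hu0
  have hle : ∀ {G : Type} [NormedAddCommGroup G] {f : ℕ → Euc n → G},
      Tendsto (fun j => eLpNorm (f j) 2 volume) atTop (𝓝 0) →
      Tendsto (fun j => eLpNorm (f j) 2 (volume.restrict U)) atTop (𝓝 0) := fun hf =>
    tendsto_of_tendsto_of_tendsto_of_le_of_le tendsto_const_nhds hf (fun _ => zero_le)
      fun j => eLpNorm_mono_measure _ Measure.restrict_le_self
  exact memW12Zero_of_approx hφ (h.mono (subset_univ _)).memLp (h.mono (subset_univ _)).memLp_grad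
    (hle h1) (hle h2)

theorem MemW12.test_mul (hD : IsOpen D) (h : MemW12 D u Du) {ζ : Euc n → ℝ}
    (hζ : IsTestFunction D ζ) :
    MemW12Zero D (fun x => ζ x * u x) (fun x => ζ x • Du x + u x • gradient ζ x) :=
  (h.cutoff hD.measurableSet hζ).memW12Zero hζ.2.1 hD hζ.2.2 fun x hx => by
    simp [image_eq_zero_of_notMem_tsupport hx]

theorem exists_test_eq_one {K U : Set (Euc n)} (hK : IsCompact K) (hU : IsOpen U) (hKU : K ⊆ U) :
    ∃ ζ : Euc n → ℝ, IsTestFunction U ζ ∧ (∀ x, ζ x ∈ Icc (0 : ℝ) 1) ∧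
      ∃ V, IsOpen V ∧ K ⊆ V ∧ ∀ x ∈ V, ζ x = 1 := by
  obtain ⟨L, hL, hKL, hLU⟩ := exists_compact_between hK hU hKU
  obtain ⟨L', hL', hLL', hLU'⟩ := exists_compact_between hL hU hLU
  obtain ⟨f, hf, hf01, hfs, hf1⟩ := exists_contMDiff_support_eq_eq_one_iff
    (modelWithCornersSelf ℝ (Euc n)) (n := (⊤ : ℕ∞)) (s := interior L') (t := L) isOpen_interior
    hL.isClosed hLL'
  have hts : tsupport f ⊆ L' := by
    refine closure_minimal ?_ hL'.isClosed
    rw [hfs]; exact interior_subset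
  refine ⟨f, ⟨hf.contDiff, hL'.of_isClosed_subset (isClosed_tsupport _) hts, hts.trans hLU'⟩,
    fun x => hf01 (mem_range_self x), interior L, isOpen_interior, hKL, fun x hx => ?_⟩
  exact (hf1 x).1 (interior_subset hx)

theorem gradient_comp {a : ℝ → ℝ} {φ : Euc n → ℝ} {x : Euc n} (ha : DifferentiableAt ℝ a (φ x))
    (hφ : DifferentiableAt ℝ φ x) :
    gradient (fun y => a (φ y)) x = deriv a (φ x) • gradient φ x := by
  unfold gradient
  have := ha.hasDerivAt.comp_hasFDerivAt x hφ.hasFDerivAt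
  rw [show (fun y => a (φ y)) = a ∘ φ from rfl, this.fderiv]
  simp

/-- Smooth functions of a continuous Sobolev function, cut off to a compact set. -/
theorem MemW12.test_mul_comp (hD : IsOpen D) (h : MemW12 D u Du) (hc : ContinuousOn u D)
    {a : ℝ → ℝ} (ha : ContDiff ℝ ∞ a) {ζ : Euc n → ℝ} (hζ : IsTestFunction D ζ) :
    MemW12Zero D (fun x => ζ x * a (u x))
      (fun x => (ζ x * deriv a (u x)) • Du x + a (u x) • gradient ζ x) := by
  obtain ⟨ξ, hξ, -, V, hV, hKV, hξ1⟩ := exists_test_eq_one hζ.2.1 hD hζ.2.2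
  have hcut := h.cutoff hD.measurableSet hξ
  have hucont : Continuous fun x => ξ x * u x := by
    refine continuous_iff_continuousAt.2 fun x => ?_
    by_cases hx : x ∈ tsupport ξ
    · exact hξ.1.continuous.continuousAt.mul (hc.continuousAt (hD.mem_nhds (hξ.2.2 hx)))
    · refine (continuousAt_const (y := (0 : ℝ))).congr ?_
      filter_upwards [(isClosed_tsupport ξ).isOpen_compl.mem_nhds hx] with y hy
      simp [image_eq_zero_of_notMem_tsupport hy]
  obtain ⟨φ, hφ, hφ1, hφ2, hφ3⟩ := hcut.exists_test_approx hξ.2.1 hD hξ.2.2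
    (fun x hx => by simp [image_eq_zero_of_notMem_tsupport hx])
  have hunif := hφ3 hucont
  -- On the support of `ζ` nothing changes if `u` is replaced by `U = ξ u`.
  set U : Euc n → ℝ := fun x => ξ x * u x with hU
  set DU : Euc n → Euc n := fun x => ξ x • Du x + u x • gradient ξ x with hDU
  have hUu : ∀ x ∈ tsupport ζ, U x = u x := fun x hx => by simp [hU, hξ1 x (hKV hx)]
  have hDUu : ∀ x ∈ tsupport ζ, DU x = Du x := fun x hx => by
    have : gradient ξ x = 0 := by
      have h1 : ξ =ᶠ[𝓝 x] fun _ => (1 : ℝ) := by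
        filter_upwards [hV.mem_nhds (hKV hx)] with y hy using hξ1 y hy
      rw [h1.gradient_eq, gradient_fun_const]
    simp [hDU, hξ1 x (hKV hx), this]
  have e1 : (fun x => ζ x * a (u x)) = fun x => ζ x * a (U x) := by
    ext x
    by_cases hx : x ∈ tsupport ζ
    · rw [hUu x hx]
    · simp [image_eq_zero_of_notMem_tsupport hx]
  have e2 : (fun x => (ζ x * deriv a (u x)) • Du x + a (u x) • gradient ζ x)
      = fun x => (ζ x * deriv a (U x)) • DU x + a (U x) • gradient ζ x := by
    ext1 x
    by_cases hx : x ∈ tsupport ζ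
    · rw [hUu x hx, hDUu x hx]
    · have : gradient ζ x = 0 := by rw [gradient, fderiv_of_notMem_tsupport ℝ hx, map_zero]
      simp [image_eq_zero_of_notMem_tsupport hx, this]
  rw [e1, e2]
  have hUs : HasCompactSupport U := hξ.2.1.mul_right
  have hDUm : MemLp DU 2 volume := by simpa using hcut.memLp_grad
  have hac : Continuous a := ha.continuous
  have hdac : Continuous (deriv a) := ha.continuous_deriv (by simp)
  have hζc := hζ.1.continuous
  have hgζc := continuous_gradient hζ.1
  -- uniform convergence of `b (φ j)` to `b U` for continuous `b`
  have hcomp : ∀ b : ℝ → ℝ, Continuous b → TendstoUniformly (fun j x => b (φ j x))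
      (fun x => b (U x)) atTop := by
    intro b hb
    obtain ⟨C, hC⟩ := hUs.isCompact_range hucont |>.isBounded.exists_norm_le
    have hub : UniformContinuousOn b (Icc (-(C + 1)) (C + 1)) :=
      isCompact_Icc.uniformContinuousOn_of_continuous hb.continuousOn
    refine hub.comp_tendstoUniformly_eventually ?_ ?_ hunif
    · filter_upwards [Metric.tendstoUniformly_iff.1 hunif 1 one_pos] with j hj x
      have h1 := hj x
      have h2 := hC _ (mem_range_self x)
      rw [Real.dist_eq] at h1
      rw [Real.norm_eq_abs] at h2
      rw [abs_lt] at h1; rw [abs_le] at h2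
      constructor <;> linarith
    · intro x
      have h2 := hC _ (mem_range_self x)
      rw [Real.norm_eq_abs, abs_le] at h2
      constructor <;> linarith
  -- products with compactly supported factors converge in `L²`
  have hprod : ∀ {G : Type} [NormedAddCommGroup G] [NormedSpace ℝ G] (b : ℝ → ℝ) (g : Euc n → G),
      Continuous b → MemLp g 2 volume →
      Tendsto (fun j => eLpNorm (fun x => (b (φ j x) - b (U x)) • g x) 2 volume)
        atTop (𝓝 0) := by
    intro G _ _ b g hb hg
    refine ENNReal.tendsto_nhds_zero.2 fun ε hε => ?_
    obtain ⟨c, hc, hcA⟩ := ENNReal.exists_nnreal_pos_mul_lt hg.2.ne hε.ne'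
    filter_upwards [Metric.tendstoUniformly_iff.1 (hcomp b hb) c (by exact_mod_cast hc)] with j hj
    have : ∀ x, ‖(b (φ j x) - b (U x)) • g x‖ ≤ ‖((c : ℝ) • g) x‖ := by
      intro x
      have := hj x
      rw [dist_comm, Real.dist_eq] at this
      simp only [Pi.smul_apply, norm_smul, Real.norm_eq_abs, NNReal.abs_eq]
      gcongr
    refine (eLpNorm_mono this).trans ?_
    rw [eLpNorm_const_smul]
    simpa using hcA.le
  have hle : ∀ {G : Type} [NormedAddCommGroup G] {f : ℕ → Euc n → G},
      Tendsto (fun j => eLpNorm (f j) 2 volume) atTop (𝓝 0) →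
      Tendsto (fun j => eLpNorm (f j) 2 (volume.restrict D)) atTop (𝓝 0) := fun hf =>
    tendsto_of_tendsto_of_tendsto_of_le_of_le tendsto_const_nhds hf (fun _ => zero_le)
      fun j => eLpNorm_mono_measure _ Measure.restrict_le_self
  have hφg : ∀ j, MemLp (gradient (φ j)) 2 volume := fun j => (hφ j).memLp_gradient
  have hcs : ∀ b : Euc n → ℝ, Continuous b → ∀ p : ℝ≥0∞,
      MemLp (fun x => ζ x * b x) p volume := fun b hb p =>
    (hζc.mul hb).memLp_of_hasCompactSupport hζ.2.1.mul_right
  have hgs : ∀ b : Euc n → ℝ, Continuous b → ∀ p : ℝ≥0∞,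
      MemLp (fun x => b x • gradient ζ x) p volume := fun b hb p =>
    (hb.smul hgζc).memLp_of_hasCompactSupport (hasCompactSupport_gradient hζ.2.1).smul_left
  refine memW12Zero_of_approx (φ := fun j x => ζ x * a (φ j x)) (fun j => ?_)
    ((hcs _ (hac.comp hucont) 2).restrict _) (MemLp.restrict _ (MemLp.add ?_ ?_)) ?_ ?_
  · refine ⟨hζ.1.mul (ha.comp (hφ j).1), hζ.2.1.mul_right, ?_⟩
    exact tsupport_mul_subset_left.trans hζ.2.2
  · exact hDUm.smul (hcs _ (hdac.comp hucont) ⊤) (p := ⊤) (q := 2)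
  · exact hgs _ (hac.comp hucont) 2
  · refine hle ?_
    have := hprod a ζ hac hζ.memLp
    refine this.congr fun j => ?_
    congr 1; ext x; simp; ring
  · refine hle ?_
    have t1 := hprod a (gradient ζ) hac hζ.memLp_gradient
    have t2 := hprod (deriv a) (fun x => ζ x • DU x) hdac
      (hDUm.smul hζ.memLp (p := ⊤) (q := 2))
    -- the remaining part: `ζ a'(φ j) (∇φ j - DU)`
    obtain ⟨B, hB⟩ : ∃ B : ℝ, ∀ᶠ j in atTop, ∀ x, ‖ζ x * deriv a (φ j x)‖ ≤ B := by
      obtain ⟨C, hC⟩ := hUs.isCompact_range hucont |>.isBounded.exists_norm_le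
      obtain ⟨A, hA⟩ := (isCompact_Icc (a := -(C + 1)) (b := C + 1)).exists_bound_of_continuousOn
        hdac.continuousOn
      obtain ⟨Z, hZ⟩ := hζ.2.1.exists_bound_of_continuous hζc
      refine ⟨Z * A, ?_⟩
      filter_upwards [Metric.tendstoUniformly_iff.1 hunif 1 one_pos] with j hj x
      rw [norm_mul]
      have hZ0 : 0 ≤ Z := (norm_nonneg _).trans (hZ x)
      refine mul_le_mul (hZ x) (hA _ ?_) (norm_nonneg _) hZ0
      have h1 := hj x
      have h2 := hC _ (mem_range_self x)
      rw [Real.dist_eq, abs_lt] at h1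
      rw [Real.norm_eq_abs, abs_le] at h2
      constructor <;> linarith
    have t3 : Tendsto (fun j => eLpNorm (fun x => (ζ x * deriv a (φ j x)) •
        (gradient (φ j) x - DU x)) 2 volume) atTop (𝓝 0) := by
      have hB' := ENNReal.Tendsto.const_mul (a := ‖B‖ₑ) hφ2 (Or.inr enorm_ne_top)
      rw [mul_zero] at hB'
      refine tendsto_of_tendsto_of_tendsto_of_le_of_le' tendsto_const_nhds hB'
        (Eventually.of_forall fun _ => zero_le) ?_
      filter_upwards [hB] with j hj
      rw [← eLpNorm_const_smul]
      refine eLpNorm_mono fun x => ?_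
      simp only [Pi.smul_apply, norm_smul]
      gcongr
      exact (hj x).trans (le_abs_self _)
    have t := (t3.add (t2.add t1))
    simp only [add_zero] at t
    refine tendsto_of_tendsto_of_tendsto_of_le_of_le tendsto_const_nhds t (fun _ => zero_le)
      fun j => ?_
    have hφc := (hφ j).1.continuous
    have m1 : AEStronglyMeasurable (fun x => (ζ x * deriv a (φ j x)) •
        (gradient (φ j) x - DU x)) volume :=
      (hζc.mul (hdac.comp hφc)).aestronglyMeasurable.smul ((hφg j).1.sub hDUm.1)
    have m2 : AEStronglyMeasurable (fun x => (deriv a (φ j x) - deriv a (U x)) •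
        ζ x • DU x) volume :=
      ((hdac.comp hφc).sub (hdac.comp hucont)).aestronglyMeasurable.smul
        (hζc.aestronglyMeasurable.smul hDUm.1)
    have m3 : AEStronglyMeasurable (fun x => (a (φ j x) - a (U x)) • gradient ζ x) volume :=
      (((hac.comp hφc).sub (hac.comp hucont)).smul hgζc).aestronglyMeasurable
    refine le_trans (le_of_eq ?_) ((eLpNorm_add_le m1 (m2.add m3) (by norm_num)).trans
      (add_le_add le_rfl (eLpNorm_add_le m2 m3 (by norm_num))))
    congr 1; ext1 x
    have hda : DifferentiableAt ℝ a (φ j x) := ha.differentiable (by simp) _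
    rw [gradient_mul (ψ := fun y => a (φ j y)) (hζ.differentiableAt x)
        (hda.comp x ((hφ j).differentiableAt x)),
      gradient_comp hda ((hφ j).differentiableAt x)]
    simp only [Pi.add_apply]
    module

/-! ### First variations of local minimizers -/

/-- The minimality clause of `IsLocalMinimizer` for a fixed `ε₀`: `u` minimizes `J_Q` on every ball
in `Ω` among all competitors which are `ε₀`-close to it. -/
def MinimizesOnBalls (Q : Euc n → ℝ) (Ω : Set (Euc n)) (u : Euc n → ℝ) (Du : Euc n → Euc n)
    (ε₀ : ℝ) : Prop :=
  ∀ (x : Euc n) (r : ℝ), 0 < r → ball x r ⊆ Ω →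
    ∀ (v : Euc n → ℝ) (Dv : Euc n → Euc n), MemK (ball x r) u Du v Dv →
      (∫ y in ball x r, ‖Du y - Dv y‖ ^ 2) + (∫ y in ball x r, |posChar u y - posChar v y|) < ε₀ →
      energyJ Q (ball x r) u Du ≤ energyJ Q (ball x r) v Dv

instance isFiniteMeasure_restrict_ball (x : Euc n) (r : ℝ) :
    IsFiniteMeasure (volume.restrict (ball x r)) :=
  ⟨by rw [Measure.restrict_apply_univ]; exact measure_ball_lt_top⟩

theorem posChar_nonneg (u : Euc n → ℝ) (x : Euc n) : 0 ≤ posChar u x :=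
  indicator_nonneg (fun _ _ => zero_le_one) x

theorem posChar_le_one (u : Euc n → ℝ) (x : Euc n) : posChar u x ≤ 1 :=
  indicator_le' (fun _ _ => le_rfl) (fun _ _ => zero_le_one) x

theorem posChar_congr {x y : Euc n} (h : 0 < u x ↔ 0 < v y) : posChar u x = posChar v y := by
  unfold posChar
  by_cases hx : 0 < u x
  · rw [indicator_of_mem (by exact hx), indicator_of_mem (by exact h.1 hx)]
  · rw [indicator_of_notMem (by exact hx), indicator_of_notMem (by exact fun h' => hx (h.2 h'))]

theorem aestronglyMeasurable_posChar {μ : Measure (Euc n)} (h : AEStronglyMeasurable u μ) :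
    AEStronglyMeasurable (posChar u) μ := by
  have : NullMeasurableSet {x | 0 < u x} μ := nullMeasurableSet_lt aemeasurable_const h.aemeasurable
  exact aestronglyMeasurable_const.indicator₀ this

theorem integrableOn_weight (hQ : Continuous Q) {x : Euc n} {r : ℝ}
    (h : AEStronglyMeasurable u (volume.restrict (ball x r))) :
    IntegrableOn (fun y => Q y ^ 2 * posChar u y) (ball x r) := by
  obtain ⟨C, hC⟩ := (isCompact_closedBall x r).exists_bound_of_continuousOn (hQ.pow 2).continuousOn
  refine Integrable.of_bound
    ((hQ.pow 2).aestronglyMeasurable.mul (aestronglyMeasurable_posChar h)) C ?_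
  filter_upwards [ae_restrict_mem measurableSet_ball] with y hy
  rw [norm_mul, Real.norm_of_nonneg (posChar_nonneg u y)]
  have h1 := hC y (ball_subset_closedBall hy)
  calc ‖Q y ^ 2‖ * posChar u y ≤ ‖Q y ^ 2‖ * 1 := by gcongr; exact posChar_le_one u y
    _ ≤ C := by rwa [mul_one]

theorem energyJ_eq (hQ : Continuous Q) {x : Euc n} {r : ℝ} (h : MemW12 (ball x r) u Du) :
    energyJ Q (ball x r) u Du
      = (∫ y in ball x r, ‖Du y‖ ^ 2) + ∫ y in ball x r, Q y ^ 2 * posChar u y :=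
  integral_add (integrable_norm_sq h.memLp_grad) (integrableOn_weight hQ h.memLp.1)

theorem integral_norm_sq_add_smul {α F : Type*} [MeasurableSpace α] {μ : Measure α}
    [NormedAddCommGroup F] [InnerProductSpace ℝ F] {f g : α → F} (hf : MemLp f 2 μ)
    (hg : MemLp g 2 μ) (t : ℝ) :
    ∫ x, ‖f x + t • g x‖ ^ 2 ∂μ
      = (∫ x, ‖f x‖ ^ 2 ∂μ) + 2 * t * (∫ x, inner ℝ (f x) (g x) ∂μ)
        + t ^ 2 * ∫ x, ‖g x‖ ^ 2 ∂μ := by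
  have : ∀ x, ‖f x + t • g x‖ ^ 2 = ‖f x‖ ^ 2 + 2 * t * inner ℝ (f x) (g x) + t ^ 2 * ‖g x‖ ^ 2 := by
    intro x
    rw [norm_add_sq_real, inner_smul_right, norm_smul, mul_pow, Real.norm_eq_abs, sq_abs]
    ring
  simp only [this]
  rw [integral_add, integral_add, integral_const_mul, integral_const_mul]
  · exact integrable_norm_sq hf
  · exact (integrable_inner hf hg).const_mul _
  · exact (integrable_norm_sq hf).add ((integrable_inner hf hg).const_mul _)
  · exact (integrable_norm_sq hg).const_mul _

/-- The quadratic inequality obtained by comparing `u` with `u + t w`. -/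
theorem MinimizesOnBalls.le_perturbation {ε₀ : ℝ} (hmin : MinimizesOnBalls Q Ω u Du ε₀)
    (hQ : Continuous Q) (hu : MemW12 Ω u Du) {x : Euc n} {r : ℝ} (hr : 0 < r)
    (hB : ball x r ⊆ Ω) (hw : MemW12Zero (ball x r) w Dw) (t : ℝ)
    (ht : t ^ 2 * (∫ y in ball x r, ‖Dw y‖ ^ 2)
      + (∫ y in ball x r, |posChar u y - posChar (fun y => u y + t * w y) y|) < ε₀) :
    0 ≤ 2 * t * (∫ y in ball x r, inner ℝ (Du y) (Dw y)) + t ^ 2 * (∫ y in ball x r, ‖Dw y‖ ^ 2)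
      + ((∫ y in ball x r, Q y ^ 2 * posChar (fun y => u y + t * w y) y)
        - ∫ y in ball x r, Q y ^ 2 * posChar u y) := by
  have huB := hu.mono hB
  have hK := memK_add huB (hw.const_mul t)
  have h := hmin x r hr hB _ _ hK (by
    refine lt_of_eq_of_lt ?_ ht
    congr 1
    rw [← integral_const_mul]
    refine integral_congr_ae (Eventually.of_forall fun y => ?_)
    simp [norm_smul, mul_pow])
  rw [energyJ_eq hQ huB, energyJ_eq hQ hK.1,
    integral_norm_sq_add_smul huB.memLp_grad hw.memW12.memLp_grad] at h
  linarith

/-- The first variation vanishes in directions that do not alter the positivity set. -/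
theorem MinimizesOnBalls.first_variation {ε₀ : ℝ} (hmin : MinimizesOnBalls Q Ω u Du ε₀)
    (hε : 0 < ε₀) (hQ : Continuous Q) (hu : MemW12 Ω u Du) {x : Euc n} {r : ℝ} (hr : 0 < r)
    (hB : ball x r ⊆ Ω) (hw : MemW12Zero (ball x r) w Dw)
    (hpos : ∀ᶠ t in 𝓝 (0 : ℝ), ∀ y ∈ ball x r, (0 < u y + t * w y ↔ 0 < u y)) :
    ∫ y in ball x r, inner ℝ (Du y) (Dw y) = 0 := by
  set I := ∫ y in ball x r, inner ℝ (Du y) (Dw y)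
  set N := ∫ y in ball x r, ‖Dw y‖ ^ 2
  have hev : ∀ᶠ t in 𝓝 (0 : ℝ), 0 ≤ 2 * t * I + t ^ 2 * N := by
    have h1 : ∀ᶠ t in 𝓝 (0 : ℝ), t ^ 2 * N < ε₀ := by
      have : Tendsto (fun t : ℝ => t ^ 2 * N) (𝓝 0) (𝓝 (0 ^ 2 * N)) :=
        (Continuous.tendsto (by fun_prop) 0)
      simp only [ne_eq, OfNat.ofNat_ne_zero, not_false_eq_true, zero_pow, zero_mul] at this
      exact this.eventually (gt_mem_nhds hε)
    filter_upwards [h1, hpos] with t ht hpt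
    have e1 : ∫ y in ball x r, |posChar u y - posChar (fun y => u y + t * w y) y| = 0 := by
      rw [← integral_zero (Euc n) ℝ (μ := volume.restrict (ball x r))]
      refine setIntegral_congr_fun measurableSet_ball fun y hy => ?_
      rw [posChar_congr (v := fun y => u y + t * w y) (x := y) (y := y) (hpt y hy).symm]
      simp
    have e2 : ∫ y in ball x r, Q y ^ 2 * posChar (fun y => u y + t * w y) y
        = ∫ y in ball x r, Q y ^ 2 * posChar u y := by
      refine setIntegral_congr_fun measurableSet_ball fun y hy => ?_
      rw [posChar_congr (v := fun y => u y + t * w y) (x := y) (y := y) (hpt y hy).symm]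
    have := hmin.le_perturbation hQ hu hr hB hw t (by rw [e1, add_zero]; exact ht)
    rw [e2, sub_self, add_zero] at this
    exact this
  -- a function `2 t I + t² N` which is nonnegative near `0` has `I = 0`
  by_contra hI
  have hd : HasDerivAt (fun t : ℝ => 2 * t * I + t ^ 2 * N) (2 * I) 0 := by
    have := ((hasDerivAt_id (0 : ℝ)).const_mul 2 |>.mul_const I).add
      (((hasDerivAt_id (0 : ℝ)).pow 2).mul_const N)
    refine this.congr_deriv ?_
    simp
  have hmin' : IsLocalMin (fun t : ℝ => 2 * t * I + t ^ 2 * N) 0 := by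
    filter_upwards [hev] with t ht
    simpa using ht
  have := hmin'.hasDerivAt_eq_zero hd
  exact hI (by linarith)

/-- On small balls `u` is harmonic up to an error controlled by the supremum of `Q`: the weight
alone bounds the first variation, after optimising the size of the perturbation. -/
theorem MinimizesOnBalls.abs_integral_inner_le {ε₀ : ℝ} (hmin : MinimizesOnBalls Q Ω u Du ε₀)
    (hQ : Continuous Q) (hQ0 : ∀ y, 0 ≤ Q y) (hu : MemW12 Ω u Du) {x : Euc n} {r : ℝ} (hr : 0 < r)
    (hB : ball x r ⊆ Ω) {q : ℝ} (hq : 0 < q) (hQq : ∀ y ∈ ball x r, Q y ≤ q)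
    (hsmall : q ^ 2 * volume.real (ball x r) + volume.real (ball x r) < ε₀)
    (hw : MemW12Zero (ball x r) w Dw) :
    |∫ y in ball x r, inner ℝ (Du y) (Dw y)|
      ≤ q * √(volume.real (ball x r)) * √(∫ y in ball x r, ‖Dw y‖ ^ 2) := by
  have huB := hu.mono hB
  have hCS := _root_.abs_integral_inner_le huB.memLp_grad hw.memW12.memLp_grad
  set I := ∫ y in ball x r, inner ℝ (Du y) (Dw y)
  set N := ∫ y in ball x r, ‖Dw y‖ ^ 2 with hN
  set b := volume.real (ball x r) with hb
  have hN0 : 0 ≤ N := integral_nonneg fun y => by positivity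
  have hb0 : 0 < b := ENNReal.toReal_pos (measure_ball_pos _ _ hr).ne' measure_ball_lt_top.ne
  rcases hN0.eq_or_lt with h0 | hNpos
  · rw [← h0, Real.sqrt_zero, mul_zero] at hCS
    rw [← h0, Real.sqrt_zero, mul_zero]
    exact hCS
  have key : ∀ t : ℝ, t ^ 2 * N = q ^ 2 * b → 0 ≤ 2 * t * I + 2 * (q ^ 2 * b) := by
    intro t ht
    have hvm : AEStronglyMeasurable (fun y => u y + t * w y) (volume.restrict (ball x r)) :=
      huB.memLp.1.add (hw.memW12.memLp.1.const_mul t)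
    have c1 : ∫ y in ball x r, |posChar u y - posChar (fun y => u y + t * w y) y| ≤ b := by
      calc ∫ y in ball x r, |posChar u y - posChar (fun y => u y + t * w y) y|
          ≤ ∫ y in ball x r, (1 : ℝ) := by
            refine integral_mono_of_nonneg (Eventually.of_forall fun y => abs_nonneg _)
              (integrable_const _) (Eventually.of_forall fun y => ?_)
            simp only
            rw [abs_le]
            have := posChar_nonneg u y
            have := posChar_le_one u y
            have := posChar_nonneg (fun y => u y + t * w y) y
            have := posChar_le_one (fun y => u y + t * w y) y
            constructor <;> linarith
        _ = b := by simp [hb]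
    have c2 : ∫ y in ball x r, Q y ^ 2 * posChar (fun y => u y + t * w y) y ≤ q ^ 2 * b := by
      calc ∫ y in ball x r, Q y ^ 2 * posChar (fun y => u y + t * w y) y
          ≤ ∫ y in ball x r, q ^ 2 := by
            refine setIntegral_mono_on (integrableOn_weight hQ hvm) (integrable_const _)
              measurableSet_ball fun y hy => ?_
            have h1 : Q y ^ 2 ≤ q ^ 2 := pow_le_pow_left₀ (hQ0 y) (hQq y hy) 2
            calc Q y ^ 2 * posChar (fun y => u y + t * w y) y ≤ Q y ^ 2 * 1 := by
                  gcongr; exact posChar_le_one _ _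
              _ ≤ q ^ 2 := by linarith
        _ = q ^ 2 * b := by simp [hb, mul_comm]
    have c3 : 0 ≤ ∫ y in ball x r, Q y ^ 2 * posChar u y :=
      integral_nonneg fun y => mul_nonneg (by positivity) (posChar_nonneg u y)
    have := hmin.le_perturbation hQ hu hr hB hw t (by
      rw [← hN, ht]; linarith)
    rw [← hN, ht] at this
    linarith
  set A := q * √b with hA
  set M := √N with hM
  have hA0 : 0 < A := by positivity
  have hM0 : 0 < M := Real.sqrt_pos.2 hNpos
  have hAsq : A ^ 2 = q ^ 2 * b := by rw [hA, mul_pow, Real.sq_sqrt hb0.le]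
  have hMsq : M ^ 2 = N := Real.sq_sqrt hN0
  have k1 := key (A / M) (by rw [← hMsq, ← hAsq]; field_simp)
  have k2 := key (-(A / M)) (by rw [← hMsq, ← hAsq]; field_simp)
  rw [← hAsq] at k1 k2
  have e1 : 0 ≤ A / M * (I + A * M) := by
    have : A / M * (I + A * M) = A / M * I + A ^ 2 := by field_simp
    rw [this]; linarith
  have e2 : 0 ≤ A / M * (-I + A * M) := by
    have : A / M * (-I + A * M) = -(A / M) * I + A ^ 2 := by field_simp
    rw [this]; linarith
  have hAM : 0 < A / M := by positivity
  rw [abs_le]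
  constructor
  · linarith [nonneg_of_mul_nonneg_right e1 hAM]
  · linarith [nonneg_of_mul_nonneg_right e2 hAM]

theorem hasGradientAt_radial {G : ℝ → ℝ} (hG : ContDiff ℝ ∞ G) (x y : Euc n) :
    HasGradientAt (fun y => G (‖y - x‖ ^ 2)) ((2 * deriv G (‖y - x‖ ^ 2)) • (y - x)) y := by
  have h1 : HasFDerivAt (fun y : Euc n => ‖y - x‖ ^ 2)
      (2 • (innerSL ℝ (y - x)).comp (ContinuousLinearMap.id ℝ (Euc n))) y :=
    ((hasFDerivAt_id y).sub_const x).norm_sq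
  have h2 := (hG.differentiable (by simp) (‖y - x‖ ^ 2)).hasDerivAt.comp_hasFDerivAt y h1
  rw [hasGradientAt_iff_hasFDerivAt]
  refine h2.congr_fderiv (ContinuousLinearMap.ext fun e => ?_)
  simp
  ring

theorem isTestFunction_radial {G : ℝ → ℝ} (hG : ContDiff ℝ ∞ G) {b R : ℝ} (hb0 : 0 ≤ b)
    (hb : b < R) (hG0 : ∀ s, b ^ 2 ≤ s → G s = 0) (x : Euc n) :
    IsTestFunction (ball x R) (fun y => G (‖y - x‖ ^ 2)) := by
  have hs : tsupport (fun y => G (‖y - x‖ ^ 2)) ⊆ closedBall x b := by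
    refine closure_minimal (fun y hy => ?_) isClosed_closedBall
    by_contra h
    rw [mem_closedBall, not_le, dist_eq_norm] at h
    exact hy (hG0 _ (by gcongr))
  refine ⟨hG.comp ((contDiff_id.sub contDiff_const).norm_sq ℝ), ?_,
    hs.trans (closedBall_subset_ball hb)⟩
  exact (isCompact_closedBall x b).of_isClosed_subset (isClosed_tsupport _) hs

theorem exists_contDiff_primitive {h : ℝ → ℝ} (hh : ContDiff ℝ ∞ h) (c : ℝ) :
    ContDiff ℝ ∞ (fun s => ∫ τ in c..s, h τ) ∧ ∀ s, deriv (fun s => ∫ τ in c..s, h τ) s = h s := by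
  have hd : ∀ s, HasDerivAt (fun s => ∫ τ in c..s, h τ) (h s) s := fun s =>
    intervalIntegral.integral_hasDerivAt_right (hh.continuous.intervalIntegrable _ _)
      hh.continuous.stronglyMeasurable.stronglyMeasurableAtFilter hh.continuous.continuousAt
  refine ⟨?_, fun s => (hd s).deriv⟩
  rw [contDiff_infty_iff_deriv]
  refine ⟨fun s => (hd s).differentiableAt, ?_⟩
  rw [show deriv (fun s => ∫ τ in c..s, h τ) = h from funext fun s => (hd s).deriv]
  exact hh

/-- Testing with (smooth approximations of) `(|y - x|² - r²) / 2` on the ball of radius `r`. -/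
theorem MinimizesOnBalls.abs_integral_inner_radial_le {ε₀ : ℝ}
    (hmin : MinimizesOnBalls Q Ω u Du ε₀)
    (hQ : Continuous Q) (hQ0 : ∀ y, 0 ≤ Q y) (hu : MemW12 Ω u Du) {x : Euc n} {r : ℝ} (hr : 0 < r)
    (hB : ball x r ⊆ Ω) {q : ℝ} (hq : 0 < q) (hQq : ∀ y ∈ ball x r, Q y ≤ q)
    (hsmall : q ^ 2 * volume.real (ball x r) + volume.real (ball x r) < ε₀) :
    |∫ y in ball x r, inner ℝ (Du y) (y - x)| ≤ q * r * volume.real (ball x r) := by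
  have huB := hu.mono hB
  set b := volume.real (ball x r) with hb
  have hb0 : 0 ≤ b := measureReal_nonneg
  let η : ℕ → ℝ := fun j => r ^ 2 / (j + 2)
  have hη0 : ∀ j, 0 < η j := fun j => by positivity
  have hη1 : ∀ j, η j ≤ r ^ 2 := fun j => by
    refine div_le_self (by positivity) ?_
    linarith [j.cast_nonneg (α := ℝ)]
  let h : ℕ → ℝ → ℝ := fun j s => Real.smoothTransition ((r ^ 2 - η j - s) / η j)
  have hh : ∀ j, ContDiff ℝ ∞ (h j) := fun j =>
    Real.smoothTransition.contDiff.comp ((contDiff_const.sub contDiff_id).div_const _)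
  have hh0 : ∀ j s, r ^ 2 - η j ≤ s → h j s = 0 := fun j s hs =>
    Real.smoothTransition.zero_of_nonpos
      (div_nonpos_of_nonpos_of_nonneg (by linarith) (hη0 j).le)
  have hh1 : ∀ j s, s ≤ r ^ 2 - 2 * η j → h j s = 1 := fun j s hs =>
    Real.smoothTransition.one_of_one_le (by
      rw [le_div_iff₀ (hη0 j)]; linarith)
  have hh01 : ∀ j s, |h j s| ≤ 1 := fun j s => by
    rw [abs_of_nonneg (Real.smoothTransition.nonneg _)]
    exact Real.smoothTransition.le_one _
  have hgrad : ∀ j, ∃ φ, IsTestFunction (ball x r) φ ∧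
      ∀ y, gradient φ y = h j (‖y - x‖ ^ 2) • (y - x) := by
    intro j
    obtain ⟨hc, hd⟩ := exists_contDiff_primitive (hh j) (r ^ 2)
    have hG : ContDiff ℝ ∞ (fun s => (1 / 2) * ∫ τ in (r ^ 2)..s, h j τ) := contDiff_const.mul hc
    have hηr : 0 ≤ r ^ 2 - η j := by linarith [hη1 j]
    refine ⟨_, isTestFunction_radial hG (b := √(r ^ 2 - η j)) (R := r) (Real.sqrt_nonneg _) ?_
      ?_ x, fun y => ?_⟩
    · rw [Real.sqrt_lt' hr]; linarith [hη0 j]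
    · intro s hs
      rw [Real.sq_sqrt hηr] at hs
      have : ∫ τ in (r ^ 2)..s, h j τ = ∫ τ in (r ^ 2)..s, (0 : ℝ) := by
        refine intervalIntegral.integral_congr fun τ hτ => hh0 j τ ?_
        refine le_trans ?_ hτ.1
        exact le_min (by linarith [hη0 j]) hs
      simp [this]
    · rw [(hasGradientAt_radial hG x y).gradient]
      congr 1
      rw [deriv_const_mul _ (hc.differentiable (by simp) _), hd]
      ring
  choose φ hφ hφg using hgrad
  have hbound : ∀ j, |∫ y in ball x r, inner ℝ (Du y) (gradient (φ j) y)| ≤ q * r * b := by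
    intro j
    refine (hmin.abs_integral_inner_le hQ hQ0 hu hr hB hq hQq hsmall
      (memW12Zero_of_test (hφ j))).trans ?_
    have : √(∫ y in ball x r, ‖gradient (φ j) y‖ ^ 2) ≤ r * √b := by
      rw [show r * √b = √(r ^ 2 * b) by rw [Real.sqrt_mul (by positivity), Real.sqrt_sq hr.le]]
      refine Real.sqrt_le_sqrt ?_
      calc ∫ y in ball x r, ‖gradient (φ j) y‖ ^ 2 ≤ ∫ y in ball x r, r ^ 2 := by
            refine setIntegral_mono_on (integrable_norm_sq (hφ j).memLp_gradient).integrableOn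
              (integrable_const _) measurableSet_ball fun y hy => ?_
            rw [hφg, norm_smul]
            rw [mem_ball, dist_eq_norm] at hy
            gcongr
            calc ‖h j (‖y - x‖ ^ 2)‖ * ‖y - x‖ ≤ 1 * r := by
                  gcongr
                  exact hh01 _ _
              _ = r := one_mul r
        _ = r ^ 2 * b := by simp [hb, mul_comm]
    calc q * √b * √(∫ y in ball x r, ‖gradient (φ j) y‖ ^ 2) ≤ q * √b * (r * √b) := by gcongr
      _ = q * r * (√b * √b) := by ring
      _ = q * r * b := by rw [Real.mul_self_sqrt hb0]
  have hxm : MemLp (fun y => y - x) 2 (volume.restrict (ball x r)) := by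
    refine MemLp.of_bound (by fun_prop) r ?_
    filter_upwards [ae_restrict_mem measurableSet_ball] with y hy
    rw [mem_ball, dist_eq_norm] at hy
    exact hy.le
  have hlim : Tendsto (fun j => ∫ y in ball x r, inner ℝ (Du y) (gradient (φ j) y)) atTop
      (𝓝 (∫ y in ball x r, inner ℝ (Du y) (y - x))) := by
    refine tendsto_integral_of_dominated_convergence (fun y => ‖inner ℝ (Du y) (y - x)‖) ?_
      (integrable_inner huB.memLp_grad hxm).norm ?_ ?_
    · intro j
      exact (integrable_inner huB.memLp_grad ((hφ j).memLp_gradient.restrict _)).1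
    · intro j
      refine Eventually.of_forall fun y => ?_
      rw [hφg, inner_smul_right, norm_mul]
      exact mul_le_of_le_one_left (norm_nonneg _) (hh01 _ _)
    · filter_upwards [ae_restrict_mem measurableSet_ball] with y hy
      rw [mem_ball, dist_eq_norm] at hy
      refine tendsto_const_nhds.congr' ?_
      have hη : Tendsto η atTop (𝓝 0) := by
        refine Tendsto.div_atTop tendsto_const_nhds ?_
        exact tendsto_atTop_add_const_right _ _ tendsto_natCast_atTop_atTop
      have hpos : 0 < (r ^ 2 - ‖y - x‖ ^ 2) / 2 := by
        have : ‖y - x‖ ^ 2 < r ^ 2 := by gcongr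
        linarith
      filter_upwards [hη.eventually (gt_mem_nhds hpos)] with j hj
      rw [hφg, hh1 j _ (by linarith), one_smul]
  exact le_of_tendsto hlim.abs (Eventually.of_forall hbound)

/-! ### Continuity and growth of local minimizers -/

theorem setIntegral_ball_eq_smul {F : Type*} [NormedAddCommGroup F] [NormedSpace ℝ F]
    (f : Euc n → F) (x : Euc n) {ρ : ℝ} (hρ : 0 < ρ) :
    ∫ y in ball x ρ, f y = ρ ^ n • ∫ y in ball (0 : Euc n) 1, f (x + ρ • y) := by
  have h1 : ∫ y in ball x ρ, f y = ∫ y in ball (0 : Euc n) ρ, f (x + y) := by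
    rw [← (measurePreserving_add_left volume x).setIntegral_preimage_emb
      (measurableEmbedding_addLeft x)]
    congr 2
    ext y; simp
  have h2 := Measure.setIntegral_comp_smul_of_pos (volume : Measure (Euc n)) (fun y => f (x + y))
    (ball (0 : Euc n) 1) hρ
  rw [h1, h2, _root_.smul_ball hρ.ne']
  simp only [finrank_euclideanSpace, Fintype.card_fin, smul_zero, Real.norm_of_nonneg hρ.le,
    mul_one]
  rw [smul_smul, mul_inv_cancel₀ (by positivity), one_smul]

theorem volume_real_ball (x : Euc n) {ρ : ℝ} (hρ : 0 < ρ) :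
    volume.real (ball x ρ) = ρ ^ n * volume.real (ball (0 : Euc n) 1) := by
  rw [Measure.real, Measure.real, Measure.addHaar_ball_of_pos _ _ hρ, ENNReal.toReal_mul,
    ENNReal.toReal_ofReal (by positivity)]
  simp

theorem volume_real_ball_pos (x : Euc n) {ρ : ℝ} (hρ : 0 < ρ) : 0 < volume.real (ball x ρ) :=
  ENNReal.toReal_pos (measure_ball_pos _ _ hρ).ne' measure_ball_lt_top.ne

theorem average_ball_eq (f : Euc n → ℝ) (x : Euc n) {ρ : ℝ} (hρ : 0 < ρ) :
    ⨍ y in ball x ρ, f y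
      = (volume.real (ball (0 : Euc n) 1))⁻¹ * ∫ y in ball (0 : Euc n) 1, f (x + ρ • y) := by
  rw [setAverage_eq, setIntegral_ball_eq_smul f x hρ, volume_real_ball x hρ, smul_eq_mul,
    smul_eq_mul]
  field_simp

theorem hasDerivAt_average_ball {φ : Euc n → ℝ} (hφ : IsTestFunction D φ) (x : Euc n) {ρ : ℝ}
    (hρ : 0 < ρ) :
    HasDerivAt (fun ρ : ℝ => (volume.real (ball (0 : Euc n) 1))⁻¹ *
        ∫ y in ball (0 : Euc n) 1, φ (x + ρ • y))
      ((ρ * volume.real (ball x ρ))⁻¹ * ∫ y in ball x ρ, inner ℝ (gradient φ y) (y - x)) ρ := by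
  have hgc := continuous_gradient hφ.1
  obtain ⟨C, hC⟩ := (hasCompactSupport_gradient hφ.2.1).exists_bound_of_continuous hgc
  have hF : ∀ s : ℝ, Continuous fun y => φ (x + s • y) := fun s =>
    hφ.1.continuous.comp (by fun_prop)
  have hF' : Continuous fun y => inner ℝ (gradient φ (x + ρ • y)) y :=
    (hgc.comp (by fun_prop)).inner continuous_id
  have hint : ∀ f : Euc n → ℝ, Continuous f → IntegrableOn f (ball (0 : Euc n) 1) := fun f hf =>
    (hf.continuousOn.integrableOn_compact (isCompact_closedBall 0 1)).mono_set
      ball_subset_closedBall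
  have h := hasDerivAt_integral_of_dominated_loc_of_deriv_le (x₀ := ρ) (s := univ)
    (μ := volume.restrict (ball (0 : Euc n) 1))
    (F := fun s y => φ (x + s • y)) (F' := fun s y => inner ℝ (gradient φ (x + s • y)) y)
    (bound := fun _ => C) univ_mem
    (Eventually.of_forall fun s => (hF s).aestronglyMeasurable) (hint _ (hF ρ))
    hF'.aestronglyMeasurable ?_ (integrable_const _) ?_
  · refine (h.2.const_mul (volume.real (ball (0 : Euc n) 1))⁻¹).congr_deriv ?_
    have e : ∫ y in ball x ρ, inner ℝ (gradient φ y) (y - x)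
        = ρ ^ n * (ρ * ∫ y in ball (0 : Euc n) 1, inner ℝ (gradient φ (x + ρ • y)) y) := by
      rw [setIntegral_ball_eq_smul _ x hρ, smul_eq_mul, ← integral_const_mul ρ]
      congr 1
      refine integral_congr_ae (Eventually.of_forall fun y => ?_)
      simp [inner_smul_right]
    rw [e, volume_real_ball x hρ]
    field_simp
  · filter_upwards [ae_restrict_mem measurableSet_ball] with y hy s _
    rw [mem_ball_zero_iff] at hy
    calc ‖inner ℝ (gradient φ (x + s • y)) y‖ ≤ ‖gradient φ (x + s • y)‖ * ‖y‖ :=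
          norm_inner_le_norm _ _
      _ ≤ C * 1 := by
          refine mul_le_mul (hC _) hy.le (norm_nonneg _) ((norm_nonneg _).trans (hC 0))
      _ = C := mul_one C
  · refine Eventually.of_forall fun y s _ => ?_
    have h1 : HasDerivAt (fun s : ℝ => x + s • y) y s := by
      simpa using ((hasDerivAt_id s).smul_const y).const_add x
    have h2 := (hφ.differentiableAt (x + s • y)).hasFDerivAt.comp_hasDerivAt s h1
    rw [inner_gradient_left]
    exact h2

/-- The averages of a minimizer over concentric balls vary at a rate bounded by `sup Q`. -/
theorem MinimizesOnBalls.abs_average_sub_le {ε₀ : ℝ} (hmin : MinimizesOnBalls Q Ω u Du ε₀)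
    (hΩ : IsOpen Ω)
    (hQ : Continuous Q) (hQ0 : ∀ y, 0 ≤ Q y) (hu : MemW12 Ω u Du) {x : Euc n} {r₁ r₂ : ℝ}
    (hr₁ : 0 < r₁) (hr : r₁ ≤ r₂) (hB : closedBall x r₂ ⊆ Ω) {q : ℝ} (hq : 0 < q)
    (hQq : ∀ y ∈ ball x r₂, Q y ≤ q)
    (hsmall : q ^ 2 * volume.real (ball x r₂) + volume.real (ball x r₂) < ε₀) :
    |(⨍ y in ball x r₂, u y) - ⨍ y in ball x r₁, u y| ≤ q * (r₂ - r₁) := by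
  obtain ⟨ξ, hξ, -, V, hV, hKV, hξ1⟩ := exists_test_eq_one (isCompact_closedBall x r₂) hΩ hB
  have hcut := hu.cutoff hΩ.measurableSet hξ
  obtain ⟨φ, hφ, hφ1, hφ2, -⟩ := hcut.exists_test_approx hξ.2.1 hΩ hξ.2.2
    (fun x hx => by simp [image_eq_zero_of_notMem_tsupport hx])
  set U : Euc n → ℝ := fun x => ξ x * u x with hU
  set DU : Euc n → Euc n := fun x => ξ x • Du x + u x • gradient ξ x with hDU
  have hUm : MemLp U 2 volume := by simpa using hcut.memLp
  have hDUm : MemLp DU 2 volume := by simpa using hcut.memLp_grad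
  have hUu : ∀ y ∈ closedBall x r₂, U y = u y := fun y hy => by simp [hU, hξ1 y (hKV hy)]
  have hDUu : ∀ y ∈ closedBall x r₂, DU y = Du y := fun y hy => by
    have : gradient ξ y = 0 := by
      have h1 : ξ =ᶠ[𝓝 y] fun _ => (1 : ℝ) := by
        filter_upwards [hV.mem_nhds (hKV hy)] with z hz using hξ1 z hz
      rw [h1.gradient_eq, gradient_fun_const]
    simp [hDU, hξ1 y (hKV hy), this]
  -- averages of the mollifications converge
  have havg : ∀ ρ, 0 < ρ → ρ ≤ r₂ → Tendsto (fun j => ⨍ y in ball x ρ, φ j y) atTop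
      (𝓝 (⨍ y in ball x ρ, u y)) := by
    intro ρ hρ hρr
    simp only [setAverage_eq, smul_eq_mul]
    refine Tendsto.const_mul _ ?_
    have e : ∫ y in ball x ρ, u y = ∫ y in ball x ρ, U y * 1 := by
      refine setIntegral_congr_fun measurableSet_ball fun y hy => ?_
      simp [hUu y (ball_subset_closedBall (ball_subset_ball hρr hy))]
    rw [e]
    have := tendsto_integral_mul (l := atTop) (μ := volume.restrict (ball x ρ)) (f := φ) (f₀ := U)
      (g := fun _ _ => (1 : ℝ)) (g₀ := fun _ => 1)
      (fun j => (hφ j).memLp.restrict _) (hUm.restrict _) (fun _ => memLp_const _) (memLp_const _)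
      (tendsto_of_tendsto_of_tendsto_of_le_of_le tendsto_const_nhds hφ1 (fun _ => zero_le)
        fun j => eLpNorm_mono_measure _ Measure.restrict_le_self) (by simp)
    simpa using this
  -- the error in the gradients
  set δ : ℕ → ℝ := fun j => √(∫ y, ‖gradient (φ j) y - DU y‖ ^ 2) with hδ
  have hδ0 : Tendsto δ atTop (𝓝 0) := by
    have hm : ∀ j, MemLp (fun y => gradient (φ j) y - DU y) 2 volume := fun j =>
      (hφ j).memLp_gradient.sub hDUm
    have t := tendsto_integral_inner (l := atTop) hm (MemLp.zero (ε := Euc n)) hm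
      (MemLp.zero (ε := Euc n)) (by simpa using hφ2) (by simpa using hφ2)
    simp only [real_inner_self_eq_norm_sq] at t
    have := (Real.continuous_sqrt.tendsto _).comp t
    simpa [hδ, Function.comp_def] using this
  have hc : 0 < volume.real (ball x r₁) := volume_real_ball_pos x hr₁
  have hderiv : ∀ j, ∀ ρ ∈ Icc r₁ r₂,
      ‖(ρ * volume.real (ball x ρ))⁻¹ * ∫ y in ball x ρ, inner ℝ (gradient (φ j) y) (y - x)‖
        ≤ q + δ j / √(volume.real (ball x r₁)) := by
    intro j ρ hρ
    have hρ0 : 0 < ρ := hr₁.trans_le hρ.1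
    have hb : 0 < volume.real (ball x ρ) := volume_real_ball_pos x hρ0
    have hsub : ball x ρ ⊆ ball x r₂ := ball_subset_ball hρ.2
    have hmono : volume.real (ball x ρ) ≤ volume.real (ball x r₂) :=
      measureReal_mono hsub measure_ball_lt_top.ne
    have hmono₁ : volume.real (ball x r₁) ≤ volume.real (ball x ρ) :=
      measureReal_mono (ball_subset_ball hρ.1) measure_ball_lt_top.ne
    have h1 := hmin.abs_integral_inner_radial_le hQ hQ0 hu hρ0
      ((hsub.trans ball_subset_closedBall).trans hB) hq (fun y hy => hQq y (hsub hy))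
      (lt_of_le_of_lt (by gcongr) hsmall)
    have hxm : MemLp (fun y => y - x) 2 (volume.restrict (ball x ρ)) := by
      refine MemLp.of_bound (by fun_prop) ρ ?_
      filter_upwards [ae_restrict_mem measurableSet_ball] with y hy
      rw [mem_ball, dist_eq_norm] at hy
      exact hy.le
    have hdm : MemLp (fun y => gradient (φ j) y - DU y) 2 (volume.restrict (ball x ρ)) :=
      ((hφ j).memLp_gradient.sub hDUm).restrict _
    have h2 := _root_.abs_integral_inner_le hdm hxm
    have h3 : √(∫ y in ball x ρ, ‖gradient (φ j) y - DU y‖ ^ 2) ≤ δ j := by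
      refine Real.sqrt_le_sqrt (setIntegral_le_integral ?_ ?_)
      · exact integrable_norm_sq ((hφ j).memLp_gradient.sub hDUm)
      · exact Eventually.of_forall fun y => by positivity
    have h4 : √(∫ y in ball x ρ, ‖y - x‖ ^ 2) ≤ ρ * √(volume.real (ball x ρ)) := by
      rw [show ρ * √(volume.real (ball x ρ)) = √(ρ ^ 2 * volume.real (ball x ρ)) by
        rw [Real.sqrt_mul (by positivity), Real.sqrt_sq hρ0.le]]
      refine Real.sqrt_le_sqrt ?_
      calc ∫ y in ball x ρ, ‖y - x‖ ^ 2 ≤ ∫ y in ball x ρ, ρ ^ 2 := by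
            refine setIntegral_mono_on (integrable_norm_sq hxm)
              (integrable_const _) measurableSet_ball fun y hy => ?_
            rw [mem_ball, dist_eq_norm] at hy
            gcongr
        _ = ρ ^ 2 * volume.real (ball x ρ) := by simp [mul_comm]
    have h5 : ∫ y in ball x ρ, inner ℝ (gradient (φ j) y) (y - x)
        = (∫ y in ball x ρ, inner ℝ (gradient (φ j) y - DU y) (y - x))
          + ∫ y in ball x ρ, inner ℝ (Du y) (y - x) := by
      have : ∫ y in ball x ρ, inner ℝ (Du y) (y - x) = ∫ y in ball x ρ, inner ℝ (DU y) (y - x) := by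
        refine setIntegral_congr_fun measurableSet_ball fun y hy => ?_
        rw [hDUu y (ball_subset_closedBall (hsub hy))]
      rw [this, ← integral_add (integrable_inner hdm hxm) (integrable_inner (hDUm.restrict _) hxm)]
      simp [inner_sub_left]
    have hδj : 0 ≤ δ j := Real.sqrt_nonneg _
    have h6 : |∫ y in ball x ρ, inner ℝ (gradient (φ j) y) (y - x)|
        ≤ δ j * (ρ * √(volume.real (ball x ρ))) + q * ρ * volume.real (ball x ρ) := by
      rw [h5]
      refine (abs_add_le _ _).trans (add_le_add (h2.trans ?_) h1)
      gcongr
    rw [norm_mul, Real.norm_eq_abs, Real.norm_eq_abs, abs_of_pos (by positivity)]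
    calc (ρ * volume.real (ball x ρ))⁻¹ * |∫ y in ball x ρ, inner ℝ (gradient (φ j) y) (y - x)|
        ≤ (ρ * volume.real (ball x ρ))⁻¹ *
          (δ j * (ρ * √(volume.real (ball x ρ))) + q * ρ * volume.real (ball x ρ)) := by gcongr
      _ = δ j / √(volume.real (ball x ρ)) + q := by
          have hs : √(volume.real (ball x ρ)) ^ 2 = volume.real (ball x ρ) := Real.sq_sqrt hb.le
          have hs0 : 0 < √(volume.real (ball x ρ)) := Real.sqrt_pos.2 hb
          generalize √(volume.real (ball x ρ)) = s at hs hs0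
          rw [← hs]
          field_simp
      _ ≤ q + δ j / √(volume.real (ball x r₁)) := by
          rw [add_comm]
          gcongr
  have hj : ∀ j, |(⨍ y in ball x r₂, φ j y) - ⨍ y in ball x r₁, φ j y|
      ≤ (q + δ j / √(volume.real (ball x r₁))) * (r₂ - r₁) := by
    intro j
    have := (convex_Icc r₁ r₂).norm_image_sub_le_of_norm_hasDerivWithin_le
      (fun ρ hρ => (hasDerivAt_average_ball (hφ j) x (hr₁.trans_le hρ.1)).hasDerivWithinAt)
      (hderiv j) (left_mem_Icc.2 hr) (right_mem_Icc.2 hr)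
    rw [average_ball_eq _ _ hr₁, average_ball_eq _ _ (hr₁.trans_le hr)]
    rw [Real.norm_eq_abs, Real.norm_of_nonneg (by linarith)] at this
    exact this
  have hl : Tendsto (fun j => (q + δ j / √(volume.real (ball x r₁))) * (r₂ - r₁)) atTop
      (𝓝 ((q + 0 / √(volume.real (ball x r₁))) * (r₂ - r₁))) :=
    (tendsto_const_nhds.add (hδ0.div_const _)).mul_const _
  rw [zero_div, add_zero] at hl
  exact le_of_tendsto_of_tendsto' (((havg r₂ (hr₁.trans_le hr) le_rfl).sub
    (havg r₁ hr₁ hr)).abs) hl hj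

/-- At a point of `Ω` the precise representative deviates from its ball averages by at most `q r`,
where `q` bounds the weight on the ball. -/
theorem MinimizesOnBalls.abs_sub_average_le {ε₀ : ℝ} (hmin : MinimizesOnBalls Q Ω u Du ε₀)
    (hΩ : IsOpen Ω)
    (hQ : Continuous Q) (hQ0 : ∀ y, 0 ≤ Q y) (hu : MemW12 Ω u Du)
    (hrep : IsPreciseRepresentative Ω u) {x : Euc n} {r : ℝ}
    (hr : 0 < r) (hB : closedBall x r ⊆ Ω) {q : ℝ} (hq : 0 < q)
    (hQq : ∀ y ∈ ball x r, Q y ≤ q)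
    (hsmall : q ^ 2 * volume.real (ball x r) + volume.real (ball x r) < ε₀) :
    |(⨍ y in ball x r, u y) - u x| ≤ q * r := by
  have h1 := (tendsto_const_nhds (x := ⨍ y in ball x r, u y)).sub
    (hrep x (hB (mem_closedBall_self hr.le)))
  refine le_of_tendsto h1.abs ?_
  filter_upwards [Ioo_mem_nhdsGT hr] with s hs
  refine (hmin.abs_average_sub_le hΩ hQ hQ0 hu hs.1 hs.2.le hB hq hQq hsmall).trans ?_
  have := hs.1
  gcongr
  linarith

theorem continuous_setIntegral_ball {f : Euc n → ℝ} (hf : Integrable f) {r : ℝ} (hr : 0 < r) :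
    Continuous fun x => ∫ y in ball x r, f y := by
  refine continuous_iff_continuousAt.2 fun x => ?_
  have : (fun x => ∫ y in ball x r, f y) = fun x => ∫ y, (ball x r).indicator f y := by
    ext x; rw [integral_indicator measurableSet_ball]
  rw [this]
  refine continuousAt_of_dominated (bound := fun y => ‖f y‖) ?_ ?_ hf.norm ?_
  · exact Eventually.of_forall fun z => hf.1.indicator measurableSet_ball
  · exact Eventually.of_forall fun z => Eventually.of_forall fun y => norm_indicator_le_norm_self _ _
  · have h0 : volume (sphere x r) = 0 := Measure.addHaar_sphere_of_ne_zero _ _ hr.ne'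
    have : ∀ᵐ y : Euc n, y ∉ sphere x r := measure_eq_zero_iff_ae_notMem.1 h0
    filter_upwards [this] with y hy
    rw [mem_sphere] at hy
    have hd : Continuous fun z : Euc n => dist y z := by fun_prop
    rcases lt_or_gt_of_ne hy with h | h
    · refine (continuousAt_const (y := f y)).congr ?_
      filter_upwards [hd.continuousAt.eventually (gt_mem_nhds h)] with z hz
      rw [indicator_of_mem (by exact hz)]
    · refine (continuousAt_const (y := (0 : ℝ))).congr ?_
      filter_upwards [hd.continuousAt.eventually (lt_mem_nhds h)] with z hz
      rw [indicator_of_notMem]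
      simp only [mem_ball, not_lt]
      exact hz.le

theorem eventually_small_volume (x : Euc n) (hn : 0 < n) (q : ℝ) {ε₀ : ℝ} (hε : 0 < ε₀) :
    ∀ᶠ r in 𝓝[>] (0 : ℝ), q ^ 2 * volume.real (ball x r) + volume.real (ball x r) < ε₀ := by
  set c := volume.real (ball (0 : Euc n) 1)
  have : Tendsto (fun r : ℝ => q ^ 2 * (r ^ n * c) + r ^ n * c) (𝓝[>] 0)
      (𝓝 (q ^ 2 * (0 ^ n * c) + 0 ^ n * c)) :=
    ((Continuous.tendsto (by fun_prop) 0)).mono_left nhdsWithin_le_nhds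
  rw [zero_pow hn.ne'] at this
  simp only [zero_mul, mul_zero, add_zero] at this
  filter_upwards [this.eventually (gt_mem_nhds hε), self_mem_nhdsWithin] with r hr hr0
  rwa [volume_real_ball x hr0]

theorem volume_real_ball_center (x y : Euc n) (r : ℝ) :
    volume.real (ball x r) = volume.real (ball y r) := by
  rw [Measure.real, Measure.real, Measure.addHaar_ball_center, Measure.addHaar_ball_center _ y]

/-- Minimizers, in their precise representative, are continuous. -/
theorem MinimizesOnBalls.continuousOn {ε₀ : ℝ} (hmin : MinimizesOnBalls Q Ω u Du ε₀)
    (hε : 0 < ε₀) (hn : 0 < n) (hΩ : IsOpen Ω) (hQ : Continuous Q) (hQ0 : ∀ y, 0 ≤ Q y)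
    (hu : MemW12 Ω u Du) (hrep : IsPreciseRepresentative Ω u) : ContinuousOn u Ω := by
  intro x hx
  refine ContinuousAt.continuousWithinAt ?_
  obtain ⟨R, hR, hRΩ⟩ := Metric.isOpen_iff.1 hΩ x hx
  obtain ⟨q, hq⟩ := (isCompact_closedBall x R).exists_bound_of_continuousOn hQ.continuousOn
  set q' := max q 1
  have hq' : 0 < q' := by positivity
  have hQq : ∀ y ∈ closedBall x R, Q y ≤ q' := fun y hy =>
    (le_abs_self _).trans ((hq y hy).trans (le_max_left _ _))
  rw [Metric.continuousAt_iff']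
  intro ε hεpos
  have hev : ∀ᶠ r in 𝓝[>] (0 : ℝ), q' * r < ε / 4 := by
    have : Tendsto (fun r : ℝ => q' * r) (𝓝[>] 0) (𝓝 (q' * 0)) :=
      (Continuous.tendsto (by fun_prop) 0).mono_left nhdsWithin_le_nhds
    rw [mul_zero] at this
    exact this.eventually (gt_mem_nhds (by positivity))
  obtain ⟨r, hr1, hr2, hr3⟩ := (hev.and ((eventually_small_volume x hn q' hε).and
    (Ioo_mem_nhdsGT (show (0 : ℝ) < R / 4 by positivity)))).exists
  have hr0 : 0 < r := hr3.1
  have key : ∀ y ∈ ball x (R / 4), |(⨍ z in ball y r, u z) - u y| ≤ ε / 4 := by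
    intro y hy
    have hsub : closedBall y r ⊆ ball x R := by
      refine closedBall_subset_ball' ?_
      rw [mem_ball] at hy
      linarith [hr3.2]
    refine (hmin.abs_sub_average_le hΩ hQ hQ0 hu hrep hr0 (hsub.trans hRΩ) hq' (fun z hz => ?_)
      ?_).trans hr1.le
    · exact hQq z (ball_subset_closedBall (hsub (ball_subset_closedBall hz)))
    · rwa [volume_real_ball_center y x]
  have hui : IntegrableOn u (ball x R) :=
    ((hu.mono hRΩ).memLp.mono_exponent (by norm_num : (1 : ℝ≥0∞) ≤ 2)).integrable le_rfl
  have hcont := (continuous_setIntegral_ball (f := (ball x R).indicator u)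
    (hui.integrable_indicator measurableSet_ball) hr0).const_mul (volume.real (ball x r))⁻¹
  have havg : ∀ y ∈ ball x (R / 4), ⨍ z in ball y r, u z
      = (volume.real (ball x r))⁻¹ * ∫ z in ball y r, (ball x R).indicator u z := by
    intro y hy
    rw [setAverage_eq, volume_real_ball_center y x, smul_eq_mul]
    congr 1
    refine setIntegral_congr_fun measurableSet_ball fun z hz => ?_
    rw [indicator_of_mem]
    refine ball_subset_ball' ?_ hz
    rw [mem_ball] at hy
    linarith [hr3.2]
  filter_upwards [ball_mem_nhds x (show 0 < R / 4 by positivity),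
    Metric.continuousAt_iff'.1 hcont.continuousAt (ε / 4) (by positivity)] with y hy hyc
  have hxx : x ∈ ball x (R / 4) := mem_ball_self (by positivity)
  rw [← havg y hy, ← havg x hxx, Real.dist_eq] at hyc
  rw [Real.dist_eq]
  have k1 := key y hy
  have k2 := key x hxx
  rw [abs_le] at k1 k2
  rw [abs_lt] at hyc ⊢
  constructor <;> linarith

/-- At a point of `Γ` where `u` vanishes, `u` grows at most like `r ^ (γ + 1)`. -/
theorem MinimizesOnBalls.growth {ε₀ : ℝ} (hmin : MinimizesOnBalls Q Ω u Du ε₀)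
    (hε : 0 < ε₀) (hn : 0 < n) (hΩ : IsOpen Ω) (hQ : Continuous Q) (hQ0 : ∀ y, 0 ≤ Q y)
    (hu : MemW12 Ω u Du) (hrep : IsPreciseRepresentative Ω u) {γ : ℝ} (hγ : 0 < γ) {x₀ : Euc n}
    (hx₀ : x₀ ∈ Ω) (hux₀ : u x₀ ≤ 0) (hpos : ∀ x ∈ Ω, 0 ≤ u x)
    (hQγ : ∀ x, Q x ≤ dist x x₀ ^ γ) :
    ∀ᶠ r in 𝓝[>] (0 : ℝ), ∀ x ∈ closedBall x₀ r,
      u x ≤ ((2 : ℝ) ^ γ + 2 ^ n * (2 * 2 ^ γ)) * r ^ (γ + 1) := by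
  obtain ⟨R, hR, hRΩ⟩ := Metric.isOpen_iff.1 hΩ x₀ hx₀
  have hvol := eventually_small_volume x₀ hn (R ^ γ) hε
  have h2 : Tendsto (fun r : ℝ => 2 * r) (𝓝[>] 0) (𝓝[>] 0) := by
    refine tendsto_nhdsWithin_iff.2 ⟨?_, ?_⟩
    · have : Tendsto (fun r : ℝ => 2 * r) (𝓝[>] 0) (𝓝 (2 * 0)) :=
        (Continuous.tendsto (by fun_prop) 0).mono_left nhdsWithin_le_nhds
      simpa using this
    · filter_upwards [self_mem_nhdsWithin] with r hr
      have : (0 : ℝ) < r := hr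
      simpa
  filter_upwards [h2.eventually hvol, Ioo_mem_nhdsGT (show (0 : ℝ) < R / 4 by positivity)]
    with r hvr hr x hx
  have hr0 : 0 < r := hr.1
  have hrR : r < R / 4 := hr.2
  rw [mem_closedBall] at hx
  set q : ℝ := (2 * r) ^ γ with hqdef
  have hq : 0 < q := by positivity
  have hqR : q ≤ R ^ γ := Real.rpow_le_rpow (by positivity) (by linarith) hγ.le
  have hsm : q ^ 2 * volume.real (ball x₀ (2 * r)) + volume.real (ball x₀ (2 * r)) < ε₀ :=
    lt_of_le_of_lt (by gcongr) hvr
  have hsub2 : closedBall x₀ (2 * r) ⊆ Ω :=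
    (closedBall_subset_ball (by linarith)).trans hRΩ
  have hsub : ball x r ⊆ ball x₀ (2 * r) := ball_subset_ball' (by linarith)
  have hsubc : closedBall x r ⊆ closedBall x₀ (2 * r) := closedBall_subset_closedBall' (by linarith)
  have hQq : ∀ y ∈ ball x₀ (2 * r), Q y ≤ q := fun y hy =>
    (hQγ y).trans (Real.rpow_le_rpow dist_nonneg (mem_ball.1 hy).le hγ.le)
  have hmono : volume.real (ball x r) ≤ volume.real (ball x₀ (2 * r)) :=
    measureReal_mono hsub measure_ball_lt_top.ne
  have k1 := hmin.abs_sub_average_le hΩ hQ hQ0 hu hrep hr0 (hsubc.trans hsub2) hq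
    (fun y hy => hQq y (hsub hy)) (lt_of_le_of_lt (by gcongr) hsm)
  have k2 := hmin.abs_sub_average_le hΩ hQ hQ0 hu hrep (by positivity) hsub2 hq hQq hsm
  have k3 : ⨍ y in ball x r, u y ≤ 2 ^ n * ⨍ y in ball x₀ (2 * r), u y := by
    rw [setAverage_eq, setAverage_eq, volume_real_ball x hr0, volume_real_ball x₀
      (by positivity : 0 < 2 * r), smul_eq_mul, smul_eq_mul]
    have hui : IntegrableOn u (ball x₀ (2 * r)) :=
      ((hu.mono (ball_subset_closedBall.trans hsub2)).memLp.mono_exponent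
        (by norm_num : (1 : ℝ≥0∞) ≤ 2)).integrable le_rfl
    have hle : ∫ y in ball x r, u y ≤ ∫ y in ball x₀ (2 * r), u y := by
      refine setIntegral_mono_set hui ?_ (LE.le.eventuallyLE hsub)
      filter_upwards [ae_restrict_mem measurableSet_ball] with y hy
      exact hpos y (hsub2 (ball_subset_closedBall hy))
    have hc : 0 < volume.real (ball (0 : Euc n) 1) := volume_real_ball_pos 0 one_pos
    set c := volume.real (ball (0 : Euc n) 1)
    have e : 2 ^ n * (((2 * r) ^ n * c)⁻¹ * ∫ y in ball x₀ (2 * r), u y)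
        = (r ^ n * c)⁻¹ * ∫ y in ball x₀ (2 * r), u y := by
      rw [mul_pow]; field_simp
    rw [e]
    gcongr
  rw [abs_le] at k1 k2
  have e1 : q * r = 2 ^ γ * r ^ (γ + 1) := by
    rw [hqdef, Real.mul_rpow (by norm_num) hr0.le, Real.rpow_add hr0, Real.rpow_one]; ring
  have k4 : ⨍ y in ball x₀ (2 * r), u y ≤ q * (2 * r) := by linarith [k2.2]
  calc u x ≤ (⨍ y in ball x r, u y) + q * r := by linarith [k1.1]
    _ ≤ 2 ^ n * (q * (2 * r)) + q * r := by
        gcongr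
        refine k3.trans ?_
        gcongr
    _ = ((2 : ℝ) ^ γ + 2 ^ n * (2 * 2 ^ γ)) * r ^ (γ + 1) := by
        rw [show q * (2 * r) = 2 * (q * r) by ring, e1]; ring

/-! ### Polar coordinates -/

/-- Integrability for the radial measure `y ^ m dy` of polar coordinates, in terms of Lebesgue
measure. -/
theorem integrable_volumeIoiPow_iff (m : ℕ) (f : ℝ → ℝ) :
    Integrable (fun x : Ioi (0 : ℝ) => f x) (Measure.volumeIoiPow m)
      ↔ IntegrableOn (fun y => y ^ m * f y) (Ioi 0) := by
  rw [Measure.volumeIoiPow, integrable_withDensity_iff_integrable_smul',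
    integrableOn_iff_comap_subtypeVal measurableSet_Ioi]
  · refine integrable_congr (Eventually.of_forall fun x => ?_)
    have hx : (0 : ℝ) < x.1 := x.2
    simp [ENNReal.toReal_ofReal (pow_nonneg hx.le m)]
  · fun_prop
  · exact Eventually.of_forall fun x => ENNReal.ofReal_lt_top

theorem integral_volumeIoiPow (m : ℕ) (f : ℝ → ℝ) :
    ∫ x : Ioi (0 : ℝ), f x ∂(Measure.volumeIoiPow m) = ∫ y in Ioi (0 : ℝ), y ^ m * f y := by
  simp only [Measure.volumeIoiPow, ENNReal.ofReal]
  rw [integral_withDensity_eq_integral_smul,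
    integral_subtype_comap measurableSet_Ioi fun a ↦ Real.toNNReal (a ^ m) • f a]
  · refine setIntegral_congr_fun measurableSet_Ioi fun x hx ↦ ?_
    simp only [NNReal.smul_def, smul_eq_mul]
    rw [Real.coe_toNNReal _ (pow_nonneg (le_of_lt hx) _)]
  · exact (measurable_subtype_coe.pow_const _).real_toNNReal

theorem ae_volumeIoiPow_iff (m : ℕ) (p : ℝ → Prop)
    (h : ∀ᵐ x : Ioi (0 : ℝ) ∂(Measure.volumeIoiPow m), p x) :
    ∀ᵐ y ∂(volume.restrict (Ioi (0 : ℝ))), p y := by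
  have h1 : ∀ᵐ x : Ioi (0 : ℝ) ∂(Measure.comap Subtype.val volume), p x := by
    rw [Measure.volumeIoiPow, ae_withDensity_iff (by fun_prop)] at h
    filter_upwards [h] with x hx
    refine hx ?_
    have hx : (0 : ℝ) < x.1 := x.2
    rw [ne_eq, ENNReal.ofReal_eq_zero, not_le]
    positivity
  rw [← map_comap_subtype_coe measurableSet_Ioi]
  exact ((MeasurableEmbedding.subtype_coe measurableSet_Ioi).ae_map_iff).2 h1

/-- Integration in polar coordinates about the origin. -/
theorem integral_polar_zero (hn : 0 < n) {F : Euc n → ℝ} (hF : Integrable F) :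
    (∀ᵐ ρ ∂(volume.restrict (Ioi (0 : ℝ))),
      Integrable (fun η : sphere (0 : Euc n) 1 => F (ρ • (η : Euc n)))
        ((volume : Measure (Euc n)).toSphere)) ∧
    IntegrableOn (fun ρ : ℝ => ρ ^ (n - 1) * ∫ η : sphere (0 : Euc n) 1, F (ρ • (η : Euc n))
      ∂((volume : Measure (Euc n)).toSphere)) (Ioi 0) ∧
    ∫ x, F x = ∫ ρ in Ioi (0 : ℝ), ρ ^ (n - 1) * ∫ η : sphere (0 : Euc n) 1, F (ρ • (η : Euc n))
      ∂((volume : Measure (Euc n)).toSphere) := by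
  have : Nonempty (Fin n) := ⟨⟨0, hn⟩⟩
  have hmp := (volume : Measure (Euc n)).measurePreserving_homeomorphUnitSphereProd
  rw [finrank_euclideanSpace, Fintype.card_fin] at hmp
  have hemb := (homeomorphUnitSphereProd (Euc n)).measurableEmbedding
  set G : sphere (0 : Euc n) 1 × Ioi (0 : ℝ) → ℝ := fun p => F ((p.2 : ℝ) • (p.1 : Euc n)) with hG
  have hcomp : ∀ x : ({0}ᶜ : Set (Euc n)), G (homeomorphUnitSphereProd (Euc n) x) = F x := by
    intro x
    have hx : ‖(x : Euc n)‖ ≠ 0 := norm_ne_zero_iff.2 x.2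
    simp only [hG, homeomorphUnitSphereProd_apply_snd_coe, homeomorphUnitSphereProd_apply_fst_coe]
    rw [smul_smul, mul_inv_cancel₀ hx, one_smul]
  have hFr : Integrable (fun x : ({0}ᶜ : Set (Euc n)) => F x) (volume.comap Subtype.val) := by
    have : IntegrableOn F ({0}ᶜ) := hF.integrableOn
    exact (integrableOn_iff_comap_subtypeVal (measurableSet_singleton _).compl).1 this
  have hGi : Integrable G ((volume : Measure (Euc n)).toSphere.prod
      (Measure.volumeIoiPow (n - 1))) := by
    rw [← hmp.integrable_comp_emb hemb]
    exact hFr.congr (Eventually.of_forall fun x => (hcomp x).symm)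
  refine ⟨?_, ?_, ?_⟩
  · exact ae_volumeIoiPow_iff (n - 1) _ hGi.prod_left_ae
  · rw [← integrable_volumeIoiPow_iff]
    exact hGi.integral_prod_right
  · rw [← integral_volumeIoiPow (n - 1) fun ρ => ∫ η : sphere (0 : Euc n) 1, F (ρ • (η : Euc n))
      ∂((volume : Measure (Euc n)).toSphere), ← integral_prod_symm G hGi,
      ← hmp.integral_comp hemb G]
    simp only [hcomp]
    rw [integral_subtype_comap (measurableSet_singleton _).compl F, restrict_compl_singleton]

/-- Integration in polar coordinates on a ball. -/
theorem polar_ball (hn : 0 < n) {f : Euc n → ℝ} {x₀ : Euc n} {R : ℝ}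
    (hf : IntegrableOn f (ball x₀ R)) :
    (∀ᵐ ρ : ℝ, ρ ∈ Ioo 0 R → SphereIntegrable x₀ ρ f) ∧
    IntegrableOn (fun ρ => sphereIntegral x₀ ρ f) (Ioo 0 R) ∧
    ∀ r ∈ Icc 0 R, ∫ x in ball x₀ r, f x = ∫ ρ in (0 : ℝ)..r, sphereIntegral x₀ ρ f := by
  have key : ∀ r ≤ R, Integrable (fun x => (ball x₀ r).indicator f (x₀ + x)) := by
    intro r hr
    exact ((hf.mono_set (ball_subset_ball hr)).integrable_indicator
      measurableSet_ball).comp_add_left x₀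
  have hind : ∀ (r ρ : ℝ) (η : sphere (0 : Euc n) 1), 0 < ρ →
      (ball x₀ r).indicator f (x₀ + ρ • (η : Euc n))
        = (Iio r).indicator (fun ρ => f (x₀ + ρ • (η : Euc n))) ρ := by
    intro r ρ η hρ
    have hη : ‖(η : Euc n)‖ = 1 := by simp
    have : x₀ + ρ • (η : Euc n) ∈ ball x₀ r ↔ ρ ∈ Iio r := by
      simp [mem_ball, dist_eq_norm, norm_smul, hη, abs_of_pos hρ]
    by_cases h : ρ ∈ Iio r
    · rw [indicator_of_mem (this.2 h), indicator_of_mem h]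
    · rw [indicator_of_notMem (fun h' => h (this.1 h')), indicator_of_notMem h]
  have hint : ∀ (r ρ : ℝ), 0 < ρ →
      ρ ^ (n - 1) * ∫ η : sphere (0 : Euc n) 1, (ball x₀ r).indicator f (x₀ + ρ • (η : Euc n))
        ∂((volume : Measure (Euc n)).toSphere)
      = (Iio r).indicator (fun ρ => sphereIntegral x₀ ρ f) ρ := by
    intro r ρ hρ
    simp only [hind r ρ _ hρ]
    by_cases h : ρ ∈ Iio r
    · simp only [indicator_of_mem h, sphereIntegral]
    · simp only [indicator_of_notMem h, integral_zero, mul_zero]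
  have hIoo : ∀ r : ℝ, Ioo 0 r = Ioi 0 ∩ Iio r := fun r => rfl
  obtain ⟨h1, h2, -⟩ := integral_polar_zero hn (key R le_rfl)
  refine ⟨?_, ?_, ?_⟩
  · rw [ae_restrict_iff' measurableSet_Ioi] at h1
    filter_upwards [h1] with ρ hρ hρR
    refine (hρ hρR.1).congr (Eventually.of_forall fun η => ?_)
    simp only [hind R ρ η hρR.1]
    rw [indicator_of_mem (by exact hρR.2)]
  · have h3 : IntegrableOn ((Iio R).indicator fun ρ => sphereIntegral x₀ ρ f) (Ioi 0) :=
      h2.congr_fun (fun ρ hρ => hint R ρ hρ) measurableSet_Ioi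
    rw [IntegrableOn, integrable_indicator_iff measurableSet_Iio, IntegrableOn,
      Measure.restrict_restrict measurableSet_Iio, inter_comm] at h3
    exact h3
  · intro r hr
    have h3 := (integral_polar_zero hn (key r hr.2)).2.2
    rw [setIntegral_congr_fun measurableSet_Ioi (fun ρ hρ => hint r ρ hρ),
      integral_add_left_eq_self (fun x => (ball x₀ r).indicator f x) x₀,
      integral_indicator measurableSet_ball, setIntegral_indicator measurableSet_Iio] at h3
    rw [h3, intervalIntegral.integral_of_le hr.1, ← integral_Ioc_eq_integral_Ioo.symm]
    rfl

theorem norm_sphere_coe (η : sphere (0 : Euc n) 1) : ‖(η : Euc n)‖ = 1 := by simp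

theorem sphereIntegral_congr {x₀ : Euc n} {r : ℝ} {f g : Euc n → ℝ}
    (h : ∀ η : Euc n, ‖η‖ = 1 → f (x₀ + r • η) = g (x₀ + r • η)) :
    sphereIntegral x₀ r f = sphereIntegral x₀ r g := by
  unfold sphereIntegral
  congr 2
  ext η
  exact h _ (norm_sphere_coe η)

theorem sphereIntegral_const_mul (x₀ : Euc n) (r c : ℝ) (f : Euc n → ℝ) :
    sphereIntegral x₀ r (fun x => c * f x) = c * sphereIntegral x₀ r f := by
  unfold sphereIntegral
  rw [integral_const_mul]; ring

theorem sphereIntegral_radial_mul (x₀ : Euc n) {r : ℝ} (hr : 0 ≤ r) (g : ℝ → ℝ) (f : Euc n → ℝ) :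
    sphereIntegral x₀ r (fun x => g ‖x - x₀‖ * f x) = g r * sphereIntegral x₀ r f := by
  rw [← sphereIntegral_const_mul]
  refine sphereIntegral_congr fun η hη => ?_
  simp [norm_smul, hη, abs_of_nonneg hr]

/-- The cut-off profiles `G` used for radial test functions: `ρ ↦ G (ρ²)` has derivative `-h`. -/
theorem exists_radial_profile {h : ℝ → ℝ} (hh : ContDiff ℝ ∞ h) {a b : ℝ} (ha : 0 < a)
    (hab : a ≤ b) (hs : ∀ ρ, ρ ∉ Icc a b → h ρ = 0) :
    ∃ G : ℝ → ℝ, ContDiff ℝ ∞ G ∧ (∀ s, b ^ 2 ≤ s → G s = 0) ∧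
      (∀ ρ, 0 ≤ ρ → 2 * ρ * deriv G (ρ ^ 2) = - h ρ) ∧
      ∀ ρ, 0 ≤ ρ → G (ρ ^ 2) = ∫ τ in ρ..b, h τ := by
  set k : ℝ → ℝ := fun s => h √s / (2 * √s) with hk
  have hkc : ContDiff ℝ ∞ k := by
    rw [contDiff_iff_contDiffAt]
    intro s
    rcases le_or_gt s 0 with h0 | h0
    · refine (contDiffAt_const (c := (0 : ℝ))).congr_of_eventuallyEq ?_
      filter_upwards [gt_mem_nhds (show s < a ^ 2 by nlinarith)] with t ht
      have : h √t = 0 := hs _ fun hmem => by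
        have h1 : √t < a := (Real.sqrt_lt' ha).2 ht
        linarith [hmem.1]
      simp [hk, this]
    · have h1 : ContDiffAt ℝ ∞ Real.sqrt s := Real.contDiffAt_sqrt h0.ne'
      refine ((hh.contDiffAt).comp s h1).div (contDiffAt_const.mul h1) ?_
      have := Real.sqrt_pos.2 h0
      positivity
  obtain ⟨hc, hd⟩ := exists_contDiff_primitive hkc (b ^ 2)
  set G : ℝ → ℝ := fun s => - ∫ τ in (b ^ 2)..s, k τ with hGdef
  have hG : ContDiff ℝ ∞ G := hc.neg
  have hGd : ∀ s, HasDerivAt G (- k s) s := fun s => by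
    have := (hc.differentiable (by simp) s).hasDerivAt
    rw [hd] at this
    exact this.neg
  have hb0 : 0 < b := ha.trans_le hab
  have hder : ∀ ρ, 0 ≤ ρ → 2 * ρ * deriv G (ρ ^ 2) = - h ρ := by
    intro ρ hρ
    rw [(hGd _).deriv, hk]
    simp only [Real.sqrt_sq hρ]
    rcases hρ.eq_or_lt with h0 | h0
    · rw [← h0, hs 0 (fun hmem => by linarith [hmem.1])]; simp
    · field_simp
  refine ⟨G, hG, ?_, hder, ?_⟩
  · intro s hbs
    have : ∫ τ in (b ^ 2)..s, k τ = ∫ τ in (b ^ 2)..s, (0 : ℝ) := by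
      refine intervalIntegral.integral_congr_ae ?_
      have : ∀ᵐ τ : ℝ, τ ≠ b ^ 2 := by simp [ae_iff, measure_singleton]
      filter_upwards [this] with τ hne hτ
      rw [uIoc_of_le hbs] at hτ
      have h1 : b < √τ := (Real.lt_sqrt hb0.le).2 hτ.1
      have : h √τ = 0 := hs _ fun hmem => by linarith [hmem.2]
      simp [hk, this]
    simp [hGdef, this]
  · intro ρ hρ
    have hF : ∀ τ ∈ uIcc ρ b, HasDerivAt (fun ρ : ℝ => G (ρ ^ 2)) (- h τ) τ := by
      intro τ hτ
      have hτ0 : 0 ≤ τ := le_trans (le_min hρ hb0.le) hτ.1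
      have h1 := (hGd (τ ^ 2)).comp τ (hasDerivAt_pow 2 τ)
      refine h1.congr_deriv ?_
      rw [← hder τ hτ0, (hGd _).deriv]
      push_cast; ring
    have h2 := intervalIntegral.integral_eq_sub_of_hasDerivAt hF
      ((hh.continuous.neg).intervalIntegrable _ _)
    have h3 : G (b ^ 2) = 0 := by simp [hGdef]
    rw [h3, intervalIntegral.integral_neg] at h2
    linarith

/-! ### Integrals over spheres and the energy identity -/

/-- The integral of `u²` over the sphere of radius `r`, in the normalised measure of the unit
sphere: `r ^ (1 - n) ∫_{∂B_r(x₀)} u²`. -/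
noncomputable def sphereSq (u : Euc n → ℝ) (x₀ : Euc n) (r : ℝ) : ℝ :=
  ∫ η : sphere (0 : Euc n) 1, u (x₀ + r • (η : Euc n)) ^ 2 ∂((volume : Measure (Euc n)).toSphere)

/-- The flux `r ^ (1 - n) ∫_{∂B_r(x₀)} u ∂_η u`. -/
noncomputable def sphereFlux (u : Euc n → ℝ) (Du : Euc n → Euc n) (x₀ : Euc n) (r : ℝ) : ℝ :=
  ∫ η : sphere (0 : Euc n) 1, u (x₀ + r • (η : Euc n)) *
    inner ℝ (Du (x₀ + r • (η : Euc n))) (η : Euc n) ∂((volume : Measure (Euc n)).toSphere)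

theorem sphereIntegral_mul_inner (hn : 0 < n) (u : Euc n → ℝ) (Du : Euc n → Euc n) (x₀ : Euc n)
    (r : ℝ) : sphereIntegral x₀ r (fun x => u x * inner ℝ (Du x) (x - x₀))
      = r ^ n * sphereFlux u Du x₀ r := by
  unfold sphereIntegral sphereFlux
  have : r ^ n = r ^ (n - 1) * r := by rw [← pow_succ, Nat.sub_add_cancel hn]
  rw [this, mul_assoc]
  have : ∀ η : sphere (0 : Euc n) 1, u (x₀ + r • (η : Euc n)) *
      inner ℝ (Du (x₀ + r • (η : Euc n))) (x₀ + r • (η : Euc n) - x₀) = r *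
      (u (x₀ + r • (η : Euc n)) * inner ℝ (Du (x₀ + r • (η : Euc n))) (η : Euc n)) := fun η => by
    rw [add_sub_cancel_left, inner_smul_right]; ring
  simp only [this, integral_const_mul]

theorem hasDerivAt_sphereSq {φ : Euc n → ℝ} (hφ : IsTestFunction D φ) (x₀ : Euc n) (r : ℝ) :
    HasDerivAt (sphereSq φ x₀) (2 * sphereFlux φ (gradient φ) x₀ r) r := by
  have hgc := continuous_gradient hφ.1
  have hφc := hφ.1.continuous
  obtain ⟨C, hC⟩ := (hasCompactSupport_gradient hφ.2.1).exists_bound_of_continuous hgc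
  obtain ⟨C', hC'⟩ := hφ.2.1.exists_bound_of_continuous hφc
  have hF : ∀ s : ℝ, Continuous fun η : sphere (0 : Euc n) 1 => φ (x₀ + s • (η : Euc n)) ^ 2 :=
    fun s => (hφc.comp (by fun_prop)).pow 2
  have hF' : Continuous fun η : sphere (0 : Euc n) 1 => 2 * (φ (x₀ + r • (η : Euc n)) *
      inner ℝ (gradient φ (x₀ + r • (η : Euc n))) (η : Euc n)) :=
    continuous_const.mul ((hφc.comp (by fun_prop)).mul
      ((hgc.comp (by fun_prop)).inner continuous_subtype_val))
  have h := hasDerivAt_integral_of_dominated_loc_of_deriv_le (x₀ := r) (s := univ)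
    (μ := (volume : Measure (Euc n)).toSphere)
    (F := fun s η => φ (x₀ + s • (η : Euc n)) ^ 2)
    (F' := fun s η => 2 * (φ (x₀ + s • (η : Euc n)) *
      inner ℝ (gradient φ (x₀ + s • (η : Euc n))) (η : Euc n)))
    (bound := fun _ => 2 * (C' * C)) univ_mem
    (Eventually.of_forall fun s => (hF s).aestronglyMeasurable)
    (Integrable.of_bound (hF r).aestronglyMeasurable (C' ^ 2)
      (Eventually.of_forall fun η => by
        rw [norm_pow]
        gcongr
        exact hC' _))
    hF'.aestronglyMeasurable ?_ (integrable_const _) ?_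
  · refine h.2.congr_deriv ?_
    rw [integral_const_mul, sphereFlux]
  · refine Eventually.of_forall fun η s _ => ?_
    rw [norm_mul, norm_mul, Real.norm_ofNat]
    have h1 : ‖inner ℝ (gradient φ (x₀ + s • (η : Euc n))) (η : Euc n)‖ ≤ C := by
      refine (norm_inner_le_norm _ _).trans ?_
      rw [norm_sphere_coe, mul_one]
      exact hC _
    have h0 : 0 ≤ C' := (norm_nonneg _).trans (hC' 0)
    have := hC' (x₀ + s • (η : Euc n))
    gcongr
  · refine Eventually.of_forall fun η s _ => ?_
    have h1 : HasDerivAt (fun s : ℝ => x₀ + s • (η : Euc n)) (η : Euc n) s := by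
      simpa using ((hasDerivAt_id s).smul_const (η : Euc n)).const_add x₀
    have h2 := (hφ.differentiableAt (x₀ + s • (η : Euc n))).hasFDerivAt.comp_hasDerivAt s h1
    have h3 := h2.pow 2
    refine h3.congr_deriv ?_
    rw [inner_gradient_left]
    simp
    ring

theorem continuous_sphereFlux {φ : Euc n → ℝ} (hφ : IsTestFunction D φ) (x₀ : Euc n) :
    Continuous (sphereFlux φ (gradient φ) x₀) := by
  have hgc := continuous_gradient hφ.1
  have hφc := hφ.1.continuous
  have := continuous_parametric_integral_of_continuous
    (μ := (volume : Measure (Euc n)).toSphere)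
    (f := fun (r : ℝ) (η : sphere (0 : Euc n) 1) => φ (x₀ + r • (η : Euc n)) *
      inner ℝ (gradient φ (x₀ + r • (η : Euc n))) (η : Euc n)) (s := univ) (by
      refine (hφc.comp (by fun_prop)).mul ((hgc.comp (by fun_prop)).inner ?_)
      exact continuous_subtype_val.comp continuous_snd) isCompact_univ
  unfold sphereFlux
  simpa only [Measure.restrict_univ] using this

theorem tendsto_eLpNorm_smul_bounded {α F ι : Type*} [MeasurableSpace α] {μ : Measure α}
    [NormedAddCommGroup F] [NormedSpace ℝ F] {l : Filter ι} {f : ι → α → ℝ} {f₀ : α → ℝ}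
    {m : α → F} {C : ℝ} (hm : ∀ᵐ x ∂μ, ‖m x‖ ≤ C)
    (h : Tendsto (fun i => eLpNorm (fun x => f i x - f₀ x) 2 μ) l (𝓝 0)) :
    Tendsto (fun i => eLpNorm (fun x => f i x • m x - f₀ x • m x) 2 μ) l (𝓝 0) := by
  have := ENNReal.Tendsto.const_mul (a := ‖C‖ₑ) h (Or.inr enorm_ne_top)
  rw [mul_zero] at this
  refine tendsto_of_tendsto_of_tendsto_of_le_of_le tendsto_const_nhds this (fun _ => zero_le)
    fun i => ?_
  rw [← eLpNorm_const_smul]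
  refine eLpNorm_mono_ae ?_
  filter_upwards [hm] with x hx
  simp only [← sub_smul, Pi.smul_apply, norm_smul]
  rw [mul_comm]
  gcongr
  exact hx.trans (le_abs_self _)

theorem integrableOn_mul_inner {x₀ : Euc n} {R : ℝ} (hu : MemW12 (ball x₀ R) u Du) :
    IntegrableOn (fun x => u x * inner ℝ (Du x) (x - x₀)) (ball x₀ R) := by
  have hxm : ∀ᵐ x ∂(volume.restrict (ball x₀ R)), ‖x - x₀‖ ≤ R := by
    filter_upwards [ae_restrict_mem measurableSet_ball] with y hy
    rw [mem_ball, dist_eq_norm] at hy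
    exact hy.le
  have h1 : MemLp (fun x => u x • (x - x₀)) 2 (volume.restrict (ball x₀ R)) := by
    have : MemLp (fun x => x - x₀) ⊤ (volume.restrict (ball x₀ R)) :=
      MemLp.of_bound (by fun_prop) R hxm
    exact this.smul hu.memLp (p := 2) (q := ⊤)
  refine (integrable_inner hu.memLp_grad h1).congr (Eventually.of_forall fun x => ?_)
  simp [inner_smul_right]

theorem intervalIntegrable_sphereFlux (hn : 0 < n) {x₀ : Euc n} {R : ℝ}
    (hu : MemW12 (ball x₀ R) u Du) {r₁ r₂ : ℝ} (h₁ : 0 < r₁) (h₁₂ : r₁ ≤ r₂) (h₂ : r₂ ≤ R) :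
    IntervalIntegrable (sphereFlux u Du x₀) volume r₁ r₂ := by
  obtain ⟨-, h, -⟩ := polar_ball hn (integrableOn_mul_inner hu)
  simp only [sphereIntegral_mul_inner hn] at h
  rw [intervalIntegrable_iff_integrableOn_Ioo_of_le h₁₂]
  have h3 := h.mono_set (Ioo_subset_Ioo h₁.le h₂)
  have h4 : IntegrableOn (fun ρ : ℝ => (ρ ^ n)⁻¹ * (ρ ^ n * sphereFlux u Du x₀ ρ)) (Ioo r₁ r₂) := by
    refine Integrable.bdd_mul (c := (r₁ ^ n)⁻¹) h3 (by fun_prop) ?_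
    filter_upwards [ae_restrict_mem measurableSet_Ioo] with ρ hρ
    have : 0 < ρ := h₁.trans hρ.1
    rw [Real.norm_of_nonneg (by positivity)]
    have := hρ.1.le
    gcongr
  refine h4.congr_fun (fun ρ hρ => ?_) measurableSet_Ioo
  have : 0 < ρ := h₁.trans hρ.1
  field_simp

/-- Over spheres, a continuous Sobolev function satisfies the fundamental theorem of calculus in
the radial direction. -/
theorem sphereSq_sub (hn : 0 < n) (hΩ : IsOpen Ω) (hu : MemW12 Ω u Du) (hc : ContinuousOn u Ω)
    {x₀ : Euc n} {r₁ r₂ : ℝ} (h₁ : 0 < r₁) (h₁₂ : r₁ ≤ r₂) (hB : closedBall x₀ r₂ ⊆ Ω) :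
    sphereSq u x₀ r₂ - sphereSq u x₀ r₁ = ∫ ρ in r₁..r₂, 2 * sphereFlux u Du x₀ ρ := by
  obtain ⟨ξ, hξ, -, V, hV, hKV, hξ1⟩ := exists_test_eq_one (isCompact_closedBall x₀ r₂) hΩ hB
  have hcut := hu.cutoff hΩ.measurableSet hξ
  have hucont : Continuous fun x => ξ x * u x := by
    refine continuous_iff_continuousAt.2 fun x => ?_
    by_cases hx : x ∈ tsupport ξ
    · exact hξ.1.continuous.continuousAt.mul (hc.continuousAt (hΩ.mem_nhds (hξ.2.2 hx)))
    · refine (continuousAt_const (y := (0 : ℝ))).congr ?_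
      filter_upwards [(isClosed_tsupport ξ).isOpen_compl.mem_nhds hx] with y hy
      simp [image_eq_zero_of_notMem_tsupport hy]
  obtain ⟨φ, hφ, hφ1, hφ2, hφ3⟩ := hcut.exists_test_approx hξ.2.1 hΩ hξ.2.2
    (fun x hx => by simp [image_eq_zero_of_notMem_tsupport hx])
  have hunif := hφ3 hucont
  set U : Euc n → ℝ := fun x => ξ x * u x with hU
  set DU : Euc n → Euc n := fun x => ξ x • Du x + u x • gradient ξ x with hDU
  have hUm : MemLp U 2 volume := by simpa using hcut.memLp
  have hDUm : MemLp DU 2 volume := by simpa using hcut.memLp_grad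
  have hUu : ∀ y ∈ closedBall x₀ r₂, U y = u y := fun y hy => by simp [hU, hξ1 y (hKV hy)]
  have hDUu : ∀ y ∈ closedBall x₀ r₂, DU y = Du y := fun y hy => by
    have : gradient ξ y = 0 := by
      have h1 : ξ =ᶠ[𝓝 y] fun _ => (1 : ℝ) := by
        filter_upwards [hV.mem_nhds (hKV hy)] with z hz using hξ1 z hz
      rw [h1.gradient_eq, gradient_fun_const]
    simp [hDU, hξ1 y (hKV hy), this]
  have hUW : MemW12 (ball x₀ r₂) U DU := hcut.mono (subset_univ _)
  have hr₂ : 0 < r₂ := h₁.trans_le h₁₂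
  have hmem : ∀ ρ ∈ Icc 0 r₂, ∀ η : sphere (0 : Euc n) 1, x₀ + ρ • (η : Euc n) ∈ closedBall x₀ r₂ := by
    intro ρ hρ η
    simp [mem_closedBall, dist_eq_norm, norm_smul, abs_of_nonneg hρ.1, hρ.2]
  have eS : ∀ ρ ∈ Icc 0 r₂, sphereSq u x₀ ρ = sphereSq U x₀ ρ := by
    intro ρ hρ
    unfold sphereSq
    congr 1; ext η
    rw [hUu _ (hmem ρ hρ η)]
  have eT : ∀ ρ ∈ Icc 0 r₂, sphereFlux u Du x₀ ρ = sphereFlux U DU x₀ ρ := by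
    intro ρ hρ
    unfold sphereFlux
    congr 1; ext η
    rw [hUu _ (hmem ρ hρ η), hDUu _ (hmem ρ hρ η)]
  rw [eS r₂ ⟨hr₂.le, le_rfl⟩, eS r₁ ⟨h₁.le, h₁₂⟩, intervalIntegral.integral_congr
    (g := fun ρ => 2 * sphereFlux U DU x₀ ρ) (fun ρ hρ => by
      rw [uIcc_of_le h₁₂] at hρ
      simp only
      rw [eT ρ ⟨h₁.le.trans hρ.1, hρ.2⟩])]
  -- the interval integral of the flux as an integral over a ball with a radial weight
  set g : ℝ → ℝ := (Ici r₁).indicator fun ρ => 2 * (ρ ^ n)⁻¹ with hg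
  have hgm : Measurable g := (by fun_prop : Measurable fun ρ : ℝ => 2 * (ρ ^ n)⁻¹).indicator
    measurableSet_Ici
  have hgb : ∀ ρ, ‖g ρ‖ ≤ 2 * (r₁ ^ n)⁻¹ := by
    intro ρ
    by_cases h : ρ ∈ Ici r₁
    · have h0 : 0 < ρ := h₁.trans_le h
      have h' : r₁ ≤ ρ := h
      rw [hg, indicator_of_mem h, Real.norm_of_nonneg (by positivity)]
      gcongr
    · rw [hg, indicator_of_notMem h, norm_zero]; positivity
  set m : Euc n → Euc n := fun x => g ‖x - x₀‖ • (x - x₀) with hm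
  have hmm : AEStronglyMeasurable m (volume.restrict (ball x₀ r₂)) := by
    have : Measurable m := (hgm.comp (by fun_prop)).smul (by fun_prop)
    exact this.aestronglyMeasurable
  have hmb : ∀ᵐ x ∂(volume.restrict (ball x₀ r₂)), ‖m x‖ ≤ 2 * (r₁ ^ n)⁻¹ * r₂ := by
    filter_upwards [ae_restrict_mem measurableSet_ball] with y hy
    rw [mem_ball, dist_eq_norm] at hy
    rw [hm, norm_smul]
    exact mul_le_mul (hgb _) hy.le (norm_nonneg _) (by positivity)
  have hmtop : MemLp m ⊤ (volume.restrict (ball x₀ r₂)) := MemLp.of_bound hmm _ hmb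
  have hflux : ∀ (f : Euc n → ℝ) (Df : Euc n → Euc n), MemW12 (ball x₀ r₂) f Df →
      ∫ ρ in r₁..r₂, 2 * sphereFlux f Df x₀ ρ = ∫ x in ball x₀ r₂, inner ℝ (Df x) (f x • m x) := by
    intro f Df hf
    have hi : IntegrableOn (fun x => inner ℝ (Df x) (f x • m x)) (ball x₀ r₂) :=
      integrable_inner hf.memLp_grad (hmtop.smul hf.memLp (p := 2) (q := ⊤))
    obtain ⟨-, hp, hpe⟩ := polar_ball hn hi
    rw [hpe r₂ ⟨hr₂.le, le_rfl⟩]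
    have hsp : ∀ ρ ∈ Ioi (0 : ℝ), sphereIntegral x₀ ρ (fun x => inner ℝ (Df x) (f x • m x))
        = (Ici r₁).indicator (fun ρ => 2 * sphereFlux f Df x₀ ρ) ρ := by
      intro ρ hρ
      have hρ0 : 0 < ρ := hρ
      have : (fun x => inner ℝ (Df x) (f x • m x))
          = fun x => g ‖x - x₀‖ * (f x * inner ℝ (Df x) (x - x₀)) := by
        ext x; rw [hm, inner_smul_right, inner_smul_right]; ring
      rw [this, sphereIntegral_radial_mul x₀ hρ0.le, sphereIntegral_mul_inner hn]
      by_cases h : ρ ∈ Ici r₁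
      · rw [hg, indicator_of_mem h, indicator_of_mem h]
        field_simp
      · rw [hg, indicator_of_notMem h, indicator_of_notMem h, zero_mul]
    rw [intervalIntegral.integral_of_le hr₂.le, intervalIntegral.integral_of_le h₁₂,
      setIntegral_congr_fun measurableSet_Ioc (fun ρ hρ => hsp ρ hρ.1),
      setIntegral_indicator measurableSet_Ici]
    have : Ioc 0 r₂ ∩ Ici r₁ = Icc r₁ r₂ := by
      ext ρ
      simp only [mem_inter_iff, mem_Ioc, mem_Ici, mem_Icc]
      constructor
      · rintro ⟨⟨_, h⟩, h'⟩; exact ⟨h', h⟩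
      · rintro ⟨h', h⟩; exact ⟨⟨h₁.trans_le h', h⟩, h'⟩
    rw [this, integral_Icc_eq_integral_Ioc]
  rw [hflux U DU hUW]
  have hj : ∀ j, sphereSq (φ j) x₀ r₂ - sphereSq (φ j) x₀ r₁
      = ∫ x in ball x₀ r₂, inner ℝ (gradient (φ j) x) (φ j x • m x) := by
    intro j
    rw [← hflux (φ j) (gradient (φ j)) (memW12_of_test (hφ j))]
    refine (intervalIntegral.integral_eq_sub_of_hasDerivAt (fun ρ _ =>
      hasDerivAt_sphereSq (hφ j) x₀ ρ) ?_).symm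
    exact (continuous_const.mul (continuous_sphereFlux (hφ j) x₀)).intervalIntegrable _ _
  have hle : ∀ {G : Type} [NormedAddCommGroup G] {f : ℕ → Euc n → G},
      Tendsto (fun j => eLpNorm (f j) 2 volume) atTop (𝓝 0) →
      Tendsto (fun j => eLpNorm (f j) 2 (volume.restrict (ball x₀ r₂))) atTop (𝓝 0) := fun hf =>
    tendsto_of_tendsto_of_tendsto_of_le_of_le tendsto_const_nhds hf (fun _ => zero_le)
      fun j => eLpNorm_mono_measure _ Measure.restrict_le_self
  have hlimR := tendsto_integral_inner (l := atTop)
    (fun j => (hφ j).memLp_gradient.restrict (ball x₀ r₂)) (hDUm.restrict _)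
    (fun j => hmtop.smul ((hφ j).memLp.restrict (ball x₀ r₂)) (p := 2) (q := ⊤))
    (hmtop.smul (hUm.restrict (ball x₀ r₂)) (p := 2) (q := ⊤)) (hle hφ2)
    (tendsto_eLpNorm_smul_bounded hmb (hle hφ1))
  have hlimS : ∀ ρ, Tendsto (fun j => sphereSq (φ j) x₀ ρ) atTop (𝓝 (sphereSq U x₀ ρ)) := by
    intro ρ
    have hUs : HasCompactSupport U := hξ.2.1.mul_right
    obtain ⟨C, hC⟩ := hUs.exists_bound_of_continuous hucont
    refine tendsto_integral_filter_of_dominated_convergence (fun _ => (C + 1) ^ 2) ?_ ?_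
      (integrable_const _) ?_
    · refine Eventually.of_forall fun j => Continuous.aestronglyMeasurable ?_
      exact ((hφ j).1.continuous.comp (by fun_prop)).pow 2
    · filter_upwards [Metric.tendstoUniformly_iff.1 hunif 1 one_pos] with j hj
      refine Eventually.of_forall fun η => ?_
      rw [norm_pow]
      gcongr
      have h1 := hj (x₀ + ρ • (η : Euc n))
      have h2 := hC (x₀ + ρ • (η : Euc n))
      rw [dist_comm, dist_eq_norm] at h1
      have := norm_sub_norm_le (φ j (x₀ + ρ • (η : Euc n))) (U (x₀ + ρ • (η : Euc n)))
      linarith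
    · exact Eventually.of_forall fun η => (hunif.tendsto_at _).pow 2
  have hlimL := (hlimS r₂).sub (hlimS r₁)
  simp only [hj] at hlimL
  exact tendsto_nhds_unique hlimL hlimR

/-- Integration by parts in the radius against the cut-off profiles of `exists_radial_profile`. -/
theorem integral_profile_mul {G h d : ℝ → ℝ} {R : ℝ} (hG : ContDiff ℝ ∞ G) (hR : 0 ≤ R)
    (hGR : G (R ^ 2) = 0) (hGd : ∀ ρ, 0 ≤ ρ → 2 * ρ * deriv G (ρ ^ 2) = - h ρ)
    (hd : IntervalIntegrable d volume 0 R) :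
    ∫ ρ in (0 : ℝ)..R, G (ρ ^ 2) * d ρ = ∫ ρ in (0 : ℝ)..R, h ρ * ∫ τ in (0 : ℝ)..ρ, d τ := by
  set DD : ℝ → ℝ := fun ρ => ∫ τ in (0 : ℝ)..ρ, d τ with hDD
  have hDDac : AbsolutelyContinuousOnInterval DD 0 R :=
    hd.absolutelyContinuousOnInterval_intervalIntegral (by simp)
  have hGder : ∀ ρ : ℝ, HasDerivAt (fun ρ : ℝ => G (ρ ^ 2)) (2 * ρ * deriv G (ρ ^ 2)) ρ := by
    intro ρ
    have := ((hG.differentiable (by simp) (ρ ^ 2)).hasDerivAt).comp ρ (hasDerivAt_pow 2 ρ)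
    refine this.congr_deriv ?_
    push_cast; ring
  have hGac : AbsolutelyContinuousOnInterval (fun ρ : ℝ => G (ρ ^ 2)) 0 R :=
    ContDiffOn.absolutelyContinuousOnInterval
      ((hG.comp (contDiff_id.pow 2)).of_le (by exact_mod_cast le_top)).contDiffOn
  have hparts := hGac.integral_mul_deriv_eq_deriv_mul hDDac
  have hDD' : ∫ ρ in (0 : ℝ)..R, G (ρ ^ 2) * d ρ = ∫ ρ in (0 : ℝ)..R, G (ρ ^ 2) * deriv DD ρ := by
    refine intervalIntegral.integral_congr_ae ?_
    filter_upwards [hd.ae_hasDerivAt_integral] with ρ hρ hρR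
    rw [(hρ (uIoc_subset_uIcc hρR) 0 (by simp)).deriv]
  have hDD0 : DD 0 = 0 := by simp [hDD]
  rw [← hDD', hGR, hDD0] at hparts
  rw [hparts, zero_mul, mul_zero, sub_zero, zero_sub, ← intervalIntegral.integral_neg]
  refine intervalIntegral.integral_congr fun ρ hρ => ?_
  rw [uIcc_of_le hR] at hρ
  rw [(hGder ρ).deriv, hGd ρ hρ.1]; ring

/-- Testing with `u` times a radial cut-off: `∫_{B_r} |∇u|² = ∫_{∂B_r} u ∂_η u` for almost every
radius, although `u` is harmonic only where it does not vanish. -/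
theorem MinimizesOnBalls.ae_dirichlet_eq {ε₀ : ℝ} (hmin : MinimizesOnBalls Q Ω u Du ε₀)
    (hε : 0 < ε₀) (hn : 0 < n) (hQ : Continuous Q) (hu : MemW12 Ω u Du) {x₀ : Euc n} {R : ℝ}
    (hR : 0 < R) (hB : ball x₀ R ⊆ Ω) :
    ∀ᵐ ρ : ℝ, ρ ∈ Ioo 0 R →
      ∫ x in ball x₀ ρ, ‖Du x‖ ^ 2 = ρ ^ (n - 1) * sphereFlux u Du x₀ ρ := by
  have huB := hu.mono hB
  have hDi : IntegrableOn (fun x => ‖Du x‖ ^ 2) (ball x₀ R) := integrable_norm_sq huB.memLp_grad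
  obtain ⟨-, hd, hdD⟩ := polar_ball hn hDi
  obtain ⟨-, hb, -⟩ := polar_ball hn (integrableOn_mul_inner huB)
  simp only [sphereIntegral_mul_inner hn] at hb
  set d : ℝ → ℝ := fun ρ => sphereIntegral x₀ ρ fun x => ‖Du x‖ ^ 2 with hdef
  have hdI : IntervalIntegrable d volume 0 R :=
    (intervalIntegrable_iff_integrableOn_Ioo_of_le hR.le).2 hd
  set DD : ℝ → ℝ := fun ρ => ∫ τ in (0 : ℝ)..ρ, d τ with hDD
  have hDDac : AbsolutelyContinuousOnInterval DD 0 R :=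
    hdI.absolutelyContinuousOnInterval_intervalIntegral (by simp)
  set f : ℝ → ℝ := fun ρ => DD ρ - ρ ^ (n - 1) * sphereFlux u Du x₀ ρ with hf
  have hfl : LocallyIntegrableOn f (Ioo 0 R) := by
    rw [locallyIntegrableOn_iff isOpen_Ioo.isLocallyClosed]
    intro K hK hKc
    refine Integrable.sub ?_ ?_
    · refine (hDDac.continuousOn.mono ?_).integrableOn_compact hKc
      rw [uIcc_of_le hR.le]
      exact hK.trans Ioo_subset_Icc_self
    · have h1 : IntegrableOn (fun ρ : ℝ => ρ ^ n * sphereFlux u Du x₀ ρ) K := hb.mono_set hK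
      have h2 : IntegrableOn (fun ρ : ℝ => ρ⁻¹ * (ρ ^ n * sphereFlux u Du x₀ ρ)) K := by
        refine h1.continuousOn_mul (continuousOn_id.inv₀ fun ρ hρ => ?_) hKc
        exact (hK hρ).1.ne'
      refine h2.congr_fun (fun ρ hρ => ?_) hKc.measurableSet
      have : 0 < ρ := (hK hρ).1
      have e : ρ ^ n = ρ ^ (n - 1) * ρ := by rw [← pow_succ, Nat.sub_add_cancel hn]
      simp only [e]
      field_simp
  have hzero : ∀ h : ℝ → ℝ, ContDiff ℝ ∞ h → HasCompactSupport h → tsupport h ⊆ Ioo 0 R →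
      ∫ ρ, h ρ • f ρ = 0 := by
    intro h hh hhc hhs
    obtain ⟨a, b, ha, hab, hbR, hsupp⟩ : ∃ a b : ℝ, 0 < a ∧ a ≤ b ∧ b < R ∧
        ∀ ρ, ρ ∉ Icc a b → h ρ = 0 := by
      rcases (tsupport h).eq_empty_or_nonempty with he | hne
      · exact ⟨R / 2, R / 2, by positivity, le_rfl, by linarith, fun ρ _ =>
          image_eq_zero_of_notMem_tsupport (by simp [he])⟩
      · have hcpt : IsCompact (tsupport h) := hhc
        refine ⟨sInf (tsupport h), sSup (tsupport h), (hhs (hcpt.sInf_mem hne)).1,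
          csInf_le_csSup hne hcpt.bddBelow hcpt.bddAbove,
          (hhs (hcpt.sSup_mem hne)).2, fun ρ hρ => ?_⟩
        refine image_eq_zero_of_notMem_tsupport fun hmem => hρ ?_
        exact ⟨csInf_le hcpt.bddBelow hmem, le_csSup hcpt.bddAbove hmem⟩
    obtain ⟨G, hG, hG0, hGd, -⟩ := exists_radial_profile hh ha hab hsupp
    have hb0 : 0 < b := ha.trans_le hab
    have hζ := isTestFunction_radial hG hb0.le hbR hG0 x₀
    set ζ : Euc n → ℝ := fun y => G (‖y - x₀‖ ^ 2) with hζdef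
    have hζg : ∀ y, gradient ζ y = (2 * deriv G (‖y - x₀‖ ^ 2)) • (y - x₀) := fun y =>
      (hasGradientAt_radial hG x₀ y).gradient
    obtain ⟨Z, hZ⟩ := hζ.2.1.exists_bound_of_continuous hζ.1.continuous
    have hfv := hmin.first_variation hε hQ hu hR hB (huB.test_mul isOpen_ball hζ) (by
      have hZ0 : 0 ≤ Z := (norm_nonneg _).trans (hZ 0)
      filter_upwards [Metric.ball_mem_nhds (0 : ℝ) (show 0 < (Z + 1)⁻¹ by positivity)]
        with t ht y _
      rw [mem_ball_zero_iff, Real.norm_eq_abs] at ht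
      have h1 : |t * ζ y| < 1 := by
        rw [abs_mul]
        calc |t| * |ζ y| ≤ |t| * Z := by gcongr; exact hZ y
          _ ≤ (Z + 1)⁻¹ * Z := by gcongr
          _ < 1 := by
            rw [inv_mul_lt_iff₀ (by positivity)]; linarith
      rw [abs_lt] at h1
      have h2 : u y + t * (ζ y * u y) = (1 + t * ζ y) * u y := by ring
      rw [h2]
      exact mul_pos_iff_of_pos_left (by linarith))
    have i1 : IntegrableOn (fun y => ζ y * ‖Du y‖ ^ 2) (ball x₀ R) :=
      hDi.bdd_mul (hζ.1.continuous.aestronglyMeasurable) (Eventually.of_forall hZ)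
    have i2 : IntegrableOn (fun y => (2 * deriv G (‖y - x₀‖ ^ 2)) * (u y * inner ℝ (Du y) (y - x₀)))
        (ball x₀ R) := by
      have := integrable_inner huB.memLp_grad
        (hζ.memLp_gradient.restrict _ |>.smul huB.memLp (p := 2) (q := ⊤))
      refine this.congr (Eventually.of_forall fun y => ?_)
      simp only [Pi.smul_apply', inner_smul_right, hζg]
      ring
    have e1 : ∫ y in ball x₀ R, inner ℝ (Du y) (ζ y • Du y + u y • gradient ζ y)
        = (∫ y in ball x₀ R, ζ y * ‖Du y‖ ^ 2)
          + ∫ y in ball x₀ R, (2 * deriv G (‖y - x₀‖ ^ 2)) * (u y * inner ℝ (Du y) (y - x₀)) := by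
      rw [← integral_add i1 i2]
      refine integral_congr_ae (Eventually.of_forall fun y => ?_)
      simp only [inner_add_right, inner_smul_right, hζg, real_inner_self_eq_norm_sq]
      ring
    rw [e1] at hfv
    -- pass to polar coordinates
    have p1 : ∫ y in ball x₀ R, ζ y * ‖Du y‖ ^ 2 = ∫ ρ in (0 : ℝ)..R, G (ρ ^ 2) * d ρ := by
      rw [(polar_ball hn i1).2.2 R ⟨hR.le, le_rfl⟩]
      refine intervalIntegral.integral_congr fun ρ hρ => ?_
      rw [uIcc_of_le hR.le] at hρ
      exact sphereIntegral_radial_mul x₀ hρ.1 (fun ρ => G (ρ ^ 2)) _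
    have p2 : ∫ y in ball x₀ R, (2 * deriv G (‖y - x₀‖ ^ 2)) * (u y * inner ℝ (Du y) (y - x₀))
        = ∫ ρ in (0 : ℝ)..R, - h ρ * (ρ ^ (n - 1) * sphereFlux u Du x₀ ρ) := by
      rw [(polar_ball hn i2).2.2 R ⟨hR.le, le_rfl⟩]
      refine intervalIntegral.integral_congr fun ρ hρ => ?_
      rw [uIcc_of_le hR.le] at hρ
      rw [sphereIntegral_radial_mul x₀ hρ.1 (fun ρ => 2 * deriv G (ρ ^ 2)),
        sphereIntegral_mul_inner hn, ← hGd ρ hρ.1]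
      have e : ρ ^ n = ρ ^ (n - 1) * ρ := by rw [← pow_succ, Nat.sub_add_cancel hn]
      rw [e]; ring
    have hGR : G (R ^ 2) = 0 := hG0 _ (by gcongr)
    rw [p1, p2, integral_profile_mul hG hR.le hGR hGd hdI] at hfv
    have hiA : IntervalIntegrable (fun ρ => h ρ * DD ρ) volume 0 R :=
      ContinuousOn.intervalIntegrable (hh.continuous.continuousOn.mul hDDac.continuousOn)
    have hiB : IntervalIntegrable (fun ρ => - h ρ * (ρ ^ (n - 1) * sphereFlux u Du x₀ ρ))
        volume 0 R := by
      have := (polar_ball hn i2).2.1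
      rw [intervalIntegrable_iff_integrableOn_Ioo_of_le hR.le]
      refine this.congr_fun (fun ρ hρ => ?_) measurableSet_Ioo
      simp only
      rw [sphereIntegral_radial_mul x₀ hρ.1.le (fun ρ => 2 * deriv G (ρ ^ 2)),
        sphereIntegral_mul_inner hn, ← hGd ρ hρ.1.le]
      have e : ρ ^ n = ρ ^ (n - 1) * ρ := by rw [← pow_succ, Nat.sub_add_cancel hn]
      rw [e]; ring
    rw [← intervalIntegral.integral_add hiA hiB] at hfv
    rw [intervalIntegral.integral_of_le hR.le] at hfv
    rw [← hfv, ← setIntegral_eq_integral_of_forall_compl_eq_zero (s := Ioc 0 R)]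
    · refine setIntegral_congr_fun measurableSet_Ioc fun ρ _ => ?_
      simp only [hf, smul_eq_mul]; ring
    · intro ρ hρ
      rw [hsupp ρ fun hmem => hρ ⟨ha.trans_le hmem.1, hmem.2.trans hbR.le⟩, zero_smul]
  filter_upwards [isOpen_Ioo.ae_eq_zero_of_integral_contDiff_smul_eq_zero hfl hzero] with ρ hρ hmem
  have := hρ hmem
  simp only [hf, hDD] at this
  rw [hdD ρ ⟨hmem.1.le, hmem.2.le⟩]
  linarith

/-! ### The geometry of `C^{1,α}` submanifolds -/

theorem isClosed_range_graph {T : Submodule ℝ (Euc n)} {f : T → Tᗮ} (hf : Continuous f)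
    (x : Euc n) : IsClosed (Set.range fun y : T => x + (y : Euc n) + (f y : Euc n)) := by
  have hP : Continuous fun p : Euc n => T.orthogonalProjectionOnto (p - x) :=
    (T.orthogonalProjectionOnto).continuous.comp (by fun_prop)
  have : (Set.range fun y : T => x + (y : Euc n) + (f y : Euc n)) =
      {p | x + (T.orthogonalProjectionOnto (p - x) : Euc n)
        + (f (T.orthogonalProjectionOnto (p - x)) : Euc n) = p} := by
    ext p
    constructor
    · rintro ⟨y, rfl⟩
      have : T.orthogonalProjectionOnto (x + (y : Euc n) + (f y : Euc n) - x) = y := by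
        rw [add_assoc, add_sub_cancel_left, map_add,
          Submodule.orthogonalProjectionOnto_mem_subspace_eq_self,
          Submodule.orthogonalProjectionOnto_apply_of_mem_orthogonal (f y).2, add_zero]
      simp only [mem_ofPred_eq, this]
    · intro h
      exact ⟨_, h⟩
  rw [this]
  exact isClosed_eq ((continuous_const.add (continuous_subtype_val.comp hP)).add
    (continuous_subtype_val.comp (hf.comp hP))) continuous_id

/-- Closedness holds because the radius `1` of the graph representation is the same at all
points. -/
theorem IsC1AlphaSubmanifold.isClosed {k : ℕ} {α M : ℝ} {Γ : Set (Euc n)}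
    (hΓ : IsC1AlphaSubmanifold k α 1 M Γ) : IsClosed Γ := by
  refine isClosed_of_closure_subset fun x hx => ?_
  obtain ⟨y, hy, hxy⟩ := Metric.mem_closure_iff.1 hx 1 one_pos
  obtain ⟨T, f, -, hf, -, hgr, -⟩ := hΓ y hy
  have h1 : x ∈ closure (Γ ∩ ball y 1) := by
    rw [inter_comm]
    exact isOpen_ball.inter_closure ⟨hxy, hx⟩
  have h2 : x ∈ Set.range fun w : T => y + (w : Euc n) + (f w : Euc n) :=
    (closure_minimal (hgr ▸ inter_subset_left) (isClosed_range_graph hf.continuous y)) h1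
  have h3 : x ∈ Γ ∩ ball y 1 := hgr ▸ ⟨h2, hxy⟩
  exact h3.1

section Holder

variable {E F : Type*} [NormedAddCommGroup E] [NormedSpace ℝ E] [NormedAddCommGroup F]
  [NormedSpace ℝ F] {f : E → F} {α M : ℝ}

theorem norm_sub_le_of_holder_fderiv (hα : 0 < α) (hM : 0 ≤ M) (hf : ContDiff ℝ 1 f)
    (h0 : fderiv ℝ f 0 = 0)
    (hH : ∀ y ∈ ball (0 : E) 1, ∀ z ∈ ball (0 : E) 1,
      ‖fderiv ℝ f y - fderiv ℝ f z‖ ≤ M * ‖y - z‖ ^ α)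
    {ρ : ℝ} {y z : E} (hy1 : ‖y‖ < 1) (hz1 : ‖z‖ < 1) (hy : ‖y‖ ≤ ρ) (hz : ‖z‖ ≤ ρ) :
    ‖f y - f z‖ ≤ M * ρ ^ α * ‖y - z‖ := by
  have hconv : Convex ℝ (ball (0 : E) 1 ∩ closedBall 0 ρ) :=
    (convex_ball _ _).inter (convex_closedBall _ _)
  refine hconv.norm_image_sub_le_of_norm_fderiv_le (𝕜 := ℝ)
    (fun x _ => hf.differentiable (by simp) x) (fun x hx => ?_) ⟨by simpa, by simpa⟩
    ⟨by simpa, by simpa⟩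
  have := hH x hx.1 0 (by simp)
  rw [h0, sub_zero, sub_zero] at this
  refine this.trans ?_
  have h2 : ‖x‖ ≤ ρ := by simpa using hx.2
  gcongr

theorem norm_le_of_holder_fderiv (hα : 0 < α) (hM : 0 ≤ M) (hf : ContDiff ℝ 1 f)
    (h0 : fderiv ℝ f 0 = 0) (hf0 : f 0 = 0)
    (hH : ∀ y ∈ ball (0 : E) 1, ∀ z ∈ ball (0 : E) 1,
      ‖fderiv ℝ f y - fderiv ℝ f z‖ ≤ M * ‖y - z‖ ^ α)
    {y : E} (hy : ‖y‖ < 1) : ‖f y‖ ≤ M * ‖y‖ ^ α * ‖y‖ := by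
  have := norm_sub_le_of_holder_fderiv hα hM hf h0 hH hy (by simp) le_rfl
    (by simp : ‖(0 : E)‖ ≤ ‖y‖)
  simpa [hf0] using this

end Holder

theorem graph_apply_zero {T : Submodule ℝ (Euc n)} {f : T → Tᗮ} {x : Euc n}
    (hx : x ∈ Set.range fun y : T => x + (y : Euc n) + (f y : Euc n)) : f 0 = 0 := by
  obtain ⟨y, hy⟩ := hx
  have h1 : (y : Euc n) + (f y : Euc n) = 0 := by
    have : x + ((y : Euc n) + (f y : Euc n)) = x := by rw [← add_assoc]; exact hy
    simpa using this
  have h2 : T.orthogonalProjectionOnto ((y : Euc n) + (f y : Euc n)) = y := by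
    rw [map_add, Submodule.orthogonalProjectionOnto_mem_subspace_eq_self,
      Submodule.orthogonalProjectionOnto_apply_of_mem_orthogonal (f y).2, add_zero]
  rw [h1, map_zero] at h2
  rw [← h2] at h1
  simpa using h1

theorem norm_le_norm_add_orthogonal {T : Submodule ℝ (Euc n)} (y : T) (v : Tᗮ) :
    ‖y‖ ≤ ‖(y : Euc n) + (v : Euc n)‖ := by
  have h2 : T.orthogonalProjectionOnto ((y : Euc n) + (v : Euc n)) = y := by
    rw [map_add, Submodule.orthogonalProjectionOnto_mem_subspace_eq_self,
      Submodule.orthogonalProjectionOnto_apply_of_mem_orthogonal v.2, add_zero]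
  conv_lhs => rw [← h2]
  exact Submodule.norm_orthogonalProjectionOnto_apply_le _ _

/-- Dilations about a point `x₀` of `Γ` distort the distance to `Γ` only to order `1 + α`: if `z` is
a point of `Γ`, then the graph of `Γ` over the tangent plane at `z` passes through `x₀`, and
the point of that graph above the dilated foot of `x₀` is close to the dilation of `z`. -/
theorem mul_infDist_dilation_le {k : ℕ} {α M : ℝ} {Γ : Set (Euc n)} (hα : 0 < α) (hM : 0 ≤ M)
    (hΓ : IsC1AlphaSubmanifold k α 1 M Γ) {x₀ y z : Euc n} (hx₀ : x₀ ∈ Γ) (hz : z ∈ Γ)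
    (hzx : dist z x₀ < 1) {l : ℝ} (hl : |l - 1| * (4 * (1 + M)) ≤ 1) :
    l * infDist (x₀ + l⁻¹ • (y - x₀)) Γ
      ≤ dist y z + |l - 1| * (dist z x₀ * min 1 (2 * (M * dist z x₀ ^ α))) := by
  have hl4 : |l - 1| ≤ 1 / 4 := by
    have := abs_nonneg (l - 1)
    nlinarith
  have hl0 : 0 < l := by have := (abs_le.1 hl4).1; linarith
  have hle : ∀ p ∈ Γ, l * infDist (x₀ + l⁻¹ • (y - x₀)) Γ ≤ ‖(y - x₀) + l • (x₀ - p)‖ := by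
    intro p hp
    calc l * infDist (x₀ + l⁻¹ • (y - x₀)) Γ ≤ l * dist (x₀ + l⁻¹ • (y - x₀)) p := by
          gcongr; exact infDist_le_dist_of_mem hp
      _ = ‖l • (x₀ + l⁻¹ • (y - x₀) - p)‖ := by
          rw [dist_eq_norm, norm_smul, Real.norm_of_nonneg hl0.le]
      _ = ‖(y - x₀) + l • (x₀ - p)‖ := by
          congr 1
          rw [smul_sub, smul_add, smul_smul, mul_inv_cancel₀ hl0.ne', one_smul, smul_sub]
          abel
  rw [mul_min_of_nonneg _ _ dist_nonneg, mul_min_of_nonneg _ _ (abs_nonneg _), ← min_add_add_left]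
  refine le_min ?_ ?_
  · refine (hle z hz).trans ?_
    have : y - x₀ + l • (x₀ - z) = (y - z) + (l - 1) • (x₀ - z) := by
      rw [sub_smul, one_smul]; abel
    rw [this]
    refine (norm_add_le _ _).trans ?_
    rw [norm_smul, Real.norm_eq_abs, mul_one, dist_eq_norm, dist_comm, dist_eq_norm]
  · obtain ⟨T, f, -, hf, hf', hgr, hH⟩ := hΓ z hz
    have hf0 : f 0 = 0 := by
      have : z ∈ Γ ∩ ball z 1 := ⟨hz, mem_ball_self one_pos⟩
      rw [hgr] at this
      exact graph_apply_zero this.1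
    obtain ⟨y₀, hy₀⟩ : x₀ ∈ Set.range fun w : T => z + (w : Euc n) + (f w : Euc n) := by
      have : x₀ ∈ Γ ∩ ball z 1 := ⟨hx₀, by rwa [mem_ball, dist_comm]⟩
      rw [hgr] at this
      exact this.1
    have hxz : x₀ - z = (y₀ : Euc n) + (f y₀ : Euc n) := by rw [← hy₀]; simp [add_assoc]
    have hy₀n : ‖y₀‖ ≤ dist z x₀ := by
      rw [dist_comm, dist_eq_norm, hxz]
      exact norm_le_norm_add_orthogonal _ _
    have hy₀1 : ‖y₀‖ < 1 := hy₀n.trans_lt hzx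
    set t : ℝ := 1 - l⁻¹ with ht
    have hlt : l * |t| = |l - 1| := by
      rw [ht, ← abs_of_pos hl0, ← abs_mul, abs_of_pos hl0, mul_sub, mul_one,
        mul_inv_cancel₀ hl0.ne']
    have ht2 : |t| * (2 * (1 + M)) ≤ 1 := by
      have h1 : 3 / 4 ≤ l := by have := (abs_le.1 hl4).1; linarith
      have h2 : 0 ≤ |t| * (1 + M) := by positivity
      have h3 : l * (|t| * (1 + M)) * 4 ≤ 1 := by rw [← mul_assoc, hlt]; linarith
      nlinarith
    have ht1 : |t| ≤ 1 / 2 := by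
      have := abs_nonneg t
      nlinarith
    have htn : ‖t • y₀‖ ≤ |t| * dist z x₀ := by
      rw [norm_smul, Real.norm_eq_abs]; gcongr
    have htn' : ‖t • y₀‖ ≤ |t| := by
      rw [norm_smul, Real.norm_eq_abs]
      exact mul_le_of_le_one_right (abs_nonneg _) hy₀1.le
    have htn1 : ‖t • y₀‖ < 1 := by linarith
    have hfy : ‖f y₀‖ ≤ M * dist z x₀ ^ α * dist z x₀ := by
      refine (norm_le_of_holder_fderiv hα hM hf hf' hf0 hH hy₀1).trans ?_
      gcongr
    have hfty : ‖f (t • y₀)‖ ≤ |t| * (M * dist z x₀ ^ α * dist z x₀) := by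
      refine (norm_le_of_holder_fderiv hα hM hf hf' hf0 hH htn1).trans ?_
      have h1 : ‖t • y₀‖ ^ α ≤ dist z x₀ ^ α := by
        refine Real.rpow_le_rpow (norm_nonneg _) (htn.trans ?_) hα.le
        exact mul_le_of_le_one_left dist_nonneg (by linarith)
      calc M * ‖t • y₀‖ ^ α * ‖t • y₀‖ ≤ M * dist z x₀ ^ α * (|t| * dist z x₀) := by gcongr
        _ = _ := by ring
    have hfty' : ‖f (t • y₀)‖ ≤ |t| * M := by
      refine hfty.trans ?_
      have h1 : dist z x₀ ^ α ≤ 1 := Real.rpow_le_one dist_nonneg hzx.le hα.le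
      have h2 : M * dist z x₀ ^ α * dist z x₀ ≤ M * 1 * 1 := by gcongr
      have := abs_nonneg t
      nlinarith
    have hmem : z + ((t • y₀ : T) : Euc n) + (f (t • y₀) : Euc n) ∈ Γ := by
      have : z + ((t • y₀ : T) : Euc n) + (f (t • y₀) : Euc n) ∈
          (Set.range fun w : T => z + (w : Euc n) + (f w : Euc n)) ∩ ball z 1 := by
        refine ⟨⟨_, rfl⟩, ?_⟩
        rw [mem_ball, dist_eq_norm, add_assoc, add_sub_cancel_left]
        refine (norm_add_le _ _).trans_lt ?_
        rw [← Submodule.coe_norm, ← Submodule.coe_norm]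
        nlinarith
      rw [← hgr] at this
      exact this.1
    refine (hle _ hmem).trans ?_
    have e : y - x₀ + l • (x₀ - (z + ((t • y₀ : T) : Euc n) + (f (t • y₀) : Euc n)))
        = (y - z) + ((l - 1) • (f y₀ : Euc n) - l • (f (t • y₀) : Euc n)) := by
      have e1 : x₀ - (z + ((t • y₀ : T) : Euc n) + (f (t • y₀) : Euc n))
          = (x₀ - z) - t • (y₀ : Euc n) - (f (t • y₀) : Euc n) := by
        rw [Submodule.coe_smul]; abel
      have e2 : y - x₀ = (y - z) - (x₀ - z) := by abel
      have e3 : l * t = l - 1 := by rw [ht, mul_sub, mul_one, mul_inv_cancel₀ hl0.ne']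
      rw [e1, e2, hxz, smul_sub, smul_sub, smul_smul, e3]
      module
    rw [e]
    refine (norm_add_le _ _).trans ?_
    rw [dist_eq_norm y z]
    gcongr
    refine (norm_sub_le _ _).trans ?_
    rw [norm_smul, norm_smul, Real.norm_eq_abs, Real.norm_of_nonneg hl0.le,
      ← Submodule.coe_norm, ← Submodule.coe_norm]
    calc |l - 1| * ‖f y₀‖ + l * ‖f (t • y₀)‖
        ≤ |l - 1| * (M * dist z x₀ ^ α * dist z x₀)
          + l * (|t| * (M * dist z x₀ ^ α * dist z x₀)) := by gcongr
      _ = |l - 1| * (dist z x₀ * (2 * (M * dist z x₀ ^ α))) := by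
          rw [← mul_assoc l, hlt]; ring

/-- If the nearest point of `Γ` is far from `x₀`, contracting `z` towards `x₀` brings it closer to
`y`. -/
theorem mul_infDist_dilation_le_of_far {Γ : Set (Euc n)} {x₀ y z : Euc n} (hz : z ∈ Γ) {b l : ℝ}
    (hy : dist y x₀ ≤ b) (hzx : 1 ≤ dist z x₀) (hl0 : 0 < l) (hl1 : l ≤ 1)
    (hl : 1 - l ≤ 2 * (1 - b)) :
    l * infDist (x₀ + l⁻¹ • (y - x₀)) Γ ≤ dist y z := by
  have hle : l * infDist (x₀ + l⁻¹ • (y - x₀)) Γ ≤ ‖(y - z) + (1 - l) • (z - x₀)‖ := by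
    calc l * infDist (x₀ + l⁻¹ • (y - x₀)) Γ ≤ l * dist (x₀ + l⁻¹ • (y - x₀)) z := by
          gcongr; exact infDist_le_dist_of_mem hz
      _ = ‖l • (x₀ + l⁻¹ • (y - x₀) - z)‖ := by
          rw [dist_eq_norm, norm_smul, Real.norm_of_nonneg hl0.le]
      _ = _ := by
          congr 1
          rw [smul_sub, smul_add, smul_smul, mul_inv_cancel₀ hl0.ne', one_smul, sub_smul,
            one_smul, smul_sub]
          abel
  refine hle.trans ?_
  rw [dist_eq_norm]
  refine (sq_le_sq₀ (norm_nonneg _) (norm_nonneg _)).1 ?_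
  rw [norm_add_sq_real, norm_smul, inner_smul_right, Real.norm_of_nonneg (by linarith)]
  have h1 : inner ℝ (y - z) (z - x₀) ≤ ‖z - x₀‖ * (b - ‖z - x₀‖) := by
    have e : y - z = (y - x₀) - (z - x₀) := by abel
    rw [e, inner_sub_left, real_inner_self_eq_norm_sq]
    have h2 := real_inner_le_norm (y - x₀) (z - x₀)
    rw [dist_eq_norm] at hy
    nlinarith [norm_nonneg (z - x₀)]
  rw [dist_eq_norm] at hzx
  have h3 : (1 - l) * ‖z - x₀‖ ≤ 2 * (‖z - x₀‖ - b) := by nlinarith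
  have h4 : 0 ≤ (1 - l) * ‖z - x₀‖ := by
    have : 0 ≤ 1 - l := by linarith
    positivity
  nlinarith [mul_le_mul_of_nonneg_left h1 (show (0:ℝ) ≤ 1 - l by linarith)]

/-! ### The weight under dilations -/

/-- Near `x₀` the distance to `Γ` is bounded below by a multiple of the height `g` above the graph
in a fixed normal direction `e`. -/
theorem exists_height_le_infDist {k : ℕ} {α M : ℝ} {Γ : Set (Euc n)} (hα : 0 < α) (hM : 0 ≤ M)
    (hk : k < n) (hΓ : IsC1AlphaSubmanifold k α 1 M Γ) {x₀ : Euc n} (hx₀ : x₀ ∈ Γ) :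
    ∃ (e : Euc n) (g : Euc n → ℝ), ‖e‖ = 1 ∧ Continuous g ∧ (∀ p (s : ℝ), g (p + s • e) = g p + s) ∧
      ∀ y z, ∀ b : ℝ, z ∈ Γ → dist y x₀ < 1 → dist z x₀ < 1 → dist y x₀ ≤ b → dist z x₀ ≤ b →
        |g y| ≤ (1 + M * b ^ α) * dist y z := by
  obtain ⟨T, f, hT, hf, hf', hgr, hH⟩ := hΓ x₀ hx₀
  obtain ⟨e, heT, he⟩ : ∃ e ∈ Tᗮ, ‖e‖ = 1 := by
    have : Nontrivial Tᗮ := by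
      rw [← Module.finrank_pos_iff (R := ℝ)]
      have := T.finrank_add_finrank_orthogonal
      rw [finrank_euclideanSpace_fin] at this
      omega
    obtain ⟨e, he⟩ := exists_norm_eq (Tᗮ) zero_le_one
    exact ⟨e, e.2, he⟩
  set P := T.orthogonalProjectionOnto with hP
  refine ⟨e, fun p => inner ℝ (p - x₀ - (f (P (p - x₀)) : Euc n)) e, he, ?_, ?_, ?_⟩
  · have : Continuous fun p : Euc n => f (P (p - x₀)) :=
      hf.continuous.comp (P.continuous.comp (by fun_prop))
    fun_prop
  · intro p s
    have h1 : P (p + s • e - x₀) = P (p - x₀) := by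
      have : p + s • e - x₀ = (p - x₀) + s • e := by abel
      rw [this, map_add, map_smul, hP,
        Submodule.orthogonalProjectionOnto_apply_of_mem_orthogonal heT, smul_zero, add_zero]
    have h2 : p + s • e - x₀ - (f (P (p - x₀)) : Euc n)
        = (p - x₀ - (f (P (p - x₀)) : Euc n)) + s • e := by abel
    simp only [h1]
    rw [h2, inner_add_left, inner_smul_left, real_inner_self_eq_norm_sq, he]
    simp
  · intro y z b hz hy1 hz1 hyb hzb
    obtain ⟨w, hw⟩ : z ∈ Set.range fun w : T => x₀ + (w : Euc n) + (f w : Euc n) := by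
      have : z ∈ Γ ∩ ball x₀ 1 := ⟨hz, hz1⟩
      rw [hgr] at this
      exact this.1
    have hzw : z - x₀ = (w : Euc n) + (f w : Euc n) := by rw [← hw]; simp [add_assoc]
    have hwn : ‖w‖ ≤ dist z x₀ := by
      rw [dist_eq_norm, hzw]; exact norm_le_norm_add_orthogonal _ _
    have hyn : ‖P (y - x₀)‖ ≤ dist y x₀ := by
      rw [dist_eq_norm]; exact Submodule.norm_orthogonalProjectionOnto_apply_le _ _
    have hwP : ‖w - P (y - x₀)‖ ≤ dist y z := by
      have : w - P (y - x₀) = P (z - y) := by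
        have h1 : P (z - x₀) = w := by
          rw [hzw, hP, map_add, Submodule.orthogonalProjectionOnto_mem_subspace_eq_self,
            Submodule.orthogonalProjectionOnto_apply_of_mem_orthogonal (f w).2, add_zero]
        rw [← h1, ← map_sub]; congr 1; abel
      rw [this, dist_comm, dist_eq_norm]
      exact Submodule.norm_orthogonalProjectionOnto_apply_le _ _
    have hfd := norm_sub_le_of_holder_fderiv hα hM hf hf' hH (hwn.trans_lt hz1) (hyn.trans_lt hy1)
      (hwn.trans hzb) (hyn.trans hyb)
    have hb : 0 ≤ b := dist_nonneg.trans hyb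
    have hwe : inner ℝ (w : Euc n) e = 0 := Submodule.inner_right_of_mem_orthogonal w.2 heT
    have e1 : inner ℝ (y - x₀ - (f (P (y - x₀)) : Euc n)) e
        = inner ℝ ((y - z) + ((f w : Euc n) - (f (P (y - x₀)) : Euc n))) e := by
      have : y - x₀ - (f (P (y - x₀)) : Euc n)
          = (w : Euc n) + ((y - z) + ((f w : Euc n) - (f (P (y - x₀)) : Euc n))) := by
        have : y - x₀ = (y - z) + (z - x₀) := by abel
        rw [this, hzw]; abel
      rw [this, inner_add_left, hwe, zero_add]
    refine (congrArg abs e1).trans_le ?_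
    refine (abs_real_inner_le_norm _ _).trans ?_
    rw [he, mul_one]
    refine (norm_add_le _ _).trans ?_
    have h3 : ‖(f w : Euc n) - (f (P (y - x₀)) : Euc n)‖ ≤ M * b ^ α * dist y z := by
      have : ‖(f w : Euc n) - (f (P (y - x₀)) : Euc n)‖ = ‖f w - f (P (y - x₀))‖ := by
        rw [← Submodule.coe_sub, ← Submodule.coe_norm]
      rw [this]
      refine hfd.trans ?_
      gcongr
    rw [← dist_eq_norm]
    linarith

theorem lintegral_Ioo_rpow {p b : ℝ} (hp : -1 < p) (hb : 0 < b) :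
    ∫⁻ t in Ioo 0 b, ‖t‖ₑ ^ p = ENNReal.ofReal (b ^ (p + 1) / (p + 1)) := by
  have h1 : ∫ t in (0 : ℝ)..b, t ^ p = b ^ (p + 1) / (p + 1) := by
    rw [integral_rpow (Or.inl hp), Real.zero_rpow (by linarith), sub_zero]
  rw [← h1, intervalIntegral.integral_of_le hb.le, ← integral_Ioc_eq_integral_Ioo.symm,
    ofReal_integral_eq_lintegral_ofReal]
  · refine setLIntegral_congr_fun measurableSet_Ioo fun t ht => ?_
    rw [← ENNReal.ofReal_rpow_of_pos ht.1, Real.enorm_eq_ofReal ht.1.le]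
  · have := (intervalIntegral.intervalIntegrable_rpow' (a := 0) (b := b) hp).1
    exact this.mono_set Ioo_subset_Ioc_self
  · filter_upwards [ae_restrict_mem measurableSet_Ioo] with t ht
    exact Real.rpow_nonneg ht.1.le _

theorem lintegral_add_rpow_le {p b : ℝ} (hp : -1 < p) (hp0 : p < 0) (hb : 0 < b) (c : ℝ) :
    ∫⁻ s in Ioo 0 b, ‖c + s‖ₑ ^ p ≤ ENNReal.ofReal ((1 + 2 / (p + 1)) * b ^ (p + 1)) := by
  have hsym : ∫⁻ t in Ioo (-b) b, ‖t‖ₑ ^ p ≤ ENNReal.ofReal (2 / (p + 1) * b ^ (p + 1)) := by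
    have h1 : Ioo (-b) b ⊆ (Ioo (-b) 0 ∪ Ioo 0 b) ∪ {0} := by
      intro t ht
      rcases lt_trichotomy t 0 with h | h | h
      · exact Or.inl (Or.inl ⟨ht.1, h⟩)
      · exact Or.inr h
      · exact Or.inl (Or.inr ⟨h, ht.2⟩)
    have h2 : ∫⁻ t in Ioo (-b) 0, ‖t‖ₑ ^ p = ∫⁻ t in Ioo 0 b, ‖t‖ₑ ^ p := by
      have hmp := (Measure.measurePreserving_neg (volume : Measure ℝ)).setLIntegral_comp_preimage
        (s := Ioo 0 b) measurableSet_Ioo (f := fun t : ℝ => ‖t‖ₑ ^ p) (by fun_prop)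
      rw [← hmp]
      simp
    refine (lintegral_mono_set h1).trans ((lintegral_union_le _ _ _).trans ?_)
    rw [Measure.restrict_singleton]
    simp only [Real.volume_singleton, zero_smul, lintegral_zero_measure, add_zero]
    refine (lintegral_union_le _ _ _).trans ?_
    rw [h2, lintegral_Ioo_rpow hp hb, ← ENNReal.ofReal_add (div_nonneg (by positivity) (by linarith)) (div_nonneg (by positivity) (by linarith))]
    refine le_of_eq (congrArg _ ?_)
    ring
  have hle : ∀ s, ‖c + s‖ₑ ^ p ≤ ENNReal.ofReal (b ^ p)
      + (Ioo (-b) b).indicator (fun t : ℝ => ‖t‖ₑ ^ p) (c + s) := by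
    intro s
    by_cases h : c + s ∈ Ioo (-b) b
    · rw [indicator_of_mem h]; exact le_add_self
    · refine le_add_right ?_
      have h1 : b ≤ |c + s| := by
        by_contra hcon
        exact h (abs_lt.1 (not_le.1 hcon))
      rw [← ENNReal.ofReal_rpow_of_pos hb, ← ofReal_norm, Real.norm_eq_abs]
      have h2 := ENNReal.inv_le_inv.2 (ENNReal.rpow_le_rpow (ENNReal.ofReal_le_ofReal h1)
        (show 0 ≤ -p by linarith))
      rwa [← ENNReal.rpow_neg, ← ENNReal.rpow_neg, neg_neg] at h2
  calc ∫⁻ s in Ioo 0 b, ‖c + s‖ₑ ^ p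
      ≤ ∫⁻ s in Ioo 0 b, (ENNReal.ofReal (b ^ p)
        + (Ioo (-b) b).indicator (fun t : ℝ => ‖t‖ₑ ^ p) (c + s)) := lintegral_mono hle
    _ = ENNReal.ofReal (b ^ p) * ENNReal.ofReal b
        + ∫⁻ s in Ioo 0 b, (Ioo (-b) b).indicator (fun t : ℝ => ‖t‖ₑ ^ p) (c + s) := by
        rw [lintegral_add_left measurable_const, setLIntegral_const, Real.volume_Ioo, sub_zero]
    _ ≤ ENNReal.ofReal (b ^ p) * ENNReal.ofReal b
        + ∫⁻ s, (Ioo (-b) b).indicator (fun t : ℝ => ‖t‖ₑ ^ p) (c + s) := by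
        gcongr; exact Measure.restrict_le_self
    _ ≤ ENNReal.ofReal (b ^ (p + 1)) + ENNReal.ofReal (2 / (p + 1) * b ^ (p + 1)) := by
        rw [lintegral_add_left_eq_self (fun s => (Ioo (-b) b).indicator (fun t : ℝ => ‖t‖ₑ ^ p) s) c,
          lintegral_indicator measurableSet_Ioo, ← ENNReal.ofReal_mul (by positivity),
          ← Real.rpow_add_one hb.ne']
        gcongr
    _ = _ := by
        have : 0 < p + 1 := by linarith
        rw [← ENNReal.ofReal_add (by positivity) (by positivity)]
        congr 1; ring

/-- Integrating over the ball first along the direction in which `g` grows with unit speed shows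
that negative powers of `g` of order above `-1` are integrable. -/
theorem lintegral_ball_rpow_le {p b : ℝ} (hp : -1 < p) (hp0 : p < 0) (hb : 0 < b) {e : Euc n}
    (he : ‖e‖ = 1) {g : Euc n → ℝ} (hg : Continuous g)
    (hge : ∀ q (s : ℝ), g (q + s • e) = g q + s) (x₀ : Euc n) :
    ∫⁻ y in ball x₀ b, ‖g y‖ₑ ^ p
      ≤ ENNReal.ofReal ((1 + 2 / (p + 1)) * b ^ p) * volume (ball x₀ (2 * b)) := by
  have hm : Measurable fun y => ‖g y‖ₑ ^ p := by fun_prop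
  have h1 : ∀ s ∈ Ioo 0 b, ∫⁻ y in ball x₀ b, ‖g y‖ₑ ^ p
      ≤ ∫⁻ y in ball x₀ (2 * b), ‖g y + s‖ₑ ^ p := by
    intro s hs
    rw [← lintegral_indicator measurableSet_ball, ← lintegral_indicator measurableSet_ball,
      ← lintegral_add_right_eq_self _ (s • e)]
    refine lintegral_mono fun y => ?_
    by_cases h : y + s • e ∈ ball x₀ b
    · have h2 : y ∈ ball x₀ (2 * b) := by
        rw [mem_ball, dist_eq_norm] at h ⊢
        have : y - x₀ = (y + s • e - x₀) - s • e := by abel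
        rw [this]
        refine (norm_sub_le _ _).trans_lt ?_
        rw [norm_smul, he, mul_one, Real.norm_of_nonneg hs.1.le]
        linarith [hs.2]
      rw [indicator_of_mem h, indicator_of_mem h2, hge]
    · rw [indicator_of_notMem h]; exact zero_le
  have h2 : ENNReal.ofReal b * ∫⁻ y in ball x₀ b, ‖g y‖ₑ ^ p
      ≤ ENNReal.ofReal ((1 + 2 / (p + 1)) * b ^ (p + 1)) * volume (ball x₀ (2 * b)) := by
    calc ENNReal.ofReal b * ∫⁻ y in ball x₀ b, ‖g y‖ₑ ^ p
        = ∫⁻ s in Ioo 0 b, (∫⁻ y in ball x₀ b, ‖g y‖ₑ ^ p) := by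
          rw [setLIntegral_const, Real.volume_Ioo, sub_zero, mul_comm]
      _ ≤ ∫⁻ s in Ioo 0 b, ∫⁻ y in ball x₀ (2 * b), ‖g y + s‖ₑ ^ p :=
          setLIntegral_mono' measurableSet_Ioo h1
      _ = ∫⁻ y in ball x₀ (2 * b), ∫⁻ s in Ioo 0 b, ‖g y + s‖ₑ ^ p := by
          refine lintegral_lintegral_swap ?_
          have : Measurable fun q : ℝ × Euc n => ‖g q.2 + q.1‖ₑ ^ p := by fun_prop
          exact this.aemeasurable
      _ ≤ ∫⁻ y in ball x₀ (2 * b), ENNReal.ofReal ((1 + 2 / (p + 1)) * b ^ (p + 1)) :=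
          lintegral_mono fun y => lintegral_add_rpow_le hp hp0 hb (g y)
      _ = _ := by rw [setLIntegral_const]
  have hb' : ENNReal.ofReal b ≠ 0 := by simpa using hb
  have : (1 + 2 / (p + 1)) * b ^ (p + 1) = b * ((1 + 2 / (p + 1)) * b ^ p) := by
    rw [Real.rpow_add_one hb.ne']; ring
  rw [this, ENNReal.ofReal_mul hb.le, mul_assoc] at h2
  exact (ENNReal.mul_le_mul_iff_right hb' ENNReal.ofReal_ne_top).1 h2

/-- The volumes of the balls of radius `2` are bounded independently of the dimension. -/
theorem exists_volume_ball_two_le :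
    ∃ C : ℝ, 0 < C ∧ ∀ n : ℕ, 0 < n → volume.real (ball (0 : Euc n) 1) * 2 ^ n ≤ C := by
  set c : ℝ := 2 * √Real.pi with hc
  have hc1 : 1 ≤ c := by
    have : 1 ≤ √Real.pi := Real.one_le_sqrt.2 (by linarith [Real.pi_gt_three])
    linarith
  have hfac : ∀ m : ℕ, (m.factorial : ℝ) ≤ 2 * Real.Gamma ((2 * m + 1 : ℕ) / 2 + 1) := by
    intro m
    have e : ∀ m : ℕ, ((2 * m + 1 : ℕ) : ℝ) / 2 + 1 = m + 1 / 2 + 1 := fun m => by push_cast; ring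
    induction m with
    | zero =>
      have : 1 ≤ √Real.pi := Real.one_le_sqrt.2 (by linarith [Real.pi_gt_three])
      rw [e, Real.Gamma_add_one (by simp), Nat.cast_zero, zero_add, Real.Gamma_one_half_eq]
      simp only [Nat.factorial_zero, Nat.cast_one]
      linarith
    | succ m ih =>
      rw [e] at ih ⊢
      have e' : ((m + 1 : ℕ) : ℝ) + 1 / 2 = m + 1 / 2 + 1 := by push_cast; ring
      have hpos : 0 < Real.Gamma (m + 1 / 2 + 1) := Real.Gamma_pos_of_pos (by positivity)
      rw [e', Real.Gamma_add_one (by positivity), Nat.factorial_succ]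
      push_cast
      calc ((m : ℝ) + 1) * m.factorial ≤ (m + 1) * (2 * Real.Gamma (m + 1 / 2 + 1)) := by gcongr
        _ ≤ (m + 1 / 2 + 1) * (2 * Real.Gamma (m + 1 / 2 + 1)) := by gcongr; linarith
        _ = _ := by ring
  have hn : ∀ n : ℕ, 0 < n →
      volume.real (ball (0 : Euc n) 1) * 2 ^ n = c ^ n / Real.Gamma (n / 2 + 1) := by
    intro n hn
    have : Nonempty (Fin n) := Fin.pos_iff_nonempty.1 hn
    have h0 : 0 < Real.Gamma ((n : ℝ) / 2 + 1) := Real.Gamma_pos_of_pos (by positivity)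
    rw [Measure.real, EuclideanSpace.volume_ball]
    simp only [Fintype.card_fin, ENNReal.ofReal_one, one_pow, one_mul]
    rw [ENNReal.toReal_ofReal (by positivity), hc, mul_pow]
    ring
  refine ⟨2 * c * Real.exp (c ^ 2), by positivity, fun n hn0 => ?_⟩
  rw [hn n hn0]
  have key : ∀ m : ℕ, c ^ (2 * m) / m.factorial ≤ Real.exp (c ^ 2) := fun m => by
    rw [pow_mul]; exact Real.pow_div_factorial_le_exp _ (by positivity) m
  obtain ⟨m, rfl | rfl⟩ := n.even_or_odd'
  · have h2 := key m
    have e : ((2 * m : ℕ) : ℝ) / 2 + 1 = m + 1 := by push_cast; ring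
    rw [e, Real.Gamma_nat_eq_factorial]
    refine h2.trans (le_mul_of_one_le_left (Real.exp_pos _).le ?_)
    linarith
  · have h1 : 0 < Real.Gamma ((2 * m + 1 : ℕ) / 2 + 1) := Real.Gamma_pos_of_pos (by positivity)
    have h2 := key m
    rw [div_le_iff₀ (by positivity)] at h2 ⊢
    have := hfac m
    calc c ^ (2 * m + 1) = c ^ (2 * m) * c := pow_succ _ _
      _ ≤ Real.exp (c ^ 2) * m.factorial * c := by gcongr
      _ ≤ Real.exp (c ^ 2) * (2 * Real.Gamma ((2 * m + 1 : ℕ) / 2 + 1)) * c := by gcongr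
      _ = _ := by ring

theorem add_rpow_le_of_one_le {d t p : ℝ} (hd : 0 ≤ d) (ht : 0 ≤ t) (hp : 1 ≤ p) :
    (d + t) ^ p ≤ d ^ p + p * t * (d + t) ^ (p - 1) := by
  rcases (add_nonneg hd ht).eq_or_lt with h | h
  · have h1 : d = 0 := by linarith
    have h2 : t = 0 := by linarith
    simp [h1, h2]
  · have h1 := one_add_mul_self_le_rpow_one_add (s := -(t / (d + t)))
      (by rw [neg_le_neg_iff, div_le_one h]; linarith) hp
    have h2 : 1 + -(t / (d + t)) = d / (d + t) := by field_simp; ring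
    rw [h2, Real.div_rpow hd h.le, le_div_iff₀ (by positivity)] at h1
    have h3 : (d + t) ^ p = (d + t) ^ (p - 1) * (d + t) := by
      rw [← Real.rpow_add_one h.ne', sub_add_cancel]
    have h4 : (1 + p * -(t / (d + t))) * (d + t) ^ p
        = (d + t) ^ p - p * t * (d + t) ^ (p - 1) := by
      rw [h3]; field_simp; ring
    linarith

theorem add_rpow_le_of_le_one {d t p : ℝ} (hd : 0 < d) (ht : 0 ≤ t) (hp0 : 0 ≤ p) (hp : p ≤ 1) :
    (d + t) ^ p ≤ d ^ p + p * t * d ^ (p - 1) := by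
  have h1 := rpow_one_add_le_one_add_mul_self (s := t / d)
    ((by norm_num : (-1 : ℝ) ≤ 0).trans (by positivity)) hp0 hp
  have h2 : d + t = d * (1 + t / d) := by field_simp
  rw [h2, Real.mul_rpow hd.le (by positivity)]
  have h3 : d ^ p = d ^ (p - 1) * d := by rw [← Real.rpow_add_one hd.ne', sub_add_cancel]
  calc d ^ p * (1 + t / d) ^ p ≤ d ^ p * (1 + p * (t / d)) := by gcongr
    _ = d ^ p + p * t * d ^ (p - 1) := by rw [h3]; field_simp

/-- The change of `dist(·, Γ) ^ (2 * γ)`, up to its homogeneity, under dilations about `x₀ ∈ Γ` is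
controlled by a density `κ` of mass `O(M b ^ (n + 2 * γ + α))` on `B_b(x₀)`, with a constant which
depends neither on the dimension nor on `Γ`. Only an upper bound holds up to radius `1`, and only
for contractions; up to radius `1 / 2` it holds for expansions too. -/
theorem exists_dilation_density {γ α : ℝ} (hγ : 0 < γ) (hα : 0 < α) :
    ∃ C : ℝ, 0 < C ∧ ∀ (n k : ℕ) (M : ℝ) (Γ : Set (Euc n)) (x₀ : Euc n) (b : ℝ), k < n → 0 ≤ M →
      IsC1AlphaSubmanifold k α 1 M Γ → x₀ ∈ Γ → 0 < b → b < 1 →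
      ∃ κ : Euc n → ℝ, (∀ y, 0 ≤ κ y) ∧ IntegrableOn κ (ball x₀ b) ∧
        ∫ y in ball x₀ b, κ y ≤ C * M * b ^ ((n : ℝ) + 2 * γ + α) ∧
        ∃ τ : ℝ, 0 < τ ∧ ∀ᵐ y ∂(volume.restrict (ball x₀ b)), ∀ l : ℝ, |l - 1| ≤ τ →
          (l ≤ 1 ∨ b ≤ 1 / 2) →
          (l * infDist (x₀ + l⁻¹ • (y - x₀)) Γ) ^ (2 * γ)
            ≤ infDist y Γ ^ (2 * γ) + |l - 1| * κ y := by
  obtain ⟨C₀, hC₀, hC₀'⟩ := exists_volume_ball_two_le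
  refine ⟨8 * γ * 2 ^ α * C₀ * (2 * (1 + 2 / (2 * γ)) + 3 ^ (2 * γ)), by positivity, ?_⟩
  intro n k M Γ x₀ b hk hM hΓ hx₀ hb hb1
  have hn : 0 < n := by omega
  set K : ℝ := M * (2 * b) ^ α with hK
  have hK0 : 0 ≤ K := by positivity
  set E : ℝ := 2 * b * min 1 (2 * K) with hE
  have hE0 : 0 ≤ E := by positivity
  have hEb : E ≤ 2 * b := mul_le_of_le_one_right (by positivity) (min_le_left _ _)
  have hKb : K = M * 2 ^ α * b ^ α := by rw [hK, Real.mul_rpow two_pos.le hb.le]; ring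
  set τ : ℝ := min (4 * (1 + M))⁻¹ (2 * (1 - b)) with hτ
  have hτ0 : 0 < τ := by
    have : 0 < 2 * (1 - b) := by linarith
    positivity
  have hvol : volume.real (ball x₀ (2 * b)) ≤ C₀ * b ^ n := by
    rw [volume_real_ball x₀ (by positivity), mul_pow]
    have := hC₀' n hn
    calc 2 ^ n * b ^ n * volume.real (ball (0 : Euc n) 1)
        = volume.real (ball (0 : Euc n) 1) * 2 ^ n * b ^ n := by ring
      _ ≤ _ := by gcongr
  have hpow : b ^ ((n : ℝ) + 2 * γ + α) = b ^ n * b ^ (2 * γ) * b ^ α := by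
    rw [Real.rpow_add hb, Real.rpow_add hb, Real.rpow_natCast]
  have hb2 : b ^ (2 * γ) = b ^ (2 * γ - 1) * b := by
    rw [← Real.rpow_add_one hb.ne', sub_add_cancel]
  -- either the nearest point `z` is within the graph's range, or contracting cannot increase the
  -- distance; expansions keep `z` in range because then `b ≤ 1 / 2`
  have hcomp : ∀ y ∈ ball x₀ b, infDist y Γ ≤ b ∧ ∃ z ∈ Γ, infDist y Γ = dist y z ∧
      dist z x₀ ≤ 2 * b ∧
      ∀ l : ℝ, |l - 1| ≤ τ → (l ≤ 1 ∨ b ≤ 1 / 2) → 0 < l ∧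
        (l * infDist (x₀ + l⁻¹ • (y - x₀)) Γ ≤ infDist y Γ ∨
          (dist z x₀ < 1 ∧
            l * infDist (x₀ + l⁻¹ • (y - x₀)) Γ ≤ infDist y Γ + |l - 1| * E)) := by
    intro y hy
    have hyb : infDist y Γ < b := (infDist_le_dist_of_mem hx₀).trans_lt hy
    obtain ⟨z, hz, hyz⟩ := hΓ.isClosed.exists_infDist_eq_dist ⟨x₀, hx₀⟩ y
    have hzb : dist z x₀ < 2 * b := by
      have := dist_triangle_left z x₀ y
      rw [mem_ball] at hy
      linarith
    refine ⟨hyb.le, z, hz, hyz, hzb.le, fun l hl hlb => ?_⟩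
    have hl1 : |l - 1| * (4 * (1 + M)) ≤ 1 := by
      rw [← le_div_iff₀ (by positivity), one_div]; exact hl.trans (min_le_left _ _)
    have hl2 : |l - 1| ≤ 2 * (1 - b) := hl.trans (min_le_right _ _)
    have hl0 : 0 < l := by
      have h4 : |l - 1| ≤ 1 / 4 := by
        have := abs_nonneg (l - 1)
        nlinarith
      linarith [(abs_le.1 h4).1]
    refine ⟨hl0, ?_⟩
    rcases lt_or_ge (dist z x₀) 1 with hz1 | hz1
    · refine Or.inr ⟨hz1, ?_⟩
      rw [hyz]
      refine (mul_infDist_dilation_le hα hM hΓ hx₀ hz hz1 hl1).trans ?_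
      rw [hE, hK]
      gcongr
    · refine Or.inl ?_
      rw [hyz]
      have hl1' : l ≤ 1 := by
        rcases hlb with h | h
        · exact h
        · linarith
      refine mul_infDist_dilation_le_of_far hz (le_of_lt hy) hz1 hl0 hl1' ?_
      linarith [neg_abs_le (l - 1)]
  have hτ1 : τ ≤ 1 := by
    refine (min_le_left _ _).trans (inv_le_one_of_one_le₀ ?_)
    linarith
  rcases le_or_gt 1 (2 * γ) with hγ1 | hγ1
  · -- the weight is Lipschitz
    set c : ℝ := 2 * γ * E * (3 * b) ^ (2 * γ - 1) with hc
    have hc0 : 0 ≤ c := by positivity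
    refine ⟨fun _ => c, fun _ => hc0, integrableOn_const measure_ball_lt_top.ne, ?_, τ, hτ0, ?_⟩
    · rw [setIntegral_const, smul_eq_mul]
      have h1 : volume.real (ball x₀ b) ≤ C₀ * b ^ n :=
        (measureReal_mono (ball_subset_ball (by linarith)) measure_ball_lt_top.ne).trans hvol
      have h2 : E ≤ 2 * b * (2 * K) := by
        rw [hE]; gcongr; exact min_le_right _ _
      have h3 : (3 * b) ^ (2 * γ - 1) ≤ 3 ^ (2 * γ) * b ^ (2 * γ - 1) := by
        rw [Real.mul_rpow (by norm_num) hb.le]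
        gcongr
        · norm_num
        · linarith
      calc volume.real (ball x₀ b) * c
          ≤ (C₀ * b ^ n) * (2 * γ * (2 * b * (2 * K)) * (3 ^ (2 * γ) * b ^ (2 * γ - 1))) := by
            rw [hc]; gcongr
        _ = 8 * γ * 2 ^ α * C₀ * (3 ^ (2 * γ)) * M * b ^ ((n : ℝ) + 2 * γ + α) := by
            rw [hpow, hb2, hKb]; ring
        _ ≤ _ := by
            gcongr
            have : 0 ≤ 2 * (1 + 2 / (2 * γ)) := by positivity
            linarith
    · filter_upwards [ae_restrict_mem measurableSet_ball] with y hy l hl hlb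
      obtain ⟨hdb, z, hz, hyz, hzb, hcl⟩ := hcomp y hy
      obtain ⟨hl0, hcl⟩ := hcl l hl hlb
      have hd0 : 0 ≤ infDist y Γ := infDist_nonneg
      have hle : l * infDist (x₀ + l⁻¹ • (y - x₀)) Γ ≤ infDist y Γ + |l - 1| * E := by
        rcases hcl with h | h
        · exact h.trans (le_add_of_nonneg_right (by positivity))
        · exact h.2
      have hnn : 0 ≤ l * infDist (x₀ + l⁻¹ • (y - x₀)) Γ := mul_nonneg hl0.le infDist_nonneg
      calc (l * infDist (x₀ + l⁻¹ • (y - x₀)) Γ) ^ (2 * γ)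
          ≤ (infDist y Γ + |l - 1| * E) ^ (2 * γ) := by gcongr
        _ ≤ infDist y Γ ^ (2 * γ)
            + 2 * γ * (|l - 1| * E) * (infDist y Γ + |l - 1| * E) ^ (2 * γ - 1) :=
            add_rpow_le_of_one_le hd0 (by positivity) hγ1
        _ ≤ infDist y Γ ^ (2 * γ) + 2 * γ * (|l - 1| * E) * (3 * b) ^ (2 * γ - 1) := by
            have h1 : |l - 1| * E ≤ 1 * (2 * b) := by
              gcongr
              exact hl.trans hτ1
            have h2 : infDist y Γ + |l - 1| * E ≤ 3 * b := by linarith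
            have h3 : 0 ≤ 2 * γ - 1 := by linarith
            gcongr
        _ = _ := by rw [hc]; ring
  · -- the weight has an integrable singularity in its derivative
    obtain ⟨e, g, he, hg, hge, hgd⟩ := exists_height_le_infDist hα hM hk hΓ hx₀
    have hint := lintegral_ball_rpow_le (p := 2 * γ - 1) (by linarith) (by linarith) hb he hg hge x₀
    rw [sub_add_cancel] at hint
    set A : ℝ := 2 * γ * E * (1 + K) ^ (1 - 2 * γ) with hA
    have hA0 : 0 ≤ A := by positivity
    have hfin : ∫⁻ y in ball x₀ b, ‖g y‖ₑ ^ (2 * γ - 1) ≠ ⊤ :=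
      (hint.trans_lt (ENNReal.mul_lt_top ENNReal.ofReal_lt_top measure_ball_lt_top)).ne
    have hgm : Measurable fun y => ‖g y‖ₑ ^ (2 * γ - 1) := by fun_prop
    have hne : ∀ᵐ y ∂(volume.restrict (ball x₀ b)), g y ≠ 0 := by
      filter_upwards [ae_lt_top hgm hfin] with y hy h0
      rw [h0, enorm_zero, ENNReal.zero_rpow_of_neg (by linarith)] at hy
      exact lt_irrefl _ hy
    have hreal : ∀ᵐ y ∂(volume.restrict (ball x₀ b)),
        (‖g y‖ₑ ^ (2 * γ - 1)).toReal = |g y| ^ (2 * γ - 1) := by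
      refine Eventually.of_forall fun y => ?_
      rw [← ENNReal.toReal_rpow, toReal_enorm, Real.norm_eq_abs]
    have hgint : IntegrableOn (fun y => |g y| ^ (2 * γ - 1)) (ball x₀ b) :=
      (integrable_toReal_of_lintegral_ne_top hgm.aemeasurable hfin).congr hreal
    have hgval : ∫ y in ball x₀ b, |g y| ^ (2 * γ - 1)
        ≤ (1 + 2 / (2 * γ)) * b ^ (2 * γ - 1) * (C₀ * b ^ n) := by
      rw [← integral_congr_ae hreal, integral_toReal hgm.aemeasurable (ae_lt_top hgm hfin)]
      refine (ENNReal.toReal_mono (ENNReal.mul_ne_top ENNReal.ofReal_ne_top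
        measure_ball_lt_top.ne) hint).trans ?_
      rw [ENNReal.toReal_mul, ENNReal.toReal_ofReal (by positivity)]
      gcongr
      exact hvol
    refine ⟨fun y => A * |g y| ^ (2 * γ - 1), fun y => by positivity, hgint.const_mul A, ?_,
      τ, hτ0, ?_⟩
    · rw [integral_const_mul]
      have h1 : min 1 (2 * K) * (1 + K) ≤ 4 * K := by
        rcases le_total K 1 with h | h
        · calc min 1 (2 * K) * (1 + K) ≤ (2 * K) * (1 + 1) := by
                gcongr; exact min_le_right _ _
            _ = 4 * K := by ring
        · calc min 1 (2 * K) * (1 + K) ≤ 1 * (1 + K) := by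
                gcongr; exact min_le_left _ _
            _ ≤ 4 * K := by linarith
      have h2 : (1 + K) ^ (1 - 2 * γ) ≤ 1 + K := by
        conv_rhs => rw [← Real.rpow_one (1 + K)]
        exact Real.rpow_le_rpow_of_exponent_le (by linarith) (by linarith)
      have h3 : A ≤ 2 * γ * (2 * b * (4 * K)) := by
        calc A ≤ 2 * γ * E * (1 + K) := by rw [hA]; gcongr
          _ = 2 * γ * (2 * b * (min 1 (2 * K) * (1 + K))) := by rw [hE]; ring
          _ ≤ _ := by gcongr
      calc A * ∫ y in ball x₀ b, |g y| ^ (2 * γ - 1)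
          ≤ 2 * γ * (2 * b * (4 * K)) * ((1 + 2 / (2 * γ)) * b ^ (2 * γ - 1) * (C₀ * b ^ n)) := by
            refine mul_le_mul h3 hgval (integral_nonneg fun y => by positivity) (by positivity)
        _ = 8 * γ * 2 ^ α * C₀ * (2 * (1 + 2 / (2 * γ))) * M * b ^ ((n : ℝ) + 2 * γ + α) := by
            rw [hpow, hb2, hKb]; ring
        _ ≤ _ := by
            gcongr
            have : (0 : ℝ) ≤ 3 ^ (2 * γ) := by positivity
            linarith
    · filter_upwards [ae_restrict_mem measurableSet_ball, hne] with y hy hgy l hl hlb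
      obtain ⟨hdb, z, hz, hyz, hzb, hcl⟩ := hcomp y hy
      obtain ⟨hl0, hcl⟩ := hcl l hl hlb
      have hnn : 0 ≤ l * infDist (x₀ + l⁻¹ • (y - x₀)) Γ := mul_nonneg hl0.le infDist_nonneg
      rcases hcl with h | ⟨hz1, h⟩
      · have : (l * infDist (x₀ + l⁻¹ • (y - x₀)) Γ) ^ (2 * γ) ≤ infDist y Γ ^ (2 * γ) := by
          gcongr
        refine this.trans (le_add_of_nonneg_right (by positivity))
      · have hgl := hgd y z (2 * b) hz ((mem_ball.1 hy).trans hb1) hz1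
          ((le_of_lt (mem_ball.1 hy)).trans (by linarith)) hzb
        rw [← hyz, ← hK] at hgl
        have hgpos : 0 < |g y| := abs_pos.2 hgy
        have hlow : |g y| / (1 + K) ≤ infDist y Γ := by
          rw [div_le_iff₀ (by positivity), mul_comm]; exact hgl
        have hdpos : 0 < infDist y Γ := lt_of_lt_of_le (by positivity) hlow
        have hsing : infDist y Γ ^ (2 * γ - 1) ≤ (1 + K) ^ (1 - 2 * γ) * |g y| ^ (2 * γ - 1) := by
          calc infDist y Γ ^ (2 * γ - 1) ≤ (|g y| / (1 + K)) ^ (2 * γ - 1) :=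
                Real.rpow_le_rpow_of_nonpos (by positivity) hlow (by linarith)
            _ = _ := by
                rw [Real.div_rpow hgpos.le (by positivity), div_eq_mul_inv,
                  ← Real.rpow_neg (by positivity), neg_sub, mul_comm]
        calc (l * infDist (x₀ + l⁻¹ • (y - x₀)) Γ) ^ (2 * γ)
            ≤ (infDist y Γ + |l - 1| * E) ^ (2 * γ) := by gcongr
          _ ≤ infDist y Γ ^ (2 * γ) + 2 * γ * (|l - 1| * E) * infDist y Γ ^ (2 * γ - 1) :=
              add_rpow_le_of_le_one hdpos (by positivity) (by positivity) hγ1.le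
          _ ≤ infDist y Γ ^ (2 * γ)
              + 2 * γ * (|l - 1| * E) * ((1 + K) ^ (1 - 2 * γ) * |g y| ^ (2 * γ - 1)) := by gcongr
          _ = _ := by rw [hA]; ring

/-! ### Radial deformations of space -/

/-- The deformation of space which dilates the sphere of radius `ρ` about `x₀` by the factor
`1 + t * G (ρ ^ 2)`. -/
noncomputable def radialMap (G : ℝ → ℝ) (t : ℝ) (x₀ x : Euc n) : Euc n :=
  x₀ + (1 + t * G (‖x - x₀‖ ^ 2)) • (x - x₀)

/-- The derivative of `radialMap`. -/
noncomputable def radialMapDeriv (G : ℝ → ℝ) (t : ℝ) (x₀ x : Euc n) : Euc n →L[ℝ] Euc n :=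
  (1 + t * G (‖x - x₀‖ ^ 2)) • ContinuousLinearMap.id ℝ (Euc n)
    + (t * (2 * deriv G (‖x - x₀‖ ^ 2))) • (innerSL ℝ (x - x₀)).smulRight (x - x₀)

theorem radialMapDeriv_apply (G : ℝ → ℝ) (t : ℝ) (x₀ x p : Euc n) :
    radialMapDeriv G t x₀ x p = (1 + t * G (‖x - x₀‖ ^ 2)) • p
      + (t * (2 * deriv G (‖x - x₀‖ ^ 2)) * inner ℝ (x - x₀) p) • (x - x₀) := by
  simp [radialMapDeriv, smul_smul]
  rw [inner_sub_left]

theorem inner_radialMapDeriv (G : ℝ → ℝ) (t : ℝ) (x₀ x p q : Euc n) :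
    inner ℝ (radialMapDeriv G t x₀ x p) q = inner ℝ p (radialMapDeriv G t x₀ x q) := by
  simp only [radialMapDeriv_apply, inner_add_left, inner_add_right, inner_smul_left,
    inner_smul_right, RCLike.conj_to_real, real_inner_comm p]
  ring

theorem norm_radialMapDeriv_sq (G : ℝ → ℝ) (t : ℝ) (x₀ x p : Euc n) :
    ‖radialMapDeriv G t x₀ x p‖ ^ 2 = (1 + t * G (‖x - x₀‖ ^ 2)) ^ 2 * ‖p‖ ^ 2
      + (2 * (1 + t * G (‖x - x₀‖ ^ 2)) * (t * (2 * deriv G (‖x - x₀‖ ^ 2)))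
        + (t * (2 * deriv G (‖x - x₀‖ ^ 2))) * (t * (2 * deriv G (‖x - x₀‖ ^ 2) * ‖x - x₀‖ ^ 2)))
        * inner ℝ (x - x₀) p ^ 2 := by
  rw [radialMapDeriv_apply, norm_add_sq_real, norm_smul, norm_smul, inner_smul_left,
    inner_smul_right, real_inner_comm (x - x₀) p, mul_pow, mul_pow, Real.norm_eq_abs,
    Real.norm_eq_abs, sq_abs, sq_abs]
  simp only [RCLike.conj_to_real]
  ring

theorem hasFDerivAt_radialMap {G : ℝ → ℝ} (hG : ContDiff ℝ ∞ G) (t : ℝ) (x₀ x : Euc n) :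
    HasFDerivAt (radialMap G t x₀) (radialMapDeriv G t x₀ x) x := by
  have h1 := (hasGradientAt_radial hG x₀ x).hasFDerivAt
  have h2 := ((h1.const_mul t).const_add 1).smul ((hasFDerivAt_id x).sub_const x₀)
  refine (h2.const_add x₀).congr_fderiv (ContinuousLinearMap.ext fun e => ?_)
  rw [radialMapDeriv_apply]
  simp
  rw [inner_sub_left]
  ring_nf

theorem contDiff_radialMap {G : ℝ → ℝ} (hG : ContDiff ℝ ∞ G) (t : ℝ) (x₀ : Euc n) :
    ContDiff ℝ ∞ (radialMap G t x₀) := by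
  have : ContDiff ℝ ∞ fun x : Euc n => G (‖x - x₀‖ ^ 2) :=
    hG.comp ((contDiff_id.sub contDiff_const).norm_sq ℝ)
  exact contDiff_const.add ((contDiff_const.add (contDiff_const.mul this)).smul
    (contDiff_id.sub contDiff_const))

theorem det_radialMapDeriv {G : ℝ → ℝ} {t : ℝ} {x₀ x : Euc n}
    (h : 1 + t * G (‖x - x₀‖ ^ 2) ≠ 0) :
    (radialMapDeriv G t x₀ x).det = (1 + t * G (‖x - x₀‖ ^ 2)) ^ n *
      (1 + t * (2 * deriv G (‖x - x₀‖ ^ 2) * ‖x - x₀‖ ^ 2) / (1 + t * G (‖x - x₀‖ ^ 2))) := by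
  set a := 1 + t * G (‖x - x₀‖ ^ 2) with ha
  set c := t * (2 * deriv G (‖x - x₀‖ ^ 2)) with hc
  have hM : LinearMap.toMatrix (EuclideanSpace.basisFun (Fin n) ℝ).toBasis
      (EuclideanSpace.basisFun (Fin n) ℝ).toBasis (radialMapDeriv G t x₀ x : Euc n →ₗ[ℝ] Euc n)
      = a • (1 + Matrix.replicateCol (Fin 1) (fun i => (x - x₀) i)
          * Matrix.replicateRow (Fin 1) (fun i => (c / a) * (x - x₀) i)) := by
    ext i j
    rw [LinearMap.toMatrix_apply]
    simp only [OrthonormalBasis.coe_toBasis, OrthonormalBasis.coe_toBasis_repr_apply,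
      EuclideanSpace.basisFun_apply, EuclideanSpace.basisFun_repr, ContinuousLinearMap.coe_coe,
      radialMapDeriv_apply, ← ha, ← hc]
    have hin : inner ℝ (x - x₀) (EuclideanSpace.single j (1 : ℝ)) = (x - x₀) j := by
      simp [EuclideanSpace.inner_single_right]
    rw [hin]
    simp only [PiLp.add_apply, PiLp.smul_apply, smul_eq_mul, Matrix.smul_apply, Matrix.add_apply,
      Matrix.mul_apply, Matrix.replicateCol_apply, Matrix.replicateRow_apply, Finset.univ_unique,
      Finset.sum_const, Finset.card_singleton, one_smul, Matrix.one_apply,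
      PiLp.single_apply]
    field_simp
  rw [ContinuousLinearMap.det, ← LinearMap.det_toMatrix
    (EuclideanSpace.basisFun (Fin n) ℝ).toBasis, hM, Matrix.det_smul,
    Matrix.det_one_add_mul_comm, Matrix.det_fin_one, Fintype.card_fin]
  simp only [Matrix.add_apply, Matrix.one_apply_eq, Matrix.mul_apply, Matrix.replicateRow_apply,
    Matrix.replicateCol_apply]
  congr 2
  have hnorm : ‖x - x₀‖ ^ 2 = ∑ i, (x - x₀) i * (x - x₀) i := by
    rw [EuclideanSpace.real_norm_sq_eq]
    simp [sq]
  rw [hnorm, Finset.mul_sum, Finset.mul_sum, Finset.sum_div]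
  refine Finset.sum_congr rfl fun i _ => ?_
  rw [hc, hnorm]
  ring

theorem exists_bound_radial_profile {G : ℝ → ℝ} (hG : ContDiff ℝ ∞ G) {b : ℝ}
    (hG0 : ∀ s, b ^ 2 ≤ s → G s = 0) :
    ∃ Λ : ℝ, 0 < Λ ∧ ∀ s, 0 ≤ s → |G s| ≤ Λ ∧ |2 * deriv G s| ≤ Λ ∧ |2 * deriv G s * s| ≤ Λ := by
  have hGd : Continuous (deriv G) := hG.continuous_deriv (by simp)
  have hc : IsCompact (Icc 0 (b ^ 2)) := isCompact_Icc
  obtain ⟨C₁, h1⟩ := hc.exists_bound_of_continuousOn hG.continuous.continuousOn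
  obtain ⟨C₂, h2⟩ := hc.exists_bound_of_continuousOn
    (continuous_const.mul hGd : Continuous fun s => 2 * deriv G s).continuousOn
  obtain ⟨C₃, h3⟩ := hc.exists_bound_of_continuousOn
    ((continuous_const.mul hGd).mul continuous_id : Continuous fun s => 2 * deriv G s * s).continuousOn
  refine ⟨max 1 (max C₁ (max C₂ C₃)), by positivity, fun s hs => ?_⟩
  rcases le_or_gt s (b ^ 2) with h | h
  · refine ⟨(h1 s ⟨hs, h⟩).trans ?_, (h2 s ⟨hs, h⟩).trans ?_, (h3 s ⟨hs, h⟩).trans ?_⟩ <;> simp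
  · have : deriv G s = 0 := by
      have : G =ᶠ[𝓝 s] fun _ => 0 := by
        filter_upwards [lt_mem_nhds h] with r hr using hG0 r hr.le
      rw [this.deriv_eq, deriv_const]
    rw [hG0 s h.le, this]
    simp

section

variable {G : ℝ → ℝ} {b t Λ : ℝ} {x₀ : Euc n}

theorem radialMap_of_le (hb : 0 ≤ b) (hG0 : ∀ s, b ^ 2 ≤ s → G s = 0) {x : Euc n}
    (hx : b ≤ ‖x - x₀‖) : radialMap G t x₀ x = x := by
  rw [radialMap, hG0 _ (by gcongr)]
  simp

theorem norm_radialMap_sub_le (hb : 0 ≤ b) (hG0 : ∀ s, b ^ 2 ≤ s → G s = 0)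
    (hΛ : ∀ s, 0 ≤ s → |G s| ≤ Λ) (x : Euc n) : ‖radialMap G t x₀ x - x‖ ≤ |t| * (Λ * b) := by
  have hΛ0 : 0 ≤ Λ := (abs_nonneg _).trans (hΛ 0 le_rfl)
  rcases le_or_gt b ‖x - x₀‖ with h | h
  · rw [radialMap_of_le hb hG0 h, sub_self, norm_zero]; positivity
  · have : radialMap G t x₀ x - x = (t * G (‖x - x₀‖ ^ 2)) • (x - x₀) := by
      rw [radialMap]; module
    rw [this, norm_smul, Real.norm_eq_abs, abs_mul, mul_assoc]
    gcongr
    exact hΛ _ (by positivity)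

theorem norm_radialMapDeriv_sub_id_le (hΛ : ∀ s, 0 ≤ s → |G s| ≤ Λ ∧ |2 * deriv G s * s| ≤ Λ)
    (x p : Euc n) : ‖radialMapDeriv G t x₀ x p - p‖ ≤ |t| * (2 * Λ) * ‖p‖ := by
  obtain ⟨h1, h2⟩ := hΛ (‖x - x₀‖ ^ 2) (by positivity)
  have : radialMapDeriv G t x₀ x p - p = (t * G (‖x - x₀‖ ^ 2)) • p
      + (t * (2 * deriv G (‖x - x₀‖ ^ 2)) * inner ℝ (x - x₀) p) • (x - x₀) := by
    rw [radialMapDeriv_apply]; module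
  rw [this]
  refine (norm_add_le _ _).trans ?_
  rw [norm_smul, norm_smul, Real.norm_eq_abs, Real.norm_eq_abs, abs_mul, abs_mul, abs_mul]
  have h3 : |t| * |2 * deriv G (‖x - x₀‖ ^ 2)| * |inner ℝ (x - x₀) p| * ‖x - x₀‖
      ≤ |t| * Λ * ‖p‖ := by
    calc |t| * |2 * deriv G (‖x - x₀‖ ^ 2)| * |inner ℝ (x - x₀) p| * ‖x - x₀‖
        ≤ |t| * |2 * deriv G (‖x - x₀‖ ^ 2)| * (‖x - x₀‖ * ‖p‖) * ‖x - x₀‖ := by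
          gcongr; exact abs_real_inner_le_norm _ _
      _ = |t| * |2 * deriv G (‖x - x₀‖ ^ 2) * ‖x - x₀‖ ^ 2| * ‖p‖ := by
          rw [abs_mul _ (‖x - x₀‖ ^ 2), abs_of_nonneg (sq_nonneg ‖x - x₀‖)]; ring
      _ ≤ _ := by gcongr
  have h4 : |t| * |G (‖x - x₀‖ ^ 2)| * ‖p‖ ≤ |t| * Λ * ‖p‖ := by gcongr
  linarith

/-- Small radial deformations are diffeomorphisms which distort volumes by a factor at most `2`. -/
theorem eventually_radialMap (hG : ContDiff ℝ ∞ G)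
    (hΛ : ∀ s, 0 ≤ s → |G s| ≤ Λ ∧ |2 * deriv G s * s| ≤ Λ) (x₀ : Euc n) :
    ∀ᶠ t in 𝓝 (0 : ℝ), Function.Bijective (radialMap G t x₀) ∧
      Measure.map (radialMap G t x₀) volume ≤ (2 : ℝ≥0∞) • (volume : Measure (Euc n)) ∧
      ∀ x, 0 < 1 + t * G (‖x - x₀‖ ^ 2) ∧ 0 < (radialMapDeriv G t x₀ x).det := by
  have hΛ0 : 0 ≤ Λ := (abs_nonneg _).trans (hΛ 0 le_rfl).1
  have hq : ContinuousAt (fun q : ℝ × ℝ => (1 + q.1) ^ n * (1 + q.2 / (1 + q.1))) (0, 0) := by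
    refine ContinuousAt.mul (by fun_prop) (continuousAt_const.add (continuousAt_snd.div
      (by fun_prop) (by simp)))
  obtain ⟨δ, hδ, hqδ⟩ := Metric.continuousAt_iff.1 hq (1 / 2) (by norm_num)
  filter_upwards [Metric.ball_mem_nhds (0 : ℝ) (show 0 < min δ (1 / 4) / (Λ + 1) by positivity)]
    with t ht
  rw [mem_ball_zero_iff, Real.norm_eq_abs, lt_div_iff₀ (by positivity)] at ht
  have htΛ : |t| * Λ < min δ (1 / 4) := by
    have := abs_nonneg t
    nlinarith
  have htδ := htΛ.trans_le (min_le_left _ _)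
  have ht4 := htΛ.trans_le (min_le_right _ _)
  have hpos : ∀ x : Euc n, 0 < 1 + t * G (‖x - x₀‖ ^ 2) := by
    intro x
    have h1 : |t * G (‖x - x₀‖ ^ 2)| ≤ |t| * Λ := by
      rw [abs_mul]; gcongr; exact (hΛ _ (by positivity)).1
    linarith [(abs_le.1 h1).1]
  have hdet : ∀ x : Euc n, 1 / 2 ≤ (radialMapDeriv G t x₀ x).det := by
    intro x
    rw [det_radialMapDeriv (hpos x).ne']
    obtain ⟨h1, h2⟩ := hΛ (‖x - x₀‖ ^ 2) (by positivity)
    have h3 := hqδ (x := (t * G (‖x - x₀‖ ^ 2), t * (2 * deriv G (‖x - x₀‖ ^ 2) * ‖x - x₀‖ ^ 2))) (by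
      rw [dist_eq_norm, Prod.norm_def]
      simp only [Prod.fst_sub, Prod.snd_sub, sub_zero, Real.norm_eq_abs, abs_mul t]
      refine max_lt (lt_of_le_of_lt ?_ htδ) (lt_of_le_of_lt ?_ htδ) <;> gcongr)
    simp only [Real.dist_eq, add_zero, one_pow, zero_div, mul_one] at h3
    linarith [(abs_lt.1 h3).1]
  have happ : ApproximatesLinearOn (radialMap G t x₀)
      ((ContinuousLinearEquiv.refl ℝ (Euc n) : Euc n ≃L[ℝ] Euc n) : Euc n →L[ℝ] Euc n) univ
      (1 / 2 : ℝ≥0) := by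
    intro x _ y _
    have hLip : LipschitzWith (1 / 2 : ℝ≥0) fun x => radialMap G t x₀ x - x := by
      refine lipschitzWith_of_nnnorm_fderiv_le (𝕜 := ℝ)
        (fun z => ((hasFDerivAt_radialMap hG t x₀ z).sub (hasFDerivAt_id z)).differentiableAt)
        fun z => ?_
      have hfd : fderiv ℝ (fun x => radialMap G t x₀ x - x) z
          = radialMapDeriv G t x₀ z - ContinuousLinearMap.id ℝ (Euc n) :=
        ((hasFDerivAt_radialMap hG t x₀ z).sub (hasFDerivAt_id z)).fderiv
      rw [hfd, ← NNReal.coe_le_coe, coe_nnnorm]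
      refine ContinuousLinearMap.opNorm_le_bound _ (by positivity) fun p => ?_
      refine (norm_radialMapDeriv_sub_id_le hΛ z p).trans ?_
      push_cast
      gcongr
      linarith
    have := hLip.dist_le_mul x y
    rw [dist_eq_norm, dist_eq_norm] at this
    refine le_trans (le_of_eq ?_) this
    congr 1
    simp only [ContinuousLinearEquiv.coe_coe, ContinuousLinearEquiv.refl_apply]
    abel
  have hcN : Subsingleton (Euc n) ∨ (1 / 2 : ℝ≥0) <
      ‖((ContinuousLinearEquiv.refl ℝ (Euc n)).symm : Euc n →L[ℝ] Euc n)‖₊⁻¹ := by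
    rcases subsingleton_or_nontrivial (Euc n) with h | h
    · exact Or.inl h
    · right
      have : ‖((ContinuousLinearEquiv.refl ℝ (Euc n)).symm : Euc n →L[ℝ] Euc n)‖₊ = 1 :=
        ContinuousLinearMap.nnnorm_id
      rw [this, inv_one, ← NNReal.coe_lt_coe]
      norm_num
  have hinj : Function.Injective (radialMap G t x₀) := injOn_univ.1 (happ.injOn hcN)
  have hsurj : Function.Surjective (radialMap G t x₀) := happ.surjective hcN
  refine ⟨⟨hinj, hsurj⟩, ?_, fun x => ⟨hpos x, lt_of_lt_of_le (by norm_num) (hdet x)⟩⟩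
  have hmeas : Measurable (radialMap G t x₀) := (contDiff_radialMap hG t x₀).continuous.measurable
  refine Measure.le_iff.2 fun s hs => ?_
  rw [Measure.map_apply hmeas hs, Measure.smul_apply, smul_eq_mul]
  have h1 := lintegral_abs_det_fderiv_eq_addHaar_image volume (hmeas hs)
    (fun x _ => (hasFDerivAt_radialMap hG t x₀ x).hasFDerivWithinAt) hinj.injOn
  rw [image_preimage_eq s hsurj] at h1
  rw [← h1, ← lintegral_const_mul']
  · calc volume (radialMap G t x₀ ⁻¹' s) = ∫⁻ _ in radialMap G t x₀ ⁻¹' s, 1 := by simp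
      _ ≤ _ := by
        refine lintegral_mono fun x => ?_
        have h2 := (hdet x).trans (le_abs_self _)
        calc (1 : ℝ≥0∞) ≤ ENNReal.ofReal (2 * |(radialMapDeriv G t x₀ x).det|) :=
              ENNReal.one_le_ofReal.2 (by linarith)
          _ = _ := by rw [ENNReal.ofReal_mul two_pos.le, ENNReal.ofReal_ofNat]
  · exact ENNReal.ofNat_ne_top

theorem radialMap_mem_ball_iff (hb : 0 ≤ b) (hG0 : ∀ s, b ^ 2 ≤ s → G s = 0)
    (hinj : Function.Injective (radialMap G t x₀)) {r : ℝ} (hr : b ≤ r) (x : Euc n) :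
    radialMap G t x₀ x ∈ ball x₀ r ↔ x ∈ ball x₀ r := by
  have key : ∀ y : Euc n, y ∉ ball x₀ r → radialMap G t x₀ y = y := fun y hy => by
    rw [mem_ball, not_lt, dist_eq_norm] at hy
    exact radialMap_of_le hb hG0 (hr.trans hy)
  constructor
  · intro h
    by_contra hx
    rw [key x hx] at h
    exact hx h
  · intro h
    by_contra hx
    exact hx (by rwa [hinj (key _ hx)])

theorem image_ball_radialMap (hb : 0 ≤ b) (hG0 : ∀ s, b ^ 2 ≤ s → G s = 0)
    (hbij : Function.Bijective (radialMap G t x₀)) {r : ℝ} (hr : b ≤ r) :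
    radialMap G t x₀ '' ball x₀ r = ball x₀ r := by
  have : ball x₀ r = radialMap G t x₀ ⁻¹' ball x₀ r :=
    (ext fun x => radialMap_mem_ball_iff hb hG0 hbij.1 hr x).symm
  conv_lhs => rw [this]
  exact image_preimage_eq _ hbij.2

theorem integral_ball_comp_radialMap (hG : ContDiff ℝ ∞ G) (hb : 0 ≤ b)
    (hG0 : ∀ s, b ^ 2 ≤ s → G s = 0) (hbij : Function.Bijective (radialMap G t x₀))
    (hdet : ∀ x, 0 < (radialMapDeriv G t x₀ x).det) {r : ℝ} (hr : b ≤ r) (f : Euc n → ℝ) :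
    ∫ x in ball x₀ r, f x
      = ∫ x in ball x₀ r, (radialMapDeriv G t x₀ x).det * f (radialMap G t x₀ x) := by
  conv_lhs => rw [← image_ball_radialMap hb hG0 hbij hr]
  rw [integral_image_eq_integral_abs_det_fderiv_smul volume measurableSet_ball
    (fun x _ => (hasFDerivAt_radialMap hG t x₀ x).hasFDerivWithinAt) hbij.1.injOn]
  refine integral_congr_ae (Eventually.of_forall fun x => ?_)
  simp only [abs_of_pos (hdet x), smul_eq_mul]

theorem integrableOn_ball_comp_radialMap (hG : ContDiff ℝ ∞ G) (hb : 0 ≤ b)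
    (hG0 : ∀ s, b ^ 2 ≤ s → G s = 0) (hbij : Function.Bijective (radialMap G t x₀))
    (hdet : ∀ x, 0 < (radialMapDeriv G t x₀ x).det) {r : ℝ} (hr : b ≤ r) {f : Euc n → ℝ}
    (hf : IntegrableOn f (ball x₀ r)) :
    IntegrableOn (fun x => (radialMapDeriv G t x₀ x).det * f (radialMap G t x₀ x))
      (ball x₀ r) := by
  rw [← image_ball_radialMap hb hG0 hbij hr,
    integrableOn_image_iff_integrableOn_abs_det_fderiv_smul volume measurableSet_ball
    (fun x _ => (hasFDerivAt_radialMap hG t x₀ x).hasFDerivWithinAt) hbij.1.injOn] at hf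
  refine hf.congr_fun (fun x _ => ?_) measurableSet_ball
  simp only [abs_of_pos (hdet x), smul_eq_mul]

end

/-! ### Sobolev functions under radial deformations -/

section

variable {σ : ℝ → Euc n → Euc n} {F : Type*} [NormedAddCommGroup F]

theorem tendsto_eLpNorm_comp_sub [NormedSpace ℝ F] {p : ℝ≥0∞} (hp1 : 1 ≤ p) (hp : p ≠ ⊤)
    (hσ : ∀ᶠ t in 𝓝 (0 : ℝ), Measurable (σ t) ∧
      Measure.map (σ t) volume ≤ (2 : ℝ≥0∞) • (volume : Measure (Euc n)))
    (hclose : ∀ δ > 0, ∀ᶠ t in 𝓝 (0 : ℝ), ∀ x, ‖σ t x - x‖ ≤ δ) {f : Euc n → F}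
    (hf : MemLp f p volume) :
    Tendsto (fun t => eLpNorm (fun x => f (σ t x) - f x) p volume) (𝓝 0) (𝓝 0) := by
  rw [ENNReal.tendsto_nhds_zero]
  intro ε hε
  obtain ⟨δ, hδ, h⟩ := exists_eLpNorm_comp_sub_le hp1 hp hf hε.ne'
  filter_upwards [hσ, hclose δ hδ] with t h1 h2
  exact h _ h1.1 h1.2 h2

theorem memLp_comp_of_map_le {p : ℝ≥0∞} (hp1 : 1 ≤ p) (hp : p ≠ ⊤) {σ : Euc n → Euc n}
    (hσ : Measurable σ) (hvol : Measure.map σ volume ≤ (2 : ℝ≥0∞) • (volume : Measure (Euc n)))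
    {f : Euc n → F} (hf : MemLp f p volume) : MemLp (fun x => f (σ x)) p volume := by
  have hac : Measure.map σ volume ≪ (volume : Measure (Euc n)) :=
    (Measure.absolutelyContinuous_of_le hvol).trans Measure.smul_absolutelyContinuous
  refine ⟨(hf.1.mono_ac hac).comp_measurable hσ, (eLpNorm_comp_le hp1 hp hf.1 hσ hvol).trans_lt ?_⟩
  exact ENNReal.mul_lt_top (by simp) hf.2

/-- Differentiation under the integral sign along a family of deformations: only the coefficient is
differentiated, the composition with the deformation converges in `L¹`. -/
theorem tendsto_integral_coeff_comp
    (hσ : ∀ᶠ t in 𝓝 (0 : ℝ), Measurable (σ t) ∧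
      Measure.map (σ t) volume ≤ (2 : ℝ≥0∞) • (volume : Measure (Euc n)))
    (hclose : ∀ δ > 0, ∀ᶠ t in 𝓝 (0 : ℝ), ∀ x, ‖σ t x - x‖ ≤ δ) {f : Euc n → ℝ}
    (hf : Integrable f) {q ℓ : ℝ × ℝ × ℝ → ℝ} (hq : DifferentiableAt ℝ q 0) (hq0 : q 0 = 0)
    (hqm : Measurable q) (hℓ : ∀ e, HasDerivAt (fun t : ℝ => q (t • e)) (ℓ e) 0)
    {e : Euc n → ℝ × ℝ × ℝ} (he : Measurable e) {Λ : ℝ} (heΛ : ∀ x, ‖e x‖ ≤ Λ) :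
    (∀ᶠ t in 𝓝[≠] (0 : ℝ), Integrable (fun x => t⁻¹ * q (t • e x) * f (σ t x))) ∧
    Tendsto (fun t => ∫ x, t⁻¹ * q (t • e x) * f (σ t x)) (𝓝[≠] 0) (𝓝 (∫ x, ℓ (e x) * f x)) := by
  have hΛ0 : 0 ≤ Λ := (norm_nonneg _).trans (heΛ 0)
  obtain ⟨K, hK, hKq⟩ := hq.isBigO_sub.exists_pos
  rw [Asymptotics.isBigOWith_iff] at hKq
  simp only [hq0, sub_zero] at hKq
  obtain ⟨δ, hδ, hKδ⟩ := Metric.eventually_nhds_iff.1 hKq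
  have hbd : ∀ᶠ t in 𝓝[≠] (0 : ℝ), ∀ x, ‖t⁻¹ * q (t • e x)‖ ≤ K * Λ := by
    have h1 : ∀ᶠ t in 𝓝[≠] (0 : ℝ), |t| < δ / (Λ + 1) := by
      filter_upwards [mem_nhdsWithin_of_mem_nhds (Metric.ball_mem_nhds (0 : ℝ)
        (show 0 < δ / (Λ + 1) by positivity))] with t ht
      simpa using ht
    filter_upwards [h1, self_mem_nhdsWithin] with t ht ht0 x
    have ht0' : t ≠ 0 := ht0
    have h2 : ‖t • e x‖ ≤ |t| * Λ := by
      rw [norm_smul, Real.norm_eq_abs]; gcongr; exact heΛ x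
    rw [lt_div_iff₀ (by positivity)] at ht
    have h3 : ‖q (t • e x)‖ ≤ K * ‖t • e x‖ := hKδ (by
      rw [dist_zero_right]
      refine h2.trans_lt ?_
      have := abs_nonneg t
      nlinarith)
    rw [norm_mul, norm_inv, Real.norm_eq_abs t, inv_mul_le_iff₀ (by positivity)]
    calc ‖q (t • e x)‖ ≤ K * (|t| * Λ) := h3.trans (by gcongr)
      _ = _ := by ring
  have hcm : ∀ t : ℝ, Measurable fun x => t⁻¹ * q (t • e x) := fun t =>
    measurable_const.mul (hqm.comp (he.const_smul t))
  have hfL : MemLp f 1 volume := memLp_one_iff_integrable.2 hf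
  have hint : ∀ᶠ t in 𝓝[≠] (0 : ℝ), Integrable (fun x => t⁻¹ * q (t • e x) * f (σ t x)) ∧
      Integrable (fun x => t⁻¹ * q (t • e x) * (f (σ t x) - f x)) ∧
      Integrable (fun x => t⁻¹ * q (t • e x) * f x) := by
    filter_upwards [hbd, mem_nhdsWithin_of_mem_nhds hσ] with t ht hσt
    have hc : Integrable (fun x => f (σ t x)) := memLp_one_iff_integrable.1
      (memLp_comp_of_map_le le_rfl ENNReal.one_ne_top hσt.1 hσt.2 hfL)
    exact ⟨hc.bdd_mul (hcm t).aestronglyMeasurable (Eventually.of_forall ht),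
      (hc.sub hf).bdd_mul (hcm t).aestronglyMeasurable (Eventually.of_forall ht),
      hf.bdd_mul (hcm t).aestronglyMeasurable (Eventually.of_forall ht)⟩
  refine ⟨hint.mono fun t h => h.1, ?_⟩
  have h1 : Tendsto (fun t => ∫ x, t⁻¹ * q (t • e x) * f x) (𝓝[≠] 0) (𝓝 (∫ x, ℓ (e x) * f x)) := by
    refine tendsto_integral_filter_of_dominated_convergence (fun x => K * Λ * ‖f x‖) ?_ ?_
      (hf.norm.const_mul _) ?_
    · exact Eventually.of_forall fun t => (hcm t).aestronglyMeasurable.mul hf.1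
    · filter_upwards [hbd] with t ht
      refine Eventually.of_forall fun x => ?_
      rw [norm_mul]
      gcongr
      exact ht x
    · refine Eventually.of_forall fun x => Tendsto.mul_const _ ?_
      have := (hasDerivAt_iff_tendsto_slope_zero.1 (hℓ (e x)))
      simpa [hq0] using this
  have h2 : Tendsto (fun t => ∫ x, t⁻¹ * q (t • e x) * (f (σ t x) - f x)) (𝓝[≠] 0) (𝓝 0) := by
    have h3 := (ENNReal.tendsto_toReal ENNReal.zero_ne_top).comp
      ((tendsto_eLpNorm_comp_sub le_rfl ENNReal.one_ne_top hσ hclose hfL).mono_left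
        (nhdsWithin_le_nhds (s := {0}ᶜ)))
    have h4 := h3.const_mul (K * Λ)
    rw [ENNReal.toReal_zero, mul_zero] at h4
    refine squeeze_zero_norm' ?_ h4
    filter_upwards [hbd, mem_nhdsWithin_of_mem_nhds hσ] with t ht hσt
    have hc : Integrable (fun x => f (σ t x)) := memLp_one_iff_integrable.1
      (memLp_comp_of_map_le le_rfl ENNReal.one_ne_top hσt.1 hσt.2 hfL)
    have hn : (eLpNorm (fun x => f (σ t x) - f x) 1 volume).toReal = ∫ x, ‖f (σ t x) - f x‖ := by
      rw [eLpNorm_one_eq_lintegral_enorm]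
      exact (integral_norm_eq_lintegral_enorm (hc.sub hf).1).symm
    rw [Function.comp_apply, hn, ← integral_const_mul]
    refine norm_integral_le_of_norm_le ((hc.sub hf).norm.const_mul _)
      (Eventually.of_forall fun x => ?_)
    rw [norm_mul]
    gcongr
    exact ht x
  have h5 := h2.add h1
  rw [zero_add] at h5
  refine h5.congr' ?_
  filter_upwards [hint] with t ht
  rw [← integral_add ht.2.1 ht.2.2]
  refine integral_congr_ae (Eventually.of_forall fun x => ?_)
  simp only
  ring

end

theorem integral_norm_sq_eq_toReal {α F : Type*} [MeasurableSpace α] {μ : Measure α}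
    [NormedAddCommGroup F] {g : α → F} (hg : AEStronglyMeasurable g μ) :
    ∫ x, ‖g x‖ ^ 2 ∂μ = (eLpNorm g 2 μ ^ 2).toReal := by
  have h : AEStronglyMeasurable (fun x => ‖g x‖ ^ 2) μ := hg.norm.pow 2
  rw [eLpNorm_two_sq, integral_eq_lintegral_of_nonneg_ae
    (Eventually.of_forall fun _ => by positivity) h]
  congr 1
  refine lintegral_congr fun x => ?_
  rw [ENNReal.ofReal_pow (norm_nonneg _), ofReal_norm]

section

variable {G : ℝ → ℝ} {b R t Λ : ℝ} {x₀ : Euc n}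

theorem radialMapDeriv_of_lt (hb : 0 ≤ b) (hG0 : ∀ s, b ^ 2 ≤ s → G s = 0) {x : Euc n}
    (hx : b < ‖x - x₀‖) (p : Euc n) : radialMapDeriv G t x₀ x p = p := by
  have h1 : b ^ 2 < ‖x - x₀‖ ^ 2 := by gcongr
  have h2 : deriv G (‖x - x₀‖ ^ 2) = 0 := by
    have : G =ᶠ[𝓝 (‖x - x₀‖ ^ 2)] fun _ => 0 := by
      filter_upwards [lt_mem_nhds h1] with r hr using hG0 r hr.le
    rw [this.deriv_eq, deriv_const]
  rw [radialMapDeriv_apply, hG0 _ h1.le, h2]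
  simp

theorem aestronglyMeasurable_radialMapDeriv (hG : ContDiff ℝ ∞ G) {g : Euc n → Euc n}
    {μ : Measure (Euc n)} (hg : AEStronglyMeasurable g μ) :
    AEStronglyMeasurable (fun x => radialMapDeriv G t x₀ x (g x)) μ := by
  simp only [radialMapDeriv_apply]
  have hGc := hG.continuous
  have hGd : Continuous (deriv G) := hG.continuous_deriv (by simp)
  have h1 : Continuous fun x : Euc n => 1 + t * G (‖x - x₀‖ ^ 2) := by fun_prop
  have h2 : Continuous fun x : Euc n => t * (2 * deriv G (‖x - x₀‖ ^ 2)) := by fun_prop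
  have h3 : Continuous fun x : Euc n => x - x₀ := by fun_prop
  exact (h1.aestronglyMeasurable.smul hg).add ((h2.aestronglyMeasurable.mul
    (h3.aestronglyMeasurable.inner hg)).smul h3.aestronglyMeasurable)

theorem eLpNorm_radialMapDeriv_le (hΛ : ∀ s, 0 ≤ s → |G s| ≤ Λ ∧ |2 * deriv G s * s| ≤ Λ)
    (g : Euc n → Euc n) :
    eLpNorm (fun x => radialMapDeriv G t x₀ x (g x) - g x) 2 volume
      ≤ ENNReal.ofReal (|t| * (2 * Λ)) * eLpNorm g 2 volume := by
  exact eLpNorm_le_mul_eLpNorm_of_ae_le_mul (c := |t| * (2 * Λ))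
    (Eventually.of_forall fun x => norm_radialMapDeriv_sub_id_le hΛ x (g x)) 2

theorem gradient_comp_radialMap (hG : ContDiff ℝ ∞ G) {φ : Euc n → ℝ} (hφ : Differentiable ℝ φ)
    (x : Euc n) : gradient (fun y => φ (radialMap G t x₀ y)) x
      = radialMapDeriv G t x₀ x (gradient φ (radialMap G t x₀ x)) := by
  have h := (hφ (radialMap G t x₀ x)).hasFDerivAt.comp x (hasFDerivAt_radialMap hG t x₀ x)
  have h' : HasGradientAt (fun y => φ (radialMap G t x₀ y))
      (radialMapDeriv G t x₀ x (gradient φ (radialMap G t x₀ x))) x := by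
    rw [hasGradientAt_iff_hasFDerivAt]
    refine h.congr_fderiv (ContinuousLinearMap.ext fun e => ?_)
    rw [InnerProductSpace.toDual_apply_apply, inner_radialMapDeriv, inner_gradient_left]
    rfl
  exact h'.gradient

/-- A Sobolev function composed with a radial deformation supported in `B_b(x₀)` is a competitor on
every larger ball. -/
theorem MemW12.memK_comp_radialMap (hu : MemW12 (ball x₀ R) u Du) (hG : ContDiff ℝ ∞ G)
    (hb : 0 ≤ b) (hbR : b < R) (hG0 : ∀ s, b ^ 2 ≤ s → G s = 0)
    (hΛ : ∀ s, 0 ≤ s → |G s| ≤ Λ ∧ |2 * deriv G s * s| ≤ Λ)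
    (hinj : Function.Injective (radialMap G t x₀))
    (hvol : Measure.map (radialMap G t x₀) volume ≤ (2 : ℝ≥0∞) • (volume : Measure (Euc n))) :
    MemK (ball x₀ R) u Du (fun x => u (radialMap G t x₀ x))
      (fun x => radialMapDeriv G t x₀ x (Du (radialMap G t x₀ x))) := by
  obtain ⟨ξ, hξ, -, V, hV, hKV, hξ1⟩ := exists_test_eq_one (isCompact_closedBall x₀ b) isOpen_ball
    (closedBall_subset_ball hbR)
  have hcut := hu.cutoff isOpen_ball.measurableSet hξ
  obtain ⟨φ, hφ, hφ1, hφ2, -⟩ := hcut.exists_test_approx hξ.2.1 isOpen_ball hξ.2.2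
    (fun x hx => by simp [image_eq_zero_of_notMem_tsupport hx])
  set U : Euc n → ℝ := fun x => ξ x * u x with hU
  set DU : Euc n → Euc n := fun x => ξ x • Du x + u x • gradient ξ x with hDU
  have hUm : MemLp U 2 volume := by simpa using hcut.memLp
  have hDUm : MemLp DU 2 volume := by simpa using hcut.memLp_grad
  have hUu : ∀ y ∈ V, U y = u y := fun y hy => by simp [hU, hξ1 y hy]
  have hDUu : ∀ y ∈ V, DU y = Du y := fun y hy => by
    have : gradient ξ y = 0 := by
      have h1 : ξ =ᶠ[𝓝 y] fun _ => 1 := by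
        filter_upwards [hV.mem_nhds hy] with z hz using hξ1 z hz
      rw [h1.gradient_eq, gradient_fun_const]
    simp [hDU, hξ1 y hy, this]
  set σ := radialMap G t x₀ with hσ
  have hσs := contDiff_radialMap hG t x₀
  have hσm : Measurable σ := hσs.continuous.measurable
  have hin : ∀ x, ‖x - x₀‖ ≤ b → x ∈ V ∧ σ x ∈ V := by
    intro x hx
    have hxb : x ∈ closedBall x₀ b := by rwa [mem_closedBall, dist_eq_norm]
    refine ⟨hKV hxb, hKV ?_⟩
    rcases hx.lt_or_eq with h | h
    · refine ball_subset_closedBall ((radialMap_mem_ball_iff hb hG0 hinj le_rfl x).2 ?_)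
      rwa [mem_ball, dist_eq_norm]
    · rwa [hσ, radialMap_of_le hb hG0 h.ge]
  have e1 : ∀ x, U (σ x) - U x = u (σ x) - u x := by
    intro x
    rcases le_or_gt ‖x - x₀‖ b with h | h
    · rw [hUu _ (hin x h).1, hUu _ (hin x h).2]
    · rw [hσ, radialMap_of_le hb hG0 h.le, sub_self, sub_self]
  have e2 : ∀ x, radialMapDeriv G t x₀ x (DU (σ x)) - DU x
      = radialMapDeriv G t x₀ x (Du (σ x)) - Du x := by
    intro x
    rcases le_or_gt ‖x - x₀‖ b with h | h
    · rw [hDUu _ (hin x h).1, hDUu _ (hin x h).2]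
    · rw [hσ, radialMap_of_le hb hG0 h.le, radialMapDeriv_of_lt hb hG0 h,
        radialMapDeriv_of_lt hb hG0 h, sub_self, sub_self]
  have hΛ0 : 0 ≤ Λ := (abs_nonneg _).trans (hΛ 0 le_rfl).1
  have hfin : ENNReal.ofReal (|t| * (2 * Λ)) + 1 ≠ ⊤ :=
    ENNReal.add_ne_top.2 ⟨ENNReal.ofReal_ne_top, ENNReal.one_ne_top⟩
  have hA : ∀ g : Euc n → Euc n, AEStronglyMeasurable g volume →
      eLpNorm (fun x => radialMapDeriv G t x₀ x (g x)) 2 volume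
        ≤ (ENNReal.ofReal (|t| * (2 * Λ)) + 1) * eLpNorm g 2 volume := by
    intro g hg
    have : (fun x => radialMapDeriv G t x₀ x (g x))
        = (fun x => radialMapDeriv G t x₀ x (g x) - g x) + g := by ext1 x; simp
    rw [this, add_mul, one_mul]
    refine (eLpNorm_add_le ((aestronglyMeasurable_radialMapDeriv hG hg).sub hg) hg
      (by norm_num)).trans ?_
    gcongr
    exact eLpNorm_radialMapDeriv_le hΛ g
  have hφd : ∀ j, Differentiable ℝ (φ j) := fun j => (hφ j).1.differentiable (by simp)
  have hφσd : ∀ j, Differentiable ℝ fun x => φ j (σ x) := fun j =>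
    (hφd j).comp (hσs.differentiable (by simp))
  have hgrad : ∀ j x, gradient (fun x => φ j (σ x) - φ j x) x
      = radialMapDeriv G t x₀ x (gradient (φ j) (σ x)) - gradient (φ j) x := by
    intro j x
    rw [gradient_sub (hφσd j x) (hφd j x), gradient_comp_radialMap hG (hφd j)]
  have htest : ∀ j, IsTestFunction (ball x₀ R) fun x => φ j (σ x) - φ j x := by
    intro j
    have hs : tsupport (fun x => φ j (σ x) - φ j x) ⊆ closedBall x₀ b := by
      refine closure_minimal (fun y hy => ?_) isClosed_closedBall
      by_contra h
      rw [mem_closedBall, not_le, dist_eq_norm] at h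
      exact hy (by simp only [hσ, radialMap_of_le hb hG0 h.le, sub_self])
    exact ⟨((hφ j).1.comp hσs).sub (hφ j).1,
      (isCompact_closedBall x₀ b).of_isClosed_subset (isClosed_tsupport _) hs,
      hs.trans (closedBall_subset_ball hbR)⟩
  have two : (1 : ℝ≥0∞) ≤ 2 := by norm_num
  have htwo : (2 : ℝ≥0∞) ≠ ⊤ := by simp
  have hW : MemLp (fun x => u (σ x) - u x) 2 volume := by
    simp only [← e1]
    exact (memLp_comp_of_map_le two htwo hσm hvol hUm).sub hUm
  have hDUσ := memLp_comp_of_map_le two htwo hσm hvol hDUm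
  have hDW : MemLp (fun x => radialMapDeriv G t x₀ x (Du (σ x)) - Du x) 2 volume := by
    simp only [← e2]
    refine MemLp.sub ⟨aestronglyMeasurable_radialMapDeriv hG hDUσ.1, (hA _ hDUσ.1).trans_lt ?_⟩ hDUm
    exact ENNReal.mul_lt_top hfin.lt_top hDUσ.2
  have hle : ∀ {G : Type} [NormedAddCommGroup G] {f : ℕ → Euc n → G} {g : ℕ → ℝ≥0∞},
      (∀ j, eLpNorm (f j) 2 volume ≤ g j) → Tendsto g atTop (𝓝 0) →
      Tendsto (fun j => eLpNorm (f j) 2 (volume.restrict (ball x₀ R))) atTop (𝓝 0) := fun hfg hg =>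
    tendsto_of_tendsto_of_tendsto_of_le_of_le tendsto_const_nhds hg (fun _ => zero_le)
      fun j => (eLpNorm_mono_measure _ Measure.restrict_le_self).trans (hfg j)
  have hzero := memW12Zero_of_approx htest (hW.restrict (ball x₀ R)) (hDW.restrict _)
    (hle (g := fun j => 2 * eLpNorm (fun x => φ j x - U x) 2 volume
        + eLpNorm (fun x => φ j x - U x) 2 volume) (fun j => by
      have hm : MemLp (fun x => φ j x - U x) 2 volume := (hφ j).memLp.sub hUm
      have : (fun x => φ j (σ x) - φ j x - (u (σ x) - u x))
          = (fun x => φ j (σ x) - U (σ x)) - (fun x => φ j x - U x) := by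
        ext x; simp only [Pi.sub_apply, ← e1]; ring
      rw [this]
      refine (eLpNorm_sub_le (memLp_comp_of_map_le two htwo hσm hvol hm).1 hm.1 two).trans ?_
      gcongr
      exact eLpNorm_comp_le two htwo hm.1 hσm hvol) (by
      simpa using (ENNReal.Tendsto.const_mul hφ1 (Or.inr htwo)).add hφ1))
    (hle (g := fun j => (ENNReal.ofReal (|t| * (2 * Λ)) + 1) *
          (2 * eLpNorm (fun x => gradient (φ j) x - DU x) 2 volume)
        + eLpNorm (fun x => gradient (φ j) x - DU x) 2 volume) (fun j => by
      have hm : MemLp (fun x => gradient (φ j) x - DU x) 2 volume := (hφ j).memLp_gradient.sub hDUm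
      have hmσ := memLp_comp_of_map_le two htwo hσm hvol hm
      have : (fun x => gradient (fun x => φ j (σ x) - φ j x) x
            - (radialMapDeriv G t x₀ x (Du (σ x)) - Du x))
          = (fun x => radialMapDeriv G t x₀ x (gradient (φ j) (σ x) - DU (σ x)))
            - (fun x => gradient (φ j) x - DU x) := by
        ext1 x
        simp only [Pi.sub_apply, ← e2, hgrad, map_sub]
        abel
      rw [this]
      refine (eLpNorm_sub_le (aestronglyMeasurable_radialMapDeriv hG hmσ.1) hm.1 two).trans ?_
      gcongr
      refine (hA _ hmσ.1).trans ?_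
      gcongr
      exact eLpNorm_comp_le two htwo hm.1 hσm hvol) (by
      simpa using (ENNReal.Tendsto.const_mul (ENNReal.Tendsto.const_mul hφ2 (Or.inr htwo))
        (Or.inr hfin)).add hφ2))
  simpa using memK_add hu hzero

end

/-! ### The inner variation -/

section

variable {G : ℝ → ℝ} {b R t Λ : ℝ} {x₀ : Euc n}

theorem eventually_norm_radialMap_sub_le (hb : 0 ≤ b) (hG0 : ∀ s, b ^ 2 ≤ s → G s = 0)
    (hΛ : ∀ s, 0 ≤ s → |G s| ≤ Λ) (x₀ : Euc n) :
    ∀ δ > 0, ∀ᶠ t in 𝓝 (0 : ℝ), ∀ x, ‖radialMap G t x₀ x - x‖ ≤ δ := by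
  intro δ hδ
  have h : Tendsto (fun t : ℝ => |t| * (Λ * b)) (𝓝 0) (𝓝 0) := by
    have : Continuous fun t : ℝ => |t| * (Λ * b) := by fun_prop
    simpa using this.tendsto 0
  filter_upwards [h.eventually (gt_mem_nhds hδ)] with t ht x
  exact (norm_radialMap_sub_le hb hG0 hΛ x).trans ht.le

/-- Small radial deformations of a minimizer are admissible competitors. -/
theorem MinimizesOnBalls.eventually_energyJ_le {ε₀ : ℝ} (hmin : MinimizesOnBalls Q Ω u Du ε₀)
    (hε : 0 < ε₀) (hu : MemW12 (ball x₀ R) u Du) (hR : 0 < R) (hB : ball x₀ R ⊆ Ω)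
    (hG : ContDiff ℝ ∞ G) (hb : 0 ≤ b) (hbR : b < R) (hG0 : ∀ s, b ^ 2 ≤ s → G s = 0)
    (hΛ : ∀ s, 0 ≤ s → |G s| ≤ Λ ∧ |2 * deriv G s * s| ≤ Λ) :
    ∀ᶠ t in 𝓝 (0 : ℝ), MemW12 (ball x₀ R) (fun x => u (radialMap G t x₀ x))
        (fun x => radialMapDeriv G t x₀ x (Du (radialMap G t x₀ x))) ∧
      energyJ Q (ball x₀ R) u Du ≤ energyJ Q (ball x₀ R) (fun x => u (radialMap G t x₀ x))
        (fun x => radialMapDeriv G t x₀ x (Du (radialMap G t x₀ x))) := by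
  have two : (1 : ℝ≥0∞) ≤ 2 := by norm_num
  have htwo : (2 : ℝ≥0∞) ≠ ⊤ := by simp
  have hΛ0 : 0 ≤ Λ := (abs_nonneg _).trans (hΛ 0 le_rfl).1
  have hev := eventually_radialMap hG hΛ x₀
  have hσ : ∀ᶠ t in 𝓝 (0 : ℝ), Measurable (radialMap G t x₀) ∧
      Measure.map (radialMap G t x₀) volume ≤ (2 : ℝ≥0∞) • (volume : Measure (Euc n)) :=
    hev.mono fun t ht => ⟨(contDiff_radialMap hG t x₀).continuous.measurable, ht.2.1⟩
  have hclose := eventually_norm_radialMap_sub_le hb hG0 (fun s hs => (hΛ s hs).1) x₀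
  set F : Euc n → Euc n := (ball x₀ R).indicator Du with hF
  set f : Euc n → ℝ := (ball x₀ R).indicator (posChar u) with hf
  have hFm : MemLp F 2 volume := (memLp_indicator_iff_restrict measurableSet_ball).2 hu.memLp_grad
  have hfm : MemLp f 1 volume := by
    refine (memLp_indicator_iff_restrict measurableSet_ball).2 ?_
    refine MemLp.of_bound (aestronglyMeasurable_posChar hu.memLp.1) 1 (Eventually.of_forall ?_)
    intro x
    rw [Real.norm_of_nonneg (posChar_nonneg u x)]
    exact posChar_le_one u x
  have hT1 := tendsto_eLpNorm_comp_sub two htwo hσ hclose hFm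
  have hT2 := tendsto_eLpNorm_comp_sub le_rfl ENNReal.one_ne_top hσ hclose hfm
  set N : ℝ → ℝ≥0∞ := fun t => ENNReal.ofReal (|t| * (2 * Λ)) * (2 * eLpNorm F 2 volume)
    + eLpNorm (fun x => F (radialMap G t x₀ x) - F x) 2 volume with hN
  have hNlim : Tendsto N (𝓝 0) (𝓝 0) := by
    have h1 : Tendsto (fun t : ℝ => ENNReal.ofReal (|t| * (2 * Λ))) (𝓝 0) (𝓝 0) := by
      have : Continuous fun t : ℝ => ENNReal.ofReal (|t| * (2 * Λ)) :=
        ENNReal.continuous_ofReal.comp (by fun_prop)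
      simpa using this.tendsto 0
    have h2 := (ENNReal.Tendsto.mul_const h1 (b := 2 * eLpNorm F 2 volume)
      (Or.inr (ENNReal.mul_ne_top htwo hFm.2.ne))).add hT1
    rwa [zero_mul, zero_add] at h2
  have hlim : Tendsto (fun t => (N t ^ 2).toReal
      + (eLpNorm (fun x => f (radialMap G t x₀ x) - f x) 1 volume).toReal) (𝓝 0) (𝓝 0) := by
    have h1 := (ENNReal.tendsto_toReal (by simp)).comp (ENNReal.Tendsto.pow (n := 2) hNlim)
    have h2 := (ENNReal.tendsto_toReal (by simp)).comp hT2
    have := h1.add h2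
    simpa using this
  filter_upwards [hev, hlim.eventually (gt_mem_nhds hε), hNlim.eventually (gt_mem_nhds one_pos)]
    with t ht htε htN
  obtain ⟨hbij, hvol, -⟩ := ht
  have hσm : Measurable (radialMap G t x₀) := (contDiff_radialMap hG t x₀).continuous.measurable
  have hK := hu.memK_comp_radialMap hG hb hbR hG0 hΛ hbij.1 hvol
  refine ⟨hK.1, hmin x₀ R hR hB _ _ hK (lt_of_le_of_lt (add_le_add ?_ ?_) htε)⟩
  · have hFσ := memLp_comp_of_map_le two htwo hσm hvol hFm
    have hm1 : AEStronglyMeasurable (fun x => radialMapDeriv G t x₀ x (F (radialMap G t x₀ x))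
        - F (radialMap G t x₀ x)) volume :=
      (aestronglyMeasurable_radialMapDeriv hG hFσ.1).sub hFσ.1
    have e1 : ∫ y in ball x₀ R, ‖Du y - radialMapDeriv G t x₀ y (Du (radialMap G t x₀ y))‖ ^ 2
        = ∫ y in ball x₀ R, ‖(radialMapDeriv G t x₀ y (F (radialMap G t x₀ y))
            - F (radialMap G t x₀ y)) + (F (radialMap G t x₀ y) - F y)‖ ^ 2 := by
      refine setIntegral_congr_fun measurableSet_ball fun y hy => ?_
      have h2 := (radialMap_mem_ball_iff hb hG0 hbij.1 hbR.le y).2 hy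
      simp only [hF, indicator_of_mem hy, indicator_of_mem h2]
      rw [norm_sub_rev, sub_add_sub_cancel]
    have hm2 : AEStronglyMeasurable (fun x => (radialMapDeriv G t x₀ x (F (radialMap G t x₀ x))
        - F (radialMap G t x₀ x)) + (F (radialMap G t x₀ x) - F x)) volume :=
      hm1.add (hFσ.1.sub hFm.1)
    rw [e1, integral_norm_sq_eq_toReal hm2.restrict]
    refine ENNReal.toReal_mono (ENNReal.pow_ne_top (htN.trans ENNReal.one_lt_top).ne) ?_
    refine pow_le_pow_left₀ zero_le ?_ 2
    refine (eLpNorm_mono_measure _ Measure.restrict_le_self).trans ?_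
    refine (eLpNorm_add_le hm1 (hFσ.1.sub hFm.1) two).trans ?_
    refine add_le_add ?_ le_rfl
    refine (eLpNorm_radialMapDeriv_le hΛ _).trans ?_
    refine mul_le_mul' le_rfl ?_
    exact eLpNorm_comp_le two htwo hFm.1 hσm hvol
  · have hfσ := memLp_comp_of_map_le le_rfl ENNReal.one_ne_top hσm hvol hfm
    have hi : Integrable (fun x => f (radialMap G t x₀ x) - f x) :=
      (memLp_one_iff_integrable.1 hfσ).sub (memLp_one_iff_integrable.1 hfm)
    have e1 : (eLpNorm (fun x => f (radialMap G t x₀ x) - f x) 1 volume).toReal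
        = ∫ x, ‖f (radialMap G t x₀ x) - f x‖ := by
      rw [eLpNorm_one_eq_lintegral_enorm]
      exact (integral_norm_eq_lintegral_enorm hi.1).symm
    rw [e1]
    refine le_trans (le_of_eq ?_) (setIntegral_le_integral (s := ball x₀ R) hi.norm
      (Eventually.of_forall fun _ => norm_nonneg _))
    refine setIntegral_congr_fun measurableSet_ball fun y hy => ?_
    have h2 := (radialMap_mem_ball_iff hb hG0 hbij.1 hbR.le y).2 hy
    simp only [hf, indicator_of_mem hy, indicator_of_mem h2]
    rw [Real.norm_eq_abs, abs_sub_comm]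
    rfl

theorem hasDerivAt_dilation_det (n : ℕ) (e : ℝ × ℝ × ℝ) :
    HasDerivAt (fun t : ℝ => (1 + (t • e).1) ^ n * (1 + (t • e).2.1 / (1 + (t • e).1)))
      (n * e.1 + e.2.1) 0 := by
  have h1 : HasDerivAt (fun t : ℝ => 1 + t * e.1) e.1 0 := by
    simpa using ((hasDerivAt_id (0 : ℝ)).mul_const e.1).const_add 1
  have h2 : HasDerivAt (fun t : ℝ => t * e.2.1) e.2.1 0 := by
    simpa using (hasDerivAt_id (0 : ℝ)).mul_const e.2.1
  have h3 := (h1.pow n).mul ((h2.div h1 (by simp)).const_add 1)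
  refine h3.congr_deriv ?_
  simp

/-- The inequality obtained from the minimality of `u` among its compositions with radial
deformations. The parameter `s = ± 1` says whether one dilates or contracts; if `Q` were
homogeneous about `x₀` of degree `p / 2` one could take `κ = 0` and the bracket would vanish. -/
theorem MinimizesOnBalls.domain_variation {ε₀ : ℝ} (hmin : MinimizesOnBalls Q Ω u Du ε₀)
    (hε : 0 < ε₀) (hQ : Continuous Q) (hu : MemW12 (ball x₀ R) u Du) (hR : 0 < R)
    (hB : ball x₀ R ⊆ Ω) (hG : ContDiff ℝ ∞ G) (hb : 0 ≤ b) (hbR : b < R)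
    (hG0 : ∀ s, b ^ 2 ≤ s → G s = 0) (hGnn : ∀ s, 0 ≤ s → 0 ≤ G s) {p : ℝ} {κ : Euc n → ℝ}
    (hκ0 : ∀ y, 0 ≤ κ y) (hκ : IntegrableOn κ (ball x₀ b)) {s τ : ℝ} (hs : s = 1 ∨ s = -1)
    (hτ : 0 < τ) (hcomp : ∀ᵐ y ∂(volume.restrict (ball x₀ b)), ∀ l : ℝ, |l - 1| ≤ τ →
      0 ≤ s * (l - 1) → l ^ p * Q (x₀ + l⁻¹ • (y - x₀)) ^ 2 ≤ Q y ^ 2 + |l - 1| * κ y) :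
    0 ≤ s * ((∫ x in ball x₀ R, ((2 - n) * G (‖x - x₀‖ ^ 2)
            - 2 * deriv G (‖x - x₀‖ ^ 2) * ‖x - x₀‖ ^ 2) * ‖Du x‖ ^ 2)
          + (∫ x in ball x₀ R, (2 * (2 * deriv G (‖x - x₀‖ ^ 2))) * inner ℝ (x - x₀) (Du x) ^ 2)
          + ∫ x in ball x₀ R, (-p * G (‖x - x₀‖ ^ 2) - (n * G (‖x - x₀‖ ^ 2)
            + 2 * deriv G (‖x - x₀‖ ^ 2) * ‖x - x₀‖ ^ 2)) * (Q x ^ 2 * posChar u x))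
        + ∫ x in ball x₀ b, G (‖x - x₀‖ ^ 2) * κ x := by
  obtain ⟨Λ, hΛ0, hΛ⟩ := exists_bound_radial_profile hG hG0
  have hΛ' : ∀ s, 0 ≤ s → |G s| ≤ Λ ∧ |2 * deriv G s * s| ≤ Λ := fun s hs =>
    ⟨(hΛ s hs).1, (hΛ s hs).2.2⟩
  have hev := eventually_radialMap hG hΛ' x₀
  have hσ : ∀ᶠ t in 𝓝 (0 : ℝ), Measurable (radialMap G t x₀) ∧
      Measure.map (radialMap G t x₀) volume ≤ (2 : ℝ≥0∞) • (volume : Measure (Euc n)) :=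
    hev.mono fun t ht => ⟨(contDiff_radialMap hG t x₀).continuous.measurable, ht.2.1⟩
  have hclose := eventually_norm_radialMap_sub_le hb hG0 (fun s hs => (hΛ s hs).1) x₀
  have hGd : Continuous (deriv G) := hG.continuous_deriv (by simp)
  have hGc := hG.continuous
  set e : Euc n → ℝ × ℝ × ℝ := fun x => (G (‖x - x₀‖ ^ 2),
    2 * deriv G (‖x - x₀‖ ^ 2) * ‖x - x₀‖ ^ 2, 2 * deriv G (‖x - x₀‖ ^ 2)) with he
  have hem : Measurable e := by
    have : Continuous e := by fun_prop
    exact this.measurable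
  have heΛ : ∀ x, ‖e x‖ ≤ Λ := fun x => by
    obtain ⟨h1, h2, h3⟩ := hΛ (‖x - x₀‖ ^ 2) (by positivity)
    simp only [he, Prod.norm_def]
    exact max_le h1 (max_le h3 h2)
  have hin : IntegrableOn (fun x => ‖Du x‖ ^ 2) (ball x₀ R) := integrable_norm_sq hu.memLp_grad
  set B := ball x₀ R with hBdef
  set f₁ : Euc n → ℝ := B.indicator fun x => ‖Du x‖ ^ 2 with hf₁
  set f₂ : Euc n → ℝ := B.indicator fun x => inner ℝ (x - x₀) (Du x) ^ 2 with hf₂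
  set f₃ : Euc n → ℝ := B.indicator fun x => Q x ^ 2 * posChar u x with hf₃
  set f₄ : Euc n → ℝ := (ball x₀ b).indicator κ with hf₄
  have i₁ : Integrable f₁ := hin.integrable_indicator measurableSet_ball
  have i₂ : Integrable f₂ := by
    refine IntegrableOn.integrable_indicator ?_ measurableSet_ball
    refine (hin.const_mul (R ^ 2)).mono' ?_ ?_
    · have : AEStronglyMeasurable (fun x => inner ℝ (x - x₀) (Du x)) (volume.restrict B) :=
        (by fun_prop : Continuous fun x : Euc n => x - x₀).aestronglyMeasurable.inner
          hu.memLp_grad.1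
      exact this.pow 2
    · filter_upwards [ae_restrict_mem measurableSet_ball] with x hx
      rw [mem_ball, dist_eq_norm] at hx
      rw [Real.norm_of_nonneg (sq_nonneg _), ← mul_pow, ← sq_abs]
      gcongr
      exact (abs_real_inner_le_norm _ _).trans (by gcongr)
  have i₃ : Integrable f₃ :=
    (integrableOn_weight hQ hu.memLp.1).integrable_indicator measurableSet_ball
  have i₄ : Integrable f₄ := hκ.integrable_indicator measurableSet_ball
  set dt : ℝ × ℝ × ℝ → ℝ := fun e => (1 + e.1) ^ n * (1 + e.2.1 / (1 + e.1)) with hdt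
  have hdtd : DifferentiableAt ℝ dt 0 := by
    rw [hdt]
    fun_prop (disch := simp)
  have hdtm : Measurable dt := by fun_prop
  have hrd : DifferentiableAt ℝ (fun e : ℝ × ℝ × ℝ => (1 + e.1) ^ (-p)) 0 :=
    DifferentiableAt.rpow_const (by fun_prop) (Or.inl (by simp))
  have hlin : ∀ e : ℝ × ℝ × ℝ, HasDerivAt (fun t : ℝ => 1 + (t • e).1) e.1 0 := fun e => by
    simpa using ((hasDerivAt_id (0 : ℝ)).mul_const e.1).const_add 1
  have hrl : ∀ e : ℝ × ℝ × ℝ, HasDerivAt (fun t : ℝ => (1 + (t • e).1) ^ (-p)) (-p * e.1) 0 := by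
    intro e
    refine ((hlin e).rpow_const (Or.inl (by simp))).congr_deriv ?_
    simp
    ring
  obtain ⟨j₁, l₁⟩ := tendsto_integral_coeff_comp hσ hclose i₁
    (q := fun e => (1 + e.1) ^ 2 - dt e) (ℓ := fun e => (2 - n) * e.1 - e.2.1)
    ((by fun_prop : DifferentiableAt ℝ (fun e : ℝ × ℝ × ℝ => (1 + e.1) ^ 2) 0).sub hdtd)
    (by simp [hdt]) (by fun_prop) (fun e => by
      refine (((hlin e).pow 2).sub (hasDerivAt_dilation_det n e)).congr_deriv ?_
      simp
      ring) hem heΛ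
  obtain ⟨j₂, l₂⟩ := tendsto_integral_coeff_comp hσ hclose i₂
    (q := fun e => (2 * (1 + e.1) * e.2.2 + e.2.2 * e.2.1) * ((1 + e.1) ^ 2)⁻¹)
    (ℓ := fun e => 2 * e.2.2)
    (by fun_prop (disch := simp)) (by simp) (by fun_prop) (fun e => by
      have h1 : HasDerivAt (fun t : ℝ => t * e.2.2) e.2.2 0 := by
        simpa using (hasDerivAt_id (0 : ℝ)).mul_const e.2.2
      have h2 : HasDerivAt (fun t : ℝ => t * e.2.1) e.2.1 0 := by
        simpa using (hasDerivAt_id (0 : ℝ)).mul_const e.2.1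
      refine (((((hlin e).const_mul 2).mul h1).add (h1.mul h2)).mul
        (((hlin e).pow 2).inv (by simp))).congr_deriv ?_
      simp) hem heΛ
  obtain ⟨j₃, l₃⟩ := tendsto_integral_coeff_comp hσ hclose i₃
    (q := fun e => (1 + e.1) ^ (-p) - dt e) (ℓ := fun e => -p * e.1 - (n * e.1 + e.2.1))
    (hrd.sub hdtd) (by simp [hdt]) (by fun_prop)
    (fun e => (hrl e).sub (hasDerivAt_dilation_det n e)) hem heΛ
  obtain ⟨j₄, l₄⟩ := tendsto_integral_coeff_comp hσ hclose i₄
    (q := fun e => (1 + e.1) ^ (-p) * e.1) (ℓ := fun e => e.1)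
    (hrd.mul (by fun_prop)) (by simp) (by fun_prop) (fun e => by
      have h1 : HasDerivAt (fun t : ℝ => t * e.1) e.1 0 := by
        simpa using (hasDerivAt_id (0 : ℝ)).mul_const e.1
      refine ((hrl e).mul h1).congr_deriv ?_
      simp) hem heΛ
  have hind : ∀ (A : Set (Euc n)) (c f : Euc n → ℝ), MeasurableSet A →
      ∫ x in A, c x * f x = ∫ x, c x * A.indicator f x := by
    intro A c f hA
    rw [← integral_indicator hA]
    refine integral_congr_ae (Eventually.of_forall fun x => ?_)
    simp only [indicator_mul_right]
  rw [hind B _ _ measurableSet_ball, hind B _ _ measurableSet_ball, hind B _ _ measurableSet_ball,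
    hind (ball x₀ b) _ _ measurableSet_ball]
  have hsr : Tendsto (fun r : ℝ => s * r) (𝓝[>] 0) (𝓝[≠] 0) := by
    refine tendsto_nhdsWithin_iff.2 ⟨?_, ?_⟩
    · have : Continuous fun r : ℝ => s * r := by fun_prop
      simpa using (this.tendsto 0).mono_left (nhdsWithin_le_nhds (s := Ioi 0))
    · filter_upwards [self_mem_nhdsWithin] with r hr
      have hr' : 0 < r := hr
      rcases hs with rfl | rfl
      · simpa using hr'.ne'
      · simpa using hr'.ne'
  have hlim := ((((l₁.comp hsr).add (l₂.comp hsr)).add (l₃.comp hsr)).const_mul s).add (l₄.comp hsr)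
  refine ge_of_tendsto hlim ?_
  have htend : Tendsto (fun r : ℝ => s * r) (𝓝[>] 0) (𝓝 0) := hsr.mono_right nhdsWithin_le_nhds
  have htau : ∀ᶠ t in 𝓝 (0 : ℝ), |t| * Λ ≤ τ := by
    have h : Tendsto (fun t : ℝ => |t| * Λ) (𝓝 0) (𝓝 0) := by
      have : Continuous fun t : ℝ => |t| * Λ := by fun_prop
      simpa using this.tendsto 0
    filter_upwards [h.eventually (gt_mem_nhds hτ)] with t ht using ht.le
  filter_upwards [self_mem_nhdsWithin, hsr.eventually j₁, hsr.eventually j₂, hsr.eventually j₃,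
    hsr.eventually j₄, htend.eventually hev, htend.eventually htau,
    htend.eventually (hmin.eventually_energyJ_le hε hu hR hB hG hb hbR hG0 hΛ')]
    with r hr k₁ k₂ k₃ k₄ hgood htτ hen
  have hr0 : 0 < r := hr
  simp only [Function.comp_apply]
  set t := s * r with ht
  have hss : s * s = 1 := by rcases hs with rfl | rfl <;> norm_num
  have hsabs : |s| = 1 := by rcases hs with rfl | rfl <;> simp
  have htabs : |t| = r := by rw [ht, abs_mul, hsabs, one_mul, abs_of_pos hr0]
  have ht0 : t ≠ 0 := by
    intro h; rw [h, abs_zero] at htabs; exact hr0.ne htabs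
  obtain ⟨hbij, hvol, hpd⟩ := hgood
  obtain ⟨hvW, hen⟩ := hen
  have hmemB := radialMap_mem_ball_iff hb hG0 hbij.1 hbR.le
  have hmemb := radialMap_mem_ball_iff hb hG0 hbij.1 (le_refl b)
  have hcv := integral_ball_comp_radialMap hG hb hG0 hbij (fun x => (hpd x).2) hbR.le
    (fun x => ‖Du x‖ ^ 2 + Q x ^ 2 * posChar u x)
  have hi0 : IntegrableOn (fun x => ‖Du x‖ ^ 2 + Q x ^ 2 * posChar u x) (ball x₀ R) :=
    hin.add (integrableOn_weight hQ hu.memLp.1)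
  have hi1 := integrableOn_ball_comp_radialMap hG hb hG0 hbij (fun x => (hpd x).2) hbR.le
    hi0
  have hi2 : IntegrableOn (fun x => ‖radialMapDeriv G t x₀ x (Du (radialMap G t x₀ x))‖ ^ 2
      + Q x ^ 2 * posChar (fun x => u (radialMap G t x₀ x)) x) (ball x₀ R) :=
    (integrable_norm_sq hvW.memLp_grad).add (integrableOn_weight hQ hvW.memLp.1)
  rw [energyJ, energyJ, hcv, ← sub_nonneg, ← integral_sub hi2 hi1] at hen
  -- the integrand of the right-hand side
  set rhs : Euc n → ℝ := fun x =>
    t * (t⁻¹ * ((1 + (t • e x).1) ^ 2 - dt (t • e x)) * f₁ (radialMap G t x₀ x)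
      + t⁻¹ * ((2 * (1 + (t • e x).1) * (t • e x).2.2 + (t • e x).2.2 * (t • e x).2.1)
          * ((1 + (t • e x).1) ^ 2)⁻¹) * f₂ (radialMap G t x₀ x)
      + t⁻¹ * ((1 + (t • e x).1) ^ (-p) - dt (t • e x)) * f₃ (radialMap G t x₀ x))
    + r * (t⁻¹ * ((1 + (t • e x).1) ^ (-p) * (t • e x).1) * f₄ (radialMap G t x₀ x)) with hrhs
  have hrint : Integrable rhs := (((k₁.add k₂).add k₃).const_mul t).add (k₄.const_mul r)
  have hrval : ∫ x, rhs x = r * (s * ((∫ x, t⁻¹ * ((1 + (t • e x).1) ^ 2 - dt (t • e x))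
        * f₁ (radialMap G t x₀ x))
      + (∫ x, t⁻¹ * ((2 * (1 + (t • e x).1) * (t • e x).2.2 + (t • e x).2.2 * (t • e x).2.1)
          * ((1 + (t • e x).1) ^ 2)⁻¹) * f₂ (radialMap G t x₀ x))
      + ∫ x, t⁻¹ * ((1 + (t • e x).1) ^ (-p) - dt (t • e x)) * f₃ (radialMap G t x₀ x))
      + ∫ x, t⁻¹ * ((1 + (t • e x).1) ^ (-p) * (t • e x).1) * f₄ (radialMap G t x₀ x)) := by
    have h12 : Integrable fun x => t⁻¹ * ((1 + (t • e x).1) ^ 2 - dt (t • e x))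
        * f₁ (radialMap G t x₀ x)
      + t⁻¹ * ((2 * (1 + (t • e x).1) * (t • e x).2.2 + (t • e x).2.2 * (t • e x).2.1)
          * ((1 + (t • e x).1) ^ 2)⁻¹) * f₂ (radialMap G t x₀ x) := k₁.add k₂
    have h123 : Integrable fun x => t⁻¹ * ((1 + (t • e x).1) ^ 2 - dt (t • e x))
        * f₁ (radialMap G t x₀ x)
      + t⁻¹ * ((2 * (1 + (t • e x).1) * (t • e x).2.2 + (t • e x).2.2 * (t • e x).2.1)
          * ((1 + (t • e x).1) ^ 2)⁻¹) * f₂ (radialMap G t x₀ x)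
      + t⁻¹ * ((1 + (t • e x).1) ^ (-p) - dt (t • e x)) * f₃ (radialMap G t x₀ x) := h12.add k₃
    have e1 := integral_add (h123.const_mul t) (k₄.const_mul r)
    have e2 := integral_add h12 k₃
    have e3 := integral_add k₁ k₂
    simp only [hrhs]
    rw [e1, integral_const_mul, integral_const_mul, e2, e3, ht]
    ring
  have hroff : ∀ x, x ∉ ball x₀ R → rhs x = 0 := by
    intro x hx
    have h1 : radialMap G t x₀ x ∉ B := fun h => hx ((hmemB x).1 h)
    have h2 : radialMap G t x₀ x ∉ ball x₀ b := fun h => h1 (ball_subset_ball hbR.le h)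
    simp only [hrhs, hf₁, hf₂, hf₃, hf₄, indicator_of_notMem h1, indicator_of_notMem h2]
    ring
  have hac : Measure.map (radialMap G t x₀) volume ≪ (volume : Measure (Euc n)) :=
    (Measure.absolutelyContinuous_of_le hvol).trans Measure.smul_absolutelyContinuous
  have hcomp' : ∀ᵐ x : Euc n, radialMap G t x₀ x ∈ ball x₀ b → ∀ l : ℝ, |l - 1| ≤ τ →
      0 ≤ s * (l - 1) → l ^ p * Q (x₀ + l⁻¹ • (radialMap G t x₀ x - x₀)) ^ 2
        ≤ Q (radialMap G t x₀ x) ^ 2 + |l - 1| * κ (radialMap G t x₀ x) := by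
    have hm : Measurable (radialMap G t x₀) := (contDiff_radialMap hG t x₀).continuous.measurable
    exact ae_of_ae_map hm.aemeasurable (hac.ae_le ((ae_restrict_iff' measurableSet_ball).1 hcomp))
  have hmono : ∀ᵐ x ∂(volume.restrict (ball x₀ R)),
      (‖radialMapDeriv G t x₀ x (Du (radialMap G t x₀ x))‖ ^ 2
        + Q x ^ 2 * posChar (fun x => u (radialMap G t x₀ x)) x)
      - (radialMapDeriv G t x₀ x).det * (‖Du (radialMap G t x₀ x)‖ ^ 2
          + Q (radialMap G t x₀ x) ^ 2 * posChar u (radialMap G t x₀ x)) ≤ rhs x := by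
    filter_upwards [ae_restrict_of_ae hcomp', ae_restrict_mem measurableSet_ball] with x hx hxB
    obtain ⟨hp0, -⟩ := hpd x
    have hσB : radialMap G t x₀ x ∈ B := (hmemB x).2 hxB
    have hpc : posChar (fun x => u (radialMap G t x₀ x)) x = posChar u (radialMap G t x₀ x) := rfl
    rw [hpc]
    have he1 : (t • e x).1 = t * G (‖x - x₀‖ ^ 2) := rfl
    have he2 : (t • e x).2.1 = t * (2 * deriv G (‖x - x₀‖ ^ 2) * ‖x - x₀‖ ^ 2) := rfl
    have he3 : (t • e x).2.2 = t * (2 * deriv G (‖x - x₀‖ ^ 2)) := rfl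
    have hsub : radialMap G t x₀ x - x₀ = (1 + t * G (‖x - x₀‖ ^ 2)) • (x - x₀) := by
      rw [radialMap]; simp
    have hdet : (radialMapDeriv G t x₀ x).det = dt (t • e x) := by
      rw [det_radialMapDeriv hp0.ne', hdt]
      rfl
    have hv₁ : f₁ (radialMap G t x₀ x) = ‖Du (radialMap G t x₀ x)‖ ^ 2 := indicator_of_mem hσB _
    have hv₂ : f₂ (radialMap G t x₀ x) = (1 + t * G (‖x - x₀‖ ^ 2)) ^ 2
        * inner ℝ (x - x₀) (Du (radialMap G t x₀ x)) ^ 2 := by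
      rw [hf₂, indicator_of_mem hσB, hsub, inner_smul_left, RCLike.conj_to_real, mul_pow]
    have hv₃ : f₃ (radialMap G t x₀ x)
        = Q (radialMap G t x₀ x) ^ 2 * posChar u (radialMap G t x₀ x) := indicator_of_mem hσB _
    simp only [hrhs, hv₁, hv₂, hv₃]
    rw [hdet, norm_radialMapDeriv_sq]
    have hl : (1 : ℝ) + (t • e x).1 = 1 + t * G (‖x - x₀‖ ^ 2) := by rw [he1]
    rw [hl, he2, he3]
    set l := 1 + t * G (‖x - x₀‖ ^ 2) with hldef
    set χ := posChar u (radialMap G t x₀ x) with hχ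
    have hχ0 : 0 ≤ χ := posChar_nonneg _ _
    have hχ1 : χ ≤ 1 := posChar_le_one _ _
    -- the only inequality: comparison of the weights
    have hweight : Q x ^ 2 * χ ≤ l ^ (-p) * (Q (radialMap G t x₀ x) ^ 2 * χ)
        + r * (t⁻¹ * (l ^ (-p) * (t • e x).1) * f₄ (radialMap G t x₀ x)) := by
      by_cases hxb : x ∈ ball x₀ b
      · have hσb : radialMap G t x₀ x ∈ ball x₀ b := (hmemb x).2 hxb
        have hGx : 0 ≤ G (‖x - x₀‖ ^ 2) := hGnn _ (by positivity)
        have hl1 : l - 1 = t * G (‖x - x₀‖ ^ 2) := by rw [hldef]; ring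
        have hl2 : |l - 1| = r * G (‖x - x₀‖ ^ 2) := by
          rw [hl1, abs_mul, htabs, abs_of_nonneg hGx]
        have h1 := hx hσb l (by
          rw [hl1, abs_mul]
          refine le_trans ?_ htτ
          gcongr
          exact (hΛ _ (by positivity)).1) (by
          rw [hl1, ht, ← mul_assoc, ← mul_assoc, hss, one_mul]; positivity)
        have hback : x₀ + l⁻¹ • (radialMap G t x₀ x - x₀) = x := by
          rw [hsub, smul_smul, inv_mul_cancel₀ hp0.ne', one_smul, add_sub_cancel]
        rw [hback, hl2] at h1
        have hκx := hκ0 (radialMap G t x₀ x)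
        have hlp : l ^ (-p) * l ^ p = 1 := by
          rw [← Real.rpow_add hp0, neg_add_cancel, Real.rpow_zero]
        have hlp0 : 0 < l ^ (-p) := Real.rpow_pos_of_pos hp0 _
        have hv₄ : f₄ (radialMap G t x₀ x) = κ (radialMap G t x₀ x) := indicator_of_mem hσb _
        rw [hv₄, he1]
        calc Q x ^ 2 * χ = l ^ (-p) * (l ^ p * Q x ^ 2) * χ := by
              rw [← mul_assoc, hlp, one_mul]
          _ ≤ l ^ (-p) * (Q (radialMap G t x₀ x) ^ 2
                + r * G (‖x - x₀‖ ^ 2) * κ (radialMap G t x₀ x)) * χ := by gcongr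
          _ = l ^ (-p) * (Q (radialMap G t x₀ x) ^ 2 * χ)
                + r * (l ^ (-p) * G (‖x - x₀‖ ^ 2)) * κ (radialMap G t x₀ x) * χ := by ring
          _ ≤ l ^ (-p) * (Q (radialMap G t x₀ x) ^ 2 * χ)
                + r * (l ^ (-p) * G (‖x - x₀‖ ^ 2)) * κ (radialMap G t x₀ x) * 1 := by gcongr
          _ = _ := by field_simp
      · have hge : b ≤ ‖x - x₀‖ := by rwa [mem_ball, not_lt, dist_eq_norm] at hxb
        have hσx : radialMap G t x₀ x = x := radialMap_of_le hb hG0 hge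
        have hG00 : G (‖x - x₀‖ ^ 2) = 0 := hG0 _ (by gcongr)
        have hl1 : l = 1 := by rw [hldef, hG00]; ring
        rw [he1, hl1, hσx, hG00]
        simp
    have hexp : t * (t⁻¹ * (l ^ 2 - dt (t • e x)) * ‖Du (radialMap G t x₀ x)‖ ^ 2
          + t⁻¹ * ((2 * l * (t * (2 * deriv G (‖x - x₀‖ ^ 2))) + t * (2 * deriv G (‖x - x₀‖ ^ 2))
              * (t * (2 * deriv G (‖x - x₀‖ ^ 2) * ‖x - x₀‖ ^ 2))) * (l ^ 2)⁻¹)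
            * (l ^ 2 * inner ℝ (x - x₀) (Du (radialMap G t x₀ x)) ^ 2)
          + t⁻¹ * (l ^ (-p) - dt (t • e x)) * (Q (radialMap G t x₀ x) ^ 2 * χ))
        = (l ^ 2 - dt (t • e x)) * ‖Du (radialMap G t x₀ x)‖ ^ 2
          + (2 * l * (t * (2 * deriv G (‖x - x₀‖ ^ 2))) + t * (2 * deriv G (‖x - x₀‖ ^ 2))
              * (t * (2 * deriv G (‖x - x₀‖ ^ 2) * ‖x - x₀‖ ^ 2)))
            * inner ℝ (x - x₀) (Du (radialMap G t x₀ x)) ^ 2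
          + (l ^ (-p) - dt (t • e x)) * (Q (radialMap G t x₀ x) ^ 2 * χ) := by
      have hl0 : l ≠ 0 := hp0.ne'
      field_simp
    rw [hexp]
    linarith
  have h1 := integral_mono_ae (hi2.sub hi1) hrint.restrict hmono
  have h2 : ∫ x in ball x₀ R, rhs x = ∫ x, rhs x :=
    setIntegral_eq_integral_of_forall_compl_eq_zero hroff
  rw [h2, hrval] at h1
  have h3 := hen.trans h1
  exact nonneg_of_mul_nonneg_right h3 hr0

end

/-! ### The Pohozaev inequalities -/

/-- Polar coordinates for an integrand with a radial factor. -/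
theorem integral_ball_radial_mul (hn : 0 < n) {f : Euc n → ℝ} {g : ℝ → ℝ} {x₀ : Euc n} {R : ℝ}
    (hR : 0 ≤ R) (hg : Continuous g) (hf : IntegrableOn f (ball x₀ R)) :
    IntegrableOn (fun x => g ‖x - x₀‖ * f x) (ball x₀ R) ∧
    ∫ x in ball x₀ R, g ‖x - x₀‖ * f x = ∫ ρ in (0 : ℝ)..R, g ρ * sphereIntegral x₀ ρ f := by
  obtain ⟨K, hK⟩ := (isCompact_Icc (a := (0 : ℝ)) (b := R)).exists_bound_of_continuousOn
    hg.continuousOn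
  have hi : IntegrableOn (fun x => g ‖x - x₀‖ * f x) (ball x₀ R) := by
    refine hf.bdd_mul (c := K)
      (by fun_prop : Continuous fun x : Euc n => g ‖x - x₀‖).aestronglyMeasurable ?_
    filter_upwards [ae_restrict_mem measurableSet_ball] with x hx
    rw [mem_ball, dist_eq_norm] at hx
    exact hK _ ⟨norm_nonneg _, hx.le⟩
  refine ⟨hi, ?_⟩
  rw [(polar_ball hn hi).2.2 R ⟨hR, le_rfl⟩]
  refine intervalIntegral.integral_congr fun ρ hρ => ?_
  rw [uIcc_of_le hR] at hρ
  exact sphereIntegral_radial_mul x₀ hρ.1 g _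

/-- A pointwise almost everywhere bound obtained by testing with bumps concentrating at a
Lebesgue point. -/
theorem ae_nonneg_of_forall_bump {f k : ℝ → ℝ} {r₁ : ℝ} (hf : LocallyIntegrable f)
    (hk : ∀ ρ, 0 < ρ → ContinuousAt k ρ)
    (h : ∀ (g : ℝ → ℝ) (a b : ℝ), ContDiff ℝ ∞ g → (∀ ρ, 0 ≤ g ρ) → 0 < a → a ≤ b → b < r₁ →
      (∀ ρ, ρ ∉ Icc a b → g ρ = 0) → 0 ≤ (∫ ρ, g ρ * f ρ) + (∫ ρ, g ρ) * k b) :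
    ∀ᵐ ρ : ℝ, ρ ∈ Ioo 0 r₁ → 0 ≤ f ρ + k ρ := by
  have hpos : ∀ j : ℕ, (0 : ℝ) < 1 / ((j : ℝ) + 1) := fun j => by positivity
  set φ : ℕ → ContDiffBump (0 : ℝ) := fun j =>
    ⟨1 / ((j : ℝ) + 1) / 2, 1 / ((j : ℝ) + 1), half_pos (hpos j), half_lt_self (hpos j)⟩ with hφ
  have hout : Tendsto (fun j => (φ j).rOut) atTop (𝓝 0) :=
    tendsto_one_div_add_atTop_nhds_zero_nat
  have hKj : ∀ᶠ j in atTop, (φ j).rOut ≤ 2 * (φ j).rIn :=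
    Eventually.of_forall fun j => le_of_eq (by simp only [hφ]; ring)
  filter_upwards [ContDiffBump.ae_convolution_tendsto_right_of_locallyIntegrable hout hKj hf]
    with ρ hlim hρ
  have hkb : Tendsto (fun j => k (ρ + (φ j).rOut)) atTop (𝓝 (k ρ)) := by
    have h1 : Tendsto (fun j => ρ + (φ j).rOut) atTop (𝓝 ρ) := by simpa using hout.const_add ρ
    exact (hk ρ hρ.1).tendsto.comp h1
  refine ge_of_tendsto (hlim.add hkb) ?_
  filter_upwards [hout.eventually (gt_mem_nhds hρ.1),
    hout.eventually (gt_mem_nhds (sub_pos.2 hρ.2))] with j hj1 hj2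
  have := h (fun τ => (φ j).normed volume (ρ - τ)) (ρ - (φ j).rOut) (ρ + (φ j).rOut)
    ((φ j).contDiff_normed.comp (contDiff_const.sub contDiff_id)) (fun τ => (φ j).nonneg_normed _)
    (by linarith) (by linarith [(φ j).rOut_pos]) (by linarith) (fun τ hτ => by
      rw [← Function.notMem_support, (φ j).support_normed_eq, mem_ball_zero_iff, Real.norm_eq_abs,
        abs_lt]
      rintro ⟨h1, h2⟩
      exact hτ ⟨by linarith, by linarith⟩)
  have e1 : ∫ τ, (φ j).normed volume (ρ - τ) = 1 := by
    rw [integral_sub_left_eq_self (fun τ => (φ j).normed volume τ)]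
    exact (φ j).integral_normed
  rw [e1, one_mul] at this
  rw [convolution_lsmul_swap]
  exact this

/-- The defect in the radial Rellich–Pohozaev identity of radius `ρ` about `x₀`, for a weight `Q²`
that is homogeneous of degree `p`. The third term is `2 ρ ∫ (∂_η u)²`. -/
noncomputable def pohozaevDefect (p : ℝ) (Q u : Euc n → ℝ) (Du : Euc n → Euc n) (x₀ : Euc n)
    (ρ : ℝ) : ℝ :=
  (2 - n) * (∫ x in ball x₀ ρ, ‖Du x‖ ^ 2) + ρ * sphereIntegral x₀ ρ (fun x => ‖Du x‖ ^ 2)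
    - 2 * sphereIntegral x₀ ρ (fun x => ‖x - x₀‖⁻¹ * inner ℝ (x - x₀) (Du x) ^ 2)
    - (n + p) * (∫ x in ball x₀ ρ, Q x ^ 2 * posChar u x)
    + ρ * sphereIntegral x₀ ρ (fun x => Q x ^ 2 * posChar u x)

theorem integrableOn_radial_component {x₀ : Euc n} {R : ℝ}
    (hu : MemLp Du 2 (volume.restrict (ball x₀ R))) :
    IntegrableOn (fun x => ‖x - x₀‖⁻¹ * inner ℝ (x - x₀) (Du x) ^ 2) (ball x₀ R) := by
  refine ((integrable_norm_sq hu).const_mul R).mono' ?_ ?_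
  · have h1 : AEStronglyMeasurable (fun x => inner ℝ (x - x₀) (Du x))
        (volume.restrict (ball x₀ R)) :=
      (by fun_prop : Continuous fun x : Euc n => x - x₀).aestronglyMeasurable.inner hu.1
    have h2 : Measurable fun x : Euc n => ‖x - x₀‖⁻¹ := by fun_prop
    exact h2.aestronglyMeasurable.mul (h1.pow 2)
  · filter_upwards [ae_restrict_mem measurableSet_ball] with x hx
    rw [mem_ball, dist_eq_norm] at hx
    rw [Real.norm_of_nonneg (by positivity)]
    rcases (norm_nonneg (x - x₀)).eq_or_lt with h0 | h0
    · rw [← h0, inv_zero, zero_mul]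
      have := (norm_nonneg (x - x₀)).trans_lt hx
      positivity
    · calc ‖x - x₀‖⁻¹ * inner ℝ (x - x₀) (Du x) ^ 2
          ≤ ‖x - x₀‖⁻¹ * (‖x - x₀‖ * ‖Du x‖) ^ 2 := by
            gcongr ?_ * ?_
            rw [← sq_abs]
            gcongr
            exact abs_real_inner_le_norm _ _
        _ = ‖x - x₀‖ * ‖Du x‖ ^ 2 := by field_simp
        _ ≤ R * ‖Du x‖ ^ 2 := by gcongr

theorem integrableOn_pohozaevDefect (hn : 0 < n) (hQ : Continuous Q) {x₀ : Euc n} {R : ℝ}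
    (hR : 0 ≤ R) (hu : MemW12 (ball x₀ R) u Du) (p : ℝ) :
    IntegrableOn (pohozaevDefect p Q u Du x₀) (Ioo 0 R) := by
  obtain ⟨-, d1, D1⟩ := polar_ball hn (integrable_norm_sq hu.memLp_grad)
  obtain ⟨-, e1, -⟩ := polar_ball hn (integrableOn_radial_component hu.memLp_grad)
  obtain ⟨-, v1, V1⟩ := polar_ball hn (integrableOn_weight hQ hu.memLp.1)
  have hprim : ∀ (g : ℝ → ℝ) (f : ℝ → ℝ), IntegrableOn f (Ioo 0 R) →
      (∀ r ∈ Icc 0 R, g r = ∫ ρ in (0 : ℝ)..r, f ρ) → IntegrableOn g (Ioo 0 R) := by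
    intro g f hf hg
    have hfi : IntervalIntegrable f volume 0 R :=
      (intervalIntegrable_iff_integrableOn_Ioo_of_le hR).2 hf
    have hac := hfi.absolutelyContinuousOnInterval_intervalIntegral (c := 0) (by simp)
    have hc := hac.continuousOn
    rw [uIcc_of_le hR] at hc
    refine ((hc.integrableOn_Icc).mono_set Ioo_subset_Icc_self).congr_fun (fun r hr => ?_)
      measurableSet_Ioo
    exact (hg r ⟨hr.1.le, hr.2.le⟩).symm
  have hmul : ∀ f : ℝ → ℝ, IntegrableOn f (Ioo 0 R) → IntegrableOn (fun ρ => ρ * f ρ) (Ioo 0 R) := by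
    intro f hf
    refine hf.bdd_mul (c := R) continuous_id.aestronglyMeasurable ?_
    filter_upwards [ae_restrict_mem measurableSet_Ioo] with x hx
    exact (Real.norm_of_nonneg hx.1.le).trans_le hx.2.le
  exact (((((hprim _ _ d1 D1).const_mul (2 - (n : ℝ))).add (hmul _ d1)).sub (e1.const_mul 2)).sub
    ((hprim _ _ v1 V1).const_mul (n + p))).add (hmul _ v1)

/-- The inner variation inequality in polar coordinates, after an integration by parts. -/
theorem MinimizesOnBalls.integral_mul_pohozaevDefect {ε₀ : ℝ}
    (hmin : MinimizesOnBalls Q Ω u Du ε₀)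
    (hε : 0 < ε₀) (hn : 0 < n) (hQ : Continuous Q) {x₀ : Euc n} {R : ℝ}
    (hu : MemW12 (ball x₀ R) u Du) (hR : 0 < R)
    (hB : ball x₀ R ⊆ Ω) {a b : ℝ} {h : ℝ → ℝ} (hh : ContDiff ℝ ∞ h) (hh0 : ∀ ρ, 0 ≤ h ρ)
    (ha : 0 < a) (hab : a ≤ b) (hbR : b < R) (hs : ∀ ρ, ρ ∉ Icc a b → h ρ = 0)
    {p : ℝ} {κ : Euc n → ℝ}
    (hκ0 : ∀ y, 0 ≤ κ y) (hκ : IntegrableOn κ (ball x₀ b)) {s τ : ℝ} (hs1 : s = 1 ∨ s = -1)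
    (hτ : 0 < τ) (hcomp : ∀ᵐ y ∂(volume.restrict (ball x₀ b)), ∀ l : ℝ, |l - 1| ≤ τ →
      0 ≤ s * (l - 1) → l ^ p * Q (x₀ + l⁻¹ • (y - x₀)) ^ 2 ≤ Q y ^ 2 + |l - 1| * κ y) :
    0 ≤ s * (∫ ρ in (0 : ℝ)..R, h ρ * pohozaevDefect p Q u Du x₀ ρ)
      + (∫ ρ, h ρ) * ∫ x in ball x₀ b, κ x := by
  obtain ⟨G, hG, hG0, hGd, hGi⟩ := exists_radial_profile hh ha hab hs
  have hb : 0 < b := ha.trans_le hab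
  have hhi : Integrable h := by
    refine hh.continuous.integrable_of_hasCompactSupport ?_
    exact HasCompactSupport.intro isCompact_Icc hs
  have hGnn : ∀ s, 0 ≤ s → 0 ≤ G s := by
    intro s hs
    rcases le_or_gt (b ^ 2) s with h1 | h1
    · rw [hG0 s h1]
    · rw [← Real.sq_sqrt hs, hGi _ (Real.sqrt_nonneg s)]
      refine intervalIntegral.integral_nonneg ?_ fun _ _ => hh0 _
      exact Real.sqrt_le_iff.2 ⟨hb.le, h1.le⟩
  have hGle : ∀ ρ, 0 ≤ ρ → ρ ≤ b → G (ρ ^ 2) ≤ ∫ ρ, h ρ := by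
    intro ρ h0 h1
    rw [hGi ρ h0, intervalIntegral.integral_of_le h1]
    exact setIntegral_le_integral hhi (Eventually.of_forall hh0)
  have key := hmin.domain_variation hε hQ hu hR hB hG hb.le hbR hG0 hGnn hκ0 hκ hs1 hτ hcomp
  have hGdc : Continuous (deriv G) := hG.continuous_deriv (by simp)
  have hGc := hG.continuous
  have iD : IntegrableOn (fun x => ‖Du x‖ ^ 2) (ball x₀ R) := integrable_norm_sq hu.memLp_grad
  have iE := integrableOn_radial_component hu.memLp_grad
  have iV := integrableOn_weight hQ hu.memLp.1
  obtain ⟨-, d1, D1⟩ := polar_ball hn iD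
  obtain ⟨-, e1, -⟩ := polar_ball hn iE
  obtain ⟨-, v1, V1⟩ := polar_ball hn iV
  set d : ℝ → ℝ := fun ρ => sphereIntegral x₀ ρ fun x => ‖Du x‖ ^ 2 with hd
  set e : ℝ → ℝ := fun ρ => sphereIntegral x₀ ρ
    fun x => ‖x - x₀‖⁻¹ * inner ℝ (x - x₀) (Du x) ^ 2 with he
  set v : ℝ → ℝ := fun ρ => sphereIntegral x₀ ρ fun x => Q x ^ 2 * posChar u x with hv
  have d2 : IntervalIntegrable d volume 0 R :=
    (intervalIntegrable_iff_integrableOn_Ioo_of_le hR.le).2 d1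
  have e2 : IntervalIntegrable e volume 0 R :=
    (intervalIntegrable_iff_integrableOn_Ioo_of_le hR.le).2 e1
  have v2 : IntervalIntegrable v volume 0 R :=
    (intervalIntegrable_iff_integrableOn_Ioo_of_le hR.le).2 v1
  have hGR : G (R ^ 2) = 0 := hG0 _ (by gcongr)
  have hGcont : ∀ S : Set ℝ, ContinuousOn (fun ρ : ℝ => G (ρ ^ 2)) S := fun S => by fun_prop
  have hhcont : ∀ S : Set ℝ, ContinuousOn h S := fun S => hh.continuous.continuousOn
  have hr := fun ρ (hρ : ρ ∈ uIcc 0 R) => (by rwa [uIcc_of_le hR.le] at hρ : ρ ∈ Icc 0 R)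
  have L1 : ∫ x in ball x₀ R, ((2 - n) * G (‖x - x₀‖ ^ 2)
      - 2 * deriv G (‖x - x₀‖ ^ 2) * ‖x - x₀‖ ^ 2) * ‖Du x‖ ^ 2
      = ∫ ρ in (0 : ℝ)..R, h ρ * ((2 - n) * (∫ x in ball x₀ ρ, ‖Du x‖ ^ 2) + ρ * d ρ) := by
    rw [(integral_ball_radial_mul hn hR.le (g := fun ρ => (2 - n) * G (ρ ^ 2)
      - 2 * deriv G (ρ ^ 2) * ρ ^ 2) (by fun_prop) iD).2]
    have e0 : ∀ ρ ∈ uIcc 0 R, ((2 - n) * G (ρ ^ 2) - 2 * deriv G (ρ ^ 2) * ρ ^ 2) * d ρ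
        = (2 - n) * (G (ρ ^ 2) * d ρ) + h ρ * (ρ * d ρ) := by
      intro ρ hρ
      linear_combination (-ρ * d ρ) * hGd ρ (hr ρ hρ).1
    have e3 : ∀ ρ ∈ uIcc 0 R, h ρ * ((2 - n) * (∫ x in ball x₀ ρ, ‖Du x‖ ^ 2) + ρ * d ρ)
        = (2 - n) * (h ρ * ∫ τ in (0 : ℝ)..ρ, d τ) + h ρ * (ρ * d ρ) := by
      intro ρ hρ
      rw [D1 ρ (hr ρ hρ)]; ring
    have i1 : IntervalIntegrable (fun ρ => h ρ * (ρ * d ρ)) volume 0 R :=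
      (d2.continuousOn_mul continuousOn_id).continuousOn_mul (hhcont _)
    have i2 : IntervalIntegrable (fun ρ => h ρ * ∫ τ in (0 : ℝ)..ρ, d τ) volume 0 R :=
      ((hhcont _).mul (d2.absolutelyContinuousOnInterval_intervalIntegral (c := 0)
        (by simp)).continuousOn).intervalIntegrable
    rw [intervalIntegral.integral_congr e0, intervalIntegral.integral_congr e3,
      intervalIntegral.integral_add ((d2.continuousOn_mul (hGcont _)).const_mul (2 - (n : ℝ))) i1,
      intervalIntegral.integral_add (i2.const_mul (2 - (n : ℝ))) i1, intervalIntegral.integral_const_mul,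
      intervalIntegral.integral_const_mul, integral_profile_mul hG hR.le hGR hGd d2]
  have L2 : ∫ x in ball x₀ R, (2 * (2 * deriv G (‖x - x₀‖ ^ 2))) * inner ℝ (x - x₀) (Du x) ^ 2
      = ∫ ρ in (0 : ℝ)..R, h ρ * (- (2 * e ρ)) := by
    have h1 : ∀ x : Euc n, (2 * (2 * deriv G (‖x - x₀‖ ^ 2))) * inner ℝ (x - x₀) (Du x) ^ 2
        = (fun ρ : ℝ => 2 * (2 * ρ * deriv G (ρ ^ 2))) ‖x - x₀‖
          * (‖x - x₀‖⁻¹ * inner ℝ (x - x₀) (Du x) ^ 2) := by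
      intro x
      rcases eq_or_ne x x₀ with rfl | hx
      · simp
      · have : ‖x - x₀‖ ≠ 0 := norm_ne_zero_iff.2 (sub_ne_zero.2 hx)
        simp only
        field_simp
    simp only [h1]
    rw [(integral_ball_radial_mul hn hR.le (g := fun ρ => 2 * (2 * ρ * deriv G (ρ ^ 2)))
      (by fun_prop) iE).2]
    refine intervalIntegral.integral_congr fun ρ hρ => ?_
    rw [hGd ρ (hr ρ hρ).1]; ring
  have L3 : ∫ x in ball x₀ R, (-p * G (‖x - x₀‖ ^ 2) - (n * G (‖x - x₀‖ ^ 2)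
      + 2 * deriv G (‖x - x₀‖ ^ 2) * ‖x - x₀‖ ^ 2)) * (Q x ^ 2 * posChar u x)
      = ∫ ρ in (0 : ℝ)..R, h ρ * (-(n + p) * (∫ x in ball x₀ ρ, Q x ^ 2 * posChar u x)
          + ρ * v ρ) := by
    rw [(integral_ball_radial_mul hn hR.le (g := fun ρ => -p * G (ρ ^ 2) - (n * G (ρ ^ 2)
      + 2 * deriv G (ρ ^ 2) * ρ ^ 2)) (by fun_prop) iV).2]
    have e0 : ∀ ρ ∈ uIcc 0 R, (-p * G (ρ ^ 2) - (n * G (ρ ^ 2)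
          + 2 * deriv G (ρ ^ 2) * ρ ^ 2)) * v ρ
        = -(n + p) * (G (ρ ^ 2) * v ρ) + h ρ * (ρ * v ρ) := by
      intro ρ hρ
      linear_combination (-ρ * v ρ) * hGd ρ (hr ρ hρ).1
    have e3 : ∀ ρ ∈ uIcc 0 R, h ρ * (-(n + p) * (∫ x in ball x₀ ρ, Q x ^ 2 * posChar u x)
          + ρ * v ρ) = -(n + p) * (h ρ * ∫ τ in (0 : ℝ)..ρ, v τ) + h ρ * (ρ * v ρ) := by
      intro ρ hρ
      rw [V1 ρ (hr ρ hρ)]; ring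
    have i1 : IntervalIntegrable (fun ρ => h ρ * (ρ * v ρ)) volume 0 R :=
      (v2.continuousOn_mul continuousOn_id).continuousOn_mul (hhcont _)
    have i2 : IntervalIntegrable (fun ρ => h ρ * ∫ τ in (0 : ℝ)..ρ, v τ) volume 0 R :=
      ((hhcont _).mul (v2.absolutelyContinuousOnInterval_intervalIntegral (c := 0)
        (by simp)).continuousOn).intervalIntegrable
    rw [intervalIntegral.integral_congr e0, intervalIntegral.integral_congr e3,
      intervalIntegral.integral_add ((v2.continuousOn_mul (hGcont _)).const_mul (-(n + p))) i1,
      intervalIntegral.integral_add (i2.const_mul (-(n + p))) i1, intervalIntegral.integral_const_mul,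
      intervalIntegral.integral_const_mul, integral_profile_mul hG hR.le hGR hGd v2]
  have hprim : ∀ (g f : ℝ → ℝ), IntervalIntegrable f volume 0 R →
      (∀ r ∈ Icc 0 R, g r = ∫ ρ in (0 : ℝ)..r, f ρ) → IntervalIntegrable g volume 0 R := by
    intro g f hf hg
    refine ContinuousOn.intervalIntegrable ?_
    refine (hf.absolutelyContinuousOnInterval_intervalIntegral (c := 0)
      (by simp)).continuousOn.congr fun r hr' => hg r (hr r hr')
  have j1 : IntervalIntegrable (fun ρ => h ρ * ((2 - n) * (∫ x in ball x₀ ρ, ‖Du x‖ ^ 2)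
      + ρ * d ρ)) volume 0 R :=
    (((hprim _ _ d2 D1).const_mul _).add (d2.continuousOn_mul continuousOn_id)).continuousOn_mul
      (hhcont _)
  have j2 : IntervalIntegrable (fun ρ => h ρ * (- (2 * e ρ))) volume 0 R :=
    (e2.const_mul 2).neg.continuousOn_mul (hhcont _)
  have j3 : IntervalIntegrable (fun ρ => h ρ * (-(n + p) * (∫ x in ball x₀ ρ,
      Q x ^ 2 * posChar u x) + ρ * v ρ)) volume 0 R :=
    (((hprim _ _ v2 V1).const_mul _).add (v2.continuousOn_mul continuousOn_id)).continuousOn_mul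
      (hhcont _)
  have j12 : IntervalIntegrable (fun ρ => h ρ * ((2 - n) * (∫ x in ball x₀ ρ, ‖Du x‖ ^ 2)
      + ρ * d ρ) + h ρ * (- (2 * e ρ))) volume 0 R := j1.add j2
  rw [L1, L2, L3, ← intervalIntegral.integral_add j1 j2,
    ← intervalIntegral.integral_add j12 j3] at key
  have hsum : ∫ ρ in (0 : ℝ)..R, h ρ * pohozaevDefect p Q u Du x₀ ρ
      = ∫ ρ in (0 : ℝ)..R, (h ρ * ((2 - n) * (∫ x in ball x₀ ρ, ‖Du x‖ ^ 2) + ρ * d ρ)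
        + h ρ * (- (2 * e ρ))) + h ρ * (-(n + p) * (∫ x in ball x₀ ρ,
          Q x ^ 2 * posChar u x) + ρ * v ρ) := by
    refine intervalIntegral.integral_congr fun ρ _ => ?_
    simp only [pohozaevDefect, hd, he, hv]
    ring
  rw [hsum]
  refine key.trans (add_le_add le_rfl ?_)
  rw [← integral_const_mul]
  refine setIntegral_mono_on ?_ (hκ.const_mul _) measurableSet_ball fun x hx => ?_
  · exact (integral_ball_radial_mul hn hb.le (g := fun ρ => G (ρ ^ 2)) (by fun_prop) hκ).1
  · rw [mem_ball, dist_eq_norm] at hx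
    exact mul_le_mul_of_nonneg_right (hGle _ (norm_nonneg _) hx.le) (hκ0 x)

theorem continuous_distWeight {γ : ℝ} (hγ : 0 < γ) (Γ : Set (Euc n)) :
    Continuous (distWeight γ Γ) :=
  (continuous_infDist_pt Γ).rpow_const fun _ => Or.inr hγ.le

theorem distWeight_sq {γ : ℝ} (Γ : Set (Euc n)) (x : Euc n) :
    distWeight γ Γ x ^ 2 = infDist x Γ ^ (2 * γ) := by
  rw [distWeight, ← Real.rpow_natCast, ← Real.rpow_mul infDist_nonneg]
  congr 1
  push_cast; ring

theorem IsC1AlphaSubmanifold.mono {k : ℕ} {α r M M' : ℝ} {Γ : Set (Euc n)}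
    (h : IsC1AlphaSubmanifold k α r M Γ) (hM : M ≤ M') : IsC1AlphaSubmanifold k α r M' Γ := by
  intro x hx
  obtain ⟨T, f, h1, h2, h3, h4, h5⟩ := h x hx
  refine ⟨T, f, h1, h2, h3, h4, fun y hy z hz => (h5 y hy z hz).trans ?_⟩
  gcongr

/-- The defect in the Pohozaev identity is of higher order, since `Γ` is close to a plane through
`x₀` at small scales. The two bounds come from contracting and from dilating `u`. -/
theorem exists_pohozaevDefect_bound {γ α : ℝ} (hγ : 0 < γ) (hα : 0 < α) :
    ∃ C : ℝ, 0 < C ∧ ∀ (n k : ℕ) (M : ℝ) (Γ Ω : Set (Euc n)) (u : Euc n → ℝ)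
      (Du : Euc n → Euc n) (ε₀ : ℝ) (x₀ : Euc n) (R : ℝ), k < n →
      IsC1AlphaSubmanifold k α 1 M Γ → x₀ ∈ Γ →
      MinimizesOnBalls (distWeight γ Γ) Ω u Du ε₀ → 0 < ε₀ → MemW12 (ball x₀ R) u Du → 0 < R →
      ball x₀ R ⊆ Ω →
      (∀ᵐ ρ : ℝ, ρ ∈ Ioo 0 (min 1 R) → pohozaevDefect (2 * γ) (distWeight γ Γ) u Du x₀ ρ
        ≤ C * holderSeminorm k α Γ * ρ ^ ((n : ℝ) + 2 * γ + α)) ∧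
      ∀ᵐ ρ : ℝ, ρ ∈ Ioo 0 (min (1 / 2) R) → -(C * holderSeminorm k α Γ * ρ ^ ((n : ℝ) + 2 * γ + α))
        ≤ pohozaevDefect (2 * γ) (distWeight γ Γ) u Du x₀ ρ := by
  obtain ⟨C, hC, hdens⟩ := exists_dilation_density hγ hα
  refine ⟨C, hC, ?_⟩
  intro n k M Γ Ω u Du ε₀ x₀ R hk hΓ hx₀ hmin hε hu hR hB
  have hn : 0 < n := by omega
  have hQ := continuous_distWeight (n := n) hγ Γ
  have hfint := integrableOn_pohozaevDefect hn hQ hR.le hu (2 * γ)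
  set f : ℝ → ℝ := (Ioo 0 R).indicator (pohozaevDefect (2 * γ) (distWeight γ Γ) u Du x₀) with hf
  have hfi : Integrable f := hfint.integrable_indicator measurableSet_Ioo
  have main : ∀ (s r₁ : ℝ), (s = 1 ∨ s = -1) → r₁ ≤ R → r₁ ≤ 1 → (s = 1 → r₁ ≤ 1 / 2) →
      ∀ᵐ ρ : ℝ, ρ ∈ Ioo 0 r₁ → 0 ≤ s * f ρ
        + C * holderSeminorm k α Γ * ρ ^ ((n : ℝ) + 2 * γ + α) := by
    intro s r₁ hs hr₁R hr₁ hs1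
    have step : ∀ M', 0 ≤ M' → IsC1AlphaSubmanifold k α 1 M' Γ → ∀ᵐ ρ : ℝ, ρ ∈ Ioo 0 r₁ →
        0 ≤ s * f ρ + C * M' * ρ ^ ((n : ℝ) + 2 * γ + α) := by
      intro M' hM' hΓ'
      refine ae_nonneg_of_forall_bump (f := fun ρ => s * f ρ)
        (k := fun ρ => C * M' * ρ ^ ((n : ℝ) + 2 * γ + α)) (hfi.const_mul s).locallyIntegrable
        (fun ρ hρ => ?_) ?_
      · exact (Real.continuousAt_rpow_const _ _ (Or.inl hρ.ne')).const_mul _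
      · intro h a b hh hh0 ha hab hbr hsupp
        have hb : 0 < b := ha.trans_le hab
        have hbR : b < R := hbr.trans_le hr₁R
        have hhi : Integrable h := hh.continuous.integrable_of_hasCompactSupport
          (HasCompactSupport.intro isCompact_Icc hsupp)
        obtain ⟨κ, hκ0, hκi, hκm, τ, hτ, hκ⟩ := hdens n k M' Γ x₀ b hk hM' hΓ' hx₀ hb (by linarith)
        have key := hmin.integral_mul_pohozaevDefect hε hn hQ hu hR hB hh hh0 ha hab hbR hsupp
          (p := 2 * γ) hκ0 hκi hs (lt_min hτ (show (0 : ℝ) < 1 / 2 by norm_num)) (by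
            filter_upwards [hκ] with y hy l hl hsl
            have h1 := hy l (hl.trans (min_le_left _ _)) (by
              rcases hs with rfl | rfl
              · right; linarith [hs1 rfl]
              · left; linarith)
            have hl0 : 0 ≤ l := by
              have := (abs_le.1 (hl.trans (min_le_right _ _))).1
              linarith
            rwa [distWeight_sq, distWeight_sq, ← Real.mul_rpow hl0 infDist_nonneg])
        have e1 : ∫ ρ, h ρ * (s * f ρ) = s * ∫ ρ in (0 : ℝ)..R, h ρ *
            pohozaevDefect (2 * γ) (distWeight γ Γ) u Du x₀ ρ := by
          rw [intervalIntegral.integral_of_le hR.le, integral_Ioc_eq_integral_Ioo,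
            ← integral_indicator measurableSet_Ioo, ← integral_const_mul]
          refine integral_congr_ae (Eventually.of_forall fun ρ => ?_)
          simp only [hf, indicator_mul_right]
          ring
        rw [e1]
        refine key.trans (add_le_add le_rfl ?_)
        exact mul_le_mul_of_nonneg_left hκm (integral_nonneg hh0)
    have hne : {M : ℝ | 0 ≤ M ∧ IsC1AlphaSubmanifold k α 1 M Γ}.Nonempty :=
      ⟨max M 0, le_max_right _ _, hΓ.mono (le_max_left _ _)⟩
    obtain ⟨m, -, hmlim, hm⟩ := exists_seq_tendsto_sInf hne ⟨0, fun _ h => h.1⟩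
    filter_upwards [ae_all_iff.2 fun j => step (m j) (hm j).1 (hm j).2] with ρ hρ hmem
    exact ge_of_tendsto (((hmlim.const_mul C).mul_const _).const_add _)
      (Eventually.of_forall fun j => hρ j hmem)
  constructor
  · filter_upwards [main (-1) (min 1 R) (Or.inr rfl) (min_le_right _ _) (min_le_left _ _)
      (by norm_num)] with ρ hρ hmem
    have := hρ hmem
    rw [hf, indicator_of_mem (show ρ ∈ Ioo 0 R from
      ⟨hmem.1, hmem.2.trans_le (min_le_right _ _)⟩)] at this
    linarith
  · filter_upwards [main 1 (min (1 / 2) R) (Or.inl rfl) (min_le_right _ _)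
      ((min_le_left _ _).trans (by norm_num)) (fun _ => min_le_left _ _)] with ρ hρ hmem
    have := hρ hmem
    rw [hf, indicator_of_mem (show ρ ∈ Ioo 0 R from
      ⟨hmem.1, hmem.2.trans_le (min_le_right _ _)⟩)] at this
    linarith

/-! ### The derivative of the Weiss density -/

theorem AbsolutelyContinuousOnInterval.congr {f g : ℝ → ℝ} {a b : ℝ}
    (hf : AbsolutelyContinuousOnInterval f a b) (h : ∀ x ∈ uIcc a b, f x = g x) :
    AbsolutelyContinuousOnInterval g a b := by
  rw [absolutelyContinuousOnInterval_iff] at hf ⊢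
  intro ε hε
  obtain ⟨δ, hδ, hfδ⟩ := hf ε hε
  refine ⟨δ, hδ, fun E hE hEδ => ?_⟩
  refine lt_of_eq_of_lt (Finset.sum_congr rfl fun i hi => ?_) (hfδ E hE hEδ)
  have := hE.1 i hi
  rw [h _ this.1, h _ this.2]

theorem ae_hasDerivAt_of_sub_eq_integral {F f : ℝ → ℝ} {a b : ℝ}
    (h : ∀ r₁ r₂, a < r₁ → r₁ ≤ r₂ → r₂ < b →
      IntervalIntegrable f volume r₁ r₂ ∧ F r₂ - F r₁ = ∫ ρ in r₁..r₂, f ρ) :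
    (∀ᵐ r : ℝ, r ∈ Ioo a b → HasDerivAt F (f r) r) ∧
      ∀ r₁ r₂, a < r₁ → r₁ ≤ r₂ → r₂ < b → AbsolutelyContinuousOnInterval F r₁ r₂ := by
  have hF : ∀ r₁ r₂, a < r₁ → r₁ ≤ r₂ → r₂ < b → ∀ r ∈ Icc r₁ r₂,
      F r = F r₁ + ∫ ρ in r₁..r, f ρ := fun r₁ r₂ h₁ h₁₂ h₂ r hr => by
    rw [← (h r₁ r h₁ hr.1 (hr.2.trans_lt h₂)).2]; ring
  constructor
  · have key : ∀ q₁ q₂ : ℚ, ∀ᵐ r : ℝ, a < q₁ → (q₂ : ℝ) < b → r ∈ Ioo (q₁ : ℝ) q₂ →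
        HasDerivAt F (f r) r := by
      intro q₁ q₂
      by_cases h₁ : a < q₁
      swap
      · exact Eventually.of_forall fun r h => absurd h h₁
      by_cases h₂ : (q₂ : ℝ) < b
      swap
      · exact Eventually.of_forall fun r _ h => absurd h h₂
      by_cases h₁₂ : (q₁ : ℝ) ≤ q₂
      swap
      · exact Eventually.of_forall fun r _ _ h => absurd (h.1.trans h.2).le h₁₂
      filter_upwards [(h q₁ q₂ h₁ h₁₂ h₂).1.ae_hasDerivAt_integral] with r hr _ _ hmem
      rw [uIcc_of_le h₁₂] at hr
      have h3 := (hr ⟨hmem.1.le, hmem.2.le⟩ q₁ ⟨le_rfl, h₁₂⟩).const_add (F q₁)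
      refine h3.congr_of_eventuallyEq ?_
      filter_upwards [Ioo_mem_nhds hmem.1 hmem.2] with s hs
      exact hF q₁ q₂ h₁ h₁₂ h₂ s ⟨hs.1.le, hs.2.le⟩
    filter_upwards [ae_all_iff.2 fun q₁ => ae_all_iff.2 fun q₂ => key q₁ q₂] with r hr hmem
    obtain ⟨q₁, h1, h2⟩ := exists_rat_btwn hmem.1
    obtain ⟨q₂, h3, h4⟩ := exists_rat_btwn hmem.2
    exact hr q₁ q₂ h1 h4 ⟨h2, h3⟩
  · intro r₁ r₂ h₁ h₁₂ h₂
    have hc : AbsolutelyContinuousOnInterval (fun _ : ℝ => F r₁) r₁ r₂ :=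
      contDiffOn_const.absolutelyContinuousOnInterval
    refine (hc.add ((h r₁ r₂ h₁ h₁₂ h₂).1.absolutelyContinuousOnInterval_intervalIntegral
      (c := r₁) (by simp))).congr fun r hr => ?_
    rw [uIcc_of_le h₁₂] at hr
    exact (hF r₁ r₂ h₁ h₁₂ h₂ r hr).symm

/-- The homogeneity defect, expanded in terms of the quantities entering the derivative of the
Weiss density. -/
theorem sphereIntegral_homogeneityDefect (hn : 0 < n) {γ r : ℝ} {x₀ : Euc n} (hr : 0 < r)
    (h₁ : SphereIntegrable x₀ r fun x => ‖x - x₀‖⁻¹ * inner ℝ (x - x₀) (Du x) ^ 2)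
    (h₂ : SphereIntegrable x₀ r fun x => u x * inner ℝ (Du x) (x - x₀))
    (h₃ : SphereIntegrable x₀ r fun x => u x ^ 2) :
    SphereIntegrable x₀ r (homogeneityDefect γ u Du x₀ r) ∧
    r * sphereIntegral x₀ r (homogeneityDefect γ u Du x₀ r)
      = sphereIntegral x₀ r (fun x => ‖x - x₀‖⁻¹ * inner ℝ (x - x₀) (Du x) ^ 2)
        - 2 * (γ + 1) * (r ^ (n - 1) * sphereFlux u Du x₀ r)
        + (γ + 1) ^ 2 * r⁻¹ * (r ^ (n - 1) * sphereSq u x₀ r) := by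
  set F₁ : sphere (0 : Euc n) 1 → ℝ := fun η => ‖x₀ + r • (η : Euc n) - x₀‖⁻¹
    * inner ℝ (x₀ + r • (η : Euc n) - x₀) (Du (x₀ + r • (η : Euc n))) ^ 2 with hF₁
  set F₂ : sphere (0 : Euc n) 1 → ℝ := fun η => u (x₀ + r • (η : Euc n))
    * inner ℝ (Du (x₀ + r • (η : Euc n))) (x₀ + r • (η : Euc n) - x₀) with hF₂
  set F₃ : sphere (0 : Euc n) 1 → ℝ := fun η => u (x₀ + r • (η : Euc n)) ^ 2 with hF₃
  have h₁' : Integrable F₁ (volume : Measure (Euc n)).toSphere := h₁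
  have h₂' : Integrable F₂ (volume : Measure (Euc n)).toSphere := h₂
  have h₃' : Integrable F₃ (volume : Measure (Euc n)).toSphere := h₃
  have hpt : ∀ η : sphere (0 : Euc n) 1,
      homogeneityDefect γ u Du x₀ r (x₀ + r • (η : Euc n))
        = r⁻¹ * F₁ η + (-(2 * (γ + 1) * (r⁻¹) ^ 2)) * F₂ η + ((γ + 1) / r) ^ 2 * F₃ η := by
    intro η
    simp only [homogeneityDefect, hF₁, hF₂, hF₃, add_sub_cancel_left, norm_smul, norm_sphere_coe,
      inner_smul_right, inner_smul_left, RCLike.conj_to_real, Real.norm_of_nonneg hr.le]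
    rw [real_inner_comm]
    field_simp
    ring
  have i12 : Integrable (fun η => r⁻¹ * F₁ η + (-(2 * (γ + 1) * (r⁻¹) ^ 2)) * F₂ η)
      (volume : Measure (Euc n)).toSphere := (h₁'.const_mul _).add (h₂'.const_mul _)
  have i123 : Integrable (fun η => r⁻¹ * F₁ η + (-(2 * (γ + 1) * (r⁻¹) ^ 2)) * F₂ η
      + ((γ + 1) / r) ^ 2 * F₃ η) (volume : Measure (Euc n)).toSphere :=
    i12.add (h₃'.const_mul _)
  refine ⟨i123.congr (Eventually.of_forall fun η => (hpt η).symm), ?_⟩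
  have e₂ : r * sphereFlux u Du x₀ r = ∫ η, F₂ η ∂(volume : Measure (Euc n)).toSphere := by
    have := sphereIntegral_mul_inner hn u Du x₀ r
    rw [sphereIntegral] at this
    have hp : r ^ n = r ^ (n - 1) * r := by rw [← pow_succ, Nat.sub_add_cancel hn]
    rw [hp, mul_assoc] at this
    exact (mul_left_cancel₀ (by positivity) this).symm
  have e₁ : ∫ η, homogeneityDefect γ u Du x₀ r (x₀ + r • ((η : sphere (0 : Euc n) 1) : Euc n))
        ∂(volume : Measure (Euc n)).toSphere
      = r⁻¹ * (∫ η, F₁ η ∂(volume : Measure (Euc n)).toSphere)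
        + (-(2 * (γ + 1) * (r⁻¹) ^ 2)) * (r * sphereFlux u Du x₀ r)
        + ((γ + 1) / r) ^ 2 * sphereSq u x₀ r := by
    rw [integral_congr_ae (Eventually.of_forall hpt), integral_add i12 (h₃'.const_mul _),
      integral_add (h₁'.const_mul _) (h₂'.const_mul _), integral_const_mul, integral_const_mul,
      integral_const_mul, e₂]
    rfl
  have e₃ : sphereIntegral x₀ r (fun x => ‖x - x₀‖⁻¹ * inner ℝ (x - x₀) (Du x) ^ 2)
      = r ^ (n - 1) * ∫ η, F₁ η ∂(volume : Measure (Euc n)).toSphere := rfl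
  rw [e₃, sphereIntegral, e₁]
  field_simp
  ring

theorem weissDensity_eq {γ r : ℝ} (Γ : Set (Euc n)) (u : Euc n → ℝ) (Du : Euc n → Euc n)
    (x₀ : Euc n) (hn : 0 < n) (hr : 0 < r) :
    weissDensity γ Γ u Du x₀ r
      = r ^ (-((n : ℝ) + 2 * γ)) * energyJ (distWeight γ Γ) (ball x₀ r) u Du
        - (γ + 1) * (r ^ (-(2 * γ + 2)) * sphereSq u x₀ r) := by
  have e1 : (1 : ℝ) / r ^ ((n : ℝ) - 2 + 2 * (γ + 1)) = r ^ (-((n : ℝ) + 2 * γ)) := by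
    rw [Real.rpow_neg hr.le, one_div]
    congr 2; ring
  have e2 : (γ + 1) / r ^ ((n : ℝ) - 1 + 2 * (γ + 1)) * r ^ (n - 1)
      = (γ + 1) * r ^ (-(2 * γ + 2)) := by
    have : (r : ℝ) ^ (n - 1) = r ^ ((n : ℝ) - 1) := by
      rw [← Real.rpow_natCast, Nat.cast_sub hn, Nat.cast_one]
    rw [this, div_mul_eq_mul_div, mul_div_assoc, ← Real.rpow_sub hr]
    congr 2; ring
  rw [weissDensity, e1, sphereIntegral, ← mul_assoc, e2, mul_assoc]
  rfl

/-- The derivative of the Weiss density: up to the defect in the Pohozaev identity, it is the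
squared deviation from homogeneity. -/
theorem MinimizesOnBalls.hasDerivAt_weissDensity {γ : ℝ} {Γ : Set (Euc n)} {ε₀ : ℝ}
    (hmin : MinimizesOnBalls (distWeight γ Γ) Ω u Du ε₀) (hε : 0 < ε₀) (hn : 0 < n) (hγ : 0 < γ)
    (hΩ : IsOpen Ω) (hu : MemW12 Ω u Du) (hc : ContinuousOn u Ω) {x₀ : Euc n} {R : ℝ} (hR : 0 < R)
    (hB : ball x₀ R ⊆ Ω) :
    (∀ᵐ r : ℝ, r ∈ Ioo 0 R → SphereIntegrable x₀ r (homogeneityDefect γ u Du x₀ r) ∧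
      HasDerivAt (fun s => weissDensity γ Γ u Du x₀ s)
        (2 / r ^ ((n : ℝ) + 2 * γ) * sphereIntegral x₀ r (homogeneityDefect γ u Du x₀ r)
          + r ^ (-((n : ℝ) + 2 * γ) - 1) * pohozaevDefect (2 * γ) (distWeight γ Γ) u Du x₀ r) r) ∧
    ∀ r₁ r₂, 0 < r₁ → r₁ ≤ r₂ → r₂ < R →
      AbsolutelyContinuousOnInterval (fun s => weissDensity γ Γ u Du x₀ s) r₁ r₂ := by
  have hQ := continuous_distWeight (n := n) hγ Γ
  have huB := hu.mono hB
  obtain ⟨-, d1, D1⟩ := polar_ball hn (integrable_norm_sq huB.memLp_grad)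
  obtain ⟨v0, v1, V1⟩ := polar_ball hn (integrableOn_weight hQ huB.memLp.1)
  obtain ⟨e0, -, -⟩ := polar_ball hn (integrableOn_radial_component huB.memLp_grad)
  obtain ⟨b0, -, -⟩ := polar_ball hn (integrableOn_mul_inner huB)
  obtain ⟨s0, -, -⟩ := polar_ball hn (f := fun x => u x ^ 2) (x₀ := x₀) (R := R) (by
    have := integrable_norm_sq huB.memLp
    simp only [Real.norm_eq_abs, sq_abs] at this
    exact this)
  set d : ℝ → ℝ := fun ρ => sphereIntegral x₀ ρ fun x => ‖Du x‖ ^ 2 with hd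
  set v : ℝ → ℝ := fun ρ => sphereIntegral x₀ ρ fun x => distWeight γ Γ x ^ 2 * posChar u x with hv
  have d2 : IntervalIntegrable d volume 0 R :=
    (intervalIntegrable_iff_integrableOn_Ioo_of_le hR.le).2 d1
  have v2 : IntervalIntegrable v volume 0 R :=
    (intervalIntegrable_iff_integrableOn_Ioo_of_le hR.le).2 v1
  obtain ⟨hE, hEac⟩ := ae_hasDerivAt_of_sub_eq_integral (a := 0) (b := R)
    (F := fun r => energyJ (distWeight γ Γ) (ball x₀ r) u Du) (f := fun r => d r + v r) (by
      intro r₁ r₂ h₁ h₁₂ h₂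
      have hsub : ∀ {r}, r ∈ Icc r₁ r₂ → uIcc 0 r ⊆ uIcc 0 R := fun hr => by
        rw [uIcc_of_le hR.le, uIcc_of_le (h₁.le.trans hr.1)]
        exact Icc_subset_Icc_right (hr.2.trans h₂.le)
      have m₁ : r₁ ∈ Icc r₁ r₂ := ⟨le_rfl, h₁₂⟩
      have m₂ : r₂ ∈ Icc r₁ r₂ := ⟨h₁₂, le_rfl⟩
      have hdv := d2.add v2
      have hEr : ∀ r ∈ Icc r₁ r₂, energyJ (distWeight γ Γ) (ball x₀ r) u Du
          = ∫ ρ in (0 : ℝ)..r, d ρ + v ρ := by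
        intro r hr
        have hmem : r ∈ Icc 0 R := ⟨h₁.le.trans hr.1, hr.2.trans h₂.le⟩
        rw [energyJ_eq hQ (huB.mono (ball_subset_ball hmem.2)), D1 r hmem, V1 r hmem,
          ← intervalIntegral.integral_add (d2.mono_set (hsub hr)) (v2.mono_set (hsub hr))]
      refine ⟨hdv.mono_set ?_, ?_⟩
      · rw [uIcc_of_le hR.le, uIcc_of_le h₁₂]
        exact Icc_subset_Icc h₁.le h₂.le
      · rw [hEr _ m₁, hEr _ m₂]
        exact intervalIntegral.integral_interval_sub_left (hdv.mono_set (hsub m₂))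
          (hdv.mono_set (hsub m₁)))
  obtain ⟨hS, hSac⟩ := ae_hasDerivAt_of_sub_eq_integral (a := 0) (b := R)
    (F := sphereSq u x₀) (f := fun r => 2 * sphereFlux u Du x₀ r) (by
      intro r₁ r₂ h₁ h₁₂ h₂
      exact ⟨(intervalIntegrable_sphereFlux hn huB h₁ h₁₂ h₂.le).const_mul 2,
        sphereSq_sub hn hΩ hu hc h₁ h₁₂ ((closedBall_subset_ball h₂).trans hB)⟩)
  constructor
  · filter_upwards [hE, hS, e0, b0, s0, hmin.ae_dirichlet_eq hε hn hQ hu hR hB]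
      with r hEr hSr er br sr hdir hmem
    have hr : 0 < r := hmem.1
    obtain ⟨hint, hval⟩ := sphereIntegral_homogeneityDefect (γ := γ) hn hr (er hmem) (br hmem)
      (sr hmem)
    refine ⟨hint, ?_⟩
    have p1 := (Real.hasDerivAt_rpow_const (p := -((n : ℝ) + 2 * γ)) (Or.inl hr.ne')).mul (hEr hmem)
    have p2 := ((Real.hasDerivAt_rpow_const (p := -(2 * γ + 2)) (Or.inl hr.ne')).mul
      (hSr hmem)).const_mul (γ + 1)
    refine ((p1.sub p2).congr_of_eventuallyEq ?_).congr_deriv ?_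
    · filter_upwards [Ioi_mem_nhds hr] with s hs
      exact weissDensity_eq Γ u Du x₀ hn hs
    · have hp := fun (x : ℝ) => Real.rpow_sub_one hr.ne' x
      have ha : r ^ (-(2 * γ + 2)) = r ^ (-((n : ℝ) + 2 * γ)) * r ^ (n - 1) * r⁻¹ := by
        rw [← Real.rpow_neg_one, ← Real.rpow_natCast, ← Real.rpow_add hr, ← Real.rpow_add hr,
          Nat.cast_sub hn]
        congr 1; push_cast; ring
      have hI : sphereIntegral x₀ r (homogeneityDefect γ u Du x₀ r)
          = r⁻¹ * (sphereIntegral x₀ r (fun x => ‖x - x₀‖⁻¹ * inner ℝ (x - x₀) (Du x) ^ 2)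
            - 2 * (γ + 1) * (r ^ (n - 1) * sphereFlux u Du x₀ r)
            + (γ + 1) ^ 2 * r⁻¹ * (r ^ (n - 1) * sphereSq u x₀ r)) := by
        rw [← hval, inv_mul_cancel_left₀ hr.ne']
      have hinv : 2 / r ^ ((n : ℝ) + 2 * γ) = 2 * r ^ (-((n : ℝ) + 2 * γ)) := by
        rw [Real.rpow_neg hr.le]; rfl
      rw [hinv, hI, pohozaevDefect, energyJ_eq hQ (huB.mono (ball_subset_ball hmem.2.le)),
        hdir hmem, hp, hp, ha]
      simp only [hd, hv]
      field_simp
      ring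
  · intro r₁ r₂ h₁ h₁₂ h₂
    have hpow : ∀ p : ℝ, AbsolutelyContinuousOnInterval (fun s : ℝ => s ^ p) r₁ r₂ := fun p => by
      refine ContDiffOn.absolutelyContinuousOnInterval fun s hs => ?_
      rw [uIcc_of_le h₁₂] at hs
      exact (Real.contDiffAt_rpow_const (Or.inl (h₁.trans_le hs.1).ne')).contDiffWithinAt
    refine (((hpow (-((n : ℝ) + 2 * γ))).mul (hEac r₁ r₂ h₁ h₁₂ h₂)).sub
      (((hpow (-(2 * γ + 2))).mul (hSac r₁ r₂ h₁ h₁₂ h₂)).const_mul (γ + 1))).congr fun s hs => ?_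
    rw [uIcc_of_le h₁₂] at hs
    exact (weissDensity_eq Γ u Du x₀ hn (h₁.trans_le hs.1)).symm

theorem holderSeminorm_nonneg (k : ℕ) (α : ℝ) (Γ : Set (Euc n)) : 0 ≤ holderSeminorm k α Γ :=
  Real.sInf_nonneg fun _ h => h.1

/-- The two monotonicity formulas, in terms of a constant `C` for which the Pohozaev defect is
bounded. -/
theorem MinimizesOnBalls.weissDensity_monotone {γ α : ℝ} {Γ : Set (Euc n)} {ε₀ H : ℝ}
    (hmin : MinimizesOnBalls (distWeight γ Γ) Ω u Du ε₀) (hε : 0 < ε₀) (hn : 0 < n) (hγ : 0 < γ)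
    (hα : 0 < α) (hΩ : IsOpen Ω) (hu : MemW12 Ω u Du) (hc : ContinuousOn u Ω) {x₀ : Euc n}
    (hP : ∀ R, 0 < R → ball x₀ R ⊆ Ω →
      (∀ᵐ ρ : ℝ, ρ ∈ Ioo 0 (min 1 R) → pohozaevDefect (2 * γ) (distWeight γ Γ) u Du x₀ ρ
        ≤ H * ρ ^ ((n : ℝ) + 2 * γ + α)) ∧
      ∀ᵐ ρ : ℝ, ρ ∈ Ioo 0 (min (1 / 2) R) → -(H * ρ ^ ((n : ℝ) + 2 * γ + α))
        ≤ pohozaevDefect (2 * γ) (distWeight γ Γ) u Du x₀ ρ) :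
    (∀ᵐ r : ℝ, 0 < r → r ≤ 1 → ball x₀ (2 * r) ⊆ Ω →
      SphereIntegrable x₀ r (homogeneityDefect γ u Du x₀ r) ∧
      ∃ W' : ℝ, HasDerivAt (fun s => weissDensity γ Γ u Du x₀ s) W' r ∧
        W' ≤ 2 / r ^ ((n : ℝ) + 2 * γ) * sphereIntegral x₀ r (homogeneityDefect γ u Du x₀ r)
          + H * r ^ (α - 1)) ∧
    ∀ r R : ℝ, 0 < r → r < R → R ≤ 1 / 2 → ball x₀ (2 * R) ⊆ Ω →
      weissDensity γ Γ u Du x₀ r + H / α * r ^ α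
        ≤ weissDensity γ Γ u Du x₀ R + H / α * R ^ α := by
  have hpw : ∀ r : ℝ, 0 < r → r ^ (-((n : ℝ) + 2 * γ) - 1) * (H * r ^ ((n : ℝ) + 2 * γ + α))
      = H * r ^ (α - 1) := fun r hr => by
    rw [mul_left_comm, ← Real.rpow_add hr]
    congr 2; ring
  constructor
  · have key : ∀ q : ℚ, ∀ᵐ r : ℝ, 0 < (q : ℝ) → ball x₀ q ⊆ Ω → r ∈ Ioo 0 (min 1 (q : ℝ)) →
        SphereIntegrable x₀ r (homogeneityDefect γ u Du x₀ r) ∧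
        ∃ W' : ℝ, HasDerivAt (fun s => weissDensity γ Γ u Du x₀ s) W' r ∧
          W' ≤ 2 / r ^ ((n : ℝ) + 2 * γ) * sphereIntegral x₀ r (homogeneityDefect γ u Du x₀ r)
            + H * r ^ (α - 1) := by
      intro q
      by_cases hq : 0 < (q : ℝ)
      swap
      · exact Eventually.of_forall fun r h => absurd h hq
      by_cases hB : ball x₀ q ⊆ Ω
      swap
      · exact Eventually.of_forall fun r _ h => absurd h hB
      filter_upwards [(hP q hq hB).1,
        (hmin.hasDerivAt_weissDensity hε hn hγ hΩ hu hc hq hB).1] with r h1 h2 _ _ hmem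
      obtain ⟨h3, h4⟩ := h2 ⟨hmem.1, hmem.2.trans_le (min_le_right _ _)⟩
      have hr : 0 < r := hmem.1
      refine ⟨h3, _, h4, add_le_add le_rfl ?_⟩
      rw [← hpw r hr]
      exact mul_le_mul_of_nonneg_left (h1 hmem) (by positivity)
    have hne : ∀ᵐ r : ℝ, r ≠ 1 := by simp [ae_iff, measure_singleton]
    filter_upwards [ae_all_iff.2 key, hne] with r hr hr1 h0 h1 hB
    obtain ⟨q, hq1, hq2⟩ := exists_rat_btwn (show r < 2 * r by linarith)
    exact hr q (h0.trans hq1) ((ball_subset_ball hq2.le).trans hB)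
      ⟨h0, lt_min (lt_of_le_of_ne h1 hr1) hq1⟩
  · intro r R hr hrR hR hB
    have hR0 : 0 < R := hr.trans hrR
    obtain ⟨hder, hac⟩ := hmin.hasDerivAt_weissDensity hε hn hγ hΩ hu hc
      (show 0 < 2 * R by positivity) hB
    have hW := (hac r R hr hrR.le (by linarith))
    have hP2 := (hP (2 * R) (by positivity) hB).2
    have hFTC := hW.integral_deriv_eq_sub
    have hpi : ∫ ρ in r..R, -(H * ρ ^ (α - 1)) = -(H * ((R ^ α - r ^ α) / α)) := by
      rw [intervalIntegral.integral_neg, intervalIntegral.integral_const_mul,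
        integral_rpow (Or.inl (by linarith)), sub_add_cancel]
    have hle : ∫ ρ in r..R, -(H * ρ ^ (α - 1))
        ≤ ∫ ρ in r..R, deriv (fun s => weissDensity γ Γ u Du x₀ s) ρ := by
      refine intervalIntegral.integral_mono_ae_restrict hrR.le ?_ hW.intervalIntegrable_deriv ?_
      · exact ((intervalIntegral.intervalIntegrable_rpow' (by linarith)).const_mul H).neg
      · have hne : ∀ᵐ ρ : ℝ, ρ ≠ R := by simp [ae_iff, measure_singleton]
        filter_upwards [ae_restrict_of_ae hder, ae_restrict_of_ae hP2, ae_restrict_of_ae hne,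
          ae_restrict_mem measurableSet_Icc] with ρ h1 h2 hρR hρ
        have hρ0 : 0 < ρ := hr.trans_le hρ.1
        have hρ1 : ρ < R := lt_of_le_of_ne hρ.2 hρR
        rw [(h1 ⟨hρ0, by linarith⟩).2.deriv, ← hpw ρ hρ0]
        have h3 := h2 ⟨hρ0, lt_min (by linarith) (by linarith)⟩
        have h4 : 0 ≤ sphereIntegral x₀ ρ (homogeneityDefect γ u Du x₀ ρ) :=
          mul_nonneg (by positivity) (integral_nonneg fun _ => sq_nonneg _)
        have h5 := mul_le_mul_of_nonneg_left h3
          (show 0 ≤ ρ ^ (-((n : ℝ) + 2 * γ) - 1) by positivity)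
        have h6 : 0 ≤ 2 / ρ ^ ((n : ℝ) + 2 * γ)
          * sphereIntegral x₀ ρ (homogeneityDefect γ u Du x₀ ρ) := by positivity
        rw [mul_neg] at h5
        linarith
    rw [hFTC, hpi] at hle
    have h1 : H * ((R ^ α - r ^ α) / α) = H / α * R ^ α - H / α * r ^ α := by ring
    linarith

/-! ### Nonnegativity of local minimizers -/

theorem tendsto_eLpNorm_smul_of_ae {α F : Type*} [MeasurableSpace α] {μ : Measure α}
    [NormedAddCommGroup F] [NormedSpace ℝ F] {c : ℕ → α → ℝ} {K : ℝ} {Y : α → F}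
    (hcm : ∀ j, AEStronglyMeasurable (c j) μ) (hcK : ∀ j x, |c j x| ≤ K) (hY : MemLp Y 2 μ)
    (hlim : ∀ᵐ x ∂μ, Tendsto (fun j => c j x) atTop (𝓝 0)) :
    Tendsto (fun j => eLpNorm (fun x => c j x • Y x) 2 μ) atTop (𝓝 0) := by
  have hfin : ∫⁻ x, ENNReal.ofReal K ^ 2 * ‖Y x‖ₑ ^ 2 ∂μ ≠ ⊤ := by
    rw [lintegral_const_mul' _ _ (by simp), ← eLpNorm_two_sq]
    exact ENNReal.mul_ne_top (by simp) (ENNReal.pow_ne_top hY.2.ne)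
  have h := tendsto_lintegral_of_dominated_convergence' (μ := μ)
    (F := fun j x => ‖c j x • Y x‖ₑ ^ 2) (f := fun _ => 0)
    (fun x => ENNReal.ofReal K ^ 2 * ‖Y x‖ₑ ^ 2)
    (fun j => ((hcm j).smul hY.1).enorm.pow_const 2)
    (fun j => Eventually.of_forall fun x => by
      simp only [enorm_smul, mul_pow]
      gcongr
      rw [Real.enorm_eq_ofReal_abs]
      exact ENNReal.ofReal_le_ofReal (hcK j x)) hfin (by
      filter_upwards [hlim] with x hx
      have h1 : Tendsto (fun j => c j x • Y x) atTop (𝓝 0) := by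
        simpa using hx.smul_const (Y x)
      have h2 := (ENNReal.continuous_pow 2).tendsto _ |>.comp h1.enorm
      rw [enorm_zero, zero_pow two_ne_zero] at h2
      exact h2)
  simp only [lintegral_zero] at h
  have h3 := ((ENNReal.continuous_rpow_const (y := ((2 : ℕ) : ℝ)⁻¹)).tendsto _).comp h
  rw [ENNReal.zero_rpow_of_pos (by norm_num)] at h3
  refine h3.congr fun j => ?_
  simp only [Function.comp_apply, ← eLpNorm_two_sq]
  exact ENNReal.pow_rpow_inv_natCast (by norm_num) _

/-- A square integrable function on `ℝⁿ` with vanishing weak gradient vanishes. -/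
theorem MemW12.eq_zero_of_gradient_zero (hn : 0 < n) {f : Euc n → ℝ}
    (hf : MemW12 univ f fun _ => 0) : f =ᵐ[volume] 0 := by
  have hfL : MemLp f 2 volume := by simpa using hf.memLp
  have hpos : ∀ j : ℕ, (0 : ℝ) < 1 / ((j : ℝ) + 1) := fun j => by positivity
  set ρ : ℕ → ContDiffBump (0 : Euc n) := fun j =>
    ⟨1 / ((j : ℝ) + 1) / 2, 1 / ((j : ℝ) + 1), half_pos (hpos j), half_lt_self (hpos j)⟩ with hρ
  have hout : Tendsto (fun j => (ρ j).rOut) atTop (𝓝 0) :=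
    tendsto_one_div_add_atTop_nhds_zero_nat
  have hlim := tendsto_eLpNorm_convolution_sub hout hfL
  set g : ℕ → Euc n → ℝ := fun j => convolution ((ρ j).normed volume) f
    (ContinuousLinearMap.lsmul ℝ ℝ) volume with hg
  have hgrad : ∀ j x, HasGradientAt (g j) 0 x := fun j x => by
    have := hf.hasGradientAt_convolution (ρ j) x
    rwa [show (fun _ : Euc n => (0 : Euc n)) = 0 from rfl, convolution_zero] at this
  have hconst : ∀ j x, g j x = g j 0 := fun j x =>
    is_const_of_fderiv_eq_zero (𝕜 := ℝ) (fun y => (hgrad j y).hasFDerivAt.differentiableAt)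
      (fun y => by rw [(hgrad j y).hasFDerivAt.fderiv]; simp) x 0
  have hgc : ∀ j, Continuous (g j) := fun j =>
    continuous_iff_continuousAt.2 fun x => (hgrad j x).hasFDerivAt.continuousAt
  have hz : ∀ᶠ j in atTop, ∀ x, g j x = 0 := by
    filter_upwards [hlim.eventually (gt_mem_nhds (show (0 : ℝ≥0∞) < 1 by norm_num))] with j hj
    have h1 : MemLp (fun x => g j x - f x) 2 volume :=
      ⟨(hgc j).aestronglyMeasurable.sub hfL.1, hj.trans ENNReal.one_lt_top⟩
    have h2 : MemLp (fun _ : Euc n => g j 0) 2 volume := by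
      refine (h1.add hfL).ae_eq (Eventually.of_forall fun x => ?_)
      simp [hconst j x]
    rw [memLp_const_iff (by norm_num) (by norm_num)] at h2
    have : Nonempty (Fin n) := ⟨⟨0, hn⟩⟩
    have h3 : (volume : Measure (Euc n)) univ = ⊤ := measure_univ_of_isAddLeftInvariant _
    intro x
    rw [hconst j x]
    exact h2.resolve_right (by rw [h3]; exact lt_irrefl _)
  have h0 : eLpNorm f 2 volume = 0 := by
    refine tendsto_nhds_unique (tendsto_const_nhds.congr' ?_) hlim
    filter_upwards [hz] with j hj
    rw [← eLpNorm_neg]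
    congr 1
    ext x
    have := hj x
    simp only [hg] at this
    simp [this]
  exact (eLpNorm_eq_zero_iff hfL.1 (by norm_num)).1 h0

/-- A test function in an open set is a finite sum of test functions in balls. -/
theorem IsTestFunction.exists_sum_ball (hΩ : IsOpen Ω) {ζ : Euc n → ℝ} (hζ : IsTestFunction Ω ζ) :
    ∃ (t : Finset (Euc n)) (r : Euc n → ℝ) (ψ : Euc n → Euc n → ℝ),
      (∀ i ∈ t, 0 < r i ∧ ball i (r i) ⊆ Ω ∧ IsTestFunction (ball i (r i)) (ψ i)) ∧
      ∀ x, ζ x = ∑ i ∈ t, ψ i x := by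
  have h1 : ∀ i : Euc n, ∃ r : ℝ, 0 < r ∧ (i ∈ Ω → ball i r ⊆ Ω) := fun i => by
    by_cases hi : i ∈ Ω
    · obtain ⟨r, hr, h⟩ := Metric.isOpen_iff.1 hΩ i hi
      exact ⟨r, hr, fun _ => h⟩
    · exact ⟨1, one_pos, fun h => absurd h hi⟩
  choose r hr hrΩ using h1
  have hK : IsCompact (tsupport ζ) := hζ.2.1
  obtain ⟨t, htK, ht⟩ := hK.elim_nhds_subcover (fun i => ball i (r i))
    fun i _ => ball_mem_nhds i (hr i)
  obtain ⟨f, hf⟩ := SmoothPartitionOfUnity.exists_isSubordinate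
    (modelWithCornersSelf ℝ (Euc n)) hK.isClosed (fun i : t => ball (i : Euc n) (r i))
    (fun _ => isOpen_ball) (fun x hx => by simpa using ht hx)
  classical
  refine ⟨t, r, fun i x => if h : i ∈ t then f ⟨i, h⟩ x * ζ x else 0, fun i hi => ?_, fun x => ?_⟩
  · refine ⟨hr i, hrΩ i (hζ.2.2 (htK i hi)), ?_⟩
    simp only [hi, dif_pos]
    have h2 := hζ.mul_left (f ⟨i, hi⟩).contMDiff.contDiff
    exact ⟨h2.1, h2.2.1, tsupport_mul_subset_left.trans (hf ⟨i, hi⟩)⟩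
  · by_cases hx : x ∈ tsupport ζ
    · have h2 := f.sum_eq_one hx
      rw [finsum_eq_sum_of_fintype] at h2
      rw [← Finset.sum_coe_sort]
      simp only [Finset.coe_mem, dif_pos, Subtype.coe_eta]
      rw [← Finset.sum_mul, h2, one_mul]
    · simp [image_eq_zero_of_notMem_tsupport hx]

theorem gradient_sum {t : Finset (Euc n)} {ψ : Euc n → Euc n → ℝ} {x : Euc n}
    (h : ∀ i ∈ t, DifferentiableAt ℝ (ψ i) x) :
    gradient (fun y => ∑ i ∈ t, ψ i y) x = ∑ i ∈ t, gradient (ψ i) x := by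
  unfold gradient
  rw [fderiv_fun_sum h, map_sum]

/-- The first variation of a minimizer vanishes in the direction of a function of `u` supported
where `u` is negative, localised by any test function. -/
theorem MinimizesOnBalls.integral_inner_comp_eq_zero {ε₀ : ℝ} (hmin : MinimizesOnBalls Q Ω u Du ε₀)
    (hε : 0 < ε₀) (hΩ : IsOpen Ω) (hQ : Continuous Q) (hu : MemW12 Ω u Du)
    (hc : ContinuousOn u Ω) {a : ℝ → ℝ} (ha : ContDiff ℝ ∞ a) {δ K : ℝ} (hδ : 0 < δ)
    (ha1 : ∀ s, |a s| ≤ 1) (haK : ∀ s, |deriv a s| ≤ K) (ha0 : ∀ s, -δ ≤ s → a s = 0)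
    {ζ : Euc n → ℝ} (hζ : IsTestFunction Ω ζ) :
    ∫ x in Ω, (deriv a (u x) * ‖Du x‖ ^ 2 * ζ x + a (u x) * inner ℝ (Du x) (gradient ζ x)) = 0 := by
  have ham : AEStronglyMeasurable (fun x => a (u x)) (volume.restrict Ω) :=
    ha.continuous.comp_aestronglyMeasurable hu.memLp.1
  have hdm : AEStronglyMeasurable (fun x => deriv a (u x)) (volume.restrict Ω) :=
    (ha.continuous_deriv (by simp)).comp_aestronglyMeasurable hu.memLp.1
  have hint : ∀ ψ : Euc n → ℝ, IsTestFunction Ω ψ → IntegrableOn (fun x =>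
      deriv a (u x) * ‖Du x‖ ^ 2 * ψ x + a (u x) * inner ℝ (Du x) (gradient ψ x)) Ω := by
    intro ψ hψ
    obtain ⟨Z, hZ⟩ := hψ.2.1.exists_bound_of_continuous hψ.1.continuous
    refine Integrable.add ?_ ?_
    · exact ((integrable_norm_sq hu.memLp_grad).bdd_mul hdm
        (Eventually.of_forall fun x => haK (u x))).mul_bdd (c := Z)
        hψ.1.continuous.aestronglyMeasurable (Eventually.of_forall hZ)
    · exact (integrable_inner hu.memLp_grad (hψ.memLp_gradient.restrict _)).bdd_mul ham
        (Eventually.of_forall fun x => ha1 (u x))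
  obtain ⟨t, r, ψ, hψ, hsum⟩ := hζ.exists_sum_ball hΩ
  have hψΩ : ∀ i ∈ t, IsTestFunction Ω (ψ i) := fun i hi => (hψ i hi).2.2.mono (hψ i hi).2.1
  have hgs : ∀ x, gradient ζ x = ∑ i ∈ t, gradient (ψ i) x := fun x => by
    rw [← gradient_sum fun i hi => (hψΩ i hi).differentiableAt x]
    congr 1
    ext y
    exact hsum y
  have hexp : ∀ x, deriv a (u x) * ‖Du x‖ ^ 2 * ζ x + a (u x) * inner ℝ (Du x) (gradient ζ x)
      = ∑ i ∈ t, (deriv a (u x) * ‖Du x‖ ^ 2 * ψ i x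
        + a (u x) * inner ℝ (Du x) (gradient (ψ i) x)) := fun x => by
    rw [hsum x, hgs x, inner_sum, Finset.mul_sum, Finset.mul_sum, ← Finset.sum_add_distrib]
  simp only [hexp]
  rw [integral_finsetSum _ fun i hi => hint _ (hψΩ i hi)]
  refine Finset.sum_eq_zero fun i hi => ?_
  obtain ⟨hr, hB, hψi⟩ := hψ i hi
  obtain ⟨Z, hZ⟩ := hψi.2.1.exists_bound_of_continuous hψi.1.continuous
  have hfv := hmin.first_variation hε hQ hu hr hB
    ((hu.mono hB).test_mul_comp isOpen_ball (hc.mono hB) ha hψi) (by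
      have hZ0 : 0 ≤ Z := (norm_nonneg _).trans (hZ 0)
      filter_upwards [Metric.ball_mem_nhds (0 : ℝ) (show 0 < δ / (Z + 1) by positivity)]
        with s hs y _
      rw [mem_ball_zero_iff, Real.norm_eq_abs] at hs
      rcases le_or_gt (-δ) (u y) with h | h
      · rw [ha0 _ h]; simp
      · have h1 : |s * (ψ i y * a (u y))| < δ := by
          rw [abs_mul, abs_mul]
          calc |s| * (|ψ i y| * |a (u y)|) ≤ |s| * (Z * 1) := by
                gcongr
                · exact hZ y
                · exact ha1 _
            _ ≤ δ / (Z + 1) * (Z * 1) := by gcongr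
            _ < δ := by
              rw [div_mul_eq_mul_div, div_lt_iff₀ (by positivity)]
              nlinarith
        rw [abs_lt] at h1
        constructor
        · intro h2; linarith
        · intro h2; linarith)
  rw [← hfv, setIntegral_eq_of_subset_of_forall_sdiff_eq_zero hΩ.measurableSet hB]
  · refine setIntegral_congr_fun measurableSet_ball fun x _ => ?_
    simp only [inner_add_right, inner_smul_right, real_inner_self_eq_norm_sq]
    ring
  · rintro x ⟨-, hx⟩
    rw [hψi.eq_zero hx, hψi.gradient_eq_zero hx]
    simp

/-- Where a smooth function of `u` has vanishing gradient almost everywhere, it has vanishing weak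
gradient. -/
theorem MemW12.integral_comp_mul_fderiv (hΩ : IsOpen Ω) (hu : MemW12 Ω u Du)
    (hc : ContinuousOn u Ω) {a : ℝ → ℝ} (ha : ContDiff ℝ ∞ a)
    (ha0 : ∀ᵐ x ∂(volume.restrict Ω), deriv a (u x) • Du x = 0) {ζ : Euc n → ℝ}
    (hζ : IsTestFunction Ω ζ) (e : Euc n) : ∫ x in Ω, a (u x) * fderiv ℝ ζ x e = 0 := by
  obtain ⟨ξ, hξ, -, V, hV, hKV, hξ1⟩ := exists_test_eq_one hζ.2.1 hΩ hζ.2.2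
  have h := (hu.test_mul_comp hΩ hc ha hζ).memW12.weak_grad ξ hξ e
  have e1 : ∫ x in Ω, ζ x * a (u x) * fderiv ℝ ξ x e = 0 := by
    refine integral_eq_zero_of_ae (Eventually.of_forall fun x => ?_)
    by_cases hx : x ∈ tsupport ζ
    · have h1 : ξ =ᶠ[𝓝 x] fun _ => (1 : ℝ) := by
        filter_upwards [hV.mem_nhds (hKV hx)] with y hy using hξ1 y hy
      simp [h1.fderiv_eq]
    · simp [image_eq_zero_of_notMem_tsupport hx]
  rw [e1, eq_comm, neg_eq_zero] at h
  rw [← h]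
  refine integral_congr_ae ?_
  filter_upwards [ha0] with x hx
  have h2 : (ζ x * deriv a (u x)) • Du x = 0 := by rw [mul_smul, hx, smul_zero]
  rw [h2, zero_add, inner_smul_left, inner_gradient_left, RCLike.conj_to_real]
  by_cases hxs : x ∈ tsupport ζ
  · rw [hξ1 x (hKV hxs), mul_one]
  · have : fderiv ℝ ζ x = 0 := by
      by_contra hne
      exact hxs (support_fderiv_subset ℝ hne)
    simp [this]

/-- Smooth profiles: `a` detects values below `-2δ`, and `b` is a cut-off which is `1` there and
vanishes near `0`. -/
theorem exists_negative_cutoffs {δ : ℝ} (hδ : 0 < δ) :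
    ∃ (a b : ℝ → ℝ) (K : ℝ), ContDiff ℝ ∞ a ∧ ContDiff ℝ ∞ b ∧ (∀ s, |a s| ≤ 1) ∧
      (∀ s, |b s| ≤ 1) ∧ (∀ s, |deriv a s| ≤ K) ∧ (∀ s, |deriv b s| ≤ K / δ) ∧
      (∀ s, -(2 * δ) ≤ s → a s = 0) ∧ (∀ s, s < -(2 * δ) → 0 < a s) ∧
      (∀ s, -(2 * δ) < s → deriv a s = 0) ∧ (∀ s, deriv a s ≤ 0) ∧
      (∀ t, -δ ≤ t → b t = 0) ∧ (∀ t, t ≤ -(2 * δ) → b t = 1) ∧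
      ∀ t, t < -(2 * δ) → deriv b t = 0 := by
  have hT : ContDiff ℝ ∞ Real.smoothTransition := Real.smoothTransition.contDiff
  have hTb : ∃ K, ∀ s, |deriv Real.smoothTransition s| ≤ K := by
    obtain ⟨K, hK⟩ := (HasCompactSupport.intro (isCompact_Icc (a := (0 : ℝ)) (b := 1))
      (f := deriv Real.smoothTransition) fun s hs => by
        rw [mem_Icc, not_and_or, not_le, not_le] at hs
        rcases hs with h | h
        · have : Real.smoothTransition =ᶠ[𝓝 s] fun _ => 0 := by
            filter_upwards [gt_mem_nhds h] with y hy
            exact Real.smoothTransition.zero_of_nonpos hy.le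
          simp [this.deriv_eq]
        · have : Real.smoothTransition =ᶠ[𝓝 s] fun _ => 1 := by
            filter_upwards [lt_mem_nhds h] with y hy
            exact Real.smoothTransition.one_of_one_le hy.le
          simp [this.deriv_eq]).exists_bound_of_continuous (hT.continuous_deriv (by simp))
    exact ⟨K, hK⟩
  obtain ⟨K, hK⟩ := hTb
  have hTd : ∀ s, HasDerivAt Real.smoothTransition (deriv Real.smoothTransition s) s := fun s =>
    (hT.differentiable (by simp) s).hasDerivAt
  have hTabs : ∀ s, |Real.smoothTransition s| ≤ 1 := fun s => by
    rw [abs_of_nonneg (Real.smoothTransition.nonneg s)]; exact Real.smoothTransition.le_one s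
  set a : ℝ → ℝ := fun s => Real.smoothTransition (-2 * δ - s) with ha
  set b : ℝ → ℝ := fun t => Real.smoothTransition ((-t - δ) / δ) with hb
  have hac : ContDiff ℝ ∞ a := hT.comp (contDiff_const.sub contDiff_id)
  have hbc : ContDiff ℝ ∞ b := hT.comp (((contDiff_id.neg).sub contDiff_const).div_const _)
  have had : ∀ s, deriv a s = -deriv Real.smoothTransition (-2 * δ - s) := fun s => by
    have h1 : HasDerivAt (fun s : ℝ => -2 * δ - s) (-1) s := by
      simpa using (hasDerivAt_id s).const_sub (-2 * δ)
    have := (hTd (-2 * δ - s)).comp s h1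
    rw [show a = Real.smoothTransition ∘ fun s => -2 * δ - s from rfl, this.deriv]; ring
  have hbd : ∀ s, deriv b s = deriv Real.smoothTransition ((-s - δ) / δ) * (-1 / δ) := fun s => by
    have h1 : HasDerivAt (fun s : ℝ => (-s - δ) / δ) (-1 / δ) s := by
      simpa using (((hasDerivAt_id s).neg).sub_const δ).div_const δ
    have := (hTd ((-s - δ) / δ)).comp s h1
    rw [show b = Real.smoothTransition ∘ fun s => (-s - δ) / δ from rfl, this.deriv]
  have ha1 : ∀ s, |a s| ≤ 1 := fun s => hTabs _
  have hb1 : ∀ s, |b s| ≤ 1 := fun s => hTabs _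
  have haK : ∀ s, |deriv a s| ≤ K := fun s => by rw [had, abs_neg]; exact hK _
  have hbK : ∀ s, |deriv b s| ≤ K / δ := fun s => by
    rw [hbd, abs_mul, abs_div, abs_neg, abs_one, abs_of_pos hδ, mul_one_div]
    gcongr
    exact hK _
  have ha0 : ∀ s, -(2 * δ) ≤ s → a s = 0 := fun s hs =>
    Real.smoothTransition.zero_of_nonpos (by linarith)
  have hapos : ∀ s, s < -(2 * δ) → 0 < a s := fun s hs =>
    Real.smoothTransition.pos_of_pos (by linarith)
  have had0 : ∀ s, -(2 * δ) < s → deriv a s = 0 := fun s hs => by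
    have : a =ᶠ[𝓝 s] fun _ => 0 := by
      filter_upwards [lt_mem_nhds hs] with y hy using ha0 y hy.le
    simp [this.deriv_eq]
  have hadn : ∀ s, deriv a s ≤ 0 := fun s => by
    rw [had, neg_nonpos]
    exact Real.smoothTransition.monotone.deriv_nonneg
  have hb0 : ∀ t, -δ ≤ t → b t = 0 := fun t ht =>
    Real.smoothTransition.zero_of_nonpos (div_nonpos_of_nonpos_of_nonneg (by linarith) hδ.le)
  have hb1' : ∀ t, t ≤ -(2 * δ) → b t = 1 := fun t ht =>
    Real.smoothTransition.one_of_one_le (by rw [le_div_iff₀ hδ]; linarith)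
  have hbd0 : ∀ t, t < -(2 * δ) → deriv b t = 0 := fun t ht => by
    have : b =ᶠ[𝓝 t] fun _ => 1 := by
      filter_upwards [gt_mem_nhds ht] with y hy using hb1' y hy.le
    simp [this.deriv_eq]
  exact ⟨a, b, K, hac, hbc, ha1, hb1, haK, hbK, ha0, hapos, had0, hadn, hb0, hb1', hbd0⟩

/-- Local minimizers with nonnegative boundary data are nonnegative. On balls a minimizer is
harmonic where it is negative; since `u - u₀` is a limit of test functions, the vanishing of the
boundary values of the negative part may be used globally, without any regularity of `Ω`. -/
theorem MinimizesOnBalls.ae_neg_le {ε₀ : ℝ} (hmin : MinimizesOnBalls Q Ω u Du ε₀)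
    (hε : 0 < ε₀) (hn : 0 < n) (hΩ : IsOpen Ω) (hQ : Continuous Q) (hu : MemW12 Ω u Du)
    (hc : ContinuousOn u Ω) (hw : MemW12Zero Ω w Dw)
    (hwu : ∀ᵐ x ∂(volume.restrict Ω), w x ≤ u x) {δ : ℝ} (hδ : 0 < δ) :
    ∀ᵐ x ∂(volume.restrict Ω), -(2 * δ) ≤ u x := by
  obtain ⟨a, b, K, hac, hbc, ha1, hb1, haK, hbK, ha0, hapos, had0, hadn, hb0, hb1', hbd0⟩ :=
    exists_negative_cutoffs hδ
  have ham : AEStronglyMeasurable (fun x => a (u x)) (volume.restrict Ω) :=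
    hac.continuous.comp_aestronglyMeasurable hu.memLp.1
  have hdm : AEStronglyMeasurable (fun x => deriv a (u x)) (volume.restrict Ω) :=
    (hac.continuous_deriv (by simp)).comp_aestronglyMeasurable hu.memLp.1
  -- test functions converging to `w`, also almost everywhere
  obtain ⟨φ', hφ', hl', hg'⟩ := hw.approx
  obtain ⟨ns, hns, hae⟩ := (tendstoInMeasure_of_tendsto_eLpNorm (p := 2) (by norm_num)
    (fun j => (hφ' j).1.continuous.aestronglyMeasurable) hw.memW12.memLp.1 hl').exists_seq_tendsto_ae
  set φ : ℕ → Euc n → ℝ := fun j => φ' (ns j) with hφdef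
  have hφ : ∀ j, IsTestFunction Ω (φ j) := fun j => hφ' _
  have hgl : Tendsto (fun j => eLpNorm (fun x => gradient (φ j) x - Dw x) 2 (volume.restrict Ω))
      atTop (𝓝 0) := hg'.comp hns.tendsto_atTop
  have hbφ : ∀ j, IsTestFunction Ω fun x => b (φ j x) := fun j => by
    have hsub : tsupport (fun x => b (φ j x)) ⊆ tsupport (φ j) :=
      closure_mono fun x hx h0 => hx (by
        simp only [h0]; exact hb0 0 (by linarith))
    exact ⟨hbc.comp (hφ j).1, (hφ j).2.1.mono' (subset_closure.trans hsub),
      hsub.trans (hφ j).2.2⟩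
  have hbgrad : ∀ j x, gradient (fun x => b (φ j x)) x = deriv b (φ j x) • gradient (φ j) x :=
    fun j x => gradient_comp (hbc.differentiable (by simp) _) ((hφ j).differentiableAt x)
  -- the terms in which `b ∘ φ j` is differentiated disappear in the limit
  have hvanish : ∀ Y : Euc n → Euc n, MemLp Y 2 (volume.restrict Ω) →
      Tendsto (fun j => ∫ x in Ω, a (u x) * inner ℝ (Y x) (gradient (fun x => b (φ j x)) x))
        atTop (𝓝 0) := by
    intro Y hY
    have hcm : ∀ j, AEStronglyMeasurable (fun x => a (u x) * deriv b (φ j x))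
        (volume.restrict Ω) := fun j =>
      ham.mul ((hbc.continuous_deriv (by simp)).comp (hφ j).1.continuous).aestronglyMeasurable
    have hcK : ∀ j x, |a (u x) * deriv b (φ j x)| ≤ 1 * (K / δ) := fun j x => by
      rw [abs_mul]
      exact mul_le_mul (ha1 _) (hbK _) (abs_nonneg _) zero_le_one
    have h1 := tendsto_eLpNorm_smul_of_ae hcm hcK hY (by
      filter_upwards [hae, hwu] with x hx hxu
      rcases le_or_gt (-(2 * δ)) (u x) with h | h
      · rw [ha0 _ h]; simp
      · have h2 := ((hbc.continuous_deriv (by simp)).tendsto (w x)).comp hx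
        rw [hbd0 _ (hxu.trans_lt h)] at h2
        simpa using h2.const_mul (a (u x)))
    have hmem : ∀ j, MemLp (fun x => (a (u x) * deriv b (φ j x)) • Y x) 2 (volume.restrict Ω) :=
      fun j => hY.of_le_mul (c := 1 * (K / δ)) ((hcm j).smul hY.1) (Eventually.of_forall fun x => by
        rw [norm_smul]
        exact mul_le_mul_of_nonneg_right (hcK j x) (norm_nonneg _))
    have h2 := tendsto_integral_inner hmem (MemLp.zero' (ε := Euc n))
      (fun j => (hφ j).memLp_gradient.restrict Ω) hw.memW12.memLp_grad (by simpa using h1) hgl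
    simp only [inner_zero_left, integral_zero] at h2
    refine h2.congr fun j => integral_congr_ae (Eventually.of_forall fun x => ?_)
    simp only [hbgrad, inner_smul_left, inner_smul_right, RCLike.conj_to_real]
    ring
  have hblim : ∀ᵐ x ∂(volume.restrict Ω), u x ≤ -(2 * δ) →
      Tendsto (fun j => b (φ j x)) atTop (𝓝 1) := by
    filter_upwards [hae, hwu] with x hx hxu h
    have := (hbc.continuous.tendsto (w x)).comp hx
    rwa [hb1' _ (hxu.trans h)] at this
  have hDi := integrable_norm_sq hu.memLp_grad
  have hadi : IntegrableOn (fun x => deriv a (u x) * ‖Du x‖ ^ 2) Ω :=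
    hDi.bdd_mul hdm (Eventually.of_forall fun x => haK (u x))
  have hzero : ∀ᵐ x ∂(volume.restrict Ω), deriv a (u x) • Du x = 0 := by
    have h1 : ∀ j, ∫ x in Ω, deriv a (u x) * ‖Du x‖ ^ 2 * b (φ j x)
        = -∫ x in Ω, a (u x) * inner ℝ (Du x) (gradient (fun x => b (φ j x)) x) := fun j => by
      have h := hmin.integral_inner_comp_eq_zero hε hΩ hQ hu hc hac (δ := 2 * δ) (by linarith)
        ha1 haK ha0 (hbφ j)
      have i1 : IntegrableOn (fun x => deriv a (u x) * ‖Du x‖ ^ 2 * b (φ j x)) Ω :=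
        hadi.mul_bdd (c := 1) (hbφ j).1.continuous.aestronglyMeasurable
          (Eventually.of_forall fun x => hb1 _)
      have i2 : IntegrableOn (fun x => a (u x) * inner ℝ (Du x)
          (gradient (fun x => b (φ j x)) x)) Ω :=
        (integrable_inner hu.memLp_grad ((hbφ j).memLp_gradient.restrict _)).bdd_mul ham
          (Eventually.of_forall fun x => ha1 (u x))
      rw [integral_add i1 i2] at h
      linarith
    have h2 : Tendsto (fun j => ∫ x in Ω, deriv a (u x) * ‖Du x‖ ^ 2 * b (φ j x)) atTop
        (𝓝 (∫ x in Ω, deriv a (u x) * ‖Du x‖ ^ 2)) := by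
      refine tendsto_integral_of_dominated_convergence (fun x => |deriv a (u x) * ‖Du x‖ ^ 2|)
        (fun j => hadi.1.mul (hbφ j).1.continuous.aestronglyMeasurable) hadi.abs
        (fun j => Eventually.of_forall fun x => ?_) ?_
      · rw [Real.norm_eq_abs, abs_mul]
        exact mul_le_of_le_one_right (abs_nonneg _) (hb1 _)
      · filter_upwards [hblim] with x hx
        rcases le_or_gt (u x) (-(2 * δ)) with h | h
        · simpa using (hx h).const_mul (deriv a (u x) * ‖Du x‖ ^ 2)
        · rw [had0 _ h]; simp
    have h3 := (hvanish Du hu.memLp_grad).neg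
    simp only [h1] at h2
    have h4 := tendsto_nhds_unique h2 h3
    rw [neg_zero] at h4
    have h5 : ∫ x in Ω, -(deriv a (u x) * ‖Du x‖ ^ 2) = 0 := by rw [integral_neg, h4, neg_zero]
    have h6 : IntegrableOn (fun x => -(deriv a (u x) * ‖Du x‖ ^ 2)) Ω := hadi.neg
    rw [integral_eq_zero_iff_of_nonneg (fun x => by
      rw [Pi.zero_apply, ← neg_mul]
      exact mul_nonneg (neg_nonneg.2 (hadn (u x))) (sq_nonneg ‖Du x‖)) h6] at h5
    filter_upwards [h5] with x hx
    simp only [Pi.zero_apply, neg_eq_zero, mul_eq_zero] at hx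
    rcases hx with h | h
    · rw [h, zero_smul]
    · rw [norm_eq_zero.1 (pow_eq_zero_iff (two_ne_zero) |>.1 h), smul_zero]
  -- extended by zero, `a ∘ u` has no gradient at all
  have haL : MemLp (fun x => a (u x)) 2 (volume.restrict Ω) := by
    refine hu.memLp.of_le_mul (c := 1 / (2 * δ)) ham (Eventually.of_forall fun x => ?_)
    rcases le_or_gt (-(2 * δ)) (u x) with h | h
    · rw [ha0 _ h, norm_zero]; positivity
    · refine (ha1 _).trans ?_
      rw [one_div, ← div_eq_inv_mul, one_le_div (by positivity), Real.norm_eq_abs, abs_of_neg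
        (by linarith)]
      linarith
  have hW : MemW12 univ (Ω.indicator fun x => a (u x)) fun _ => 0 := by
    refine ⟨?_, MemLp.zero, fun ψ hψ e => ?_⟩
    · rw [Measure.restrict_univ]
      exact (memLp_indicator_iff_restrict hΩ.measurableSet).2 haL
    · simp only [inner_zero_left, zero_mul, integral_zero, neg_zero, Measure.restrict_univ]
      have e1 : ∫ x, Ω.indicator (fun x => a (u x)) x * fderiv ℝ ψ x e
          = ∫ x in Ω, a (u x) * fderiv ℝ ψ x e := by
        rw [← integral_indicator hΩ.measurableSet]
        refine integral_congr_ae (Eventually.of_forall fun x => ?_)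
        simp only [indicator_mul_left]
      rw [e1]
      have hψm : MemLp (fun x => fderiv ℝ ψ x e) 2 (volume.restrict Ω) :=
        (memLp_fderiv_apply hψ e).restrict _
      have hi : IntegrableOn (fun x => a (u x) * fderiv ℝ ψ x e) Ω := haL.integrable_mul hψm
      have h2 : Tendsto (fun j => ∫ x in Ω, a (u x) * fderiv ℝ ψ x e * b (φ j x)) atTop
          (𝓝 (∫ x in Ω, a (u x) * fderiv ℝ ψ x e)) := by
        refine tendsto_integral_of_dominated_convergence (fun x => |a (u x) * fderiv ℝ ψ x e|)
          (fun j => hi.1.mul (hbφ j).1.continuous.aestronglyMeasurable) hi.abs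
          (fun j => Eventually.of_forall fun x => ?_) ?_
        · rw [Real.norm_eq_abs, abs_mul]
          exact mul_le_of_le_one_right (abs_nonneg _) (hb1 _)
        · filter_upwards [hblim] with x hx
          rcases le_or_gt (u x) (-(2 * δ)) with h | h
          · simpa using (hx h).const_mul (a (u x) * fderiv ℝ ψ x e)
          · rw [ha0 _ h.le]; simp
      have hY : MemLp (fun x => ψ x • e) 2 (volume.restrict Ω) := by
        obtain ⟨Z, hZ⟩ := hψ.2.1.exists_bound_of_continuous hψ.1.continuous
        refine (hψ.memLp.restrict _).of_le_mul (c := ‖e‖)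
          (hψ.1.continuous.smul continuous_const).aestronglyMeasurable
          (Eventually.of_forall fun x => ?_)
        rw [norm_smul, mul_comm]
      have h3 := (hvanish _ hY).neg
      rw [neg_zero] at h3
      refine tendsto_nhds_unique h2 (h3.congr fun j => ?_)
      have hprod : IsTestFunction Ω fun x => ψ x * b (φ j x) := (hbφ j).mul_left hψ.1
      have h4 := hu.integral_comp_mul_fderiv hΩ hc hac hzero hprod e
      have h5 : ∀ x, a (u x) * fderiv ℝ (fun x => ψ x * b (φ j x)) x e
          = a (u x) * fderiv ℝ ψ x e * b (φ j x)
            + a (u x) * inner ℝ (ψ x • e) (gradient (fun x => b (φ j x)) x) := fun x => by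
        rw [fderiv_fun_mul (hψ.differentiableAt x) ((hbφ j).differentiableAt x),
          real_inner_comm, inner_smul_right, inner_gradient_left]
        simp only [add_apply, smul_apply, smul_eq_mul]
        ring
      simp only [h5] at h4
      have i1 : IntegrableOn (fun x => a (u x) * fderiv ℝ ψ x e * b (φ j x)) Ω :=
        hi.mul_bdd (c := 1) (hbφ j).1.continuous.aestronglyMeasurable
          (Eventually.of_forall fun x => hb1 _)
      have i2 : IntegrableOn (fun x => a (u x) * inner ℝ (ψ x • e)
          (gradient (fun x => b (φ j x)) x)) Ω :=
        (integrable_inner hY ((hbφ j).memLp_gradient.restrict _)).bdd_mul ham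
          (Eventually.of_forall fun x => ha1 (u x))
      rw [integral_add i1 i2] at h4
      linarith
  have hfin := hW.eq_zero_of_gradient_zero hn
  filter_upwards [ae_restrict_of_ae hfin, ae_restrict_mem hΩ.measurableSet] with x hx hxΩ
  by_contra h
  rw [indicator_of_mem hxΩ] at hx
  exact (hapos _ (not_le.1 h)).ne' hx

/-- A local minimizer is nonnegative, in its precise representative. -/
theorem MinimizesOnBalls.nonneg {ε₀ : ℝ} (hmin : MinimizesOnBalls Q Ω u Du ε₀)
    (hε : 0 < ε₀) (hn : 0 < n) (hΩ : IsOpen Ω) (hQ : Continuous Q) (hu : MemW12 Ω u Du)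
    (hc : ContinuousOn u Ω) (hrep : IsPreciseRepresentative Ω u) (hw : MemW12Zero Ω w Dw)
    (hwu : ∀ᵐ x ∂(volume.restrict Ω), w x ≤ u x) {x : Euc n} (hx : x ∈ Ω) : 0 ≤ u x := by
  have hpos : ∀ j : ℕ, (0 : ℝ) < 1 / ((j : ℝ) + 1) := fun j => by positivity
  have h0 : ∀ᵐ y ∂(volume.restrict Ω), 0 ≤ u y := by
    filter_upwards [ae_all_iff.2 fun j => hmin.ae_neg_le hε hn hΩ hQ hu hc hw hwu (hpos j)]
      with y hy
    have := (tendsto_one_div_add_atTop_nhds_zero_nat (𝕜 := ℝ)).const_mul 2 |>.neg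
    rw [mul_zero, neg_zero] at this
    exact le_of_tendsto this (Eventually.of_forall hy)
  refine ge_of_tendsto (hrep x hx) ?_
  obtain ⟨R, hR, hRΩ⟩ := Metric.isOpen_iff.1 hΩ x hx
  filter_upwards [Ioo_mem_nhdsGT hR] with ρ hρ
  rw [setAverage_eq]
  refine smul_nonneg (by positivity) (integral_nonneg_of_ae ?_)
  exact ae_restrict_of_ae_restrict_of_subset ((ball_subset_ball hρ.2.le).trans hRΩ) h0

/-! ### Bounds for the Weiss density and its limit -/

theorem sphereSq_nonneg (u : Euc n → ℝ) (x₀ : Euc n) (r : ℝ) : 0 ≤ sphereSq u x₀ r :=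
  integral_nonneg fun _ => sq_nonneg _

theorem sphereSq_le {x₀ : Euc n} {r K : ℝ} (hr : 0 ≤ r) (h0 : ∀ x ∈ closedBall x₀ r, 0 ≤ u x)
    (hK : ∀ x ∈ closedBall x₀ r, u x ≤ K) :
    sphereSq u x₀ r ≤ K ^ 2 * (volume : Measure (Euc n)).toSphere.real univ := by
  have hmem : ∀ η : sphere (0 : Euc n) 1, x₀ + r • (η : Euc n) ∈ closedBall x₀ r := fun η => by
    simp [mem_closedBall, dist_eq_norm, norm_smul, abs_of_nonneg hr]
  have := integral_mono_of_nonneg (μ := (volume : Measure (Euc n)).toSphere)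
    (f := fun η : sphere (0 : Euc n) 1 => u (x₀ + r • (η : Euc n)) ^ 2) (g := fun _ => K ^ 2)
    (Eventually.of_forall fun _ => sq_nonneg _) (integrable_const _)
    (Eventually.of_forall fun η => pow_le_pow_left₀ (h0 _ (hmem η)) (hK _ (hmem η)) 2)
  rw [integral_const, smul_eq_mul, mul_comm] at this
  exact this

theorem integral_weight_le (hn : 0 < n) {γ r : ℝ} (hγ : 0 < γ) (hr : 0 < r) {x₀ : Euc n}
    (hQ0 : ∀ x, 0 ≤ Q x) (hQγ : ∀ x, Q x ≤ dist x x₀ ^ γ) (u : Euc n → ℝ) :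
    ∫ x in ball x₀ r, Q x ^ 2 * posChar u x
      ≤ volume.real (ball (0 : Euc n) 1) * r ^ ((n : ℝ) + 2 * γ) := by
  have hle : ∀ x ∈ ball x₀ r, Q x ^ 2 * posChar u x ≤ r ^ (2 * γ) := by
    intro x hx
    calc Q x ^ 2 * posChar u x ≤ Q x ^ 2 * 1 := by gcongr; exact posChar_le_one u x
      _ = Q x ^ 2 := mul_one _
      _ ≤ (r ^ γ) ^ 2 := by
        refine pow_le_pow_left₀ (hQ0 x) ((hQγ x).trans ?_) 2
        exact Real.rpow_le_rpow dist_nonneg (mem_ball.1 hx).le hγ.le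
      _ = r ^ (2 * γ) := by
        rw [← Real.rpow_natCast, ← Real.rpow_mul hr.le]; congr 1; push_cast; ring
  have h1 : ∫ x in ball x₀ r, Q x ^ 2 * posChar u x ≤ ∫ _ in ball x₀ r, r ^ (2 * γ) := by
    refine integral_mono_of_nonneg (Eventually.of_forall fun x =>
      mul_nonneg (sq_nonneg _) (posChar_nonneg u x)) (integrable_const _) ?_
    filter_upwards [ae_restrict_mem measurableSet_ball] with x hx using hle x hx
  refine h1.trans (le_of_eq ?_)
  have : Nonempty (Fin n) := ⟨⟨0, hn⟩⟩
  rw [setIntegral_const, smul_eq_mul, volume_real_ball x₀ hr, Real.rpow_add hr, Real.rpow_natCast]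
  ring

/-- The Dirichlet integral of a function with vanishing first variation is controlled by its values:
a Caccioppoli inequality read off from `∫_{B_ρ} |∇u|² = ½ ρ ^ (n - 1) (sphereSq)' (ρ)`. -/
theorem MinimizesOnBalls.dirichlet_le {ε₀ : ℝ} (hmin : MinimizesOnBalls Q Ω u Du ε₀)
    (hε : 0 < ε₀) (hn : 0 < n) (hΩ : IsOpen Ω) (hQ : Continuous Q) (hu : MemW12 Ω u Du)
    (hc : ContinuousOn u Ω) {x₀ : Euc n} {r : ℝ} (hr : 0 < r) (hB : closedBall x₀ (2 * r) ⊆ Ω) :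
    r * ∫ x in ball x₀ r, ‖Du x‖ ^ 2 ≤ (2 * r) ^ (n - 1) * (sphereSq u x₀ (2 * r) / 2) := by
  have hB' : ball x₀ (2 * r) ⊆ Ω := ball_subset_closedBall.trans hB
  have huB := hu.mono hB'
  have hDi : IntegrableOn (fun x => ‖Du x‖ ^ 2) (ball x₀ (2 * r)) :=
    integrable_norm_sq huB.memLp_grad
  have hr2 : r ≤ 2 * r := by linarith
  have hdir := hmin.ae_dirichlet_eq hε hn hQ hu (x₀ := x₀) (R := 2 * r) (by positivity) hB'
  have hT := intervalIntegrable_sphereFlux hn huB hr hr2 le_rfl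
  have hsub := sphereSq_sub hn hΩ hu hc hr hr2 hB
  rw [intervalIntegral.integral_const_mul] at hsub
  have h1 : ∫ _ in r..(2 * r), (∫ x in ball x₀ r, ‖Du x‖ ^ 2)
      ≤ ∫ ρ in r..(2 * r), (2 * r) ^ (n - 1) * sphereFlux u Du x₀ ρ := by
    refine intervalIntegral.integral_mono_ae_restrict hr2 intervalIntegrable_const
      (hT.const_mul _) ?_
    have hne : ∀ᵐ ρ : ℝ, ρ ≠ 2 * r := by simp [ae_iff, measure_singleton]
    filter_upwards [ae_restrict_of_ae hdir, ae_restrict_of_ae hne,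
      ae_restrict_mem measurableSet_Icc] with ρ h2 h3 hρ
    have hρ0 : 0 < ρ := hr.trans_le hρ.1
    have h4 := h2 ⟨hρ0, lt_of_le_of_ne hρ.2 h3⟩
    have h5 : (∫ x in ball x₀ r, ‖Du x‖ ^ 2) ≤ ∫ x in ball x₀ ρ, ‖Du x‖ ^ 2 :=
      setIntegral_mono_set (hDi.mono_set (ball_subset_ball hρ.2))
        (Eventually.of_forall fun _ => sq_nonneg _) (ball_subset_ball hρ.1).eventuallyLE
    have h6 : 0 ≤ ∫ x in ball x₀ ρ, ‖Du x‖ ^ 2 := integral_nonneg fun _ => sq_nonneg _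
    have h7 : 0 ≤ sphereFlux u Du x₀ ρ := by
      rw [h4] at h6
      exact nonneg_of_mul_nonneg_right h6 (by positivity)
    refine h5.trans (h4.trans_le ?_)
    have := hρ.2
    gcongr
  rw [intervalIntegral.integral_const, smul_eq_mul, intervalIntegral.integral_const_mul] at h1
  have h2 : ∫ ρ in r..(2 * r), sphereFlux u Du x₀ ρ ≤ sphereSq u x₀ (2 * r) / 2 := by
    have := sphereSq_nonneg u x₀ r
    linarith
  calc r * ∫ x in ball x₀ r, ‖Du x‖ ^ 2 = (2 * r - r) * ∫ x in ball x₀ r, ‖Du x‖ ^ 2 := by ring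
    _ ≤ _ := h1
    _ ≤ _ := by gcongr

/-- A bound for the Weiss density of a function that grows at most like `K r ^ (γ + 1)`. -/
noncomputable def weissBound (n : ℕ) (γ K : ℝ) : ℝ :=
  (γ + 1) * (K ^ 2 * (volume : Measure (Euc n)).toSphere.real univ)
    + 2 ^ ((n : ℝ) + 2 * γ) * (K ^ 2 * (volume : Measure (Euc n)).toSphere.real univ)
    + volume.real (ball (0 : Euc n) 1)

/-- Growth of order `γ + 1` on `B_r` and `B_{2r}` bounds the Weiss density: the spherical term is
bounded directly, and the Dirichlet integral on `B_r` by the energy identity up to `B_{2r}`. -/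
theorem MinimizesOnBalls.abs_weissDensity_le {γ ε₀ : ℝ} {Γ : Set (Euc n)}
    (hmin : MinimizesOnBalls (distWeight γ Γ) Ω u Du ε₀)
    (hε : 0 < ε₀) (hn : 0 < n) (hΩ : IsOpen Ω) (hγ : 0 < γ) (hu : MemW12 Ω u Du)
    (hc : ContinuousOn u Ω) (hpos : ∀ x ∈ Ω, 0 ≤ u x) {x₀ : Euc n}
    (hQγ : ∀ x, distWeight γ Γ x ≤ dist x x₀ ^ γ) {r K : ℝ} (hr : 0 < r)
    (hB : closedBall x₀ (2 * r) ⊆ Ω) (hK₁ : ∀ x ∈ closedBall x₀ r, u x ≤ K * r ^ (γ + 1))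
    (hK₂ : ∀ x ∈ closedBall x₀ (2 * r), u x ≤ K * (2 * r) ^ (γ + 1)) :
    |weissDensity γ Γ u Du x₀ r| ≤ weissBound n γ K := by
  have hQ := continuous_distWeight (n := n) hγ Γ
  have hQ0 : ∀ x, 0 ≤ distWeight γ Γ x := fun x => Real.rpow_nonneg infDist_nonneg _
  have hr2 : 0 < 2 * r := by positivity
  have hB1 : closedBall x₀ r ⊆ Ω := (closedBall_subset_closedBall (by linarith)).trans hB
  have huB := hu.mono (ball_subset_closedBall.trans hB1)
  set σ := (volume : Measure (Euc n)).toSphere.real univ with hσ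
  have hσ0 : 0 ≤ σ := measureReal_nonneg
  have hsq : ∀ s : ℝ, 0 < s → (K * s ^ (γ + 1)) ^ 2 = K ^ 2 * s ^ (2 * γ + 2) := fun s hs => by
    rw [mul_pow, ← Real.rpow_natCast (s ^ (γ + 1)), ← Real.rpow_mul hs.le]
    congr 2; push_cast; ring
  have S1 := sphereSq_le hr.le (fun x hx => hpos x (hB1 hx)) hK₁
  have S2 := sphereSq_le hr2.le (fun x hx => hpos x (hB hx)) hK₂
  rw [hsq _ hr] at S1
  rw [hsq _ hr2] at S2
  have hV := integral_weight_le hn hγ hr hQ0 hQγ u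
  have hV0 : 0 ≤ ∫ x in ball x₀ r, distWeight γ Γ x ^ 2 * posChar u x :=
    integral_nonneg fun x => mul_nonneg (sq_nonneg _) (posChar_nonneg u x)
  have hD0 : 0 ≤ ∫ x in ball x₀ r, ‖Du x‖ ^ 2 := integral_nonneg fun _ => sq_nonneg _
  have hD : ∫ x in ball x₀ r, ‖Du x‖ ^ 2
      ≤ 2 ^ ((n : ℝ) + 2 * γ) * (K ^ 2 * σ) * r ^ ((n : ℝ) + 2 * γ) := by
    have h1 := hmin.dirichlet_le hε hn hΩ hQ hu hc hr hB
    have h2 : r * ∫ x in ball x₀ r, ‖Du x‖ ^ 2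
        ≤ r * (2 ^ ((n : ℝ) + 2 * γ) * (K ^ 2 * σ) * r ^ ((n : ℝ) + 2 * γ)) := by
      refine h1.trans ?_
      calc (2 * r) ^ (n - 1) * (sphereSq u x₀ (2 * r) / 2)
          ≤ (2 * r) ^ (n - 1) * (K ^ 2 * (2 * r) ^ (2 * γ + 2) * σ / 2) := by gcongr
        _ = (K ^ 2 * σ / 2) * ((2 * r) ^ ((n : ℝ) - 1) * (2 * r) ^ (2 * γ + 2)) := by
            have : (2 * r) ^ (n - 1) = (2 * r) ^ ((n : ℝ) - 1) := by
              rw [← Real.rpow_natCast, Nat.cast_sub hn, Nat.cast_one]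
            rw [this]; ring
        _ = (K ^ 2 * σ / 2) * ((2 * r) ^ ((n : ℝ) + 2 * γ) * (2 * r)) := by
            rw [← Real.rpow_add hr2]
            nth_rewrite 3 [← Real.rpow_one (2 * r)]
            rw [← Real.rpow_add hr2]
            congr 2; ring
        _ = _ := by
            rw [Real.mul_rpow (by norm_num) hr.le]; ring
    exact le_of_mul_le_mul_left h2 hr
  have hp1 : r ^ (-((n : ℝ) + 2 * γ)) * r ^ ((n : ℝ) + 2 * γ) = 1 := by
    rw [← Real.rpow_add hr, neg_add_cancel, Real.rpow_zero]
  have hp2 : r ^ (-(2 * γ + 2)) * r ^ (2 * γ + 2) = 1 := by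
    rw [← Real.rpow_add hr, neg_add_cancel, Real.rpow_zero]
  have hA0 : 0 ≤ r ^ (-((n : ℝ) + 2 * γ)) := by positivity
  have hC0 : 0 ≤ r ^ (-(2 * γ + 2)) := by positivity
  have hE1 : r ^ (-((n : ℝ) + 2 * γ)) * energyJ (distWeight γ Γ) (ball x₀ r) u Du
      ≤ 2 ^ ((n : ℝ) + 2 * γ) * (K ^ 2 * σ) + volume.real (ball (0 : Euc n) 1) := by
    rw [energyJ_eq hQ huB]
    refine (mul_le_mul_of_nonneg_left (add_le_add hD hV) hA0).trans (le_of_eq ?_)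
    linear_combination (2 ^ ((n : ℝ) + 2 * γ) * (K ^ 2 * σ)
      + volume.real (ball (0 : Euc n) 1)) * hp1
  have hE0 : 0 ≤ r ^ (-((n : ℝ) + 2 * γ)) * energyJ (distWeight γ Γ) (ball x₀ r) u Du := by
    rw [energyJ_eq hQ huB]
    positivity
  have hS1 : r ^ (-(2 * γ + 2)) * sphereSq u x₀ r ≤ K ^ 2 * σ := by
    refine (mul_le_mul_of_nonneg_left S1 hC0).trans (le_of_eq ?_)
    linear_combination (K ^ 2 * σ) * hp2
  have hS0 : 0 ≤ r ^ (-(2 * γ + 2)) * sphereSq u x₀ r := mul_nonneg hC0 (sphereSq_nonneg _ _ _)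
  have hS1' := mul_le_mul_of_nonneg_left hS1 (show 0 ≤ γ + 1 by linarith)
  have hS0' := mul_nonneg (show 0 ≤ γ + 1 by linarith) hS0
  have hω : 0 ≤ volume.real (ball (0 : Euc n) 1) := measureReal_nonneg
  have hX : 0 ≤ 2 ^ ((n : ℝ) + 2 * γ) * (K ^ 2 * σ) := by positivity
  rw [weissDensity_eq Γ u Du x₀ hn hr, weissBound, abs_le]
  constructor <;> linarith

/-- Almost monotone bounded functions of the radius have a limit at `0`. -/
theorem exists_tendsto_of_almost_monotone {g : ℝ → ℝ} {A α c R : ℝ} (hα : 0 < α) (hR : 0 < R)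
    (hA : 0 ≤ A)
    (hmono : ∀ r s, 0 < r → r < s → s < R → g r + A * r ^ α ≤ g s + A * s ^ α)
    (hb : ∀ᶠ r in 𝓝[>] (0 : ℝ), |g r| ≤ c) :
    ∃ L ∈ Icc (-c) c, Tendsto g (𝓝[>] 0) (𝓝 L) := by
  obtain ⟨δ, hδ, hbδ⟩ := mem_nhdsGT_iff_exists_Ioo_subset.1 hb
  have hδ0 : 0 < δ := hδ
  have hmin : 0 < min δ R := lt_min hδ0 hR
  have hM : MonotoneOn (fun r => g r + A * r ^ α) (Ioo 0 (min δ R)) := by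
    intro r hr s hs hrs
    rcases hrs.eq_or_lt with rfl | h
    · exact le_rfl
    · exact hmono r s hr.1 h (hs.2.trans_le (min_le_right _ _))
  have hbdd : BddBelow ((fun r => g r + A * r ^ α) '' Ioo 0 (min δ R)) := by
    refine ⟨-c, ?_⟩
    rintro _ ⟨r, hr, rfl⟩
    have h1 : |g r| ≤ c := hbδ ⟨hr.1, hr.2.trans_le (min_le_left _ _)⟩
    have h2 : 0 ≤ A * r ^ α := mul_nonneg hA (Real.rpow_nonneg hr.1.le _)
    have h3 := (abs_le.1 h1).1
    simp only
    linarith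
  have hlim := hM.tendsto_nhdsWithin_Ioo_right (nonempty_Ioo.2 hmin) hbdd
  have hpow : Tendsto (fun r : ℝ => A * r ^ α) (𝓝[>] 0) (𝓝 0) := by
    have h1 : Tendsto (fun r : ℝ => r ^ α) (𝓝[>] 0) (𝓝 0) := by
      have := (Real.continuousAt_rpow_const 0 α (Or.inr hα.le)).tendsto
      rw [Real.zero_rpow hα.ne'] at this
      exact this.mono_left nhdsWithin_le_nhds
    simpa using h1.const_mul A
  have hg := hlim.sub hpow
  simp only [add_sub_cancel_right, sub_zero] at hg
  exact ⟨_, ⟨ge_of_tendsto hg (hb.mono fun r hr => (abs_le.1 hr).1),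
    le_of_tendsto hg (hb.mono fun r hr => (abs_le.1 hr).2)⟩, hg⟩

end

theorem theorem4p3 (γ α : ℝ) (hγ : 0 < γ) (hα : 0 < α) (hα' : α ≤ 1) :
    ∃ C : ℝ, 0 < C ∧ ∀ n : ℕ, 2 ≤ n → ∃ c : ℝ, 0 < c ∧
      ∀ (k : ℕ), k < n →
      ∀ (M : ℝ) (Γ Ω : Set (Euc n)), IsC1AlphaSubmanifold k α 1 M Γ → IsOpen Ω →
      ∀ (u₀ : Euc n → ℝ) (Du₀ : Euc n → Euc n) (u : Euc n → ℝ) (Du : Euc n → Euc n),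
        IsLocalMinimizer (distWeight γ Γ) Ω u₀ Du₀ u Du → IsPreciseRepresentative Ω u →
      ∀ x₀ ∈ Ω ∩ Γ ∩ frontier {x ∈ Ω | 0 < u x},
        (∀ᵐ r : ℝ, 0 < r → r ≤ 1 → ball x₀ (2 * r) ⊆ Ω →
          SphereIntegrable x₀ r (homogeneityDefect γ u Du x₀ r) ∧
          ∃ W' : ℝ, HasDerivAt (fun s => weissDensity γ Γ u Du x₀ s) W' r ∧
            W' ≤ 2 / r ^ ((n : ℝ) + 2 * γ) *
                  sphereIntegral x₀ r (homogeneityDefect γ u Du x₀ r)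
                + C * γ * holderSeminorm k α Γ * r ^ (α - 1)) ∧
        (∀ r R : ℝ, 0 < r → r < R → R ≤ 1 / 2 → ball x₀ (2 * R) ⊆ Ω →
          weissDensity γ Γ u Du x₀ r ≤ weissDensity γ Γ u Du x₀ R
            + C * γ / α * holderSeminorm k α Γ * R ^ α) ∧
        ∃ W₀ : ℝ, W₀ ∈ Set.Icc (-c) c ∧
          Tendsto (fun r => weissDensity γ Γ u Du x₀ r) (𝓝[>] 0) (𝓝 W₀) := by
  obtain ⟨C, hC, hPoh⟩ := exists_pohozaevDefect_bound hγ hα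
  -- the Pohozaev bound has no factor `γ`, while the claim has `C * γ`
  refine ⟨C / γ, by positivity, fun n hn2 => ?_⟩
  have hn : 0 < n := by omega
  -- the growth constant of `MinimizesOnBalls.growth`
  set K : ℝ := (2 : ℝ) ^ γ + 2 ^ n * (2 * 2 ^ γ) with hK
  have hbound0 : 0 ≤ weissBound n γ K := by
    unfold weissBound
    positivity
  refine ⟨weissBound n γ K + 1, by linarith, ?_⟩
  intro k hk M Γ Ω hΓ hΩ u₀ Du₀ u Du hloc hrep x₀ hx₀
  obtain ⟨⟨hx₀Ω, hx₀Γ⟩, hx₀F⟩ := hx₀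
  obtain ⟨ε₀, hε, hmin⟩ := hloc.minimal
  have hmin' : MinimizesOnBalls (distWeight γ Γ) Ω u Du ε₀ := hmin
  have hu := hloc.memK.1
  have hQ := continuous_distWeight (n := n) hγ Γ
  have hQ0 : ∀ x, 0 ≤ distWeight γ Γ x := fun x => Real.rpow_nonneg infDist_nonneg _
  have hQγ : ∀ x, distWeight γ Γ x ≤ dist x x₀ ^ γ := fun x =>
    Real.rpow_le_rpow infDist_nonneg (infDist_le_dist_of_mem hx₀Γ) hγ.le
  have hc := hmin'.continuousOn hε hn hΩ hQ hQ0 hu hrep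
  have hpos : ∀ x ∈ Ω, 0 ≤ u x := fun x hx =>
    hmin'.nonneg hε hn hΩ hQ hu hc hrep hloc.memK.2 (by
      filter_upwards [hloc.data_nonneg] with y hy
      linarith) hx
  have hux₀ : u x₀ ≤ 0 := by
    by_contra h
    rw [not_le] at h
    refine hx₀F.2 (mem_interior_iff_mem_nhds.2 ?_)
    filter_upwards [hΩ.mem_nhds hx₀Ω, (hc.continuousAt (hΩ.mem_nhds hx₀Ω)).eventually
      (lt_mem_nhds h)] with y hy1 hy2 using ⟨hy1, hy2⟩
  have hH := holderSeminorm_nonneg k α Γ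
  set H := C * holderSeminorm k α Γ with hHdef
  have hH0 : 0 ≤ H := mul_nonneg hC.le hH
  obtain ⟨h1, h2⟩ := hmin'.weissDensity_monotone hε hn hγ hα hΩ hu hc (x₀ := x₀)
    fun R hR hB => hPoh n k M Γ Ω u Du ε₀ x₀ R hk hΓ hx₀Γ hmin' hε (hu.mono hB) hR hB
  have hCγ : C / γ * γ = C := div_mul_cancel₀ C hγ.ne'
  refine ⟨?_, fun r R hr hrR hR hB => ?_, ?_⟩
  · rw [hCγ]
    exact h1
  · have h3 := h2 r R hr hrR hR hB
    have h4 : 0 ≤ H / α * r ^ α := by positivity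
    have h5 : C / γ * γ / α * holderSeminorm k α Γ * R ^ α = H / α * R ^ α := by
      rw [hCγ, hHdef]; ring
    rw [h5]
    linarith
  · obtain ⟨R₀, hR₀, hR₀Ω⟩ := Metric.isOpen_iff.1 hΩ x₀ hx₀Ω
    have hgrow := hmin'.growth hε hn hΩ hQ hQ0 hu hrep hγ hx₀Ω hux₀ hpos hQγ
    have h2t : Tendsto (fun r : ℝ => 2 * r) (𝓝[>] 0) (𝓝[>] 0) := by
      refine tendsto_nhdsWithin_iff.2 ⟨?_, ?_⟩
      · have : Tendsto (fun r : ℝ => 2 * r) (𝓝[>] 0) (𝓝 (2 * 0)) :=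
          ((continuous_const.mul continuous_id).tendsto (0 : ℝ)).mono_left nhdsWithin_le_nhds
        simpa using this
      · filter_upwards [self_mem_nhdsWithin] with r hr
        have : 0 < r := hr
        exact mul_pos two_pos this
    refine exists_tendsto_of_almost_monotone (A := H / α) hα
      (show 0 < min (1 / 2) (R₀ / 2) by positivity) (by positivity)
      (fun r s hr hrs hs => h2 r s hr hrs (hs.le.trans (min_le_left _ _)) ?_) ?_
    · refine (ball_subset_ball ?_).trans hR₀Ω
      linarith [hs.trans_le (min_le_right _ _)]
    · filter_upwards [hgrow, h2t.eventually hgrow, Ioo_mem_nhdsGT (show 0 < R₀ / 2 by positivity)]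
        with r hr1 hr2 hr
      refine (hmin'.abs_weissDensity_le hε hn hΩ hγ hu hc hpos hQγ hr.1
        ((closedBall_subset_ball ?_).trans hR₀Ω) hr1 hr2).trans (by linarith)
      linarith [hr.2]
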